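/- **Definitions.** Let $\mathbb k=\mathbb R$ or $\mathbb C$. *Chains and spaces.* An *sc-chain* $\mathbb E$ is a sequence of Banach spaces $E_0\leftarrow E_1\leftarrow E_2\leftarrow\cdots$ with injective compact linear maps $\iota_k:E_{k+1}\to E_k$ of norm $\le 1$ with dense image; $\iota^k_l:E_k\to E_l$ denotes the compositions, $E_\infty$ the projective limit. For a strictly increasing $\mathbf k=(k_j)$ the rescaling $\mathbb E^{\mathbf k}$ has levels $E_{k_j}$; $\mathbf k$ is *tame* if $k_j\le j+c$ for some $c$. An *$\overline{\mathrm{sc}}$-structure* on a topological vector space $E$ is an sc-chain with a topological isomorphism $E_\infty\cong E$; write $\|x\|_j$ for the resulting norms of $x\in E$. Two such structures $\mathbb E,\tilde{\mathbb E}$ are *tamely equivalent* if, in both directions, $\mathrm{id}_E$ extends to a levelwise continuous linear operator from a tame rescaling of the one chain to the other, and to a levelwise injective one between some rescalings. A *pre-tame $\overline{\mathrm{sc}}$-Fréchet space* is a topological vector space with a tame equivalence class of structures (the *tamely compatible* ones). A continuous linear map is a *tame morphism* if, for some tamely compatible structures, it extends to a continuous linear operator $\mathbb E^{\mathbf k}\to\mathbb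 E'$ with $\mathbf k$ tame. The space is *weakly tame* if a tame rescaling of a tamely compatible chain admits smoothing operators: a continuous map $S:[0,\infty)\times E_0\to E_\infty$, linear in the second variable, with $p\in\mathbb N_0$ and $C^k_l\ge0$ such that the induced maps $S^k_{l,t}:E_k\to E_l$ satisfy $\|S^k_{l,t}\|\le C^k_l(1+e^{(p+l-k)t})$ for all $k,l,t$ and $\|\iota^k_l-S^k_{l,t}\|\le C^k_l e^{(p-(k-l))t}$ for $k-l\ge p$. Direct sums are formed levelwise; a closed subspace carries the structure given by a chain of closed subspaces of a tamely compatible chain with the restricted norms; a finite-dimensional space carries its unique structure. *Maps.* All structures below are tamely compatible ones. An *envelope* of $f:A\to E'$, $A\subseteq E$, consists of open $U_j\subseteq E_j$ with $\iota_j(U_{j+1})\subseteq U_j$ and $A$ the set of points of $E$ lying in all the $U_j$, and continuous $f_j:U_j\to E'_j$ extending $f$ and compatible with the $\iota_j$; it is *tame* if for every $j$ there is $C$ with $\|f_j(y)\|\le C(1+\|y\|)$ on $U_j$. For $U$ open, $f:U\to E'$ is $\overline{\mathrm{sc}}^0$ (resp. tame) if every point has a neighbourhood on which $f$ has an envelope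 (resp. a tame envelope). It is $\underline{\mathrm{sc}}^0$ if every point has a neighbourhood $V\subseteq U$ and structures such that for every $j$ the set $V$ is $\|\cdot\|_j$-open and $f|_V$ is continuous from $\|\cdot\|_j$ to $\|\cdot\|'_j$; it is moreover tame if locally, for suitable structures, $\|f(y)\|'_j\le C_j(1+\|y\|_j)$ for every $j$. $f$ is *weakly Fréchet differentiable* at $x$ with derivative $Df(x)$, a continuous linear map, if for some convex balanced neighbourhood $V$ of $0$ with $x+V\subseteq U$ the map $(u,t)\mapsto \frac1t(f(x+tu)-f(x))-Df(x)u$, extended by $0$ at $t=0$, is continuous on $V\times[0,1]$. $f$ is $\overline{\mathrm{sc}}^{n+1}$ if it is weakly Fréchet differentiable and $\overline{\mathrm{sc}}^0$ on $U$ and $Df:U\times E\to E'$ is $\overline{\mathrm{sc}}^{n}$; $\overline{\mathrm{sc}}^\infty$ means all finite orders; the same with $\underline{\mathrm{sc}}$. $f$ is *tame up to order $k$* if $D^jf:U\times E^j\to E'$ is tame for all finite $0\le j\le k$. An *$\underline{\mathrm{sc}}^k$ diffeomorphism, tame up to order $k$*, is a bijection between open sets that, together with its inverse, is $\underline{\mathrm{sc}}^k$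 and tame up to order $k$. *Fredholm maps.* A *tame family* $\phi:U\times E^1\to E^2$ is a tame $\overline{\mathrm{sc}}^0$ map that is linear in the second variable. It is *strongly smoothing* if every point of $U$ has a neighbourhood $V$ such that $\phi|_{V\times E^1}$ has an envelope $\kappa_j:U_j\times E^1_j\to E^2_j$ with the following property: for every tame $\mathbf k$ it lifts to an envelope $\kappa_{\mathbf k,j}:U_{k_j}\times E^1_j\to E^2_{k_j}$, meaning $\kappa_j(\iota^{k_j}_jy,v)=\iota^{k_j}_j\kappa_{\mathbf k,j}(y,v)$, and these envelopes satisfy, for each $j$ and $R$, tame estimates $\|\cdot\|\le C_{j,R}(1+\|y\|+\|v\|)$ for all $v$ with $\|\iota^j_0v\|_0\le R$. A tame family $\phi$ is *tame Fredholm* if locally there are a tame family $\psi$ and strongly smoothing $\kappa,\kappa'$ with $\psi\phi=\mathrm{id}+\kappa$, $\phi\psi=\mathrm{id}+\kappa'$. A map $f$ is *tame Fredholm* if it is $\overline{\mathrm{sc}}^1$ and tame and $Df$ is a tame Fredholm family; it then has *constant rank* if $\dim\operatorname{coker}Df(x)$ is constant in $x$. **Theorem (constant rank theorem).** Let $E$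 and $E'$ be weakly tame $\overline{\mathrm{sc}}$-Fréchet spaces, let $U\subseteq E$ be open and let $f:U\to E'$ be $\overline{\mathrm{sc}}^k$ and tame up to order $k$ for some $k\in\mathbb N_0\cup\{\infty\}$ with $k\ge2$. Let $x_0\in U$ and suppose that there is an open neighbourhood $V\subseteq U$ of $x_0$ such that $f|_V$ is tame Fredholm and has constant rank. Then $\operatorname{im}Df(x_0)\subseteq E'$ and $\ker Df(x_0)\subseteq E$ are closed subspaces carrying the induced pre-tame structures, $\operatorname{coker}Df(x_0)=E'/\operatorname{im}Df(x_0)$ is finite-dimensional (and carries a structure for which the quotient map is a tame morphism), and there exist open neighbourhoods $W\subseteq U$ of $x_0$ and $W'\subseteq E'$ of $f(x_0)$ with $f(W)\subseteq W'$, open sets $$\tilde W\subseteq\operatorname{im}Df(x_0)\oplus\ker Df(x_0),\qquad \tilde W'\subseteq\operatorname{im}Df(x_0)\oplus\operatorname{coker}Df(x_0),$$ and $\underline{\mathrm{sc}}^k$ diffeomorphisms $\Phi:W\to\tilde W$ and $\Psi:W'\to\tilde W'$, tame up to order $k$, such that $$\Psi\bigl(f(\Phi^{-1}(u,z))\bigr)=(u,0)\qquad\text{for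 all }(u,z)\in\tilde W.$$ -/

import Mathlib

open Set Filter Topology
open scoped NNReal

universe u

/-- An sc-chain: a sequence of Banach spaces `X 0 ← X 1 ← X 2 ← ⋯` over `𝕜` with injective compact
linear maps of norm at most one and dense image. -/
structure ScChain (𝕜 : Type*) [RCLike 𝕜] where
  X : ℕ → Type u
  [normed : ∀ k, NormedAddCommGroup (X k)]
  [space : ∀ k, NormedSpace 𝕜 (X k)]
  [complete : ∀ k, CompleteSpace (X k)]
  ι : ∀ k, X (k + 1) →L[𝕜] X k
  ι_injective : ∀ k, Function.Injective (ι k)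
  ι_dense : ∀ k, DenseRange (ι k)
  ι_norm : ∀ k, ‖ι k‖ ≤ 1
  ι_compact : ∀ k, IsCompactOperator (ι k)

attribute [instance] ScChain.normed ScChain.space ScChain.complete

namespace ScChain

variable {𝕜 : Type*} [RCLike 𝕜] (C D : ScChain.{u} 𝕜)

/-- The iterated inclusion `X n → X m` for `m ≤ n`. -/
noncomputable def incl {m n : ℕ} (h : m ≤ n) : C.X n →L[𝕜] C.X m :=
  Nat.leRec (motive := fun n _ => C.X n →L[𝕜] C.X m) (ContinuousLinearMap.id 𝕜 (C.X m))
    (fun k _ A => A.comp (C.ι k)) h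

theorem incl_self (m : ℕ) : C.incl (le_refl m) = ContinuousLinearMap.id 𝕜 (C.X m) :=
  Nat.leRec_self _ _

theorem incl_succ {m n : ℕ} (h : m ≤ n) :
    C.incl (Nat.le_succ_of_le h) = (C.incl h).comp (C.ι n) :=
  Nat.leRec_succ (motive := fun n _ => C.X n →L[𝕜] C.X m) _ _ h

theorem incl_injective {m n : ℕ} (h : m ≤ n) : Function.Injective (C.incl h) := by
  induction n, h using Nat.le_induction with
  | base => rw [incl_self]; exact fun _ _ h => h
  | succ n h ih =>
    rw [C.incl_succ h]
    exact ih.comp (C.ι_injective n)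

theorem incl_dense {m n : ℕ} (h : m ≤ n) : DenseRange (C.incl h) := by
  induction n, h using Nat.le_induction with
  | base => rw [incl_self]; exact Function.surjective_id.denseRange
  | succ n h ih =>
    rw [C.incl_succ h]
    exact ih.comp (C.ι_dense n) (C.incl h).continuous

theorem incl_norm {m n : ℕ} (h : m ≤ n) : ‖C.incl h‖ ≤ 1 := by
  induction n, h using Nat.le_induction with
  | base => rw [incl_self]; exact ContinuousLinearMap.norm_id_le
  | succ n h ih =>
    rw [C.incl_succ h]
    exact ((C.incl h).opNorm_comp_le (C.ι n)).trans
      (mul_le_one₀ ih (norm_nonneg _) (C.ι_norm n))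

theorem incl_compact {m n : ℕ} (h : m < n) : IsCompactOperator (C.incl h.le) := by
  obtain ⟨n, rfl⟩ : ∃ l, n = l + 1 := ⟨n - 1, by omega⟩
  rw [C.incl_succ (Nat.le_of_lt_succ h)]
  exact (C.ι_compact n).clm_comp _

theorem incl_incl {l m n : ℕ} (h : l ≤ m) (h' : m ≤ n) (y : C.X n) :
    C.incl h (C.incl h' y) = C.incl (h.trans h') y := by
  induction n, h' using Nat.le_induction with
  | base => rw [incl_self]; rfl
  | succ n h' ih =>
    rw [C.incl_succ h', C.incl_succ (h.trans h')]
    exact ih _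

/-- The rescaled chain `X (k 0) ← X (k 1) ← ⋯` along a strictly increasing sequence. -/
noncomputable abbrev rescale (k : ℕ → ℕ) (hk : StrictMono k) : ScChain.{u} 𝕜 where
  X j := C.X (k j)
  ι j := C.incl (hk (Nat.lt_succ_self j)).le
  ι_injective _ := C.incl_injective _
  ι_dense _ := C.incl_dense _
  ι_norm _ := C.incl_norm _
  ι_compact j := C.incl_compact (hk (Nat.lt_succ_self j))

/-- The direct sum of two chains. -/
noncomputable abbrev prod : ScChain.{u} 𝕜 where
  X j := C.X j × D.X j
  ι j := (C.ι j).prodMap (D.ι j)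
  ι_injective j := (C.ι_injective j).prodMap (D.ι_injective j)
  ι_dense j := (C.ι_dense j).prodMap (D.ι_dense j)
  ι_norm j := by
    refine ContinuousLinearMap.opNorm_le_bound _ zero_le_one fun x => ?_
    rw [one_mul]
    exact max_le_max ((C.ι j).le_of_opNorm_le (C.ι_norm j) x.1 |>.trans_eq (one_mul _))
      ((D.ι j).le_of_opNorm_le (D.ι_norm j) x.2 |>.trans_eq (one_mul _))
  ι_compact j := by
    obtain ⟨K, hK, hK'⟩ := C.ι_compact j
    obtain ⟨L, hL, hL'⟩ := D.ι_compact j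
    exact ⟨K ×ˢ L, hK.prod hL, prod_mem_nhds hK' hL'⟩

/-- The direct sum of `n` copies of a chain. -/
noncomputable abbrev pi (n : ℕ) : ScChain.{u} 𝕜 where
  X j := Fin n → C.X j
  ι j := ContinuousLinearMap.piMap fun _ => C.ι j
  ι_injective j := fun x y h => funext fun i => C.ι_injective j (congrFun h i)
  ι_dense j := DenseRange.piMap fun _ => C.ι_dense j
  ι_norm j := by
    refine ContinuousLinearMap.opNorm_le_bound _ zero_le_one fun x => ?_
    rw [one_mul]
    refine (pi_norm_le_iff_of_nonneg (norm_nonneg _)).2 fun i => ?_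
    exact ((C.ι j).le_of_opNorm_le (C.ι_norm j) (x i)).trans
      ((one_mul _).trans_le (norm_le_pi_norm x i))
  ι_compact j := by
    obtain ⟨K, hK, hK'⟩ := C.ι_compact j
    exact ⟨Set.univ.pi fun _ => K, isCompact_univ_pi fun _ => hK,
      set_pi_mem_nhds Set.finite_univ fun _ _ => hK'⟩

end ScChain

/-- An sc-structure on a topological vector space `E`: a chain together with an isomorphism of
topological vector spaces between `E` and the projective limit of the chain. The isomorphism is
recorded by its components `π k : E → X k`: they are compatible with the maps of the chain, every
compatible sequence comes from exactly one vector, and the topology of `E` is the projective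
limit topology. -/
structure ScStructure (𝕜 : Type*) [RCLike 𝕜] (E : Type u) [AddCommGroup E] [Module 𝕜 E]
    [TopologicalSpace E] extends ScChain.{u} 𝕜 where
  π : ∀ k, E →L[𝕜] toScChain.X k
  ι_π : ∀ k x, toScChain.ι k (π (k + 1) x) = π k x
  existsUnique_lift : ∀ y : ∀ k, toScChain.X k,
    (∀ k, toScChain.ι k (y (k + 1)) = y k) → ∃! x : E, ∀ k, π k x = y k
  topology_eq : (inferInstance : TopologicalSpace E) =
    ⨅ k, TopologicalSpace.induced (π k) inferInstance

/-- A strictly increasing sequence that stays within bounded distance of the identity. -/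
def IsTameSeq (k : ℕ → ℕ) : Prop := StrictMono k ∧ ∃ c, ∀ j, k j ≤ j + c

namespace ScStructure

variable {𝕜 : Type*} [RCLike 𝕜]
variable {E : Type u} [AddCommGroup E] [Module 𝕜 E] [TopologicalSpace E]
variable {F : Type u} [AddCommGroup F] [Module 𝕜 F] [TopologicalSpace F]

theorem incl_π (s : ScStructure 𝕜 E) {m n : ℕ} (h : m ≤ n) (x : E) :
    s.incl h (s.π n x) = s.π m x := by
  induction n, h using Nat.le_induction with
  | base => rw [ScChain.incl_self]; rfl
  | succ n h ih =>
    rw [ScChain.incl_succ _ h, ContinuousLinearMap.comp_apply, s.ι_π, ih]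

/-- The structure given by the rescaled chain. -/
noncomputable abbrev rescale (s : ScStructure 𝕜 E) (k : ℕ → ℕ) (hk : StrictMono k) :
    ScStructure 𝕜 E where
  toScChain := s.toScChain.rescale k hk
  π j := s.π (k j)
  ι_π j x := s.incl_π (hk (Nat.lt_succ_self j)).le x
  existsUnique_lift := by
    intro y hy
    have hy' : ∀ n, s.ι n (s.incl (hk.le_apply (x := n + 1)) (y (n + 1))) =
        s.incl (hk.le_apply (x := n)) (y n) := by
      intro n
      have h1 : s.incl (hk (Nat.lt_succ_self n)).le (y (n + 1)) = y n := hy n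
      have h2 : s.ι n = s.incl (Nat.le_succ n) := by
        rw [show s.incl (Nat.le_succ n) = _ from s.incl_succ (le_refl n), ScChain.incl_self]
        rfl
      rw [← h1, h2]
      exact (s.incl_incl _ _ _).trans (s.incl_incl _ _ _).symm
    obtain ⟨x, hx, hux⟩ := s.existsUnique_lift
      (fun n => s.incl (hk.le_apply (x := n)) (y n)) hy'
    refine ⟨x, fun j => ?_, fun x' hx' => hux x' fun n => ?_⟩
    · apply s.incl_injective (hk.le_apply (x := j))
      exact (s.incl_π _ x).trans (hx j)
    · exact (s.incl_π (hk.le_apply (x := n)) x').symm.trans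
        (congrArg (s.incl (hk.le_apply (x := n))) (hx' n))
  topology_eq := by
    refine s.topology_eq.trans (le_antisymm ?_ ?_)
    · exact le_iInf fun j => iInf_le _ (k j)
    · refine le_iInf fun n => (iInf_le _ n).trans ?_
      have : (s.π n : E → s.X n) = s.incl (hk.le_apply (x := n)) ∘ s.π (k n) :=
        funext fun x => (s.incl_π _ x).symm
      rw [this, ← induced_compose]
      exact induced_mono (s.incl _).continuous.le_induced

/-- The direct sum. The norm on each level is the maximum of the two norms. -/
noncomputable abbrev prod (s : ScStructure 𝕜 E) (t : ScStructure 𝕜 F) : ScStructure 𝕜 (E × F) where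
  toScChain := s.toScChain.prod t.toScChain
  π j := (s.π j).prodMap (t.π j)
  ι_π j x := Prod.ext (s.ι_π j x.1) (t.ι_π j x.2)
  existsUnique_lift := by
    intro y hy
    obtain ⟨x, hx, hux⟩ := s.existsUnique_lift (fun n => (y n).1)
      fun n => congrArg Prod.fst (hy n)
    obtain ⟨z, hz, huz⟩ := t.existsUnique_lift (fun n => (y n).2)
      fun n => congrArg Prod.snd (hy n)
    exact ⟨(x, z), fun j => Prod.ext (hx j) (hz j), fun w hw =>
      Prod.ext (hux _ fun n => congrArg Prod.fst (hw n))
        (huz _ fun n => congrArg Prod.snd (hw n))⟩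
  topology_eq := by
    have h : (inferInstance : TopologicalSpace (E × F)) =
        TopologicalSpace.induced Prod.fst (⨅ k, TopologicalSpace.induced (s.π k) inferInstance) ⊓
        TopologicalSpace.induced Prod.snd
          (⨅ k, TopologicalSpace.induced (t.π k) inferInstance) := by
      rw [← s.topology_eq, ← t.topology_eq]
      rfl
    rw [h, induced_iInf, induced_iInf, ← iInf_inf_eq]
    refine iInf_congr fun k => ?_
    refine Eq.trans ?_ (induced_inf (t₁ := TopologicalSpace.induced Prod.fst inferInstance)
      (t₂ := TopologicalSpace.induced Prod.snd inferInstance)).symm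
    rw [induced_compose, induced_compose, induced_compose, induced_compose]
    rfl

/-- The direct sum of `n` copies. The norm on each level is the maximum norm. -/
noncomputable abbrev pi (n : ℕ) (s : ScStructure 𝕜 E) : ScStructure 𝕜 (Fin n → E) where
  toScChain := s.toScChain.pi n
  π j := ContinuousLinearMap.piMap fun _ => s.π j
  ι_π j x := funext fun i => s.ι_π j (x i)
  existsUnique_lift := by
    intro y hy
    have h := fun i => s.existsUnique_lift (fun n => y n i) fun n => congrFun (hy n) i
    choose x hx hux using h
    exact ⟨x, fun j => funext fun i => hx i j, fun w hw =>
      funext fun i => hux i (w i) fun n => congrFun (hw n) i⟩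
  topology_eq := by
    have h : (inferInstance : TopologicalSpace (Fin n → E)) =
        ⨅ i, TopologicalSpace.induced (fun x : Fin n → E => x i)
          (⨅ k, TopologicalSpace.induced (s.π k) inferInstance) := by
      rw [← s.topology_eq]
      rfl
    simp_rw [induced_iInf] at h
    rw [h, iInf_comm]
    refine iInf_congr fun k => ?_
    refine Eq.trans ?_ (induced_iInf (t := fun i : Fin n =>
      TopologicalSpace.induced (fun y : Fin n → s.X k => y i) inferInstance)).symm
    refine iInf_congr fun i => ?_
    rw [induced_compose, induced_compose]
    rfl

/-- `A` is an extension of the linear map `T` to a continuous linear operator between the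
chains. -/
def IsExtension (s : ScStructure 𝕜 E) (t : ScStructure 𝕜 F) (T : E →L[𝕜] F)
    (A : ∀ j, s.X j →L[𝕜] t.X j) : Prop :=
  (∀ j x, A j (s.π j x) = t.π j (T x)) ∧ ∀ j y, A j (s.ι j y) = t.ι j (A (j + 1) y)

/-- `T` extends to a continuous linear operator from a tame rescaling of the first chain to the
second chain. -/
def IsTameWeakMorphism (s : ScStructure 𝕜 E) (t : ScStructure 𝕜 F) (T : E →L[𝕜] F) : Prop :=
  ∃ (k : ℕ → ℕ) (hk : IsTameSeq k) (A : ∀ j, (s.rescale k hk.1).X j →L[𝕜] t.X j),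
    IsExtension (s.rescale k hk.1) t T A

/-- `T` extends to a continuous linear operator between rescaled chains all of whose levels are
injective. -/
def IsWeakEmbedding (s : ScStructure 𝕜 E) (t : ScStructure 𝕜 F) (T : E →L[𝕜] F) : Prop :=
  ∃ (k l : ℕ → ℕ) (hk : StrictMono k) (hl : StrictMono l)
    (A : ∀ j, (s.rescale k hk).X j →L[𝕜] (t.rescale l hl).X j),
    IsExtension (s.rescale k hk) (t.rescale l hl) T A ∧ ∀ j, Function.Injective (A j)

/-- Two structures on the same space are tamely equivalent if the identity is a tame weak
embedding in both directions. -/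
def TamelyEquiv (s t : ScStructure 𝕜 E) : Prop :=
  (IsTameWeakMorphism s t (ContinuousLinearMap.id 𝕜 E) ∧
    IsWeakEmbedding s t (ContinuousLinearMap.id 𝕜 E)) ∧
  (IsTameWeakMorphism t s (ContinuousLinearMap.id 𝕜 E) ∧
    IsWeakEmbedding t s (ContinuousLinearMap.id 𝕜 E))

/-- The chain has smoothing operators `S t : X 0 → E`, `t ≥ 0`, jointly continuous and linear
for each `t`, with the two standard families of estimates. -/
def HasSmoothing (s : ScStructure 𝕜 E) : Prop :=
  ∃ S : ℝ≥0 → s.X 0 →ₗ[𝕜] E, Continuous (fun z : ℝ≥0 × s.X 0 => S z.1 z.2) ∧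
    ∃ (p : ℕ) (C : ℕ → ℕ → ℝ), (∀ k l, 0 ≤ C k l) ∧
      (∀ (k l : ℕ) (t : ℝ≥0) (y : s.X k), ‖s.π l (S t (s.incl (Nat.zero_le k) y))‖ ≤
        C k l * (1 + Real.exp (((p : ℝ) + ((l : ℝ) - k)) * t)) * ‖y‖) ∧
      ∀ (k l : ℕ) (h : l ≤ k), p ≤ k - l → ∀ (t : ℝ≥0) (y : s.X k),
        ‖s.incl h y - s.π l (S t (s.incl (Nat.zero_le k) y))‖ ≤
          C k l * Real.exp (((p : ℝ) - ((k : ℝ) - l)) * t) * ‖y‖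

/-- `(V, F)` is an envelope of `f` on the set `A`: open sets `V j ⊆ X j` that cut out `A`, and
continuous maps `F j` on them that extend `f` and are compatible with each other. -/
structure IsEnvelope (s : ScStructure 𝕜 E) (t : ScStructure 𝕜 F) (A : Set E) (f : E → F)
    (V : ∀ j, Set (s.X j)) (G : ∀ j, s.X j → t.X j) : Prop where
  isOpen : ∀ j, IsOpen (V j)
  mapsTo : ∀ j, MapsTo (s.ι j) (V (j + 1)) (V j)
  eq_iInter : A = ⋂ j, s.π j ⁻¹' V j
  continuousOn : ∀ j, ContinuousOn (G j) (V j)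
  extends_map : ∀ j, ∀ x ∈ A, G j (s.π j x) = t.π j (f x)
  compatible : ∀ j, ∀ y ∈ V (j + 1), G j (s.ι j y) = t.ι j (G (j + 1) y)

/-- An envelope all of whose levels grow at most linearly. -/
structure IsTameEnvelope (s : ScStructure 𝕜 E) (t : ScStructure 𝕜 F) (A : Set E) (f : E → F)
    (V : ∀ j, Set (s.X j)) (G : ∀ j, s.X j → t.X j) : Prop extends IsEnvelope s t A f V G where
  tame : ∀ j, ∃ C : ℝ, ∀ y ∈ V j, ‖G j y‖ ≤ C * (1 + ‖y‖)

end ScStructure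

/-- A pre-tame sc-Fréchet space structure: a tame equivalence class of sc-structures. Its members
are the tamely compatible structures. -/
structure PreTameSc (𝕜 : Type*) [RCLike 𝕜] (E : Type u) [AddCommGroup E] [Module 𝕜 E]
    [TopologicalSpace E] where
  compat : Set (ScStructure.{u} 𝕜 E)
  isClass : ∃ s : ScStructure.{u} 𝕜 E, compat = {t | s.TamelyEquiv t}

namespace PreTameSc

variable {𝕜 : Type*} [RCLike 𝕜]
variable {E : Type u} [AddCommGroup E] [Module 𝕜 E] [TopologicalSpace E]
variable {F : Type u} [AddCommGroup F] [Module 𝕜 F] [TopologicalSpace F]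
variable {G : Type u} [AddCommGroup G] [Module 𝕜 G] [TopologicalSpace G]

/-- The class of a structure. -/
def ofRep (s : ScStructure 𝕜 E) : PreTameSc 𝕜 E := ⟨{t | s.TamelyEquiv t}, s, rfl⟩

/-- A representative of the class. -/
noncomputable def rep (P : PreTameSc 𝕜 E) : ScStructure 𝕜 E := P.isClass.choose

/-- The direct sum (its class does not depend on the representatives). -/
noncomputable def prod (P : PreTameSc 𝕜 E) (Q : PreTameSc 𝕜 F) : PreTameSc 𝕜 (E × F) :=
  ofRep (P.rep.prod Q.rep)

/-- The direct sum of `n` copies. -/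
noncomputable def pi (n : ℕ) (P : PreTameSc 𝕜 E) : PreTameSc 𝕜 (Fin n → E) :=
  ofRep (P.rep.pi n)

/-- Weakly tame: some tame rescaling of some tamely compatible structure has smoothing
operators. -/
def IsWeaklyTame (P : PreTameSc 𝕜 E) : Prop :=
  ∃ s ∈ P.compat, ∃ (k : ℕ → ℕ) (hk : IsTameSeq k), (s.rescale k hk.1).HasSmoothing

/-- A continuous linear map is a tame morphism if it is a tame weak morphism for some tamely
compatible structures. -/
def IsTameMorphism (P : PreTameSc 𝕜 E) (Q : PreTameSc 𝕜 F) (T : E →L[𝕜] F) : Prop :=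
  ∃ s ∈ P.compat, ∃ t ∈ Q.compat, ScStructure.IsTameWeakMorphism s t T

/-- `Q` is the structure induced by `P` on the closed subspace `S`: for some tamely compatible
structures the chain of `Q` is a chain of (necessarily closed) subspaces, with the restricted
norms and inclusions, of the chain of `P`. -/
def IsSubspace (P : PreTameSc 𝕜 E) (S : Submodule 𝕜 E) (Q : PreTameSc 𝕜 S) : Prop :=
  IsClosed (S : Set E) ∧ ∃ s ∈ P.compat, ∃ t ∈ Q.compat,
    ∃ a : ∀ j, t.X j →ₗᵢ[𝕜] s.X j,
      (∀ j y, a j (t.ι j y) = s.ι j (a (j + 1) y)) ∧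
      ∀ j (x : S), a j (t.π j x) = s.π j (x : E)

/-! ### Continuity and tameness -/

/-- `f` is upper sc-continuous on `U`: locally it has an envelope. -/
def ScBarZero (P : PreTameSc 𝕜 E) (Q : PreTameSc 𝕜 F) (U : Set E) (f : E → F) : Prop :=
  ∀ x ∈ U, ∃ V ∈ 𝓝 x, V ⊆ U ∧ ∃ s ∈ P.compat, ∃ t ∈ Q.compat,
    ∃ (O : ∀ j, Set (s.X j)) (H : ∀ j, s.X j → t.X j), s.IsEnvelope t V f O H

/-- `f` is tame on `U` as an upper sc-continuous map: locally it has a tame envelope. -/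
def TameBar (P : PreTameSc 𝕜 E) (Q : PreTameSc 𝕜 F) (U : Set E) (f : E → F) : Prop :=
  ∀ x ∈ U, ∃ V ∈ 𝓝 x, V ⊆ U ∧ ∃ s ∈ P.compat, ∃ t ∈ Q.compat,
    ∃ (O : ∀ j, Set (s.X j)) (H : ∀ j, s.X j → t.X j), s.IsTameEnvelope t V f O H

/-- `f` is lower sc-continuous on `V` for the given structures: `V` is open and `f` is continuous
on it for each of the norms `‖π j ·‖` separately. -/
def IsLevelwiseContinuous (s : ScStructure 𝕜 E) (t : ScStructure 𝕜 F) (V : Set E) (f : E → F) :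
    Prop :=
  ∀ j, @IsOpen E (TopologicalSpace.induced (s.π j) inferInstance) V ∧
    @ContinuousOn E F (TopologicalSpace.induced (s.π j) inferInstance)
      (TopologicalSpace.induced (t.π j) inferInstance) f V

/-- `f` is lower sc-continuous on `U`. -/
def ScUnderZero (P : PreTameSc 𝕜 E) (Q : PreTameSc 𝕜 F) (U : Set E) (f : E → F) : Prop :=
  ∀ x ∈ U, ∃ V ∈ 𝓝 x, V ⊆ U ∧ ∃ s ∈ P.compat, ∃ t ∈ Q.compat, IsLevelwiseContinuous s t V f

/-- `f` is tame on `U` as a lower sc-continuous map. -/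
def TameUnder (P : PreTameSc 𝕜 E) (Q : PreTameSc 𝕜 F) (U : Set E) (f : E → F) : Prop :=
  ∀ x ∈ U, ∃ V ∈ 𝓝 x, V ⊆ U ∧ ∃ s ∈ P.compat, ∃ t ∈ Q.compat, IsLevelwiseContinuous s t V f ∧
    ∀ j, ∃ C : ℝ, ∀ y ∈ V, ‖t.π j (f y)‖ ≤ C * (1 + ‖s.π j y‖)

end PreTameSc

/-! ### Differentiability -/

section Derivative

variable {𝕜 : Type*} [RCLike 𝕜]
variable {E : Type u} [AddCommGroup E] [Module 𝕜 E] [TopologicalSpace E]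
variable {F : Type u} [AddCommGroup F] [Module 𝕜 F] [TopologicalSpace F]

open Classical in
/-- The difference quotient remainder `(f (x + t u) - f x) / t - L u`, and `0` at `t = 0`. -/
noncomputable def wRemainder (f : E → F) (x : E) (L : E →L[𝕜] F) (z : E × ℝ) : F :=
  if z.2 = 0 then 0 else ((z.2 : 𝕜)⁻¹) • (f (x + (z.2 : 𝕜) • z.1) - f x) - L z.1

/-- `f` (defined on `U`) is weakly Fréchet differentiable at `x` with derivative `L`: the remainder
is continuous on `V × [0, 1]` for some convex balanced neighbourhood `V` of `0` with
`x + V ⊆ U`. -/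
def HasWDerivAt (f : E → F) (U : Set E) (x : E) (L : E →L[𝕜] F) : Prop :=
  ∃ V ∈ 𝓝 (0 : E), Balanced 𝕜 V ∧
    (∀ u ∈ V, ∀ v ∈ V, ∀ a b : ℝ, 0 ≤ a → 0 ≤ b → a + b = 1 →
      (a : 𝕜) • u + (b : 𝕜) • v ∈ V) ∧
    (∀ u ∈ V, x + u ∈ U) ∧ ContinuousOn (wRemainder f x L) (V ×ˢ Icc (0 : ℝ) 1)

variable (𝕜)

/-- `f` is weakly Fréchet differentiable on `U`. -/
def WDiffOn (f : E → F) (U : Set E) : Prop := ∀ x ∈ U, ∃ L : E →L[𝕜] F, HasWDerivAt f U x L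

open Classical in
/-- The weak Fréchet derivative of `f : U → F` at `x` (zero if there is none). -/
noncomputable def wDeriv (f : E → F) (U : Set E) (x : E) : E →L[𝕜] F :=
  if h : ∃ L : E →L[𝕜] F, HasWDerivAt f U x L then h.choose else 0

/-- The differential `Df : U × E → F`. -/
noncomputable def differential (f : E → F) (U : Set E) (z : E × E) : F := wDeriv 𝕜 f U z.1 z.2

/-- The iterated differential `D^j f : U × E^j → F`. -/
noncomputable def iterDifferential (f : E → F) (U : Set E) : ∀ j : ℕ, E → (Fin j → E) → F
  | 0, x, _ => f x
  | j + 1, x, v => wDeriv 𝕜 (fun y => iterDifferential f U j y (Fin.init v)) U x (v (Fin.last j))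

end Derivative

namespace PreTameSc

variable {𝕜 : Type*} [RCLike 𝕜]

/-- Upper sc-differentiability of finite order on `U`. -/
def ScBarNat : ℕ → ∀ {E : Type u} [AddCommGroup E] [Module 𝕜 E] [TopologicalSpace E]
    {F : Type u} [AddCommGroup F] [Module 𝕜 F] [TopologicalSpace F]
    (_ : PreTameSc 𝕜 E) (_ : PreTameSc 𝕜 F) (_ : Set E) (_ : E → F), Prop
  | 0, _, _, _, _, _, _, _, _, P, Q, U, f => ScBarZero P Q U f
  | n + 1, _, _, _, _, _, _, _, _, P, Q, U, f =>
    WDiffOn 𝕜 f U ∧ ScBarZero P Q U f ∧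
      ScBarNat n (P.prod P) Q (U ×ˢ univ) (differential 𝕜 f U)

/-- Lower sc-differentiability of finite order on `U`. -/
def ScUnderNat : ℕ → ∀ {E : Type u} [AddCommGroup E] [Module 𝕜 E] [TopologicalSpace E]
    {F : Type u} [AddCommGroup F] [Module 𝕜 F] [TopologicalSpace F]
    (_ : PreTameSc 𝕜 E) (_ : PreTameSc 𝕜 F) (_ : Set E) (_ : E → F), Prop
  | 0, _, _, _, _, _, _, _, _, P, Q, U, f => ScUnderZero P Q U f
  | n + 1, _, _, _, _, _, _, _, _, P, Q, U, f =>
    WDiffOn 𝕜 f U ∧ ScUnderZero P Q U f ∧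
      ScUnderNat n (P.prod P) Q (U ×ˢ univ) (differential 𝕜 f U)

variable {E : Type u} [AddCommGroup E] [Module 𝕜 E] [TopologicalSpace E]
variable {F : Type u} [AddCommGroup F] [Module 𝕜 F] [TopologicalSpace F]
variable {G : Type u} [AddCommGroup G] [Module 𝕜 G] [TopologicalSpace G]

/-- Upper sc-differentiability of order `k ≤ ∞` on `U`. -/
def ScBar (k : ℕ∞) (P : PreTameSc 𝕜 E) (Q : PreTameSc 𝕜 F) (U : Set E) (f : E → F) : Prop :=
  ∀ n : ℕ, (n : ℕ∞) ≤ k → ScBarNat n P Q U f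

/-- Lower sc-differentiability of order `k ≤ ∞` on `U`. -/
def ScUnder (k : ℕ∞) (P : PreTameSc 𝕜 E) (Q : PreTameSc 𝕜 F) (U : Set E) (f : E → F) : Prop :=
  ∀ n : ℕ, (n : ℕ∞) ≤ k → ScUnderNat n P Q U f

/-- Tame up to order `k`, for an upper sc-differentiable map of order `k`. -/
def TameBarUpTo (k : ℕ∞) (P : PreTameSc 𝕜 E) (Q : PreTameSc 𝕜 F) (U : Set E) (f : E → F) :
    Prop :=
  ∀ j : ℕ, (j : ℕ∞) ≤ k → TameBar (P.prod (P.pi j)) Q (U ×ˢ univ)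
    fun z => iterDifferential 𝕜 f U j z.1 z.2

/-- Tame up to order `k`, for a lower sc-differentiable map of order `k`. -/
def TameUnderUpTo (k : ℕ∞) (P : PreTameSc 𝕜 E) (Q : PreTameSc 𝕜 F) (U : Set E) (f : E → F) :
    Prop :=
  ∀ j : ℕ, (j : ℕ∞) ≤ k → TameUnder (P.prod (P.pi j)) Q (U ×ˢ univ)
    fun z => iterDifferential 𝕜 f U j z.1 z.2

/-- `φ : W → W'` with inverse `ψ : W' → W` is a lower sc-diffeomorphism of order `k` between open
sets, tame up to order `k`. -/
structure IsTameDiffeo (k : ℕ∞) (P : PreTameSc 𝕜 E) (Q : PreTameSc 𝕜 F) (W : Set E) (W' : Set F)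
    (φ : E → F) (ψ : F → E) : Prop where
  isOpen_source : IsOpen W
  isOpen_target : IsOpen W'
  mapsTo : MapsTo φ W W'
  mapsTo_inv : MapsTo ψ W' W
  invOn : InvOn ψ φ W W'
  sc : ScUnder k P Q W φ
  sc_inv : ScUnder k Q P W' ψ
  tame : TameUnderUpTo k P Q W φ
  tame_inv : TameUnderUpTo k Q P W' ψ

/-! ### Families of operators and Fredholm maps -/

/-- A tame family of morphisms over `U`. -/
def IsTameFamily (P : PreTameSc 𝕜 E) (P₁ : PreTameSc 𝕜 F) (P₂ : PreTameSc 𝕜 G) (U : Set E)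
    (φ : E → F →ₗ[𝕜] G) : Prop :=
  TameBar (P.prod P₁) P₂ (U ×ˢ univ) fun z => φ z.1 z.2

/-- A family is (tamely) strongly smoothing if locally it has an envelope `H` defined on sets of
the form `O j ×ˢ univ` that lifts, for every tame sequence `k`, to an envelope `K` from
`O (k j) ×ˢ univ` to the `k j`-th level of the target, where `H` and all the `K` satisfy tame
estimates. As the maps are linear in the second variable `v`, the tame estimates are required on
the sets `‖v‖₀ ≤ R`, with a constant depending on `R`; a bound by `C * (1 + ‖y‖ + ‖v‖)` for all
`v` with one constant would force the operator norms to be bounded uniformly in `y`. -/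
def IsStronglySmoothing (P : PreTameSc 𝕜 E) (P₁ : PreTameSc 𝕜 F) (P₂ : PreTameSc 𝕜 G) (U : Set E)
    (κ : E → F →ₗ[𝕜] G) : Prop :=
  ∀ x ∈ U, ∃ V ∈ 𝓝 x, V ⊆ U ∧
    ∃ s ∈ P.compat, ∃ s₁ ∈ P₁.compat, ∃ s₂ ∈ P₂.compat,
    ∃ (O : ∀ j, Set (s.X j)) (H : ∀ j, s.X j × s₁.X j → s₂.X j),
      (s.prod s₁).IsEnvelope s₂ (V ×ˢ univ) (fun z => κ z.1 z.2)
        (fun j => (O j ×ˢ univ : Set (s.X j × s₁.X j))) H ∧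
      (∀ (j : ℕ) (R : ℝ), ∃ C : ℝ, ∀ y ∈ O j, ∀ v : s₁.X j,
        ‖s₁.incl (Nat.zero_le j) v‖ ≤ R → ‖H j (y, v)‖ ≤ C * (1 + ‖y‖ + ‖v‖)) ∧
      ∀ (k : ℕ → ℕ) (hk : IsTameSeq k),
        ∃ K : ∀ j, s.X (k j) × s₁.X j → s₂.X (k j),
          ((s.rescale k hk.1).prod s₁).IsEnvelope (s₂.rescale k hk.1) (V ×ˢ univ)
            (fun z => κ z.1 z.2)
            (fun j => (O (k j) ×ˢ univ : Set (s.X (k j) × s₁.X j))) K ∧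
          (∀ (j : ℕ) (R : ℝ), ∃ C : ℝ, ∀ y ∈ O (k j), ∀ v : s₁.X j,
            ‖s₁.incl (Nat.zero_le j) v‖ ≤ R → ‖K j (y, v)‖ ≤ C * (1 + ‖y‖ + ‖v‖)) ∧
          ∀ j, ∀ y ∈ O (k j), ∀ v : s₁.X j,
            H j (s.incl (hk.1.le_apply (x := j)) y, v) =
              s₂.incl (hk.1.le_apply (x := j)) (K j (y, v))

/-- A tame Fredholm family: a tame family that is locally invertible modulo strongly smoothing
families. -/
def IsTameFredholmFamily (P : PreTameSc 𝕜 E) (P₁ : PreTameSc 𝕜 F) (P₂ : PreTameSc 𝕜 G) (U : Set E)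
    (φ : E → F →ₗ[𝕜] G) : Prop :=
  IsTameFamily P P₁ P₂ U φ ∧
    ∀ x ∈ U, ∃ V : Set E, IsOpen V ∧ x ∈ V ∧ V ⊆ U ∧
      ∃ (ψ : E → G →ₗ[𝕜] F) (κ : E → F →ₗ[𝕜] F) (κ' : E → G →ₗ[𝕜] G),
        IsTameFamily P P₂ P₁ V ψ ∧
        IsStronglySmoothing P P₁ P₁ V κ ∧ IsStronglySmoothing P P₂ P₂ V κ' ∧
        ∀ y ∈ V, ψ y ∘ₗ φ y = LinearMap.id + κ y ∧ φ y ∘ₗ ψ y = LinearMap.id + κ' y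

/-- `f` is a tame Fredholm map on the open set `U`. -/
def IsTameFredholm (P : PreTameSc 𝕜 E) (Q : PreTameSc 𝕜 F) (U : Set E) (f : E → F) : Prop :=
  ScBar 1 P Q U f ∧ TameBar P Q U f ∧
    IsTameFredholmFamily P P Q U fun x => (wDeriv 𝕜 f U x).toLinearMap

end PreTameSc

section Rank

variable (𝕜 : Type*) [RCLike 𝕜]
variable {E : Type u} [AddCommGroup E] [Module 𝕜 E] [TopologicalSpace E]
variable {F : Type u} [AddCommGroup F] [Module 𝕜 F] [TopologicalSpace F]

/-- The dimension of the cokernel of the derivative of `f : U → F` at `x`. -/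
noncomputable def corank (f : E → F) (U : Set E) (x : E) : ℕ :=
  Module.finrank 𝕜 (F ⧸ (wDeriv 𝕜 f U x).range)

/-- `f` has constant rank on `U`. -/
def HasConstantRank (f : E → F) (U : Set E) : Prop :=
  ∃ c : ℕ, ∀ x ∈ U, corank 𝕜 f U x = c

end Rank

/-! Everything is reduced to the norms `nm j` on the vectors of the Fréchet space, with a bounded
loss of indices. Tame equivalence of structures shifts these indices by a constant
(`TamelyEquiv.nEq`). An envelope gives continuity and growth estimates for each norm
(`IsEnvelope.lct`). Conversely, norm estimates with bounded loss are lower sc-regularity for a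
shifted structure (`LCT.exists_isLevelwiseContinuous`). The working notion in between is `SCN`:
iterated Hadamard derivatives that are continuous norm by norm, with linear growth. It is stable
under composition, under products and under change of structures. The constructed maps are
controlled on vectors only and are never extended to the levels, so the conclusion is of the lower
kind.

Linear part. The parametrix of `Df(x₀)` has smoothing remainders, which extend to compact operators
on one Banach level. Riesz theory (`fredholm_of_parametrix`) therefore gives a finite-dimensional
kernel `K` and a closed range `R` of finite codimension. Choose a projection `ϖ` onto `K` and a
splitting of the target into `R` and a finite-dimensional `Q`, with projections `p`, `q` and section
`σ`. The augmented map `G = (p ∘ f, ϖ)` then has a bijective derivative at `x₀`, and it still has a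
parametrix, because the change is of finite rank.

Openness of invertibility. The parametrix is corrected by a smoothing operator so that its
remainders vanish at `x₀`. A family of operators on a Fréchet space that is merely jointly
continuous need not be continuous in an operator norm. Here the remainder gains one level, and
bounded sets of that level are totally bounded in the one below, so it suffices to control a finite
net (`Fam.small`). The Neumann series then makes the derivatives of `G` bijective near `x₀`, with
tame estimates for the inverses (`Fam.exists_inverse`).

Nonlinear part. Class two gives a quadratic tame Taylor estimate (`SCN.tameNewton`). Newton's method
with smoothing operators, whose parameters grow like `(3/2)^n`, converges in all norms
(`TameNewton.exists_solution`). A Lipschitz estimate gives uniqueness. The local inverse `φ` of `G`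
is differentiable with derivative the inverse of the derivative of `G`, and inverse families inherit
their class, so the class of `φ` follows by bootstrapping (`SCN.exists_local_inverse`).

Normal form. In the coordinates `φ` one has `p (f (φ (u, z))) = u`. Near `x₀` the composite of the
derivative with `p` is onto `R`, so constant corank forces the range of the derivative to meet the
complement `σ Q` only in `0` (`eq_zero_of_corank_eq`). Hence `q ∘ f ∘ φ` has zero derivative in the
kernel variable and depends on `u` alone, say as `b u`. The shear `y ↦ (p y, q y - b (p y))` of the
target removes it. -/

set_option linter.unusedSectionVars false

/-! ### Norms, filters and completeness of an sc-structure -/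

namespace ScStructure

section Basic

variable {𝕜 : Type*} [RCLike 𝕜]
variable {E : Type u} [AddCommGroup E] [Module 𝕜 E] [TopologicalSpace E]
variable {F : Type u} [AddCommGroup F] [Module 𝕜 F] [TopologicalSpace F]

/-- The `j`-th norm on `E`. -/
noncomputable def nm (s : ScStructure 𝕜 E) (j : ℕ) : Seminorm 𝕜 E :=
  (normSeminorm 𝕜 (s.X j)).comp (s.π j).toLinearMap

/-- The neighbourhood filter of `x` for the `j`-th norm. -/
def nh (s : ScStructure 𝕜 E) (j : ℕ) (x : E) : Filter E := comap (s.π j) (𝓝 (s.π j x))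

theorem nm_apply (s : ScStructure 𝕜 E) (j : ℕ) (x : E) : s.nm j x = ‖s.π j x‖ := rfl

theorem nm_mono (s : ScStructure 𝕜 E) {i j : ℕ} (h : i ≤ j) (x : E) : s.nm i x ≤ s.nm j x := by
  rw [nm_apply, nm_apply, ← s.incl_π h x]
  exact ((s.incl h).le_of_opNorm_le (s.incl_norm h) _).trans_eq (one_mul _)

theorem nm_prod (s : ScStructure 𝕜 E) (t : ScStructure 𝕜 F) (j : ℕ) (z : E × F) :
    (s.prod t).nm j z = max (s.nm j z.1) (t.nm j z.2) := rfl

theorem nm_pi_le (s : ScStructure 𝕜 E) (n j : ℕ) (z : Fin n → E) {c : ℝ} (hc : 0 ≤ c) :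
    (s.pi n).nm j z ≤ c ↔ ∀ i, s.nm j (z i) ≤ c :=
  pi_norm_le_iff_of_nonneg (x := fun i => s.π j (z i)) hc

theorem nm_le_nm_pi (s : ScStructure 𝕜 E) (n j : ℕ) (z : Fin n → E) (i : Fin n) :
    s.nm j (z i) ≤ (s.pi n).nm j z :=
  norm_le_pi_norm (fun i => s.π j (z i)) i

theorem nm_smul (s : ScStructure 𝕜 E) (j : ℕ) (c : 𝕜) (x : E) : s.nm j (c • x) = ‖c‖ * s.nm j x :=
  map_smul_eq_mul _ _ _

theorem nm_real_smul (s : ScStructure 𝕜 E) (j : ℕ) {c : ℝ} (hc : 0 ≤ c) (x : E) :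
    s.nm j ((c : 𝕜) • x) = c * s.nm j x := by
  rw [nm_smul, RCLike.norm_ofReal, abs_of_nonneg hc]

theorem nm_add (s : ScStructure 𝕜 E) (j : ℕ) (x y : E) : s.nm j (x + y) ≤ s.nm j x + s.nm j y :=
  map_add_le_add _ _ _

theorem nm_sub (s : ScStructure 𝕜 E) (j : ℕ) (x y : E) : s.nm j (x - y) ≤ s.nm j x + s.nm j y :=
  map_sub_le_add _ _ _

theorem nm_sub_rev (s : ScStructure 𝕜 E) (j : ℕ) (x y : E) : s.nm j (x - y) = s.nm j (y - x) :=
  map_sub_rev _ _ _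

theorem nm_nonneg (s : ScStructure 𝕜 E) (j : ℕ) (x : E) : 0 ≤ s.nm j x := apply_nonneg _ _

theorem nm_zero (s : ScStructure 𝕜 E) (j : ℕ) : s.nm j 0 = 0 := map_zero _

theorem nm_le_add_sub (s : ScStructure 𝕜 E) (j : ℕ) (x y : E) :
    s.nm j x ≤ s.nm j y + s.nm j (x - y) := by
  have := s.nm_add j y (x - y)
  rwa [add_sub_cancel] at this

/-- Equality in one level passes down along the inclusions and up because they are injective. The
projective limit then identifies the vectors. So each `nm j` is a norm, and an equation in `E` may
be checked in any single norm. -/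
theorem π_injective (s : ScStructure 𝕜 E) (j : ℕ) : Function.Injective (s.π j) := by
  intro x y h
  have key : ∀ k, s.π k x = s.π k y := by
    intro k
    rcases le_total k j with hk | hk
    · rw [← s.incl_π hk, ← s.incl_π hk, h]
    · apply s.incl_injective hk
      rw [s.incl_π, s.incl_π, h]
  obtain ⟨z, _, hz⟩ := s.existsUnique_lift (fun k => s.π k x) (fun k => s.ι_π k x)
  exact (hz x fun _ => rfl).trans (hz y fun k => (key k).symm).symm

theorem eq_zero_of_nm (s : ScStructure 𝕜 E) {j : ℕ} {x : E} (h : s.nm j x = 0) : x = 0 := by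
  apply s.π_injective j
  rw [map_zero]
  exact norm_eq_zero.1 h

theorem nm_pos (s : ScStructure 𝕜 E) {j : ℕ} {x : E} (h : x ≠ 0) : 0 < s.nm j x :=
  lt_of_le_of_ne (s.nm_nonneg j x) fun h' => h (s.eq_zero_of_nm h'.symm)

theorem tendsto_nh_iff (t : ScStructure 𝕜 F) {α : Type*} {l : Filter α} {f : α → F} {j : ℕ}
    {y : F} : Tendsto f l (t.nh j y) ↔ Tendsto (fun z => t.π j (f z)) l (𝓝 (t.π j y)) := by
  rw [nh, tendsto_comap_iff]; rfl

theorem tendsto_nh_iff_nm (t : ScStructure 𝕜 F) {α : Type*} {l : Filter α} {f : α → F} {j : ℕ}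
    {y : F} : Tendsto f l (t.nh j y) ↔ Tendsto (fun z => t.nm j (f z - y)) l (𝓝 0) := by
  rw [tendsto_nh_iff, tendsto_iff_norm_sub_tendsto_zero]
  simp only [nm_apply, map_sub]

theorem mem_nh_iff (s : ScStructure 𝕜 E) {j : ℕ} {x : E} {V : Set E} :
    V ∈ s.nh j x ↔ ∃ ε > 0, ∀ z, s.nm j (z - x) < ε → z ∈ V := by
  rw [nh, (Metric.nhds_basis_ball.comap (s.π j)).mem_iff]
  simp only [Set.subset_def, mem_preimage, Metric.mem_ball, dist_eq_norm_sub, nm_apply, map_sub]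

theorem ball_mem_nh (s : ScStructure 𝕜 E) (j : ℕ) (x : E) {ε : ℝ} (hε : 0 < ε) :
    {z | s.nm j (z - x) < ε} ∈ s.nh j x :=
  s.mem_nh_iff.2 ⟨ε, hε, fun _ h => h⟩

theorem nh_anti (s : ScStructure 𝕜 E) {i j : ℕ} (h : i ≤ j) (x : E) : s.nh j x ≤ s.nh i x := by
  intro V hV
  obtain ⟨ε, hε, hV⟩ := s.mem_nh_iff.1 hV
  exact s.mem_nh_iff.2 ⟨ε, hε, fun z hz => hV z ((s.nm_mono h _).trans_lt hz)⟩

theorem mem_of_mem_nh (s : ScStructure 𝕜 E) {j : ℕ} {x : E} {V : Set E} (h : V ∈ s.nh j x) :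
    x ∈ V := by
  obtain ⟨ε, hε, hV⟩ := s.mem_nh_iff.1 h
  exact hV x (by simpa using hε)

theorem nhds_eq_iInf (s : ScStructure 𝕜 E) (x : E) : 𝓝 x = ⨅ j, s.nh j x := by
  have h := congrArg (fun τ => @nhds E τ x) s.topology_eq
  simp only [nhds_iInf, nhds_induced] at h
  exact h

theorem nhds_le_nh (s : ScStructure 𝕜 E) (j : ℕ) (x : E) : 𝓝 x ≤ s.nh j x := by
  rw [s.nhds_eq_iInf]; exact iInf_le _ j

theorem tendsto_nhds_iff (t : ScStructure 𝕜 F) {α : Type*} {l : Filter α} {f : α → F} {y : F} :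
    Tendsto f l (𝓝 y) ↔ ∀ j, Tendsto f l (t.nh j y) := by
  rw [t.nhds_eq_iInf, tendsto_iInf]

theorem mem_nhds_iff' (s : ScStructure 𝕜 E) {x : E} {V : Set E} :
    V ∈ 𝓝 x ↔ ∃ j, V ∈ s.nh j x := by
  rw [s.nhds_eq_iInf, mem_iInf_of_directed]
  intro i j
  exact ⟨max i j, s.nh_anti (le_max_left _ _) x, s.nh_anti (le_max_right _ _) x⟩

theorem isOpen_ball (s : ScStructure 𝕜 E) (j : ℕ) (x : E) (ε : ℝ) :
    IsOpen {z | s.nm j (z - x) < ε} := by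
  have : Continuous fun z => ‖s.π j z - s.π j x‖ := ((s.π j).continuous.sub continuous_const).norm
  simpa only [nm_apply, map_sub] using isOpen_lt this continuous_const

theorem ball_mem_nh_of_mem (s : ScStructure 𝕜 E) {j : ℕ} {x y : E} {ε : ℝ}
    (h : s.nm j (y - x) < ε) : {z | s.nm j (z - x) < ε} ∈ s.nh j y := by
  refine s.mem_nh_iff.2 ⟨ε - s.nm j (y - x), by linarith, fun z hz => ?_⟩
  have := s.nm_add j (z - y) (y - x)
  rw [sub_add_sub_cancel] at this
  exact lt_of_le_of_lt this (by linarith)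

theorem t2Space (s : ScStructure 𝕜 E) : T2Space E := by
  refine ⟨fun x y hxy => ?_⟩
  obtain ⟨u, v, hu, hv, hxu, hyv, huv⟩ := t2_separation fun h => hxy (s.π_injective 0 h)
  exact ⟨_, _, hu.preimage (s.π 0).continuous, hv.preimage (s.π 0).continuous, hxu, hyv,
    huv.preimage _⟩

theorem nh_prod (s : ScStructure 𝕜 E) (t : ScStructure 𝕜 F) (j : ℕ) (z : E × F) :
    (s.prod t).nh j z = s.nh j z.1 ×ˢ t.nh j z.2 := by
  rw [nh, nh, nh, prod_comap_comap_eq]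
  show comap _ (𝓝 (s.π j z.1, t.π j z.2)) = _
  rw [nhds_prod_eq]; rfl

theorem tendsto_nm (s : ScStructure 𝕜 E) (j : ℕ) (x : E) :
    Tendsto (s.nm j) (s.nh j x) (𝓝 (s.nm j x)) := by
  have : Tendsto (fun z => ‖s.π j z‖) (s.nh j x) (𝓝 ‖s.π j x‖) := tendsto_comap.norm
  exact this

theorem exists_limit (s : ScStructure 𝕜 E) (x : ℕ → E)
    (hx : ∀ j, CauchySeq fun n => s.π j (x n)) :
    ∃ z : E, ∀ j, Tendsto (fun n => s.nm j (x n - z)) atTop (𝓝 0) := by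
  choose y hy using fun j => cauchySeq_tendsto_of_complete (hx j)
  obtain ⟨z, hz, _⟩ := s.existsUnique_lift y fun k => by
    refine tendsto_nhds_unique ?_ (hy k)
    simpa only [Function.comp_def, s.ι_π] using ((s.ι k).continuous.tendsto _).comp (hy (k + 1))
  refine ⟨z, fun j => ?_⟩
  have := tendsto_iff_norm_sub_tendsto_zero.1 (hy j)
  simpa only [nm_apply, map_sub, hz] using this

/-- Convergence of a sequence with summable increments. -/
theorem exists_limit_of_summable (s : ScStructure 𝕜 E) (x : ℕ → E) (a : ℕ → ℕ → ℝ)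
    (ha : ∀ j, Summable (a j)) (h : ∀ j n, s.nm j (x (n + 1) - x n) ≤ a j n) :
    ∃ z : E, ∀ j, Tendsto (fun n => s.nm j (x n - z)) atTop (𝓝 0) := by
  refine s.exists_limit x fun j => cauchySeq_of_dist_le_of_summable (a j) (fun n => ?_) (ha j)
  rw [dist_eq_norm_sub, ← map_sub, ← nm_apply, s.nm_sub_rev]
  exact h j n

/-- The vectors of `E` are dense in every level. -/
theorem denseRange_π (s : ScStructure 𝕜 E) (m : ℕ) : DenseRange (s.π m) := by
  intro y
  refine Metric.mem_closure_iff.2 fun ε hε => ?_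
  -- successive approximations `w n` at level `m + n`
  have step : ∀ n (w : s.X (m + n)), ∃ w' : s.X (m + (n + 1)),
      ‖s.ι (m + n) w' - w‖ < ε / 2 / 2 ^ (n + 1) := by
    intro n w
    obtain ⟨w', hw'⟩ := Metric.denseRange_iff.1 (s.ι_dense (m + n)) w _
      (by positivity : 0 < ε / 2 / 2 ^ (n + 1))
    exact ⟨w', by rwa [← dist_eq_norm_sub, dist_comm]⟩
  choose nx hnx using step
  let w : ∀ n, s.X (m + n) := fun n => Nat.rec y (fun n w => nx n w) n
  -- A Mittag-Leffler argument. The corrections are summable, so the images of `w` in each fixed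
  -- level are Cauchy and their limits assemble to a vector of `E`. In level `m` the total
  -- displacement from `y` is at most `ε / 2`.
  have hw : ∀ n, ‖s.ι (m + n) (w (n + 1)) - w n‖ < ε / 2 / 2 ^ (n + 1) := fun n => hnx n (w n)
  have hsum : Summable fun n : ℕ => ε / 2 / 2 ^ (n + 1) := by
    have := summable_geometric_two' (ε / 2)
    refine this.congr fun n => ?_
    rw [pow_succ]; ring
  -- the images in a fixed level
  let v : ∀ k, ℕ → s.X k := fun k n => s.incl (by omega : k ≤ m + (k + n)) (w (k + n))
  have hv : ∀ k n, ‖v k (n + 1) - v k n‖ ≤ ε / 2 / 2 ^ (k + n + 1) := by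
    intro k n
    have h1 : v k (n + 1) = s.incl (by omega : k ≤ m + (k + n)) (s.ι (m + (k + n)) (w (k + n + 1))) := by
      have := s.incl_succ (by omega : k ≤ m + (k + n))
      exact congrArg (fun A => A (w (k + n + 1))) this
    have h2 : v k (n + 1) - v k n = s.incl (by omega : k ≤ m + (k + n))
        (s.ι (m + (k + n)) (w (k + n + 1)) - w (k + n)) := by rw [h1, map_sub]
    rw [h2]
    exact ((s.incl _).le_of_opNorm_le (s.incl_norm _) _).trans
      ((one_mul _).trans_le (hw (k + n)).le)
  have hcau : ∀ k, CauchySeq (v k) := fun k =>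
    cauchySeq_of_dist_le_of_summable (fun n => ε / 2 / 2 ^ (k + n + 1)) (fun n => by
      rw [dist_eq_norm_sub, norm_sub_rev]; exact hv k n)
      (by simpa only [add_assoc, add_comm, add_left_comm] using
        (summable_nat_add_iff k).2 hsum)
  choose z hz using fun k => cauchySeq_tendsto_of_complete (hcau k)
  obtain ⟨x, hx, _⟩ := s.existsUnique_lift z fun k => by
    have h1 : Tendsto (fun n => s.ι k (v (k + 1) n)) atTop (𝓝 (s.ι k (z (k + 1)))) :=
      ((s.ι k).continuous.tendsto _).comp (hz (k + 1))
    have h2 : Tendsto (fun n => v k (n + 1)) atTop (𝓝 (z k)) := (tendsto_add_atTop_iff_nat 1).2 (hz k)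
    refine tendsto_nhds_unique h1 (h2.congr fun n => ?_)
    have e : s.ι k = s.incl (Nat.le_succ k) := by
      rw [show s.incl (Nat.le_succ k) = _ from s.incl_succ (le_refl k), ScChain.incl_self]; rfl
    have e2 : ∀ {a b : ℕ} (hab : a = b) (ha : k ≤ m + a) (hb : k ≤ m + b),
        s.incl ha (w a) = s.incl hb (w b) := by
      intro a b hab; subst hab; intros; rfl
    show _ = s.ι k (s.incl _ (w (k + 1 + n)))
    rw [e, s.incl_incl]
    exact e2 (by omega) _ _
  refine ⟨s.π m x, ⟨x, rfl⟩, ?_⟩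
  -- compare at level `m`
  have h3 : ∀ n, ‖s.incl (Nat.le_add_right m n) (w n) - y‖ ≤ ε / 2 * (1 - 1 / 2 ^ n) := by
    intro n
    induction n with
    | zero =>
      have : s.incl (Nat.le_add_right m 0) (w 0) = y :=
        congrArg (fun A => A y) (s.incl_self m)
      simp [this]
    | succ n ih =>
      have h1 : s.incl (Nat.le_add_right m (n + 1)) (w (n + 1)) =
          s.incl (Nat.le_add_right m n) (s.ι (m + n) (w (n + 1))) :=
        congrArg (fun A => A (w (n + 1))) (s.incl_succ (Nat.le_add_right m n))
      have h2 : ‖s.incl (Nat.le_add_right m n) (s.ι (m + n) (w (n + 1)) - w n)‖ ≤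
          ε / 2 / 2 ^ (n + 1) :=
        ((s.incl _).le_of_opNorm_le (s.incl_norm _) _).trans ((one_mul _).trans_le (hw n).le)
      rw [map_sub, ← h1] at h2
      have := norm_sub_le_norm_sub_add_norm_sub (s.incl (Nat.le_add_right m (n + 1)) (w (n + 1)))
        (s.incl (Nat.le_add_right m n) (w n)) y
      refine this.trans ((add_le_add h2 ih).trans_eq ?_)
      field_simp
      ring
  have h4 : Tendsto (v m) atTop (𝓝 (s.π m x)) := by rw [hx]; exact hz m
  have h5 : ∀ n, ‖v m n - y‖ ≤ ε / 2 := fun n => by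
    refine (h3 (m + n)).trans ?_
    have : (0 : ℝ) ≤ 1 / 2 ^ (m + n) := by positivity
    nlinarith
  have h6 : ‖s.π m x - y‖ ≤ ε / 2 := le_of_tendsto' (h4.sub_const y).norm h5
  rw [dist_comm, dist_eq_norm_sub]
  linarith

/-- Bounded sets for the norm `j + 1` have finite nets for the norm `j`. -/
theorem exists_finite_net (s : ScStructure 𝕜 E) (j : ℕ) (R : ℝ) {ε : ℝ} (hε : 0 < ε) :
    ∃ A : Set E, A.Finite ∧ (∀ a ∈ A, s.nm (j + 1) a ≤ R) ∧
      ∀ v, s.nm (j + 1) v ≤ R → ∃ a ∈ A, s.nm j (v - a) < ε := by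
  obtain ⟨K, hK, hK'⟩ := (s.ι_compact j).image_closedBall_subset_compact (f := (s.ι j).toLinearMap) R
  have hsub : s.π j '' {v | s.nm (j + 1) v ≤ R} ⊆ K := by
    rintro _ ⟨v, hv, rfl⟩
    exact hK' ⟨s.π (j + 1) v, by simpa [nm_apply] using hv, s.ι_π j v⟩
  have htb : TotallyBounded (s.π j '' {v | s.nm (j + 1) v ≤ R}) := hK.totallyBounded.subset hsub
  -- The net is taken inside the set itself, so its points lift to vectors of `E` with the same
  -- bound.
  obtain ⟨T, hT, hTf, hcov⟩ := totallyBounded_iff_subset.1 htb _ (Metric.dist_mem_uniformity hε)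
  obtain ⟨A, hA, hAf, rfl⟩ := exists_subset_image_finite_and.1 ⟨T, hT, hTf, rfl⟩
  refine ⟨A, hAf, fun a ha => hA ha, fun v hv => ?_⟩
  have := hcov ⟨v, hv, rfl⟩
  simp only [mem_iUnion, mem_ofPred_eq, exists_prop, exists_mem_image] at this
  obtain ⟨a, ha, h⟩ := this
  refine ⟨a, ha, ?_⟩
  rwa [dist_eq_norm_sub, ← map_sub] at h

/-- A sequence bounded for the norm `j + 1` has a subsequence that is Cauchy for the norm `j`. -/
theorem exists_subseq_cauchy (s : ScStructure 𝕜 E) (j : ℕ) {R : ℝ} {x : ℕ → E}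
    (hx : ∀ n, s.nm (j + 1) (x n) ≤ R) :
    ∃ φ : ℕ → ℕ, StrictMono φ ∧ CauchySeq fun n => s.π j (x (φ n)) := by
  obtain ⟨K, hK, hK'⟩ := (s.ι_compact j).image_closedBall_subset_compact (f := (s.ι j).toLinearMap) R
  obtain ⟨a, _, φ, hφ, hlim⟩ := hK.tendsto_subseq (x := fun n => s.π j (x n)) fun n =>
    hK' ⟨s.π (j + 1) (x n), by simpa [nm_apply] using hx n, s.ι_π j (x n)⟩
  exact ⟨φ, hφ, hlim.cauchySeq⟩

/-- A linear map with levelwise bounds is continuous. -/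
theorem continuous_of_bounds (s : ScStructure 𝕜 E) (t : ScStructure 𝕜 F) (T : E →ₗ[𝕜] F)
    (h : ∀ j, ∃ m, ∃ C : ℝ, ∀ x, t.nm j (T x) ≤ C * s.nm m x) : Continuous T := by
  refine continuous_iff_continuousAt.2 fun x => t.tendsto_nhds_iff.2 fun j => ?_
  obtain ⟨m, C, hC⟩ := h j
  refine t.tendsto_nh_iff_nm.2 ?_
  have h1 : Tendsto (fun z => C * s.nm m (z - x)) (𝓝 x) (𝓝 (C * 0)) :=
    (s.tendsto_nh_iff_nm.1 (s.nhds_le_nh m x)).const_mul C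
  rw [mul_zero] at h1
  refine squeeze_zero (fun z => t.nm_nonneg _ _) (fun z => ?_) h1
  rw [← map_sub]; exact hC _

/-- A continuous linear map is bounded for each norm of the target by some norm of the source. -/
theorem exists_bound (s : ScStructure 𝕜 E) (t : ScStructure 𝕜 F) (T : E →L[𝕜] F) (j : ℕ) :
    ∃ m, ∃ C : ℝ, 0 ≤ C ∧ ∀ x, t.nm j (T x) ≤ C * s.nm m x := by
  have h : {x | t.nm j (T x) < 1} ∈ 𝓝 (0 : E) := by
    have h0 := t.ball_mem_nh j 0 (zero_lt_one)
    have h1 : Tendsto T (𝓝 0) (t.nh j 0) := by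
      have := T.continuous.tendsto 0
      rw [map_zero] at this
      exact this.mono_right (t.nhds_le_nh j 0)
    simpa using h1 h0
  obtain ⟨m, hm⟩ := s.mem_nhds_iff'.1 h
  obtain ⟨ε, hε, hm⟩ := s.mem_nh_iff.1 hm
  refine ⟨m, 2 / ε, by positivity, fun x => ?_⟩
  by_cases hx : x = 0
  · simp [hx]
  have hp : 0 < s.nm m x := s.nm_pos hx
  set c : ℝ := ε / (2 * s.nm m x)
  have hc : 0 < c := by positivity
  have h2 := hm (((c : ℝ) : 𝕜) • x) (by
    rw [sub_zero, s.nm_real_smul m hc.le]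
    have : c * s.nm m x = ε / 2 := by simp only [c]; field_simp
    rw [this]; linarith)
  simp only [mem_ofPred_eq, map_smul] at h2
  rw [t.nm_real_smul j hc.le] at h2
  have h3 : t.nm j (T x) ≤ 1 / c := by
    rw [le_div_iff₀ hc]; linarith
  refine h3.trans_eq ?_
  simp only [c]; field_simp

end Basic

end ScStructure

/-! ### Comparison of the norms of tamely equivalent structures -/

namespace ScStructure

section Comparison

variable {𝕜 : Type*} [RCLike 𝕜]
variable {E : Type u} [AddCommGroup E] [Module 𝕜 E] [TopologicalSpace E]
variable {F : Type u} [AddCommGroup F] [Module 𝕜 F] [TopologicalSpace F]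

/-- The norms of `s` are bounded by those of `t` with a bounded shift of the index. -/
def NLe (s t : ScStructure 𝕜 E) : Prop :=
  ∃ c, ∀ j, ∃ C : ℝ, 0 ≤ C ∧ ∀ x, s.nm j x ≤ C * t.nm (j + c) x

/-- The norms of `s` and `t` are equivalent up to a bounded shift of the index. -/
def NEq (s t : ScStructure 𝕜 E) : Prop := NLe s t ∧ NLe t s

theorem NLe.refl (s : ScStructure 𝕜 E) : NLe s s :=
  ⟨0, fun _ => ⟨1, zero_le_one, fun _ => (one_mul _).ge⟩⟩

theorem NLe.trans {s t w : ScStructure 𝕜 E} (h : NLe s t) (h' : NLe t w) : NLe s w := by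
  obtain ⟨c, h⟩ := h
  obtain ⟨c', h'⟩ := h'
  refine ⟨c + c', fun j => ?_⟩
  obtain ⟨C, hC, h⟩ := h j
  obtain ⟨C', hC', h'⟩ := h' (j + c)
  refine ⟨C * C', mul_nonneg hC hC', fun x => (h x).trans ?_⟩
  rw [mul_assoc, ← add_assoc]
  exact mul_le_mul_of_nonneg_left (h' x) hC

theorem NLe.prod {s s' : ScStructure 𝕜 E} {t t' : ScStructure 𝕜 F} (h : NLe s s')
    (h' : NLe t t') : NLe (s.prod t) (s'.prod t') := by
  obtain ⟨c, h⟩ := h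
  obtain ⟨c', h'⟩ := h'
  refine ⟨max c c', fun j => ?_⟩
  obtain ⟨C, hC, h⟩ := h j
  obtain ⟨C', hC', h'⟩ := h' j
  refine ⟨max C C', le_max_of_le_left hC, fun x => ?_⟩
  rw [nm_prod, nm_prod]
  refine max_le ((h _).trans ?_) ((h' _).trans ?_)
  · exact mul_le_mul (le_max_left _ _) ((s'.nm_mono (by omega) _).trans (le_max_left _ _))
      (s'.nm_nonneg _ _) (le_max_of_le_left hC)
  · exact mul_le_mul (le_max_right _ _) ((t'.nm_mono (by omega) _).trans (le_max_right _ _))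
      (t'.nm_nonneg _ _) (le_max_of_le_left hC)

theorem NEq.refl (s : ScStructure 𝕜 E) : NEq s s := ⟨NLe.refl s, NLe.refl s⟩

theorem NEq.symm {s t : ScStructure 𝕜 E} (h : NEq s t) : NEq t s := ⟨h.2, h.1⟩

theorem NEq.trans {s t w : ScStructure 𝕜 E} (h : NEq s t) (h' : NEq t w) : NEq s w :=
  ⟨h.1.trans h'.1, h'.2.trans h.2⟩

theorem NEq.prod {s s' : ScStructure 𝕜 E} {t t' : ScStructure 𝕜 F} (h : NEq s s')
    (h' : NEq t t') : NEq (s.prod t) (s'.prod t') := ⟨h.1.prod h'.1, h.2.prod h'.2⟩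

theorem NLe.nh_le {s t : ScStructure 𝕜 E} {j m : ℕ} {C : ℝ}
    (h : ∀ x, s.nm j x ≤ C * t.nm m x) (x : E) : t.nh m x ≤ s.nh j x := by
  have h0 : Tendsto (fun z => C * t.nm m (z - x)) (t.nh m x) (𝓝 (C * 0)) :=
    (t.tendsto_nh_iff_nm.1 tendsto_id).const_mul C
  rw [mul_zero] at h0
  exact s.tendsto_nh_iff_nm.2 (squeeze_zero (fun _ => s.nm_nonneg _ _) (fun _ => h _) h0)

/-- The constant is the operator norm of the extension on level `j`, and tameness of the rescaling
bounds the shift of the index. This inequality is all that is extracted from tame equivalence. The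
injective extensions between arbitrary rescalings do not enter. -/
theorem IsTameWeakMorphism.nLe {s t : ScStructure 𝕜 E}
    (h : IsTameWeakMorphism s t (ContinuousLinearMap.id 𝕜 E)) : NLe t s := by
  obtain ⟨k, ⟨hk, c, hc⟩, A, hA, _⟩ := h
  refine ⟨c, fun j => ⟨‖A j‖, norm_nonneg _, fun x => ?_⟩⟩
  have h1 : A j (s.π (k j) x) = t.π j x := hA j x
  rw [nm_apply, ← h1]
  exact ((A j).le_opNorm _).trans
    (mul_le_mul_of_nonneg_left (s.nm_mono (hc j) x) (norm_nonneg _))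

theorem TamelyEquiv.nEq {s t : ScStructure 𝕜 E} (h : TamelyEquiv s t) : NEq s t :=
  ⟨h.2.1.nLe, h.1.1.nLe⟩

theorem strictMono_add_right (r : ℕ) : StrictMono fun j : ℕ => j + r :=
  fun _ _ h => Nat.add_lt_add_right h r

theorem isTameSeq_add (r : ℕ) : IsTameSeq fun j => j + r :=
  ⟨strictMono_add_right r, r, fun _ => le_rfl⟩

/-- The structure with the first `r` levels removed. -/
noncomputable abbrev shift (s : ScStructure 𝕜 E) (r : ℕ) : ScStructure 𝕜 E :=
  s.rescale (fun j => j + r) (strictMono_add_right r)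

/-- This is what makes a loss of `r` levels invisible: an estimate with loss becomes one without
loss after discarding the first `r` levels, and the smaller chain is still tamely compatible. -/
theorem tamelyEquiv_shift (s : ScStructure 𝕜 E) (r : ℕ) : TamelyEquiv s (s.shift r) := by
  have hid : StrictMono (fun j : ℕ => j) := strictMono_id
  refine ⟨⟨⟨_, isTameSeq_add r, fun j => ContinuousLinearMap.id 𝕜 _, fun _ _ => rfl,
    fun _ _ => rfl⟩, ⟨_, _, strictMono_add_right r, hid, fun j => ContinuousLinearMap.id 𝕜 _,
      ⟨fun _ _ => rfl, fun j y => ?_⟩, fun _ _ _ h => h⟩⟩,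
    ⟨⟨_, ⟨hid, 0, fun _ => le_rfl⟩, fun j => s.incl (Nat.le_add_right j r),
      fun j x => s.incl_π _ x, fun j y => ?_⟩,
    ⟨_, _, hid, hid, fun j => s.incl (Nat.le_add_right j r),
      ⟨fun j x => s.incl_π _ x, fun j y => ?_⟩, fun j => s.incl_injective _⟩⟩⟩
  · have h1 := (s.shift r).incl_succ (le_refl j)
    rw [ScChain.incl_self] at h1
    exact (congrArg (fun A => A y) h1).symm
  · have h2 : s.ι j = s.incl (Nat.le_succ j) := by
      rw [show s.incl (Nat.le_succ j) = _ from s.incl_succ (le_refl j), ScChain.incl_self]; rfl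
    have h1 := (s.shift r).incl_succ (le_refl j)
    rw [ScChain.incl_self] at h1
    refine (congrArg (s.incl (Nat.le_add_right j r)) (congrArg (fun A => A y) h1)).trans ?_
    rw [h2]
    exact (s.incl_incl _ _ _).trans (s.incl_incl _ _ _).symm
  · have h2 : s.incl (hid (Nat.lt_succ_self j)).le = s.incl (Nat.le_succ j) := rfl
    have h1 := (s.shift r).incl_succ (le_refl j)
    rw [ScChain.incl_self] at h1
    refine (congrArg (s.incl (Nat.le_add_right j r)) (congrArg (fun A => A y) h1)).trans ?_
    exact (s.incl_incl _ _ _).trans (s.incl_incl _ _ _).symm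

end Comparison

end ScStructure

namespace PreTameSc

open ScStructure

variable {𝕜 : Type*} [RCLike 𝕜]
variable {E : Type u} [AddCommGroup E] [Module 𝕜 E] [TopologicalSpace E]
variable {F : Type u} [AddCommGroup F] [Module 𝕜 F] [TopologicalSpace F]

theorem compat_eq (P : PreTameSc 𝕜 E) : P.compat = {t | P.rep.TamelyEquiv t} :=
  P.isClass.choose_spec

theorem shift_rep_mem (P : PreTameSc 𝕜 E) (r : ℕ) : P.rep.shift r ∈ P.compat := by
  rw [P.compat_eq]; exact tamelyEquiv_shift _ _

theorem nEq_of_mem (P : PreTameSc 𝕜 E) {s : ScStructure 𝕜 E} (h : s ∈ P.compat) :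
    NEq P.rep s := by
  rw [P.compat_eq] at h; exact TamelyEquiv.nEq h

/-- The trivial shift serves in place of `s`, since its equivalence with `s` is an instance of
`tamelyEquiv_shift`. -/
theorem mem_ofRep (s : ScStructure 𝕜 E) : s.shift 0 ∈ (ofRep s).compat := tamelyEquiv_shift s 0

theorem nEq_rep_ofRep (s : ScStructure 𝕜 E) : NEq (ofRep s).rep s :=
  ((ofRep s).nEq_of_mem (mem_ofRep s)).trans (tamelyEquiv_shift s 0).nEq.symm

theorem nEq_rep_prod (P : PreTameSc 𝕜 E) (Q : PreTameSc 𝕜 F) :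
    NEq (P.prod Q).rep (P.rep.prod Q.rep) := nEq_rep_ofRep _

theorem nEq_rep_pi (P : PreTameSc 𝕜 E) (n : ℕ) : NEq (P.pi n).rep (P.rep.pi n) :=
  nEq_rep_ofRep _

end PreTameSc

/-! ### Hadamard derivatives -/

section Hadamard

variable {𝕜 : Type*} [RCLike 𝕜]
variable {E : Type u} [AddCommGroup E] [Module 𝕜 E] [TopologicalSpace E]
variable {F : Type u} [AddCommGroup F] [Module 𝕜 F] [TopologicalSpace F]
variable {G : Type u} [AddCommGroup G] [Module 𝕜 G] [TopologicalSpace G]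

/-- `L` is the Hadamard derivative of `f` at `x`: the difference quotients
`(f (x + t u) - f x) / t` tend to `L u₀` as `u → u₀` and `t → 0`, `t > 0`. -/
def HD (f : E → F) (x : E) (L : E →L[𝕜] F) : Prop :=
  ∀ u₀, Tendsto (fun p : E × ℝ => (p.2 : 𝕜)⁻¹ • (f (x + (p.2 : 𝕜) • p.1) - f x))
    (𝓝 u₀ ×ˢ 𝓝[>] 0) (𝓝 (L u₀))

theorem eventually_snd_pos {E : Type*} [TopologicalSpace E] (u₀ : E) : ∀ᶠ p : E × ℝ in 𝓝 u₀ ×ˢ 𝓝[>] 0, 0 < p.2 :=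
  tendsto_snd.eventually (eventually_mem_nhdsWithin (a := (0 : ℝ)) (s := Ioi 0))

theorem tendsto_ofReal_snd {E : Type*} [TopologicalSpace E] (u₀ : E) :
    Tendsto (fun p : E × ℝ => (p.2 : 𝕜)) (𝓝 u₀ ×ˢ 𝓝[>] 0) (𝓝 0) := by
  have : Tendsto (fun t : ℝ => (t : 𝕜)) (𝓝 0) (𝓝 0) := by
    simpa using (RCLike.continuous_ofReal (K := 𝕜)).tendsto 0
  exact (this.mono_left nhdsWithin_le_nhds).comp tendsto_snd

theorem tendsto_add_smul [IsTopologicalAddGroup E] [ContinuousSMul 𝕜 E] (x u₀ : E) :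
    Tendsto (fun p : E × ℝ => x + (p.2 : 𝕜) • p.1) (𝓝 u₀ ×ˢ 𝓝[>] 0) (𝓝 x) := by
  have := ((tendsto_ofReal_snd (𝕜 := 𝕜) u₀).smul
    (tendsto_fst (f := 𝓝 u₀) (g := 𝓝[>] (0 : ℝ)))).const_add x
  simpa using this

theorem HD.congr [IsTopologicalAddGroup E] [ContinuousSMul 𝕜 E] {f g : E → F} {x : E}
    {L : E →L[𝕜] F} (h : HD f x L) (hfg : f =ᶠ[𝓝 x] g) : HD g x L := by
  intro u₀
  refine (h u₀).congr' ?_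
  filter_upwards [(tendsto_add_smul (𝕜 := 𝕜) x u₀).eventually hfg] with p hp
  rw [hp, hfg.eq_of_nhds]

theorem HD.unique [T2Space F] {f : E → F} {x : E} {L L' : E →L[𝕜] F} (h : HD f x L)
    (h' : HD f x L') : L = L' :=
  ContinuousLinearMap.ext fun u => tendsto_nhds_unique (h u) (h' u)

/-- The direction varies together with `t` in the definition of `HD`. The difference quotient of `f`
can thus be fed to `g` as the varying direction, and no uniformity is needed. This is the reason for
working with Hadamard derivatives. -/
theorem HD.comp {g : F → G} {f : E → F} {x : E} {L' : F →L[𝕜] G} {L : E →L[𝕜] F}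
    (hg : HD g (f x) L') (hf : HD f x L) : HD (fun y => g (f y)) x (L'.comp L) := by
  intro u₀
  have h1 := (hf u₀).prodMk (tendsto_snd (f := 𝓝 u₀) (g := 𝓝[>] (0 : ℝ)))
  refine ((hg (L u₀)).comp h1).congr' ?_
  filter_upwards [eventually_snd_pos u₀] with p hp
  have hp' : (p.2 : 𝕜) ≠ 0 := by exact_mod_cast hp.ne'
  simp only [Function.comp_apply, smul_inv_smul₀ hp', add_sub_cancel]

theorem HD.of_clm [IsTopologicalAddGroup F] (T : E →L[𝕜] F) (c : F) (x : E) :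
    HD (fun y => T y + c) x T := by
  intro u₀
  refine ((T.continuous.tendsto u₀).comp (tendsto_fst (g := 𝓝[>] (0 : ℝ)))).congr' ?_
  filter_upwards [eventually_snd_pos u₀] with p hp
  have hp' : (p.2 : 𝕜) ≠ 0 := by exact_mod_cast hp.ne'
  simp [inv_smul_smul₀ hp']

theorem HD.clm (T : E →L[𝕜] F) (x : E) : HD T x T := by
  intro u₀
  refine ((T.continuous.tendsto u₀).comp (tendsto_fst (g := 𝓝[>] (0 : ℝ)))).congr' ?_
  filter_upwards [eventually_snd_pos u₀] with p hp
  have hp' : (p.2 : 𝕜) ≠ 0 := by exact_mod_cast hp.ne'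
  simp [inv_smul_smul₀ hp']

theorem HD.const (c : F) (x : E) : HD (fun _ : E => c) x (0 : E →L[𝕜] F) := by
  intro u₀
  simp [tendsto_const_nhds]

theorem HD.prodMk {f : E → F} {g : E → G} {x : E} {L : E →L[𝕜] F} {M : E →L[𝕜] G}
    (hf : HD f x L) (hg : HD g x M) : HD (fun y => (f y, g y)) x (L.prod M) := by
  intro u₀
  exact (hf u₀).prodMk_nhds (hg u₀)

theorem HD.add [ContinuousAdd F] {f g : E → F} {x : E} {L M : E →L[𝕜] F}
    (hf : HD f x L) (hg : HD g x M) : HD (fun y => f y + g y) x (L + M) := by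
  intro u₀
  refine ((hf u₀).add (hg u₀)).congr fun p => ?_
  simp only [smul_sub, smul_add]; abel

theorem HD.const_smul [ContinuousSMul 𝕜 F] {f : E → F} {x : E} {L : E →L[𝕜] F}
    (c : 𝕜) (hf : HD f x L) : HD (fun y => c • f y) x (c • L) := by
  intro u₀
  refine ((hf u₀).const_smul c).congr fun p => ?_
  rw [smul_comm, smul_sub]

/-- The weak Fréchet remainder is controlled for directions in `V` only. Other directions are
reached by homogeneity: direction `u` at time `t` and direction `c • u` at time `t / c` give the
same point. -/
theorem HasWDerivAt.hd [IsTopologicalAddGroup F] [ContinuousSMul 𝕜 E] [ContinuousSMul 𝕜 F]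
    {f : E → F} {U : Set E} {x : E} {L : E →L[𝕜] F} (h : HasWDerivAt f U x L) : HD f x L := by
  obtain ⟨V, hV, -, -, -, hc⟩ := h
  intro u₀
  -- scale `u₀` into `V`
  have h0 : Tendsto (fun c : ℝ => (c : 𝕜) • u₀) (𝓝[>] 0) (𝓝 0) := by
    have : Tendsto (fun t : ℝ => (t : 𝕜)) (𝓝 0) (𝓝 0) := by
      simpa using (RCLike.continuous_ofReal (K := 𝕜)).tendsto 0
    simpa using (this.mono_left nhdsWithin_le_nhds).smul_const u₀
  obtain ⟨c, hcV, hc0⟩ := ((h0.eventually (interior_mem_nhds.2 hV)).and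
    (eventually_mem_nhdsWithin (a := (0 : ℝ)) (s := Ioi 0))).exists
  have hc0' : (c : 𝕜) ≠ 0 := by exact_mod_cast (ne_of_gt hc0)
  have hVn : V ∈ 𝓝 ((c : 𝕜) • u₀) := mem_interior_iff_mem_nhds.1 hcV
  have hm1 : Tendsto (fun p : E × ℝ => (c : 𝕜) • p.1) (𝓝 u₀ ×ˢ 𝓝[>] 0) (𝓝 ((c : 𝕜) • u₀)) :=
    tendsto_fst.const_smul _
  have hm2 : Tendsto (fun p : E × ℝ => p.2 / c) (𝓝 u₀ ×ˢ 𝓝[>] 0) (𝓝 0) := by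
    have : Tendsto (fun p : E × ℝ => p.2 / c) (𝓝 u₀ ×ˢ 𝓝[>] 0) (𝓝 (0 / c)) :=
      ((tendsto_id.mono_left nhdsWithin_le_nhds).comp tendsto_snd).div_const c
    simpa using this
  have hm : Tendsto (fun p : E × ℝ => ((c : 𝕜) • p.1, p.2 / c)) (𝓝 u₀ ×ˢ 𝓝[>] 0)
      (𝓝[V ×ˢ Icc (0 : ℝ) 1] ((c : 𝕜) • u₀, 0)) := by
    refine tendsto_nhdsWithin_iff.2 ⟨hm1.prodMk_nhds hm2, ?_⟩
    filter_upwards [hm1.eventually hVn, eventually_snd_pos u₀,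
      hm2.eventually (Iic_mem_nhds (zero_lt_one))] with p hp1 hp2 hp3
    exact ⟨hp1, (div_pos hp2 hc0).le, hp3⟩
  have h1 := (hc ((c : 𝕜) • u₀, 0) ⟨mem_of_mem_nhds hVn, by simp⟩).tendsto.comp hm
  have h2 : wRemainder f x L ((c : 𝕜) • u₀, (0 : ℝ)) = 0 := by simp [wRemainder]
  rw [h2] at h1
  have h3 := (h1.const_smul ((c : 𝕜)⁻¹)).add
    ((L.continuous.tendsto u₀).comp (tendsto_fst (g := 𝓝[>] (0 : ℝ))))
  rw [smul_zero, zero_add] at h3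
  refine h3.congr' ?_
  filter_upwards [eventually_snd_pos u₀] with p hp
  have hp' : (p.2 : 𝕜) ≠ 0 := by exact_mod_cast hp.ne'
  have hpc : p.2 / c ≠ 0 := (div_pos hp hc0).ne'
  simp only [Function.comp_apply, wRemainder, if_neg hpc, map_smul, smul_sub, inv_smul_smul₀ hc0',
    smul_smul, RCLike.ofReal_div, inv_div, sub_add_cancel]
  rw [div_mul_cancel₀ _ hc0', ← mul_div_assoc, inv_mul_cancel₀ hc0', one_div]

/-- Continuity of the remainder at `t = 0` is exactly the Hadamard condition, and at `t > 0` it is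
continuity of `f`. A ball of one of the norms provides the convex balanced neighbourhood. -/
theorem HD.hasWDerivAt [IsTopologicalAddGroup E] [IsTopologicalAddGroup F] [ContinuousSMul 𝕜 E]
    [ContinuousSMul 𝕜 F] (s : ScStructure 𝕜 E)
    {f : E → F} {U : Set E} (hU : IsOpen U) (hf : ContinuousOn f U) {x : E} (hx : x ∈ U)
    {L : E →L[𝕜] F} (h : HD f x L) : HasWDerivAt f U x L := by
  obtain ⟨m, hm⟩ := s.mem_nhds_iff'.1 (hU.mem_nhds hx)
  obtain ⟨ε, hε, hm⟩ := s.mem_nh_iff.1 hm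
  have hball : ∀ u, s.nm m u < ε → x + u ∈ U := fun u hu => hm _ (by simpa using hu)
  have hV : {u | s.nm m u < ε} ∈ 𝓝 (0 : E) := by
    simpa using s.nhds_le_nh m 0 (s.ball_mem_nh m 0 hε)
  refine ⟨{u | s.nm m u < ε}, hV, ?_, ?_, hball, ?_⟩
  · intro a ha
    rintro _ ⟨u, hu, rfl⟩
    show s.nm m (a • u) < ε
    rw [s.nm_smul]
    exact (mul_le_of_le_one_left (s.nm_nonneg _ _) ha).trans_lt hu
  · intro u hu v hv a b ha hb hab
    show s.nm m _ < ε
    refine (s.nm_add _ _ _).trans_lt ?_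
    rw [s.nm_real_smul m ha, s.nm_real_smul m hb]
    rcases ha.eq_or_lt with rfl | ha'
    · rw [zero_add] at hab; subst hab; simpa using hv
    · have h1 : a * s.nm m u < a * ε := mul_lt_mul_of_pos_left hu ha'
      have h2 : b * s.nm m v ≤ b * ε := mul_le_mul_of_nonneg_left (le_of_lt hv) hb
      calc _ < a * ε + b * ε := add_lt_add_of_lt_of_le h1 h2
        _ = ε := by rw [← add_mul, hab, one_mul]
  · rintro ⟨u, τ⟩ ⟨hu, hτ⟩
    rcases eq_or_ne τ 0 with rfl | hτ0
    · have h2 : wRemainder f x L (u, (0 : ℝ)) = 0 := by simp [wRemainder]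
      rw [ContinuousWithinAt, h2]
      have h3 : Tendsto (wRemainder f x L) (𝓝 u ×ˢ 𝓝[>] (0 : ℝ)) (𝓝 0) := by
        have := (h u).sub ((L.continuous.tendsto u).comp (tendsto_fst (g := 𝓝[>] (0 : ℝ))))
        rw [sub_self] at this
        refine this.congr' ?_
        filter_upwards [eventually_snd_pos u] with p hp
        simp [wRemainder, hp.ne']
      have h4 : Tendsto (wRemainder f x L) (𝓝 u ×ˢ pure (0 : ℝ)) (𝓝 0) := by
        refine (tendsto_const_nhds).congr' ?_
        have : ∀ᶠ p : E × ℝ in 𝓝 u ×ˢ pure (0 : ℝ), p.2 = 0 :=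
          tendsto_snd.eventually (show ∀ᶠ t in pure (0 : ℝ), t = 0 from rfl)
        filter_upwards [this] with p hp
        simp [wRemainder, hp]
      -- Near `0` the interval consists of the times `t > 0`, where `HD` applies, and of `t = 0`,
      -- where the remainder is `0` by definition for every direction.
      have h5 : 𝓝[{u | s.nm m u < ε} ×ˢ Icc (0 : ℝ) 1] (u, (0 : ℝ)) ≤
          (𝓝 u ×ˢ 𝓝[>] (0 : ℝ)) ⊔ (𝓝 u ×ˢ pure (0 : ℝ)) := by
        rw [← prod_sup, nhdsWithin_prod_eq]
        refine prod_mono nhdsWithin_le_nhds ?_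
        refine (nhdsWithin_mono (0 : ℝ) Icc_subset_Ici_self).trans ?_
        rw [← Ioi_insert, nhdsWithin_insert, sup_comm]
      exact (h3.sup h4).mono_left h5
    · refine ContinuousAt.continuousWithinAt ?_
      have hτ' : (τ : 𝕜) ≠ 0 := by exact_mod_cast hτ0
      have hmem : x + (τ : 𝕜) • u ∈ U := by
        refine hball _ ?_
        rw [s.nm_real_smul m hτ.1]
        exact (mul_le_of_le_one_left (s.nm_nonneg _ _) hτ.2).trans_lt hu
      have hre : Continuous fun p : E × ℝ => (p.2 : 𝕜) :=
        RCLike.continuous_ofReal.comp continuous_snd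
      have h1 : ContinuousAt (fun p : E × ℝ => f (x + (p.2 : 𝕜) • p.1)) (u, τ) := by
        refine ContinuousAt.comp (f := fun p : E × ℝ => x + (p.2 : 𝕜) • p.1) (g := f)
          (hf.continuousAt (hU.mem_nhds hmem)) ?_
        exact (continuous_const.add (hre.smul continuous_fst)).continuousAt
      have h2 : ContinuousAt (fun p : E × ℝ => (p.2 : 𝕜)⁻¹ • (f (x + (p.2 : 𝕜) • p.1) - f x) -
          L p.1) (u, τ) :=
        ((hre.continuousAt.inv₀ hτ').smul (h1.sub continuousAt_const)).sub
          (L.continuous.comp continuous_fst).continuousAt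
      refine h2.congr ?_
      have : ∀ᶠ p : E × ℝ in 𝓝 (u, τ), p.2 ≠ 0 :=
        continuous_snd.continuousAt.eventually_ne hτ0
      filter_upwards [this] with p hp
      simp [wRemainder, hp]

theorem wDeriv_eq [IsTopologicalAddGroup F] [ContinuousSMul 𝕜 E]
    [ContinuousSMul 𝕜 F] [T2Space F] {f : E → F} {U : Set E} {x : E} {L : E →L[𝕜] F}
    (h : HasWDerivAt f U x L) : wDeriv 𝕜 f U x = L := by
  have hex : ∃ L : E →L[𝕜] F, HasWDerivAt f U x L := ⟨L, h⟩
  rw [wDeriv, dif_pos hex]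
  exact hex.choose_spec.hd.unique h.hd

theorem WDiffOn.hd [IsTopologicalAddGroup F] [ContinuousSMul 𝕜 E]
    [ContinuousSMul 𝕜 F] {f : E → F} {U : Set E} {x : E}
    (h : WDiffOn 𝕜 f U) (hx : x ∈ U) : HD f x (wDeriv 𝕜 f U x) := by
  have hex := h x hx
  rw [wDeriv, dif_pos hex]
  exact hex.choose_spec.hd

theorem WDiffOn.mono_hd [IsTopologicalAddGroup F] [ContinuousSMul 𝕜 E]
    [ContinuousSMul 𝕜 F] [T2Space F] {f : E → F} {U V : Set E} {x : E}
    (h : WDiffOn 𝕜 f U) (h' : WDiffOn 𝕜 f V) (hx : x ∈ U) (hx' : x ∈ V) :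
    wDeriv 𝕜 f V x = wDeriv 𝕜 f U x :=
  (h'.hd hx').unique (h.hd hx)

/-- Right derivative along a line, at a fixed level. -/
theorem HD.hasDerivWithinAt (t : ScStructure 𝕜 F) (j : ℕ) [NormedSpace ℝ (t.X j)]
    [IsScalarTower ℝ 𝕜 (t.X j)] {g : E → F} {x v : E} {τ : ℝ} {L : E →L[𝕜] F}
    (h : HD g (x + (τ : 𝕜) • v) L) :
    HasDerivWithinAt (fun τ : ℝ => t.π j (g (x + (τ : 𝕜) • v))) (t.π j (L v)) (Ici τ) τ := by
  rw [← hasDerivWithinAt_Ioi_iff_Ici, hasDerivWithinAt_iff_tendsto_slope' self_notMem_Ioi]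
  have h1 : Tendsto (fun σ : ℝ => (v, σ - τ)) (𝓝[>] τ) (𝓝 v ×ˢ 𝓝[>] 0) := by
    refine (tendsto_const_nhds).prodMk ?_
    refine tendsto_nhdsWithin_iff.2 ⟨?_, ?_⟩
    · have : Tendsto (fun σ : ℝ => σ - τ) (𝓝 τ) (𝓝 (τ - τ)) := tendsto_id.sub_const τ
      rw [sub_self] at this
      exact this.mono_left nhdsWithin_le_nhds
    · filter_upwards [self_mem_nhdsWithin] with σ hσ
      exact sub_pos.2 (mem_Ioi.1 hσ)
  have h2 := (((t.π j).continuous.tendsto _).comp (h v)).comp h1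
  refine h2.congr fun σ => ?_
  simp only [Function.comp_apply, slope, vsub_eq_sub]
  have e1 : ((σ - τ : ℝ) : 𝕜) • v = (σ : 𝕜) • v - (τ : 𝕜) • v := by
    rw [← sub_smul]; push_cast; rfl
  have e2 : x + (τ : 𝕜) • v + ((σ - τ : ℝ) : 𝕜) • v = x + (σ : 𝕜) • v := by rw [e1]; abel
  rw [e2, map_smul, map_sub, ← RCLike.ofReal_inv, ← RCLike.real_smul_eq_coe_smul (K := 𝕜)]

/-- The mean value inequality along a segment. -/
theorem nm_sub_le_of_hd [IsTopologicalAddGroup E] [ContinuousSMul 𝕜 E]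
    (t : ScStructure 𝕜 F) (j : ℕ) {g : E → F} {x v : E}
    {L : ℝ → E →L[𝕜] F} {C : ℝ}
    (hc : ∀ τ ∈ Icc (0 : ℝ) 1, ContinuousAt g (x + (τ : 𝕜) • v))
    (hd : ∀ τ ∈ Icc (0 : ℝ) 1, HD g (x + (τ : 𝕜) • v) (L τ))
    (hC : ∀ τ ∈ Icc (0 : ℝ) 1, t.nm j (L τ v) ≤ C) : t.nm j (g (x + v) - g x) ≤ C := by
  let _ : NormedSpace ℝ (t.X j) := NormedSpace.restrictScalars ℝ 𝕜 (t.X j)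
  have _ : IsScalarTower ℝ 𝕜 (t.X j) := ⟨fun a b y => by
    rw [Algebra.smul_def, mul_smul]; rfl⟩
  have hline : Continuous fun τ : ℝ => x + (τ : 𝕜) • v :=
    continuous_const.add ((RCLike.continuous_ofReal).smul continuous_const)
  have hcont : ContinuousOn (fun τ : ℝ => t.π j (g (x + (τ : 𝕜) • v))) (Icc 0 1) := fun τ hτ =>
    ((t.π j).continuous.continuousAt.comp
      (ContinuousAt.comp (f := fun τ : ℝ => x + (τ : 𝕜) • v) (g := g) (hc τ hτ)
        hline.continuousAt)).continuousWithinAt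
  -- `HD` only involves `t > 0`, so only right derivatives along the segment are available. For a
  -- continuous curve they suffice.
  have := norm_image_sub_le_of_norm_deriv_right_le_segment hcont
    (fun τ hτ => (hd τ ⟨hτ.1, hτ.2.le⟩).hasDerivWithinAt t j)
    (fun τ hτ => hC τ ⟨hτ.1, hτ.2.le⟩) 1 ⟨zero_le_one, le_rfl⟩
  simpa [ScStructure.nm_apply] using this

end Hadamard

/-! ### Levelwise continuous and tame maps with a bounded loss of levels -/

namespace ScStructure

section Tame

variable {𝕜 : Type*} [RCLike 𝕜]
variable {E : Type u} [AddCommGroup E] [Module 𝕜 E] [TopologicalSpace E]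
variable {F : Type u} [AddCommGroup F] [Module 𝕜 F] [TopologicalSpace F]
variable {G : Type u} [AddCommGroup G] [Module 𝕜 G] [TopologicalSpace G]

/-- `g : U → F` is, locally and with a bounded loss `r` of levels, continuous for each of the norms
and, if `τ` holds, satisfies linear growth estimates. -/
def LCT (τ : Prop) (s : ScStructure 𝕜 E) (t : ScStructure 𝕜 F) (U : Set E) (g : E → F) : Prop :=
  ∀ x ∈ U, ∃ r, ∃ V ∈ s.nh r x, V ⊆ U ∧
    (∀ y ∈ V, ∀ j, Tendsto g (s.nh (j + r) y) (t.nh j (g y))) ∧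
    (τ → ∀ j, ∃ C : ℝ, 0 ≤ C ∧ ∀ y ∈ V, t.nm j (g y) ≤ C * (1 + s.nm (j + r) y))

/-- A linear map with bounded loss of levels. -/
def TameLin (s : ScStructure 𝕜 E) (t : ScStructure 𝕜 F) (T : E → F) : Prop :=
  ∃ c, ∀ j, ∃ C : ℝ, 0 ≤ C ∧ ∀ x, t.nm j (T x) ≤ C * s.nm (j + c) x

variable {τ : Prop} {s : ScStructure 𝕜 E} {t : ScStructure 𝕜 F} {w : ScStructure 𝕜 G}

theorem LCT.mem_nhds {U : Set E} {g : E → F} (h : LCT τ s t U g) {x : E} (hx : x ∈ U) :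
    U ∈ 𝓝 x := by
  obtain ⟨r, V, hV, hVU, -⟩ := h x hx
  exact mem_of_superset (s.nhds_le_nh r x hV) hVU

theorem LCT.isOpen {U : Set E} {g : E → F} (h : LCT τ s t U g) : IsOpen U :=
  isOpen_iff_mem_nhds.2 fun _ hx => h.mem_nhds hx

theorem LCT.continuousAt {U : Set E} {g : E → F} (h : LCT τ s t U g) {x : E} (hx : x ∈ U) :
    ContinuousAt g x := by
  obtain ⟨r, V, hV, hVU, hc, -⟩ := h x hx
  exact t.tendsto_nhds_iff.2 fun j =>
    (hc x (s.mem_of_mem_nh hV) j).mono_left (s.nhds_le_nh (j + r) x)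

theorem LCT.continuousOn {U : Set E} {g : E → F} (h : LCT τ s t U g) : ContinuousOn g U :=
  fun _ hx => (h.continuousAt hx).continuousWithinAt

/-- An open set is a neighbourhood of `x` for some norm, not for a prescribed one. Restriction
therefore costs additional levels `m` depending on the point, which is why the loss in `LCT` is
chosen locally. -/
theorem LCT.mono {U V : Set E} {g : E → F} (h : LCT τ s t U g) (hV : IsOpen V) (hVU : V ⊆ U) :
    LCT τ s t V g := by
  intro x hx
  obtain ⟨r, A, hA, hAU, hc, hb⟩ := h x (hVU hx)
  obtain ⟨m, hm⟩ := s.mem_nhds_iff'.1 (hV.mem_nhds hx)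
  refine ⟨r + m, A ∩ V, inter_mem (s.nh_anti (Nat.le_add_right r m) x hA)
    (s.nh_anti (Nat.le_add_left m r) x hm), inter_subset_right, fun y hy j => ?_, fun hτ j => ?_⟩
  · exact (hc y hy.1 j).mono_left (s.nh_anti (by omega) y)
  · obtain ⟨C, hC, hb⟩ := hb hτ j
    refine ⟨C, hC, fun y hy => (hb y hy.1).trans (mul_le_mul_of_nonneg_left ?_ hC)⟩
    linarith [s.nm_mono (by omega : j + r ≤ j + (r + m)) y]

theorem LCT.congr {U : Set E} {g g' : E → F} (h : LCT τ s t U g) (hg : EqOn g g' U) :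
    LCT τ s t U g' := by
  intro x hx
  obtain ⟨r, A, hA, hAU, hc, hb⟩ := h x hx
  obtain ⟨ε, hε, hA⟩ := s.mem_nh_iff.1 hA
  refine ⟨r, {z | s.nm r (z - x) < ε}, s.ball_mem_nh r x hε, fun z hz => hAU (hA z hz),
    fun y hy j => ?_, fun hτ j => ?_⟩
  · rw [← hg (hAU (hA y hy))]
    refine (hc y (hA y hy) j).congr' ?_
    filter_upwards [s.nh_anti (Nat.le_add_left r j) y (s.ball_mem_nh_of_mem hy)] with z hz
    exact hg (hAU (hA z hz))
  · obtain ⟨C, hC, hb⟩ := hb hτ j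
    refine ⟨C, hC, fun y hy => ?_⟩
    rw [← hg (hAU (hA y hy))]
    exact hb y (hA y hy)

/-- Losses add, also for the domain: the neighbourhood for `g` is open in norm `r'`, and its
preimage is a neighbourhood in norm `r' + r` because `f` is continuous between these norms. Linear
growth is preserved, with constant `C' * (1 + C)`. -/
theorem LCT.comp {g : F → G} {f : E → F} {U : Set E} {V : Set F} (hg : LCT τ t w V g)
    (hf : LCT τ s t U f) (hm : MapsTo f U V) : LCT τ s w U fun x => g (f x) := by
  intro x hx
  obtain ⟨r, A, hA, hAU, hc, hb⟩ := hf x hx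
  obtain ⟨r', A', hA', hAV, hc', hb'⟩ := hg (f x) (hm hx)
  have h1 : f ⁻¹' A' ∈ s.nh (r' + r) x := hc x (s.mem_of_mem_nh hA) r' hA'
  refine ⟨r' + r, A ∩ f ⁻¹' A', inter_mem (s.nh_anti (Nat.le_add_left r r') x hA) h1,
    fun y hy => hAU hy.1, fun y hy j => ?_, fun hτ j => ?_⟩
  · have := (hc' (f y) hy.2 j).comp (hc y hy.1 (j + r'))
    rwa [add_assoc] at this
  · obtain ⟨C', hC', hb'⟩ := hb' hτ j
    obtain ⟨C, hC, hb⟩ := hb hτ (j + r')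
    refine ⟨C' * (1 + C), by positivity, fun y hy => (hb' _ hy.2).trans ?_⟩
    rw [mul_assoc]
    refine mul_le_mul_of_nonneg_left ?_ hC'
    have h2 := hb y hy.1
    rw [add_assoc] at h2
    have h3 := s.nm_nonneg (j + (r' + r)) y
    nlinarith

theorem LCT.prodMk {f : E → F} {g : E → G} {U : Set E} (hf : LCT τ s t U f)
    (hg : LCT τ s w U g) : LCT τ s (t.prod w) U fun x => (f x, g x) := by
  intro x hx
  obtain ⟨r, A, hA, hAU, hc, hb⟩ := hf x hx
  obtain ⟨r', A', hA', hAV, hc', hb'⟩ := hg x hx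
  refine ⟨r + r', A ∩ A', inter_mem (s.nh_anti (Nat.le_add_right r r') x hA)
    (s.nh_anti (Nat.le_add_left r' r) x hA'), fun y hy => hAU hy.1, fun y hy j => ?_,
    fun hτ j => ?_⟩
  · rw [nh_prod]
    exact ((hc y hy.1 j).mono_left (s.nh_anti (by omega) y)).prodMk
      ((hc' y hy.2 j).mono_left (s.nh_anti (by omega) y))
  · obtain ⟨C', hC', hb'⟩ := hb' hτ j
    obtain ⟨C, hC, hb⟩ := hb hτ j
    refine ⟨C + C', by positivity, fun y hy => max_le ((hb y hy.1).trans ?_)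
      ((hb' y hy.2).trans ?_)⟩
    · have h1 := s.nm_mono (by omega : j + r ≤ j + (r + r')) y
      exact mul_le_mul (by linarith) (by linarith) (by linarith [s.nm_nonneg (j + r) y])
        (by positivity)
    · have h1 := s.nm_mono (by omega : j + r' ≤ j + (r + r')) y
      exact mul_le_mul (by linarith) (by linarith) (by linarith [s.nm_nonneg (j + r') y])
        (by positivity)

theorem LCT.clm {T : E →L[𝕜] F} (hT : TameLin s t T) : LCT τ s t univ T := by
  obtain ⟨c, hT⟩ := hT
  refine fun x _ => ⟨c, univ, univ_mem, subset_rfl, fun y _ j => ?_, fun _ j => ?_⟩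
  · obtain ⟨C, hC, hT⟩ := hT j
    refine t.tendsto_nh_iff_nm.2 ?_
    have h0 : Tendsto (fun z => C * s.nm (j + c) (z - y)) (s.nh (j + c) y) (𝓝 (C * 0)) :=
      (s.tendsto_nh_iff_nm.1 tendsto_id).const_mul C
    rw [mul_zero] at h0
    refine squeeze_zero (fun _ => t.nm_nonneg _ _) (fun z => ?_) h0
    rw [← map_sub]; exact hT _
  · obtain ⟨C, hC, hT⟩ := hT j
    refine ⟨C, hC, fun y _ => (hT y).trans (mul_le_mul_of_nonneg_left ?_ hC)⟩
    linarith

theorem LCT.const (c : F) : LCT τ s t univ fun _ => c := by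
  refine fun x _ => ⟨0, univ, univ_mem, subset_rfl, fun y _ j => ?_, fun _ j => ?_⟩
  · exact t.tendsto_nh_iff.2 tendsto_const_nhds
  · refine ⟨t.nm j c, t.nm_nonneg _ _, fun y _ => ?_⟩
    nlinarith [t.nm_nonneg j c, s.nm_nonneg (j + 0) y, mul_nonneg (t.nm_nonneg j c) (s.nm_nonneg (j + 0) y)]

theorem TameLin.comp {g : F → G} {f : E → F} (hg : TameLin t w g) (hf : TameLin s t f) :
    TameLin s w fun x => g (f x) := by
  obtain ⟨c, hg⟩ := hg
  obtain ⟨c', hf⟩ := hf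
  refine ⟨c + c', fun j => ?_⟩
  obtain ⟨C, hC, hg⟩ := hg j
  obtain ⟨C', hC', hf⟩ := hf (j + c)
  refine ⟨C * C', by positivity, fun x => (hg _).trans ?_⟩
  rw [mul_assoc, ← add_assoc]
  exact mul_le_mul_of_nonneg_left (hf x) hC

theorem TameLin.prodMk {f : E → F} {g : E → G} (hf : TameLin s t f) (hg : TameLin s w g) :
    TameLin s (t.prod w) fun x => (f x, g x) := by
  obtain ⟨c, hg⟩ := hg
  obtain ⟨c', hf⟩ := hf
  refine ⟨c + c', fun j => ?_⟩
  obtain ⟨C, hC, hg⟩ := hg j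
  obtain ⟨C', hC', hf⟩ := hf j
  refine ⟨C + C', by positivity, fun x => max_le ((hf x).trans ?_) ((hg x).trans ?_)⟩
  · exact mul_le_mul (by linarith) (s.nm_mono (by omega) _) (s.nm_nonneg _ _) (by positivity)
  · exact mul_le_mul (by linarith) (s.nm_mono (by omega) _) (s.nm_nonneg _ _) (by positivity)

theorem TameLin.add [IsTopologicalAddGroup F] {f g : E → F} (hf : TameLin s t f)
    (hg : TameLin s t g) : TameLin s t fun x => f x + g x := by
  obtain ⟨c, hg⟩ := hg
  obtain ⟨c', hf⟩ := hf
  refine ⟨c + c', fun j => ?_⟩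
  obtain ⟨C, hC, hg⟩ := hg j
  obtain ⟨C', hC', hf⟩ := hf j
  refine ⟨C' + C, by positivity, fun x => (t.nm_add _ _ _).trans ?_⟩
  rw [add_mul]
  exact add_le_add
    ((hf x).trans (mul_le_mul_of_nonneg_left (s.nm_mono (by omega) _) hC'))
    ((hg x).trans (mul_le_mul_of_nonneg_left (s.nm_mono (by omega) _) hC))

theorem TameLin.neg {f : E → F} (hf : TameLin s t f) : TameLin s t fun x => -f x := by
  obtain ⟨c, hf⟩ := hf
  refine ⟨c, fun j => ?_⟩
  obtain ⟨C, hC, hf⟩ := hf j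
  exact ⟨C, hC, fun x => by rw [map_neg_eq_map]; exact hf x⟩

theorem TameLin.of_nLe {s s' : ScStructure 𝕜 E} (h : NLe s s') : TameLin s' s fun x => x := h

theorem TameLin.id : TameLin s s fun x => x := NLe.refl s

theorem TameLin.fst : TameLin (s.prod t) s Prod.fst :=
  ⟨0, fun _ => ⟨1, zero_le_one, fun _ => (le_max_left _ _).trans_eq (one_mul _).symm⟩⟩

theorem TameLin.snd : TameLin (s.prod t) t Prod.snd :=
  ⟨0, fun _ => ⟨1, zero_le_one, fun _ => (le_max_right _ _).trans_eq (one_mul _).symm⟩⟩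

theorem TameLin.zero : TameLin s t fun _ => 0 :=
  ⟨0, fun _ => ⟨0, le_rfl, fun _ => by rw [nm_zero, zero_mul]⟩⟩

theorem TameLin.apply (n : ℕ) (i : Fin n) : TameLin (s.pi n) s fun v => v i :=
  ⟨0, fun _ => ⟨1, zero_le_one, fun v => (nm_le_nm_pi s n _ v i).trans_eq (one_mul _).symm⟩⟩

theorem TameLin.pi (n : ℕ) {f : Fin n → E → F} (hf : ∀ i, TameLin s t (f i)) :
    TameLin s (t.pi n) fun x i => f i x := by
  choose c C hC hf using hf
  refine ⟨∑ i, c i, fun j => ⟨∑ i, C i j, Finset.sum_nonneg fun i _ => hC i j, fun x => ?_⟩⟩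
  have h0 : 0 ≤ ∑ i, C i j := Finset.sum_nonneg fun i _ => hC i j
  refine (nm_pi_le _ _ _ _ (mul_nonneg h0 (nm_nonneg _ _ _))).2 fun i => (hf i j x).trans ?_
  refine mul_le_mul (Finset.single_le_sum (fun i _ => hC i j) (Finset.mem_univ i))
    (s.nm_mono ?_ x) (nm_nonneg _ _ _) h0
  have := Finset.single_le_sum (f := c) (fun i _ => Nat.zero_le _) (Finset.mem_univ i)
  omega

end Tame

section Differentiable

variable {𝕜 : Type*} [RCLike 𝕜]

/-- Maps of class `n` with levelwise continuous (and, if `τ` holds, tame) iterated tangent maps. -/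
def SCN (τ : Prop) : ℕ → ∀ {E : Type u} [AddCommGroup E] [Module 𝕜 E] [TopologicalSpace E]
    {F : Type u} [AddCommGroup F] [Module 𝕜 F] [TopologicalSpace F]
    (_ : ScStructure 𝕜 E) (_ : ScStructure 𝕜 F) (_ : Set E) (_ : E → F), Prop
  | 0, _, _, _, _, _, _, _, _, s, t, U, g => LCT τ s t U g
  | n + 1, E, _, _, _, F, _, _, _, s, t, U, g => LCT τ s t U g ∧ ∃ D : E × E → F,
      (∀ x ∈ U, ∃ L : E →L[𝕜] F, HD g x L ∧ ∀ v, D (x, v) = L v) ∧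
      SCN τ n (s.prod s) t (U ×ˢ univ) D

variable {E : Type u} [AddCommGroup E] [Module 𝕜 E] [TopologicalSpace E]
variable {F : Type u} [AddCommGroup F] [Module 𝕜 F] [TopologicalSpace F]
variable {G : Type u} [AddCommGroup G] [Module 𝕜 G] [TopologicalSpace G]
variable {τ : Prop} {s : ScStructure 𝕜 E} {t : ScStructure 𝕜 F} {w : ScStructure 𝕜 G}

theorem SCN.lct {n : ℕ} {U : Set E} {g : E → F} (h : SCN τ n s t U g) : LCT τ s t U g := by
  cases n with
  | zero => exact h
  | succ n => exact h.1

theorem SCN.of_succ (n : ℕ) : ∀ {E : Type u} [AddCommGroup E] [Module 𝕜 E] [TopologicalSpace E]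
    {F : Type u} [AddCommGroup F] [Module 𝕜 F] [TopologicalSpace F]
    {s : ScStructure 𝕜 E} {t : ScStructure 𝕜 F} {U : Set E} {g : E → F},
    SCN τ (n + 1) s t U g → SCN τ n s t U g := by
  induction n with
  | zero => intro _ _ _ _ _ _ _ _ _ _ _ _ h; exact h.1
  | succ n ih =>
    intro _ _ _ _ _ _ _ _ _ _ _ _ h
    obtain ⟨h1, D, h2, h3⟩ := h
    exact ⟨h1, D, h2, ih h3⟩

theorem SCN.of_le {m n : ℕ} (h : m ≤ n) {U : Set E} {g : E → F} (hg : SCN τ n s t U g) :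
    SCN τ m s t U g := by
  induction n, h using Nat.le_induction with
  | base => exact hg
  | succ n h ih => exact ih (SCN.of_succ n hg)

theorem SCN.mono {n : ℕ} : ∀ {E : Type u} [AddCommGroup E] [Module 𝕜 E] [TopologicalSpace E]
    {F : Type u} [AddCommGroup F] [Module 𝕜 F] [TopologicalSpace F]
    {s : ScStructure 𝕜 E} {t : ScStructure 𝕜 F} {U V : Set E} {g : E → F},
    SCN τ n s t U g → IsOpen V → V ⊆ U → SCN τ n s t V g := by
  induction n with
  | zero => intro _ _ _ _ _ _ _ _ _ _ _ _ _ h hV hVU; exact LCT.mono h hV hVU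
  | succ n ih =>
    intro _ _ _ _ _ _ _ _ _ _ _ _ _ h hV hVU
    obtain ⟨h1, D, h2, h3⟩ := h
    exact ⟨h1.mono hV hVU, D, fun x hx => h2 x (hVU hx),
      ih h3 (hV.prod isOpen_univ) (prod_mono hVU subset_rfl)⟩

theorem SCN.congr [IsTopologicalAddGroup E] [ContinuousSMul 𝕜 E] {n : ℕ} {U : Set E}
    {g g' : E → F} (h : SCN τ n s t U g) (hg : EqOn g g' U) : SCN τ n s t U g' := by
  cases n with
  | zero => exact LCT.congr h hg
  | succ n =>
    obtain ⟨h1, D, h2, h3⟩ := h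
    refine ⟨h1.congr hg, D, fun x hx => ?_, h3⟩
    obtain ⟨L, hL, hD⟩ := h2 x hx
    exact ⟨L, hL.congr (eventually_of_mem (h1.mem_nhds hx) hg), hD⟩

/-- Any choice of the derivative has the expected regularity. -/
theorem SCN.deriv [IsTopologicalAddGroup E] [ContinuousSMul 𝕜 E] {n : ℕ} {U : Set E} {g : E → F}
    (h : SCN τ (n + 1) s t U g) {D : E × E → F}
    (hD : ∀ x ∈ U, ∃ L : E →L[𝕜] F, HD g x L ∧ ∀ v, D (x, v) = L v) :
    SCN τ n (s.prod s) t (U ×ˢ univ) D := by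
  obtain ⟨h1, D', h2, h3⟩ := h
  have := t.t2Space
  refine h3.congr ?_
  rintro ⟨x, v⟩ ⟨hx, -⟩
  obtain ⟨L, hL, hD⟩ := hD x hx
  obtain ⟨L', hL', hD'⟩ := h2 x hx
  rw [hD, hD', hL.unique hL']

theorem SCN.const (n : ℕ) : ∀ {E : Type u} [AddCommGroup E] [Module 𝕜 E] [TopologicalSpace E]
    {F : Type u} [AddCommGroup F] [Module 𝕜 F] [TopologicalSpace F]
    {s : ScStructure 𝕜 E} {t : ScStructure 𝕜 F} (c : F), SCN τ n s t univ fun _ => c := by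
  induction n with
  | zero => intro _ _ _ _ _ _ _ _ _ _ c; exact LCT.const c
  | succ n ih =>
    intro _ _ _ _ _ _ _ _ _ _ c
    refine ⟨LCT.const c, fun _ => 0, fun x _ => ⟨0, HD.const c x, fun _ => rfl⟩, ?_⟩
    rw [univ_prod_univ]
    exact ih 0

theorem SCN.clm (n : ℕ) : ∀ {E : Type u} [AddCommGroup E] [Module 𝕜 E] [TopologicalSpace E]
    {F : Type u} [AddCommGroup F] [Module 𝕜 F] [TopologicalSpace F]
    {s : ScStructure 𝕜 E} {t : ScStructure 𝕜 F} {T : E →L[𝕜] F}, TameLin s t T →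
    SCN τ n s t univ T := by
  induction n with
  | zero => intro _ _ _ _ _ _ _ _ _ _ _ hT; exact LCT.clm hT
  | succ n ih =>
    intro E _ _ _ _ _ _ _ s t T hT
    refine ⟨LCT.clm hT, T.comp (ContinuousLinearMap.snd 𝕜 E E),
      fun x _ => ⟨T, HD.clm T x, fun _ => rfl⟩, ?_⟩
    rw [univ_prod_univ]
    exact ih (hT.comp TameLin.snd)

theorem SCN.prodMk (n : ℕ) : ∀ {E : Type u} [AddCommGroup E] [Module 𝕜 E] [TopologicalSpace E]
    {F : Type u} [AddCommGroup F] [Module 𝕜 F] [TopologicalSpace F]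
    {G : Type u} [AddCommGroup G] [Module 𝕜 G] [TopologicalSpace G]
    {s : ScStructure 𝕜 E} {t : ScStructure 𝕜 F} {w : ScStructure 𝕜 G} {U : Set E} {f : E → F}
    {g : E → G}, SCN τ n s t U f → SCN τ n s w U g →
      SCN τ n s (t.prod w) U fun x => (f x, g x) := by
  induction n with
  | zero => intro _ _ _ _ _ _ _ _ _ _ _ _ _ _ _ _ _ _ hf hg; exact LCT.prodMk hf hg
  | succ n ih =>
    intro _ _ _ _ _ _ _ _ _ _ _ _ _ _ _ _ _ _ hf hg
    obtain ⟨hf1, D, hf2, hf3⟩ := hf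
    obtain ⟨hg1, D', hg2, hg3⟩ := hg
    refine ⟨hf1.prodMk hg1, fun z => (D z, D' z), fun x hx => ?_, ih hf3 hg3⟩
    obtain ⟨L, hL, hD⟩ := hf2 x hx
    obtain ⟨L', hL', hD'⟩ := hg2 x hx
    exact ⟨L.prod L', hL.prodMk hL', fun v => by simp [hD, hD']⟩

/-- The tangent map of the composite is `(x, v) ↦ D' (f x, D (x, v))`, again a composite of maps of
one class less. The induction therefore changes the spaces, which are quantified inside the
statement. -/
theorem SCN.comp (n : ℕ) : ∀ {E : Type u} [AddCommGroup E] [Module 𝕜 E] [TopologicalSpace E]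
    {F : Type u} [AddCommGroup F] [Module 𝕜 F] [TopologicalSpace F]
    {G : Type u} [AddCommGroup G] [Module 𝕜 G] [TopologicalSpace G]
    {s : ScStructure 𝕜 E} {t : ScStructure 𝕜 F} {w : ScStructure 𝕜 G} {U : Set E} {V : Set F}
    {f : E → F} {g : F → G}, SCN τ n t w V g → SCN τ n s t U f → MapsTo f U V →
      SCN τ n s w U fun x => g (f x) := by
  induction n with
  | zero => intro _ _ _ _ _ _ _ _ _ _ _ _ _ _ _ _ _ _ _ hg hf hm; exact LCT.comp hg hf hm
  | succ n ih =>
    intro E _ _ _ _ _ _ _ _ _ _ _ s _ _ U V f _ hg hf hm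
    have hfn := SCN.of_succ n hf
    obtain ⟨hf1, D, hf2, hf3⟩ := hf
    obtain ⟨hg1, D', hg2, hg3⟩ := hg
    refine ⟨hg1.comp hf1 hm, fun z => D' (f z.1, D z), fun x hx => ?_, ?_⟩
    · obtain ⟨L, hL, hD⟩ := hf2 x hx
      obtain ⟨L', hL', hD'⟩ := hg2 (f x) (hm hx)
      exact ⟨L'.comp L, hL'.comp hL, fun v => by simp [hD, hD']⟩
    · have h1 : SCN τ n (s.prod s) s univ (ContinuousLinearMap.fst 𝕜 E E) :=
        SCN.clm n TameLin.fst
      have h2 := ih hfn (h1.mono (hf1.isOpen.prod isOpen_univ) (subset_univ _))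
        (fun z hz => hz.1)
      exact ih hg3 (SCN.prodMk n h2 hf3) fun z hz => ⟨hm hz.1, mem_univ _⟩

theorem SCN.clm_comp {n : ℕ} {T : F →L[𝕜] G} (hT : TameLin t w T) {U : Set E} {f : E → F}
    (hf : SCN τ n s t U f) : SCN τ n s w U fun x => T (f x) :=
  SCN.comp n (SCN.clm n hT) hf (mapsTo_univ _ _)

theorem SCN.comp_clm {n : ℕ} {T : E →L[𝕜] F} (hT : TameLin s t T) {V : Set F} {g : F → G}
    (hg : SCN τ n t w V g) : SCN τ n s w (T ⁻¹' V) fun x => g (T x) :=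
  SCN.comp n hg ((SCN.clm n hT).mono (hg.lct.isOpen.preimage T.continuous) (subset_univ _))
    fun _ h => h

theorem SCN.add [IsTopologicalAddGroup F] {n : ℕ} {U : Set E} {f g : E → F}
    (hf : SCN τ n s t U f) (hg : SCN τ n s t U g) : SCN τ n s t U fun x => f x + g x :=
  SCN.clm_comp (T := ContinuousLinearMap.fst 𝕜 F F + ContinuousLinearMap.snd 𝕜 F F)
    (TameLin.fst.add TameLin.snd) (SCN.prodMk n hf hg)

theorem SCN.sub [IsTopologicalAddGroup F] {n : ℕ} {U : Set E} {f g : E → F}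
    (hf : SCN τ n s t U f) (hg : SCN τ n s t U g) : SCN τ n s t U fun x => f x - g x := by
  have := SCN.clm_comp (T := ContinuousLinearMap.fst 𝕜 F F + -ContinuousLinearMap.snd 𝕜 F F)
    (TameLin.fst.add TameLin.snd.neg) (SCN.prodMk n hf hg)
  simpa [sub_eq_add_neg] using this

theorem SCN.sum [IsTopologicalAddGroup F] {n : ℕ} {U : Set E} (hU : IsOpen U) {ι : Type*}
    (A : Finset ι) {f : ι → E → F} (hf : ∀ i ∈ A, SCN τ n s t U (f i)) :
    SCN τ n s t U fun x => ∑ i ∈ A, f i x := by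
  classical
  induction A using Finset.induction_on with
  | empty => simpa using (SCN.const n (0 : F)).mono hU (subset_univ _)
  | insert a A ha ih =>
    simp only [Finset.sum_insert ha]
    exact (hf a (Finset.mem_insert_self _ _)).add
      (ih fun i hi => hf i (Finset.mem_insert_of_mem hi))

/-- A change of structures is composition with the identity, which is a tame linear map between the
two structures. -/
theorem SCN.of_nLe {n : ℕ} {s' : ScStructure 𝕜 E} {t' : ScStructure 𝕜 F} (hs : NLe s s')
    (ht : NLe t' t) {U : Set E} {g : E → F} (h : SCN τ n s t U g) : SCN τ n s' t' U g :=
  SCN.clm_comp (T := ContinuousLinearMap.id 𝕜 F) (TameLin.of_nLe ht)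
    (SCN.comp_clm (T := ContinuousLinearMap.id 𝕜 E) (TameLin.of_nLe hs) h)

theorem LCT.of_nLe {s' : ScStructure 𝕜 E} {t' : ScStructure 𝕜 F} (hs : NLe s s')
    (ht : NLe t' t) {U : Set E} {g : E → F} (h : LCT τ s t U g) : LCT τ s' t' U g :=
  SCN.of_nLe (n := 0) hs ht h

end Differentiable

end ScStructure

/-! ### Comparison with upper and lower sc-differentiability -/

namespace PreTameSc

open ScStructure

section Conversion

variable {𝕜 : Type*} [RCLike 𝕜]
variable {E : Type u} [AddCommGroup E] [Module 𝕜 E] [TopologicalSpace E]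
variable {F : Type u} [AddCommGroup F] [Module 𝕜 F] [TopologicalSpace F]

theorem _root_.ScStructure.LCT.of_local {τ : Prop} {s : ScStructure 𝕜 E} {t : ScStructure 𝕜 F}
    {U : Set E} {g : E → F} (h : ∀ x ∈ U, ∃ B, x ∈ B ∧ B ⊆ U ∧ LCT τ s t B g) :
    LCT τ s t U g := by
  intro x hx
  obtain ⟨B, hxB, hBU, hB⟩ := h x hx
  obtain ⟨r, V, hV, hVB, h1, h2⟩ := hB x hxB
  exact ⟨r, V, hV, hVB.trans hBU, h1, h2⟩

/-- Level `j` of the envelope gives continuity for the norm `j`, but only among points of `V`, which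
is cut out by conditions on infinitely many levels. Passing to a ball in norm `m` makes membership
an open condition in one norm. The loss `m` is the price. -/
theorem _root_.ScStructure.IsEnvelope.lct {τ : Prop} {s : ScStructure 𝕜 E} {t : ScStructure 𝕜 F}
    {V : Set E} {f : E → F} {O : ∀ j, Set (s.X j)} {H : ∀ j, s.X j → t.X j}
    (h : s.IsEnvelope t V f O H)
    (hτ : τ → ∀ j, ∃ C : ℝ, ∀ y ∈ O j, ‖H j y‖ ≤ C * (1 + ‖y‖)) {m : ℕ} {x : E} {ε : ℝ}
    (hB : {z | s.nm m (z - x) < ε} ⊆ V) :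
    LCT τ s t {z | s.nm m (z - x) < ε} f := by
  intro y hy
  have hmem : ∀ z ∈ V, ∀ j, s.π j z ∈ O j := fun z hz j => by
    have := h.eq_iInter ▸ hz
    exact mem_iInter.1 this j
  refine ⟨m, _, s.ball_mem_nh_of_mem hy, subset_rfl, fun z hz j => ?_, fun ht j => ?_⟩
  · rw [t.tendsto_nh_iff, ← h.extends_map j z (hB hz)]
    have h1 : Tendsto (s.π j) (s.nh (j + m) z) (𝓝 (s.π j z)) :=
      tendsto_comap.mono_left (s.nh_anti (Nat.le_add_right j m) z)
    have h2 : Tendsto (fun z' => H j (s.π j z')) (s.nh (j + m) z) (𝓝 (H j (s.π j z))) :=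
      ((h.continuousOn j).continuousAt ((h.isOpen j).mem_nhds (hmem z (hB hz) j))).tendsto.comp h1
    refine h2.congr' ?_
    filter_upwards [s.nh_anti (Nat.le_add_left m j) z (s.ball_mem_nh_of_mem hz)] with z' hz'
    exact h.extends_map j z' (hB hz')
  · obtain ⟨C, hC⟩ := hτ ht j
    refine ⟨max C 0, le_max_right _ _, fun z hz => ?_⟩
    rw [nm_apply, ← h.extends_map j z (hB hz)]
    refine (hC _ (hmem z (hB hz) j)).trans ?_
    refine mul_le_mul (le_max_left _ _) ?_ (by positivity) (le_max_right _ _)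
    have := s.nm_mono (Nat.le_add_right j m) z
    rw [nm_apply] at this
    linarith

theorem ScBarZero.lct {P : PreTameSc 𝕜 E} {Q : PreTameSc 𝕜 F} {U : Set E} {f : E → F}
    (h : ScBarZero P Q U f) : LCT False P.rep Q.rep U f := by
  refine LCT.of_local fun x hx => ?_
  obtain ⟨V, hV, hVU, s, hs, t, ht, O, H, hH⟩ := h x hx
  obtain ⟨m, hm⟩ := s.mem_nhds_iff'.1 hV
  obtain ⟨ε, hε, hm⟩ := s.mem_nh_iff.1 hm
  refine ⟨{z | s.nm m (z - x) < ε}, by simpa using hε, fun z hz => hVU (hm z hz), ?_⟩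
  exact (hH.lct False.elim hm).of_nLe (P.nEq_of_mem hs).2 (Q.nEq_of_mem ht).1

theorem TameBar.lct {P : PreTameSc 𝕜 E} {Q : PreTameSc 𝕜 F} {U : Set E} {f : E → F}
    (h : TameBar P Q U f) : LCT True P.rep Q.rep U f := by
  refine LCT.of_local fun x hx => ?_
  obtain ⟨V, hV, hVU, s, hs, t, ht, O, H, hH⟩ := h x hx
  obtain ⟨m, hm⟩ := s.mem_nhds_iff'.1 hV
  obtain ⟨ε, hε, hm⟩ := s.mem_nh_iff.1 hm
  refine ⟨{z | s.nm m (z - x) < ε}, by simpa using hε, fun z hz => hVU (hm z hz), ?_⟩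
  exact (hH.toIsEnvelope.lct (fun _ => hH.tame) hm).of_nLe (P.nEq_of_mem hs).2 (Q.nEq_of_mem ht).1

/-- The source structure is shifted by the loss `r`. The ball in norm `r` is then open for every
norm of the shifted structure, and all estimates become estimates without loss. -/
theorem _root_.ScStructure.LCT.exists_isLevelwiseContinuous {P : PreTameSc 𝕜 E}
    {Q : PreTameSc 𝕜 F} {U : Set E} {f : E → F} (h : LCT True P.rep Q.rep U f) {x : E}
    (hx : x ∈ U) : ∃ V ∈ 𝓝 x, V ⊆ U ∧ ∃ s ∈ P.compat, ∃ t ∈ Q.compat,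
      IsLevelwiseContinuous s t V f ∧
      ∀ j, ∃ C : ℝ, ∀ y ∈ V, ‖t.π j (f y)‖ ≤ C * (1 + ‖s.π j y‖) := by
  obtain ⟨r, V, hV, hVU, hc, hb⟩ := h x hx
  obtain ⟨ε, hε, hm⟩ := P.rep.mem_nh_iff.1 hV
  refine ⟨{z | P.rep.nm r (z - x) < ε}, P.rep.nhds_le_nh r x (P.rep.ball_mem_nh r x hε),
    fun z hz => hVU (hm z hz), P.rep.shift r, P.shift_rep_mem r, Q.rep.shift 0,
    Q.shift_rep_mem 0, fun j => ⟨?_, fun y hy => ?_⟩, fun j => ?_⟩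
  · rw [@isOpen_iff_mem_nhds]
    intro y hy
    rw [nhds_induced]
    exact P.rep.nh_anti (Nat.le_add_left r j) y (P.rep.ball_mem_nh_of_mem hy)
  · have h1 := hc y (hm y hy) j
    have h2 : Tendsto f (@nhds E (TopologicalSpace.induced ((P.rep.shift r).π j) inferInstance) y)
        (@nhds F (TopologicalSpace.induced ((Q.rep.shift 0).π j) inferInstance) (f y)) := by
      rw [nhds_induced, nhds_induced]
      exact h1
    exact h2.mono_left (@nhdsWithin_le_nhds E
      (TopologicalSpace.induced ((P.rep.shift r).π j) inferInstance) _ _)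
  · obtain ⟨C, _, hC⟩ := hb trivial j
    exact ⟨C, fun y hy => hC y (hm y hy)⟩

theorem _root_.ScStructure.LCT.tameUnder {P : PreTameSc 𝕜 E} {Q : PreTameSc 𝕜 F} {U : Set E}
    {f : E → F} (h : LCT True P.rep Q.rep U f) : TameUnder P Q U f :=
  fun _ hx => h.exists_isLevelwiseContinuous hx

theorem _root_.ScStructure.LCT.scUnderZero {P : PreTameSc 𝕜 E} {Q : PreTameSc 𝕜 F} {U : Set E}
    {f : E → F} (h : LCT True P.rep Q.rep U f) : ScUnderZero P Q U f := by
  intro x hx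
  obtain ⟨V, hV, hVU, s, hs, t, ht, h1, -⟩ := h.exists_isLevelwiseContinuous hx
  exact ⟨V, hV, hVU, s, hs, t, ht, h1⟩

end Conversion

variable {𝕜 : Type*} [RCLike 𝕜]

/-- The flag is `False` because sc-differentiability carries no growth estimates. These are assumed
for the iterated differentials and added afterwards by `SCN.tame`. The chosen representative of
`P.prod P` is not the product of the representatives, so each step of the induction passes through
`nEq_rep_prod`. -/
theorem ScBarNat.scn (n : ℕ) : ∀ {E : Type u} [AddCommGroup E] [Module 𝕜 E] [TopologicalSpace E]
    [IsTopologicalAddGroup E] [ContinuousSMul 𝕜 E]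
    {F : Type u} [AddCommGroup F] [Module 𝕜 F] [TopologicalSpace F]
    [IsTopologicalAddGroup F] [ContinuousSMul 𝕜 F]
    {P : PreTameSc 𝕜 E} {Q : PreTameSc 𝕜 F} {U : Set E} {f : E → F},
    ScBarNat n P Q U f → SCN False n P.rep Q.rep U f := by
  induction n with
  | zero => intro _ _ _ _ _ _ _ _ _ _ _ _ _ _ _ _ h; exact ScBarZero.lct h
  | succ n ih =>
    intro _ _ _ _ _ _ _ _ _ _ _ _ P _ U f h
    obtain ⟨h1, h2, h3⟩ := h
    exact ⟨ScBarZero.lct h2, differential 𝕜 f U, fun x hx => ⟨_, h1.hd hx, fun _ => rfl⟩,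
      (ih h3).of_nLe (nEq_rep_prod P P).1 (NLe.refl _)⟩

theorem _root_.ScStructure.SCN.scUnderNat (n : ℕ) : ∀ {E : Type u} [AddCommGroup E] [Module 𝕜 E]
    [TopologicalSpace E] [IsTopologicalAddGroup E] [ContinuousSMul 𝕜 E]
    {F : Type u} [AddCommGroup F] [Module 𝕜 F] [TopologicalSpace F]
    [IsTopologicalAddGroup F] [ContinuousSMul 𝕜 F]
    {P : PreTameSc 𝕜 E} {Q : PreTameSc 𝕜 F} {U : Set E} {f : E → F},
    SCN True n P.rep Q.rep U f → ScUnderNat n P Q U f := by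
  induction n with
  | zero => intro _ _ _ _ _ _ _ _ _ _ _ _ _ _ _ _ h; exact LCT.scUnderZero h
  | succ n ih =>
    intro _ _ _ _ _ _ _ _ _ _ _ _ P Q U f h
    have hd' : WDiffOn 𝕜 f U := by
      intro x hx
      obtain ⟨h1, D, h2, -⟩ := h
      obtain ⟨L, hL, -⟩ := h2 x hx
      exact ⟨L, hL.hasWDerivAt P.rep h1.isOpen h1.continuousOn hx⟩
    refine ⟨hd', h.1.scUnderZero, ih ?_⟩
    exact (SCN.deriv h (D := differential 𝕜 f U)
      fun x hx => ⟨_, hd'.hd hx, fun _ => rfl⟩).of_nLe (nEq_rep_prod P P).2 (NLe.refl _)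

end PreTameSc

/-! ### Iterated differentials -/

namespace ScStructure

section Iterated

variable {𝕜 : Type*} [RCLike 𝕜]
variable {E : Type u} [AddCommGroup E] [Module 𝕜 E] [TopologicalSpace E]
  [IsTopologicalAddGroup E] [ContinuousSMul 𝕜 E]
variable {F : Type u} [AddCommGroup F] [Module 𝕜 F] [TopologicalSpace F]
  [IsTopologicalAddGroup F] [ContinuousSMul 𝕜 F]
variable {τ : Prop} {s : ScStructure 𝕜 E} {t : ScStructure 𝕜 F} {U : Set E} {f : E → F}

/-- If the uncurried map is differentiable, then so are its partial maps. -/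
theorem hd_partial {j : ℕ} {g : E → (Fin j → E) → F}
    (hg : SCN τ 1 (s.prod (s.pi j)) t (U ×ˢ univ) fun z => g z.1 z.2) {x : E} (hx : x ∈ U)
    (v : Fin j → E) :
    ∃ L : E × (Fin j → E) →L[𝕜] F, HD (fun z : E × (Fin j → E) => g z.1 z.2) (x, v) L ∧
      HD (fun y => g y v) x (wDeriv 𝕜 (fun y => g y v) U x) ∧
      ∀ a, wDeriv 𝕜 (fun y => g y v) U x a = L (a, 0) := by
  have := t.t2Space
  obtain ⟨h1, D, h2, -⟩ := hg
  obtain ⟨L, hL, -⟩ := h2 (x, v) ⟨hx, mem_univ _⟩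
  have hU : IsOpen U := by
    have : IsOpen ((fun y : E => (y, v)) ⁻¹' (U ×ˢ (univ : Set (Fin j → E)))) :=
      h1.isOpen.preimage (by fun_prop)
    simpa using this
  have h3 : HD (fun y => g y v) x
      (L.comp ((ContinuousLinearMap.id 𝕜 E).prod (0 : E →L[𝕜] (Fin j → E)))) :=
    HD.comp (f := fun y : E => (y, v)) hL ((HD.clm (ContinuousLinearMap.id 𝕜 E) x).prodMk
      (HD.const v x))
  have h4 : ContinuousOn (fun y => g y v) U := by
    refine h1.continuousOn.comp (f := fun y : E => (y, v)) (by fun_prop) fun y hy => ?_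
    exact ⟨hy, mem_univ _⟩
  have h5 := wDeriv_eq (h3.hasWDerivAt s hU h4 hx)
  rw [h5]
  exact ⟨L, hL, h3, fun a => rfl⟩

/-- The linear map `(x, v) ↦ ((x, v₀, …, v_{j-1}), (v_j, 0))`. -/
noncomputable def initLast (𝕜 : Type*) [RCLike 𝕜] (E : Type u) [AddCommGroup E] [Module 𝕜 E]
    [TopologicalSpace E] (j : ℕ) :
    E × (Fin (j + 1) → E) →L[𝕜] (E × (Fin j → E)) × (E × (Fin j → E)) :=
  ((ContinuousLinearMap.fst 𝕜 _ _).prod (ContinuousLinearMap.pi fun i : Fin j =>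
    (ContinuousLinearMap.proj (R := 𝕜) (φ := fun _ : Fin (j + 1) => E) i.castSucc).comp
      (ContinuousLinearMap.snd 𝕜 _ _))).prod
  (((ContinuousLinearMap.proj (R := 𝕜) (φ := fun _ : Fin (j + 1) => E) (Fin.last j)).comp
      (ContinuousLinearMap.snd 𝕜 _ _)).prod 0)

theorem tameLin_initLast (s : ScStructure 𝕜 E) (j : ℕ) :
    TameLin (s.prod (s.pi (j + 1))) ((s.prod (s.pi j)).prod (s.prod (s.pi j)))
      (initLast 𝕜 E j) :=
  (TameLin.fst.prodMk (TameLin.pi j fun i => (TameLin.apply (j + 1) i.castSucc).comp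
    TameLin.snd)).prodMk (((TameLin.apply (j + 1) (Fin.last j)).comp TameLin.snd).prodMk
      TameLin.zero)

/-- The differential of order `j + 1` is the tangent map of the uncurried differential of order `j`,
evaluated in the direction `(v_j, 0)`. It is thus that tangent map composed with the tame linear map
`initLast`. -/
theorem SCN.iterDifferential {n : ℕ} (h : SCN τ n s t U f) (j m : ℕ) (hjm : j + m ≤ n) :
    SCN τ m (s.prod (s.pi j)) t (U ×ˢ univ)
      fun z => iterDifferential 𝕜 f U j z.1 z.2 := by
  have hU := h.lct.isOpen
  induction j generalizing m with
  | zero =>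
    have h1 := SCN.comp_clm (T := ContinuousLinearMap.fst 𝕜 E (Fin 0 → E))
      (TameLin.fst (s := s) (t := s.pi 0)) (SCN.of_le (by omega : m ≤ n) h)
    rw [show U ×ˢ (univ : Set (Fin 0 → E)) = ContinuousLinearMap.fst 𝕜 E (Fin 0 → E) ⁻¹' U from
      Set.prod_univ]
    exact h1
  | succ j ih =>
    have h1 := ih (m + 1) (by omega)
    obtain ⟨-, D, hD, hD'⟩ := id h1
    have h2 := SCN.comp_clm (tameLin_initLast s j) hD'
    have h3 : initLast 𝕜 E j ⁻¹' ((U ×ˢ (univ : Set (Fin j → E))) ×ˢ univ) =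
        U ×ˢ (univ : Set (Fin (j + 1) → E)) := by
      ext z; simp [initLast]
    rw [h3] at h2
    refine h2.congr ?_
    rintro ⟨x, v⟩ ⟨hx, -⟩
    obtain ⟨L, hL, -, hL'⟩ := hd_partial (SCN.of_le (by omega : 1 ≤ m + 1) h1) hx (Fin.init v)
    obtain ⟨L', hL1, hL2⟩ := hD (x, Fin.init v) ⟨hx, mem_univ _⟩
    have := t.t2Space
    have h4 := hL.unique hL1
    subst h4
    show D ((x, Fin.init v), (v (Fin.last j), 0)) = _
    rw [hL2, ← hL']
    rfl

/-- Iterated differentials are additive and homogeneous in each of the vectors. -/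
theorem iterDifferential_update {n : ℕ} (h : SCN τ n s t U f) (j : ℕ) (hj : j ≤ n) {x : E}
    (hx : x ∈ U) (v : Fin j → E) (i : Fin j) (a b : E) (c : 𝕜) :
    iterDifferential 𝕜 f U j x (Function.update v i (a + c • b)) =
      iterDifferential 𝕜 f U j x (Function.update v i a) +
        c • iterDifferential 𝕜 f U j x (Function.update v i b) := by
  induction j generalizing x with
  | zero => exact i.elim0
  | succ j ih =>
    refine Fin.lastCases ?_ (fun i => ?_) i
    · simp only [_root_.iterDifferential, Fin.init_update_last, Function.update_self, map_add,
        map_smul]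
    · simp only [_root_.iterDifferential, Fin.init_update_castSucc]
      have hne : Fin.last j ≠ i.castSucc := (Fin.castSucc_lt_last i).ne'
      simp only [Function.update_of_ne hne]
      -- In the earlier slots, linearity of the differential of order `j` holds at all points of
      -- `U`. Differentiating this identity in the base point gives linearity of the next one, by
      -- uniqueness of derivatives.
      have hd := fun w => (hd_partial (h.iterDifferential j 1 hj) hx w).choose_spec.2.1
      have h1 := (hd (Function.update (Fin.init v) i a)).add
        ((hd (Function.update (Fin.init v) i b)).const_smul c)
      have h2 := h1.congr (g := fun y => _root_.iterDifferential 𝕜 f U j y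
        (Function.update (Fin.init v) i (a + c • b)))
        (eventually_of_mem (h.lct.mem_nhds hx) fun y hy => (ih (by omega) hy _ _).symm)
      have := t.t2Space
      rw [(hd (Function.update (Fin.init v) i (a + c • b))).unique h2]
      rfl

/-- The linear map `((x, v), (a, b)) ↦ (x, v₀, …, v_{j-1}, a)`. -/
noncomputable def snocMap (𝕜 : Type*) [RCLike 𝕜] (E : Type u) [AddCommGroup E] [Module 𝕜 E]
    [TopologicalSpace E] (j : ℕ) :
    (E × (Fin j → E)) × (E × (Fin j → E)) →L[𝕜] E × (Fin (j + 1) → E) :=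
  ((ContinuousLinearMap.fst 𝕜 _ _).comp (ContinuousLinearMap.fst 𝕜 _ _)).prod
    (ContinuousLinearMap.pi fun i : Fin (j + 1) => Fin.lastCases
      (motive := fun _ => (E × (Fin j → E)) × (E × (Fin j → E)) →L[𝕜] E)
      ((ContinuousLinearMap.fst 𝕜 _ _).comp (ContinuousLinearMap.snd 𝕜 _ _))
      (fun i => (ContinuousLinearMap.proj (R := 𝕜) (φ := fun _ : Fin j => E) i).comp
        ((ContinuousLinearMap.snd 𝕜 _ _).comp (ContinuousLinearMap.fst 𝕜 _ _))) i)

/-- The linear map `((x, v), (a, b)) ↦ (x, v)` with `v_i` replaced by `b_i`. -/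
noncomputable def updateMap (𝕜 : Type*) [RCLike 𝕜] (E : Type u) [AddCommGroup E] [Module 𝕜 E]
    [TopologicalSpace E] (j : ℕ) (i : Fin j) :
    (E × (Fin j → E)) × (E × (Fin j → E)) →L[𝕜] E × (Fin j → E) :=
  ((ContinuousLinearMap.fst 𝕜 _ _).comp (ContinuousLinearMap.fst 𝕜 _ _)).prod
    (ContinuousLinearMap.pi fun k : Fin j =>
      (ContinuousLinearMap.proj (R := 𝕜) (φ := fun _ : Fin j => E) k).comp
        ((ContinuousLinearMap.snd 𝕜 _ _).comp
          (if k = i then ContinuousLinearMap.snd 𝕜 _ _ else ContinuousLinearMap.fst 𝕜 _ _)))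

theorem snocMap_apply (j : ℕ) (x a : E) (v b : Fin j → E) :
    snocMap 𝕜 E j ((x, v), (a, b)) = (x, (Fin.snoc v a : Fin (j + 1) → E)) := by
  refine Prod.ext rfl (funext fun i => ?_)
  refine Fin.lastCases ?_ (fun i => ?_) i
  · simp [snocMap]
  · simp [snocMap]

theorem updateMap_apply (j : ℕ) (i : Fin j) (x a : E) (v b : Fin j → E) :
    updateMap 𝕜 E j i ((x, v), (a, b)) = (x, Function.update v i (b i)) := by
  refine Prod.ext rfl (funext fun k => ?_)
  by_cases hk : k = i
  · subst hk; simp [updateMap]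
  · simp [updateMap, hk]

theorem tameLin_snocMap (s : ScStructure 𝕜 E) (j : ℕ) :
    TameLin ((s.prod (s.pi j)).prod (s.prod (s.pi j))) (s.prod (s.pi (j + 1)))
      (snocMap 𝕜 E j) := by
  have h : ∀ i, TameLin ((s.prod (s.pi j)).prod (s.prod (s.pi j))) s
      fun z => (snocMap 𝕜 E j z).2 i := by
    refine Fin.lastCases ?_ fun i => ?_
    · have : (fun z => (snocMap 𝕜 E j z).2 (Fin.last j)) = fun z => z.2.1 := by
        funext z; simp [snocMap]
      rw [this]
      exact TameLin.fst.comp TameLin.snd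
    · have : (fun z => (snocMap 𝕜 E j z).2 i.castSucc) = fun z => z.1.2 i := by
        funext z; simp [snocMap]
      rw [this]
      exact (TameLin.apply j i).comp (TameLin.snd.comp TameLin.fst)
  exact (TameLin.fst.comp TameLin.fst).prodMk (TameLin.pi (j + 1) h)

theorem tameLin_updateMap (s : ScStructure 𝕜 E) (j : ℕ) (i : Fin j) :
    TameLin ((s.prod (s.pi j)).prod (s.prod (s.pi j))) (s.prod (s.pi j))
      (updateMap 𝕜 E j i) := by
  have h : ∀ k, TameLin ((s.prod (s.pi j)).prod (s.prod (s.pi j))) s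
      fun z => (updateMap 𝕜 E j i z).2 k := by
    intro k
    by_cases hk : k = i
    · have : (fun z => (updateMap 𝕜 E j i z).2 k) = fun z => z.2.2 k := by
        funext z; simp [updateMap, hk]
      rw [this]
      exact (TameLin.apply j k).comp (TameLin.snd.comp TameLin.snd)
    · have : (fun z => (updateMap 𝕜 E j i z).2 k) = fun z => z.1.2 k := by
        funext z; simp [updateMap, hk]
      rw [this]
      exact (TameLin.apply j k).comp (TameLin.snd.comp TameLin.fst)
  exact (TameLin.fst.comp TameLin.fst).prodMk (TameLin.pi j h)

/-- The derivative of the uncurried iterated differential. -/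
theorem hd_iterDifferential {n : ℕ} (h : SCN τ n s t U f) (j : ℕ) (hj : j + 1 ≤ n) {x : E}
    (hx : x ∈ U) (v : Fin j → E) :
    ∃ L : E × (Fin j → E) →L[𝕜] F,
      HD (fun z : E × (Fin j → E) => iterDifferential 𝕜 f U j z.1 z.2) (x, v) L ∧
      ∀ a b, L (a, b) = iterDifferential 𝕜 f U (j + 1) x (Fin.snoc v a : Fin (j + 1) → E) +
        ∑ i, iterDifferential 𝕜 f U j x (Function.update v i (b i)) := by
  have := t.t2Space
  obtain ⟨L, hL, -, hL'⟩ := hd_partial (h.iterDifferential j 1 hj) hx v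
  refine ⟨L, hL, fun a b => ?_⟩
  have h1 : (a, b) = (a, 0) + ∑ i, ((0 : E), (Pi.single i (b i) : Fin j → E)) := by
    refine Prod.ext ?_ ?_
    · simp [Prod.fst_sum]
    · simp [Prod.snd_sum, Finset.univ_sum_single]
  rw [h1, map_add, map_sum, ← hL']
  congr 1
  · simp [_root_.iterDifferential]
  · refine Finset.sum_congr rfl fun i _ => ?_
    -- In a direction that changes only the slot `i`, multilinearity makes the difference quotient
    -- constant in `c`, so the derivative is that constant.
    have h2 : Tendsto (fun c : ℝ => ((((0 : E), (Pi.single i (b i) : Fin j → E))), c)) (𝓝[>] 0)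
        (𝓝 ((0 : E), (Pi.single i (b i) : Fin j → E)) ×ˢ 𝓝[>] 0) :=
      tendsto_const_nhds.prodMk tendsto_id
    refine tendsto_nhds_unique ((hL _).comp h2) (tendsto_const_nhds.congr' ?_)
    filter_upwards [self_mem_nhdsWithin] with c hc
    have hc' : (c : 𝕜) ≠ 0 := by exact_mod_cast (ne_of_gt (mem_Ioi.1 hc))
    have h3 : v + (c : 𝕜) • (Pi.single i (b i) : Fin j → E) =
        Function.update v i (v i + (c : 𝕜) • b i) := by
      ext k
      by_cases hk : k = i
      · subst hk; simp
      · simp [hk]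
    have h4 := iterDifferential_update h j (by omega) hx v i (v i) (b i) (c : 𝕜)
    rw [← h3, Function.update_eq_self] at h4
    simp only [Function.comp_apply, Prod.smul_mk, smul_zero, Prod.mk_add_mk, add_zero]
    rw [h4, add_sub_cancel_left, inv_smul_smul₀ hc']

/-- A map whose iterated differentials are tame has tame iterated tangent maps. -/
theorem SCN.tame {n : ℕ} (h : SCN False n s t U f)
    (ht : ∀ j ≤ n, LCT True (s.prod (s.pi j)) t (U ×ˢ univ)
      fun z => _root_.iterDifferential 𝕜 f U j z.1 z.2) : SCN True n s t U f := by
  -- All orders `j` are treated at once. The derivative of the uncurried differential of order `j`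
  -- is a sum of the differential of order `j + 1` and differentials of order `j` with one slot
  -- replaced. Class `m + 1` for `j` thus follows from class `m` for `j` and `j + 1`.
  have key : ∀ m j, j + m ≤ n → SCN True m (s.prod (s.pi j)) t (U ×ˢ univ)
      fun z => _root_.iterDifferential 𝕜 f U j z.1 z.2 := by
    intro m
    induction m with
    | zero => intro j hj; exact ht j (by omega)
    | succ m ih =>
      intro j hj
      have hUo : IsOpen ((U ×ˢ (univ : Set (Fin j → E))) ×ˢ (univ : Set (E × (Fin j → E)))) :=
        (h.lct.isOpen.prod isOpen_univ).prod isOpen_univ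
      refine ⟨ht j (by omega), fun z => _root_.iterDifferential 𝕜 f U (j + 1)
          (snocMap 𝕜 E j z).1 (snocMap 𝕜 E j z).2 + ∑ i, _root_.iterDifferential 𝕜 f U j
          (updateMap 𝕜 E j i z).1 (updateMap 𝕜 E j i z).2, ?_, ?_⟩
      · rintro ⟨x, v⟩ ⟨hx, -⟩
        obtain ⟨L, hL, hL'⟩ := hd_iterDifferential h j (by omega) hx v
        refine ⟨L, hL, ?_⟩
        rintro ⟨a, b⟩
        simp only [hL', snocMap_apply, updateMap_apply]
      · refine SCN.add ?_ (SCN.sum hUo _ fun i _ => ?_)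
        · exact (SCN.comp_clm (tameLin_snocMap s j) (ih (j + 1) (by omega))).mono hUo
            fun z hz => ⟨hz.1.1, mem_univ _⟩
        · exact (SCN.comp_clm (tameLin_updateMap s j i) (ih j (by omega))).mono hUo
            fun z hz => ⟨hz.1.1, mem_univ _⟩
  have h0 := key n 0 (by omega)
  have h1 : TameLin s (s.prod (s.pi 0))
      ((ContinuousLinearMap.id 𝕜 E).prod (0 : E →L[𝕜] (Fin 0 → E))) :=
    TameLin.id.prodMk TameLin.zero
  exact (SCN.comp_clm h1 h0).mono h.lct.isOpen fun x hx => ⟨hx, mem_univ _⟩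

end Iterated

end ScStructure

namespace PreTameSc

open ScStructure

variable {𝕜 : Type*} [RCLike 𝕜]
variable {E : Type u} [AddCommGroup E] [Module 𝕜 E] [TopologicalSpace E]
  [IsTopologicalAddGroup E] [ContinuousSMul 𝕜 E]
variable {F : Type u} [AddCommGroup F] [Module 𝕜 F] [TopologicalSpace F]
  [IsTopologicalAddGroup F] [ContinuousSMul 𝕜 F]

theorem nEq_rep_prod_pi (P : PreTameSc 𝕜 E) (j : ℕ) :
    NEq (P.prod (P.pi j)).rep (P.rep.prod (P.rep.pi j)) :=
  (nEq_rep_prod P (P.pi j)).trans ((NEq.refl _).prod (nEq_rep_pi P j))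

theorem scn_of_bar {P : PreTameSc 𝕜 E} {Q : PreTameSc 𝕜 F} {U : Set E} {f : E → F} {k : ℕ∞}
    (hf : ScBar k P Q U f) (hft : TameBarUpTo k P Q U f) {n : ℕ} (hn : (n : ℕ∞) ≤ k) :
    SCN True n P.rep Q.rep U f := by
  refine (ScBarNat.scn n (hf n hn)).tame fun j hj => ?_
  exact (TameBar.lct (hft j ((Nat.cast_le.2 hj).trans hn))).of_nLe (nEq_rep_prod_pi P j).1
    (NLe.refl _)

theorem scUnder_of_scn {P : PreTameSc 𝕜 E} {Q : PreTameSc 𝕜 F} {U : Set E} {f : E → F} {k : ℕ∞}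
    (h : ∀ n : ℕ, (n : ℕ∞) ≤ k → SCN True n P.rep Q.rep U f) : ScUnder k P Q U f :=
  fun n hn => (h n hn).scUnderNat n

theorem tameUnderUpTo_of_scn {P : PreTameSc 𝕜 E} {Q : PreTameSc 𝕜 F} {U : Set E} {f : E → F}
    {k : ℕ∞} (h : ∀ n : ℕ, (n : ℕ∞) ≤ k → SCN True n P.rep Q.rep U f) :
    TameUnderUpTo k P Q U f := by
  intro j hj
  refine LCT.tameUnder ?_
  exact LCT.of_nLe (nEq_rep_prod_pi P j).2 (NLe.refl _) ((h j hj).iterDifferential j 0 (by omega))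

end PreTameSc

/-! ### Families of linear maps near a point -/

namespace ScStructure

section Family

variable {𝕜 : Type*} [RCLike 𝕜]
variable {E : Type u} [AddCommGroup E] [Module 𝕜 E] [TopologicalSpace E]
variable {F : Type u} [AddCommGroup F] [Module 𝕜 F] [TopologicalSpace F]
variable {G : Type u} [AddCommGroup G] [Module 𝕜 G] [TopologicalSpace G]
variable {H : Type u} [AddCommGroup H] [Module 𝕜 H] [TopologicalSpace H]

/-- `A` is a family of linear maps, defined near `x₀` and continuous at `x₀`, with tame estimates.
For `σ = 1` this is a tame family, for `σ = 0` a smoothing family: every norm of `A x v` is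
bounded by a fixed norm of `v`. -/
def Fam (σ : ℕ) (s : ScStructure 𝕜 E) (t : ScStructure 𝕜 F) (w : ScStructure 𝕜 G) (x₀ : E)
    (A : E → F →ₗ[𝕜] G) : Prop :=
  ∃ r, ∃ V ∈ s.nh r x₀,
    (∀ v j, Tendsto (fun p : E × F => A p.1 p.2) (s.nh (j + r) x₀ ×ˢ t.nh (σ * j + r) v)
      (w.nh j (A x₀ v))) ∧
    ∀ j, ∃ C : ℝ, 0 ≤ C ∧ ∀ x ∈ V, ∀ v,
      w.nm j (A x v) ≤ C * ((1 + s.nm (j + r) x) * t.nm r v + t.nm (σ * j + r) v)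

variable {σ σ' : ℕ} {s : ScStructure 𝕜 E} {t : ScStructure 𝕜 F} {w : ScStructure 𝕜 G}
  {h : ScStructure 𝕜 H} {x₀ : E}

/-- The loss in a family can be enlarged, and the neighbourhood can be taken bounded. -/
theorem Fam.enlarge {A : E → F →ₗ[𝕜] G} (hA : Fam σ s t w x₀ A) :
    ∃ r₀, ∀ r ≥ r₀, ∃ V ∈ s.nh r x₀, (∀ x ∈ V, s.nm r x ≤ s.nm r x₀ + 1) ∧
    (∀ v j, Tendsto (fun p : E × F => A p.1 p.2) (s.nh (j + r) x₀ ×ˢ t.nh (σ * j + r) v)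
      (w.nh j (A x₀ v))) ∧
    ∀ j, ∃ C : ℝ, 0 ≤ C ∧ ∀ x ∈ V, ∀ v,
      w.nm j (A x v) ≤ C * ((1 + s.nm (j + r) x) * t.nm r v + t.nm (σ * j + r) v) := by
  obtain ⟨r₀, V, hV, hc, hb⟩ := hA
  refine ⟨r₀, fun r hr => ⟨V ∩ {x | s.nm r (x - x₀) < 1}, inter_mem (s.nh_anti hr x₀ hV)
    (s.ball_mem_nh r x₀ one_pos), fun x hx => ?_, fun v j => ?_, fun j => ?_⟩⟩
  · have := s.nm_le_add_sub r x x₀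
    have h2 : s.nm r (x - x₀) < 1 := hx.2
    linarith
  · exact (hc v j).mono_left (prod_mono (s.nh_anti (by omega) _) (t.nh_anti (by omega) _))
  · obtain ⟨C, hC, hb⟩ := hb j
    refine ⟨C, hC, fun x hx v => (hb x hx.1 v).trans (mul_le_mul_of_nonneg_left ?_ hC)⟩
    refine add_le_add (mul_le_mul ?_ (t.nm_mono hr v) (t.nm_nonneg _ _) ?_)
      (t.nm_mono (by omega) v)
    · linarith [s.nm_mono (by omega : j + r₀ ≤ j + r) x]
    · linarith [s.nm_nonneg (j + r) x]

theorem Fam.add {A B : E → F →ₗ[𝕜] G} (hA : Fam σ s t w x₀ A)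
    (hB : Fam σ s t w x₀ B) : Fam σ s t w x₀ fun x => A x + B x := by
  obtain ⟨r, hr⟩ := hA.enlarge
  obtain ⟨r', hr'⟩ := hB.enlarge
  obtain ⟨V, hV, -, hc, hb⟩ := hr (max r r') (le_max_left _ _)
  obtain ⟨V', hV', -, hc', hb'⟩ := hr' (max r r') (le_max_right _ _)
  refine ⟨max r r', V ∩ V', inter_mem hV hV', fun v j => ?_, fun j => ?_⟩
  · have h1 := w.tendsto_nh_iff.1 (hc v j)
    have h2 := w.tendsto_nh_iff.1 (hc' v j)
    refine w.tendsto_nh_iff.2 ?_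
    simpa using h1.add h2
  · obtain ⟨C, hC, hb⟩ := hb j
    obtain ⟨C', hC', hb'⟩ := hb' j
    refine ⟨C + C', add_nonneg hC hC', fun x hx v => (w.nm_add _ _ _).trans ?_⟩
    rw [add_mul]
    exact add_le_add (hb x hx.1 v) (hb' x hx.2 v)

theorem Fam.neg {A : E → F →ₗ[𝕜] G} (hA : Fam σ s t w x₀ A) :
    Fam σ s t w x₀ fun x => -A x := by
  obtain ⟨r, V, hV, hc, hb⟩ := hA
  refine ⟨r, V, hV, fun v j => ?_, fun j => ?_⟩
  · refine w.tendsto_nh_iff.2 ?_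
    simpa using (w.tendsto_nh_iff.1 (hc v j)).neg
  · obtain ⟨C, hC, hb⟩ := hb j
    exact ⟨C, hC, fun x hx v => by
      rw [LinearMap.neg_apply, map_neg_eq_map]; exact hb x hx v⟩

theorem Fam.sub {A B : E → F →ₗ[𝕜] G} (hA : Fam σ s t w x₀ A)
    (hB : Fam σ s t w x₀ B) : Fam σ s t w x₀ fun x => A x - B x := by
  simpa only [sub_eq_add_neg] using hA.add hB.neg

theorem Fam.of_smoothing {A : E → F →ₗ[𝕜] G} (hA : Fam 0 s t w x₀ A) : Fam 1 s t w x₀ A := by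
  obtain ⟨r, V, hV, hc, hb⟩ := hA
  refine ⟨r, V, hV, fun v j => ?_, fun j => ?_⟩
  · exact (hc v j).mono_left (prod_mono le_rfl (t.nh_anti (by omega) _))
  · obtain ⟨C, hC, hb⟩ := hb j
    refine ⟨C, hC, fun x hx v => (hb x hx v).trans (mul_le_mul_of_nonneg_left ?_ hC)⟩
    linarith [t.nm_mono (by omega : 0 * j + r ≤ 1 * j + r) v]

theorem Fam.const {T : F →ₗ[𝕜] G} {r : ℕ}
    (hT : ∀ j, ∃ C : ℝ, 0 ≤ C ∧ ∀ v, w.nm j (T v) ≤ C * t.nm (σ * j + r) v) :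
    Fam σ s t w x₀ fun _ => T := by
  refine ⟨r, univ, univ_mem, fun v j => ?_, fun j => ?_⟩
  · obtain ⟨C, hC, hT⟩ := hT j
    refine w.tendsto_nh_iff_nm.2 ?_
    have h0 : Tendsto (fun p : E × F => C * t.nm (σ * j + r) (p.2 - v))
        (s.nh (j + r) x₀ ×ˢ t.nh (σ * j + r) v) (𝓝 (C * 0)) :=
      ((t.tendsto_nh_iff_nm.1 tendsto_id).comp tendsto_snd).const_mul C
    rw [mul_zero] at h0
    refine squeeze_zero (fun _ => w.nm_nonneg _ _) (fun p => ?_) h0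
    rw [← map_sub]; exact hT _
  · obtain ⟨C, hC, hT⟩ := hT j
    refine ⟨C, hC, fun x _ v => (hT v).trans (mul_le_mul_of_nonneg_left ?_ hC)⟩
    have := mul_nonneg (by linarith [s.nm_nonneg (j + r) x] : 0 ≤ 1 + s.nm (j + r) x)
      (t.nm_nonneg r v)
    linarith

theorem Fam.const_of_tameLin {T : F →ₗ[𝕜] G} (hT : TameLin t w T) :
    Fam 1 s t w x₀ fun _ => T := by
  obtain ⟨c, hT⟩ := hT
  exact Fam.const (r := c) fun j => by simpa using hT j

/-- The composite is smoothing as soon as one factor is, hence the product `σ * σ'`. Multiplying the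
two estimates would give a product of norms of `x`. One of them is a fixed low norm, bounded by `M`
near `x₀`, so the estimate stays linear in the high norm of `x`. -/
theorem Fam.comp {A : E → F →ₗ[𝕜] G} {B : E → H →ₗ[𝕜] F} (hA : Fam σ s t w x₀ A)
    (hB : Fam σ' s h t x₀ B) (hσ : σ ≤ 1) (hσ' : σ' ≤ 1) :
    Fam (σ * σ') s h w x₀ fun x => A x ∘ₗ B x := by
  obtain ⟨r, hr⟩ := hA.enlarge
  obtain ⟨V, hV, -, hc, hb⟩ := hr r le_rfl
  obtain ⟨r', hr'⟩ := hB.enlarge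
  obtain ⟨V', hV', -, hc', hb'⟩ := hr' r' le_rfl
  have hidx : ∀ j, σ' * (σ * j + r) + r' ≤ σ * σ' * j + (r + r') := by
    intro j
    have h1 : σ' * r ≤ r := by nlinarith
    have h2 : σ' * (σ * j + r) = σ * σ' * j + σ' * r := by ring
    omega
  have hidx' : ∀ j, σ * j + r + r' ≤ j + (r + r') := by
    intro j
    have : σ * j ≤ j := by nlinarith
    omega
  refine ⟨r + r', (V ∩ V') ∩ {x | s.nm (r + r') (x - x₀) < 1},
    inter_mem (inter_mem (s.nh_anti (by omega) x₀ hV) (s.nh_anti (by omega) x₀ hV'))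
      (s.ball_mem_nh _ x₀ one_pos), fun v j => ?_, fun j => ?_⟩
  · have h1 : Tendsto (fun p : E × H => B p.1 p.2)
        (s.nh (j + (r + r')) x₀ ×ˢ h.nh (σ * σ' * j + (r + r')) v)
        (t.nh (σ * j + r) (B x₀ v)) :=
      (hc' v (σ * j + r)).mono_left (prod_mono (s.nh_anti (hidx' j) _) (h.nh_anti (hidx j) _))
    have h2 : Tendsto (fun p : E × H => p.1)
        (s.nh (j + (r + r')) x₀ ×ˢ h.nh (σ * σ' * j + (r + r')) v) (s.nh (j + r) x₀) :=
      tendsto_fst.mono_right (s.nh_anti (by omega) _)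
    exact (hc (B x₀ v) j).comp (h2.prodMk h1)
  · obtain ⟨C, hC, hb⟩ := hb j
    obtain ⟨C₁, hC₁, hb₁⟩ := hb' r
    obtain ⟨C₂, hC₂, hb₂⟩ := hb' (σ * j + r)
    set M := s.nm (r + r') x₀ + 1 with hM
    have hM0 : 0 ≤ M := by linarith [s.nm_nonneg (r + r') x₀]
    refine ⟨C * (C₁ * (2 + M) + C₂), by positivity, fun x hx v => (hb x hx.1.1 _).trans ?_⟩
    rw [mul_assoc]
    refine mul_le_mul_of_nonneg_left ?_ hC
    have hxM : s.nm (r + r') x ≤ M := by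
      have := s.nm_le_add_sub (r + r') x x₀
      have h2 : s.nm (r + r') (x - x₀) < 1 := hx.2
      linarith
    set X := s.nm (j + (r + r')) x
    set a := h.nm (r + r') v
    set b := h.nm (σ * σ' * j + (r + r')) v
    have ha : 0 ≤ a := h.nm_nonneg _ _
    have hbb : 0 ≤ b := h.nm_nonneg _ _
    have hX : 0 ≤ X := s.nm_nonneg _ _
    have e1 : t.nm r (B x v) ≤ C₁ * ((2 + M) * a) := by
      refine (hb₁ x hx.1.2 v).trans (mul_le_mul_of_nonneg_left ?_ hC₁)
      have i1 : h.nm r' v ≤ a := h.nm_mono (by omega) v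
      have i2 : h.nm (σ' * r + r') v ≤ a := h.nm_mono (by nlinarith) v
      have i3 := mul_le_mul (by linarith : 1 + s.nm (r + r') x ≤ 1 + M) i1 (h.nm_nonneg _ _)
        (by linarith)
      linarith
    have e2 : t.nm (σ * j + r) (B x v) ≤ C₂ * ((1 + X) * a + b) := by
      refine (hb₂ x hx.1.2 v).trans (mul_le_mul_of_nonneg_left ?_ hC₂)
      have i1 : h.nm r' v ≤ a := h.nm_mono (by omega) v
      have i2 : h.nm (σ' * (σ * j + r) + r') v ≤ b := h.nm_mono (hidx j) v
      have i4 : s.nm (σ * j + r + r') x ≤ X := s.nm_mono (hidx' j) x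
      have i3 := mul_le_mul (by linarith : 1 + s.nm (σ * j + r + r') x ≤ 1 + X) i1
        (h.nm_nonneg _ _) (by linarith)
      linarith
    have i5 : 1 + s.nm (j + r) x ≤ 1 + X := by
      linarith [s.nm_mono (by omega : j + r ≤ j + (r + r')) x]
    have e3 : (1 + s.nm (j + r) x) * t.nm r (B x v) ≤ (1 + X) * (C₁ * ((2 + M) * a)) :=
      mul_le_mul i5 e1 (t.nm_nonneg _ _) (by linarith)
    have e4 : 0 ≤ C₁ * (2 + M) * b := by positivity
    calc _ ≤ (1 + X) * (C₁ * ((2 + M) * a)) + C₂ * ((1 + X) * a + b) := add_le_add e3 e2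
      _ ≤ (C₁ * (2 + M) + C₂) * ((1 + X) * a + b) := by linarith

theorem Fam.of_nLe {s' : ScStructure 𝕜 E} {t' : ScStructure 𝕜 F} {w' : ScStructure 𝕜 G}
    (hs : NLe s s') (ht : NLe t t') (hw : NLe w' w) (hσ : σ ≤ 1) {A : E → F →ₗ[𝕜] G}
    (hA : Fam σ s t w x₀ A) : Fam σ s' t' w' x₀ A := by
  obtain ⟨r, V, hV, hc, hb⟩ := hA
  obtain ⟨a, hs⟩ := hs
  obtain ⟨b, ht⟩ := ht
  obtain ⟨c, hw⟩ := hw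
  refine ⟨r + a + b + c, V, ?_, fun v j => ?_, fun j => ?_⟩
  · obtain ⟨C, -, hC⟩ := hs r
    exact s'.nh_anti (by omega) x₀ (NLe.nh_le hC x₀ hV)
  · obtain ⟨C, -, hC⟩ := hw j
    obtain ⟨C', -, hC'⟩ := hs (j + c + r)
    obtain ⟨C'', -, hC''⟩ := ht (σ * (j + c) + r)
    refine ((hc v (j + c)).mono_right (NLe.nh_le hC _)).mono_left (prod_mono ?_ ?_)
    · exact (s'.nh_anti (by omega) x₀).trans (NLe.nh_le hC' x₀)
    · refine (t'.nh_anti ?_ v).trans (NLe.nh_le hC'' v)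
      have : σ * (j + c) ≤ σ * j + c := by nlinarith
      omega
  · obtain ⟨C, hC0, hC⟩ := hw j
    obtain ⟨D, hD, hb⟩ := hb (j + c)
    obtain ⟨C₁, hC₁, h₁⟩ := hs (j + c + r)
    obtain ⟨C₂, hC₂, h₂⟩ := ht r
    obtain ⟨C₃, hC₃, h₃⟩ := ht (σ * (j + c) + r)
    refine ⟨C * (D * ((1 + C₁) * C₂ + C₃)), by positivity, fun x hx v => (hC _).trans ?_⟩
    rw [mul_assoc, mul_assoc]
    refine mul_le_mul_of_nonneg_left ((hb x hx v).trans (mul_le_mul_of_nonneg_left ?_ hD)) hC0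
    set X := s'.nm (j + (r + a + b + c)) x
    set y := t'.nm (r + a + b + c) v
    set z := t'.nm (σ * j + (r + a + b + c)) v
    have hX : 0 ≤ X := s'.nm_nonneg _ _
    have hy : 0 ≤ y := t'.nm_nonneg _ _
    have hz : 0 ≤ z := t'.nm_nonneg _ _
    have e1 : s.nm (j + c + r) x ≤ C₁ * X :=
      (h₁ x).trans (mul_le_mul_of_nonneg_left (s'.nm_mono (by omega) x) hC₁)
    have e2 : t.nm r v ≤ C₂ * y :=
      (h₂ v).trans (mul_le_mul_of_nonneg_left (t'.nm_mono (by omega) v) hC₂)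
    have e3 : t.nm (σ * (j + c) + r) v ≤ C₃ * z := by
      refine (h₃ v).trans (mul_le_mul_of_nonneg_left (t'.nm_mono ?_ v) hC₃)
      have : σ * (j + c) ≤ σ * j + c := by nlinarith
      omega
    have e4 : (1 + s.nm (j + c + r) x) * t.nm r v ≤ ((1 + C₁) * (1 + X)) * (C₂ * y) :=
      mul_le_mul (by nlinarith) e2 (t.nm_nonneg _ _) (by positivity)
    have e5 : 0 ≤ (1 + C₁) * C₂ * z := by positivity
    have e6 : 0 ≤ C₃ * ((1 + X) * y) := by positivity
    calc _ ≤ ((1 + C₁) * (1 + X)) * (C₂ * y) + C₃ * z := add_le_add e4 e3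
      _ ≤ ((1 + C₁) * C₂ + C₃) * ((1 + X) * y + z) := by linarith

/-- Estimates of the map at the base point. -/
theorem Fam.bound_at {A : E → F →ₗ[𝕜] G} (hA : Fam σ s t w x₀ A) :
    ∃ r, ∀ j, ∃ C : ℝ, 0 ≤ C ∧ ∀ v, w.nm j (A x₀ v) ≤ C * t.nm (σ * j + r) v := by
  obtain ⟨r, V, hV, -, hb⟩ := hA
  refine ⟨r, fun j => ?_⟩
  obtain ⟨C, hC, hb⟩ := hb j
  have h0 := s.nm_nonneg (j + r) x₀
  refine ⟨C * (2 + s.nm (j + r) x₀), by positivity, fun v =>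
    (hb x₀ (s.mem_of_mem_nh hV) v).trans ?_⟩
  rw [mul_assoc]
  refine mul_le_mul_of_nonneg_left ?_ hC
  have := mul_le_mul_of_nonneg_left (t.nm_mono (by omega : r ≤ σ * j + r) v)
    (by linarith : 0 ≤ 1 + s.nm (j + r) x₀)
  linarith

/-- A tame map that is linear in the second variable is a tame family near each point. -/
theorem LCT.fam {U : Set E} {A : E → F →ₗ[𝕜] G}
    (hA : LCT True (s.prod t) w (U ×ˢ univ) fun z => A z.1 z.2) (hx : x₀ ∈ U) :
    Fam 1 s t w x₀ A := by
  obtain ⟨r, V, hV, -, hc, hb⟩ := hA (x₀, 0) ⟨hx, mem_univ _⟩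
  rw [nh_prod] at hV
  obtain ⟨V₁, hV₁, V₂, hV₂, hsub⟩ := mem_prod_iff.1 hV
  obtain ⟨ε, hε, hV₂⟩ := t.mem_nh_iff.1 hV₂
  refine ⟨r, V₁, hV₁, fun v j => ?_, fun j => ?_⟩
  · set c : ℝ := ε / (2 * (t.nm r v + 1)) with hcdef
    have hpos : 0 < t.nm r v + 1 := by linarith [t.nm_nonneg r v]
    have hc0 : 0 < c := by positivity
    have hcne : (c : 𝕜) ≠ 0 := by exact_mod_cast hc0.ne'
    have hmem : (x₀, (c : 𝕜) • v) ∈ V := by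
      refine hsub ⟨s.mem_of_mem_nh hV₁, hV₂ _ ?_⟩
      rw [sub_zero, t.nm_real_smul r hc0.le]
      have : c * (t.nm r v + 1) = ε / 2 := by rw [hcdef]; field_simp
      nlinarith
    have h1 := hc _ hmem j
    rw [nh_prod] at h1
    have h2 : Tendsto (fun p : E × F => (p.1, (c : 𝕜) • p.2))
        (s.nh (j + r) x₀ ×ˢ t.nh (1 * j + r) v)
        (s.nh (j + r) x₀ ×ˢ t.nh (j + r) ((c : 𝕜) • v)) := by
      rw [one_mul]
      refine tendsto_fst.prodMk (t.tendsto_nh_iff.2 ?_)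
      have : Tendsto (fun p : E × F => t.π (j + r) p.2)
        (s.nh (j + r) x₀ ×ˢ t.nh (j + r) v) (𝓝 (t.π (j + r) v)) := tendsto_comap.comp tendsto_snd
      simpa using this.const_smul (c : 𝕜)
    have h3 := (w.tendsto_nh_iff.1 (h1.comp h2)).const_smul ((c : 𝕜)⁻¹)
    refine w.tendsto_nh_iff.2 ?_
    simpa [inv_smul_smul₀ hcne] using h3
  · obtain ⟨C, hC, hb⟩ := hb trivial j
    refine ⟨C * (2 / ε + 1), by positivity, fun x hx v => ?_⟩
    rw [one_mul]
    by_cases hv : v = 0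
    · subst hv; simp
    have hpos : 0 < t.nm r v := t.nm_pos hv
    -- The neighbourhood contains only vectors with `‖v‖_r < ε`. Scaling `v` to length `ε / 2` and
    -- back multiplies the bound by `c⁻¹ = (2 / ε) ‖v‖_r`, which turns linear growth into the shape
    -- required by `Fam`.
    set c : ℝ := ε / (2 * t.nm r v) with hcdef
    have hc0 : 0 < c := by positivity
    have hmem : (x, (c : 𝕜) • v) ∈ V := by
      refine hsub ⟨hx, hV₂ _ ?_⟩
      rw [sub_zero, t.nm_real_smul r hc0.le]
      have : c * t.nm r v = ε / 2 := by rw [hcdef]; field_simp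
      linarith
    have h1 := hb _ hmem
    simp only [map_smul, nm_prod] at h1
    rw [w.nm_real_smul j hc0.le, t.nm_real_smul _ hc0.le] at h1
    have hX := s.nm_nonneg (j + r) x
    have hv2 := t.nm_nonneg (j + r) v
    have h2 : c * w.nm j (A x v) ≤ C * ((1 + s.nm (j + r) x) + c * t.nm (j + r) v) := by
      refine h1.trans (mul_le_mul_of_nonneg_left ?_ hC)
      have := max_le_add_of_nonneg hX (mul_nonneg hc0.le hv2)
      linarith
    have h3 : w.nm j (A x v) ≤ c⁻¹ * (C * ((1 + s.nm (j + r) x) + c * t.nm (j + r) v)) := by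
      rw [inv_mul_eq_div, le_div_iff₀ hc0]; linarith
    have hcinv : c⁻¹ = 2 / ε * t.nm r v := by rw [hcdef]; field_simp
    have h4 : c⁻¹ * (C * ((1 + s.nm (j + r) x) + c * t.nm (j + r) v)) =
        C * (c⁻¹ * (1 + s.nm (j + r) x) + t.nm (j + r) v) := by
      field_simp
    rw [h4, hcinv] at h3
    refine h3.trans ?_
    rw [mul_assoc C]
    refine mul_le_mul_of_nonneg_left ?_ hC
    have e1 : 0 ≤ (1 + s.nm (j + r) x) * t.nm r v := by positivity
    have e2 : 0 ≤ 2 / ε * t.nm (j + r) v := by positivity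
    linarith

/-- A smoothing family that vanishes at the base point is small nearby. -/
theorem Fam.small {κ : E → F →ₗ[𝕜] F} (hκ : Fam 0 s t t x₀ κ) (h0 : κ x₀ = 0) :
    ∃ b m, ∃ V ∈ s.nh m x₀, (∀ x ∈ V, ∀ v, t.nm b (κ x v) ≤ 1 / 2 * t.nm b v) ∧
      ∀ j, ∃ C : ℝ, 0 ≤ C ∧ ∀ x ∈ V, ∀ v,
        t.nm j (κ x v) ≤ C * ((1 + s.nm (j + m) x) * t.nm b v) := by
  obtain ⟨r, V, hV, hc, hb⟩ := hκ
  set m := r + 1 + r with hm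
  obtain ⟨C, hC, hbr⟩ := hb (r + 1)
  set M := C * (3 + s.nm m x₀) with hMdef
  have hx0 := s.nm_nonneg m x₀
  have hM : 0 ≤ M := by positivity
  -- uniform bound near the base point
  have hbd : ∀ x, x ∈ V → s.nm m (x - x₀) < 1 → ∀ v, t.nm (r + 1) (κ x v) ≤ M * t.nm r v := by
    intro x hx hx1 v
    refine (hbr x hx v).trans ?_
    rw [hMdef, mul_assoc]
    refine mul_le_mul_of_nonneg_left ?_ hC
    have h1 := s.nm_le_add_sub m x x₀
    rw [zero_mul, zero_add]
    have h2 := t.nm_nonneg r v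
    have h3 : (1 + s.nm (r + 1 + r) x) * t.nm r v ≤ (2 + s.nm m x₀) * t.nm r v :=
      mul_le_mul_of_nonneg_right (by linarith) h2
    linarith
  -- Pointwise continuity becomes an operator norm estimate by compactness. `κ x` maps norm `r` to
  -- norm `r + 1` with a uniform constant `M`, and the unit ball of norm `r + 1` has a finite net in
  -- norm `r`. Smallness on the net gives `1 / 4`, and the distance to the net gives another `1 /
  -- 4`.
  obtain ⟨A, hAf, hA1, hA2⟩ := t.exists_finite_net r 1 (by positivity : 0 < 1 / (4 * (M + 1)))
  have hev : ∀ᶠ x in s.nh m x₀, ∀ a ∈ A, t.nm (r + 1) (κ x a) < 1 / 4 := by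
    refine (eventually_all_finite hAf).2 fun a _ => ?_
    have h1 := (hc a (r + 1)).comp (tendsto_id.prodMk (tendsto_const_pure.mono_right
      (show pure a ≤ t.nh (0 * (r + 1) + r) a from fun S hS => t.mem_of_mem_nh hS)))
    have h2 := t.tendsto_nh_iff_nm.1 h1
    rw [h0] at h2
    have h3 := h2.eventually (gt_mem_nhds (by norm_num : (0 : ℝ) < 1 / 4))
    simpa using h3
  refine ⟨r + 1, m, V ∩ {x | s.nm m (x - x₀) < 1} ∩
      {x | ∀ a ∈ A, t.nm (r + 1) (κ x a) < 1 / 4},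
    inter_mem (inter_mem (s.nh_anti (by omega) x₀ hV) (s.ball_mem_nh m x₀ one_pos)) hev,
    fun x hx v => ?_, fun j => ?_⟩
  · by_cases hv : v = 0
    · subst hv; simp
    have hpos : 0 < t.nm (r + 1) v := t.nm_pos hv
    set c : ℝ := (t.nm (r + 1) v)⁻¹ with hcdef
    have hc0 : 0 < c := by positivity
    have hcv : c * t.nm (r + 1) v = 1 := inv_mul_cancel₀ hpos.ne'
    obtain ⟨a, haA, ha⟩ := hA2 ((c : 𝕜) • v) (by rw [t.nm_real_smul _ hc0.le, hcv])
    have h1 : t.nm (r + 1) (κ x ((c : 𝕜) • v - a)) ≤ 1 / 4 := by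
      refine (hbd x hx.1.1 hx.1.2 _).trans ?_
      refine (mul_le_mul_of_nonneg_left ha.le hM).trans ?_
      rw [mul_one_div, div_le_div_iff₀ (by positivity) (by norm_num)]
      linarith
    have h2 := hx.2 a haA
    have h3 := t.nm_add (r + 1) (κ x ((c : 𝕜) • v - a)) (κ x a)
    rw [← map_add, sub_add_cancel, map_smul, t.nm_real_smul _ hc0.le] at h3
    have h4 : c * t.nm (r + 1) (κ x v) ≤ 1 / 2 := by linarith
    have h5 : t.nm (r + 1) (κ x v) ≤ 1 / 2 / c := by rw [le_div_iff₀ hc0]; linarith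
    rwa [hcdef, div_inv_eq_mul] at h5
  · obtain ⟨C', hC', hb⟩ := hb j
    refine ⟨C' * 2, by positivity, fun x hx v => (hb x hx.1.1 v).trans ?_⟩
    rw [mul_assoc]
    refine mul_le_mul_of_nonneg_left ?_ hC'
    rw [zero_mul, zero_add]
    have h1 := t.nm_nonneg r v
    have h2 := t.nm_mono (by omega : r ≤ r + 1) v
    have h3 := s.nm_mono (by omega : j + r ≤ j + m) x
    have h4 := s.nm_nonneg (j + r) x
    have h5 := mul_le_mul (by linarith : 1 + s.nm (j + r) x ≤ 1 + s.nm (j + m) x) h2 h1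
      (by linarith)
    have h6 : t.nm r v ≤ (1 + s.nm (j + m) x) * t.nm (r + 1) v := by nlinarith
    linarith

/-- The Neumann series in a Fréchet space. -/
theorem surjective_id_add (t : ScStructure 𝕜 F) {κ : F →ₗ[𝕜] F} {b : ℕ}
    (h1 : ∀ v, t.nm b (κ v) ≤ 1 / 2 * t.nm b v)
    (h2 : ∀ j, ∃ C : ℝ, ∀ v, t.nm j (κ v) ≤ C * t.nm b v) :
    Function.Surjective (LinearMap.id + κ : F →ₗ[𝕜] F) := by
  intro y
  obtain ⟨u, hu⟩ : ∃ u : ℕ → F, ∀ n, u (n + 1) = y - κ (u n) :=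
    ⟨fun n => Nat.rec y (fun _ u => y - κ u) n, fun n => rfl⟩
  have hd : ∀ n, u (n + 1 + 1) - u (n + 1) = -κ (u (n + 1) - u n) := fun n => by
    rw [map_sub, neg_sub, hu (n + 1)]
    nth_rw 2 [hu n]
    abel
  have hb : ∀ n, t.nm b (u (n + 1) - u n) ≤ (1 / 2) ^ n * t.nm b (u 1 - u 0) := by
    intro n
    induction n with
    | zero => simp
    | succ n ih =>
      rw [hd, map_neg_eq_map, pow_succ]
      refine (h1 _).trans ?_
      nlinarith
  choose C hC using h2
  have hgeo : Summable fun n : ℕ => (1 / 2 : ℝ) ^ n := summable_geometric_two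
  -- The increments decay geometrically in the norm `b`. As `κ` is bounded from the norm `b` to
  -- every norm, they decay geometrically in all norms after one more step.
  have hstep : ∀ j n, t.nm j (u (n + 1 + 1) - u (n + 1)) ≤
      |C j| * t.nm b (u 1 - u 0) * (1 / 2) ^ n := by
    intro j n
    rw [hd, map_neg_eq_map]
    refine (hC j _).trans ((mul_le_mul_of_nonneg_right (le_abs_self _) (t.nm_nonneg _ _)).trans ?_)
    have := mul_le_mul_of_nonneg_left (hb n) (abs_nonneg (C j))
    linarith
  obtain ⟨z, hz⟩ := t.exists_limit_of_summable (fun n => u (n + 1)) _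
    (fun j => hgeo.mul_left (|C j| * t.nm b (u 1 - u 0))) hstep
  refine ⟨z, t.eq_zero_of_nm (j := 0) (x := z + κ z - y) ?_ |> sub_eq_zero.1⟩
  have h3 : ∀ n, t.nm 0 (z + κ z - y) ≤
      t.nm 0 (u (n + 1 + 1) - z) + |C 0| * t.nm b (u (n + 1) - z) := by
    intro n
    have e : z + κ z - y = -(u (n + 1 + 1) - z) - κ (u (n + 1) - z) := by
      rw [hu (n + 1), map_sub]; abel
    rw [e]
    refine (t.nm_sub _ _ _).trans (add_le_add (map_neg_eq_map _ _).le ((hC 0 _).trans ?_))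
    exact mul_le_mul_of_nonneg_right (le_abs_self _) (t.nm_nonneg _ _)
  have h4 : Tendsto (fun n => t.nm 0 (u (n + 1 + 1) - z) + |C 0| * t.nm b (u (n + 1) - z))
      atTop (𝓝 (0 + |C 0| * 0)) :=
    ((tendsto_add_atTop_iff_nat 1).2 (hz 0)).add ((hz b).const_mul _)
  rw [mul_zero, add_zero] at h4
  exact le_antisymm (ge_of_tendsto' h4 h3) (t.nm_nonneg _ _)

/-- A bijective map with a left parametrix has a bounded inverse. -/
theorem exists_inverse_bound {t : ScStructure 𝕜 F} {w : ScStructure 𝕜 G} {T : F →ₗ[𝕜] G}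
    {ψ : G →ₗ[𝕜] F} {κ : F →ₗ[𝕜] F} (hT : TameLin t w T) (hψ : TameLin w t ψ) {r : ℕ}
    (hκ : ∀ j, ∃ C : ℝ, 0 ≤ C ∧ ∀ v, t.nm j (κ v) ≤ C * t.nm r v)
    (hψT : ∀ v, ψ (T v) = v + κ v) (hinj : Function.Injective T) :
    ∃ b, ∃ C : ℝ, 0 ≤ C ∧ ∀ v, t.nm r v ≤ C * w.nm b (T v) := by
  -- Otherwise there are `v i` with `‖v i‖_r = 1` and `T (v i) → 0` in all norms. From `v = ψ (T v)
  -- - κ v` the sequence is bounded in norm `r + 1`, so a subsequence is Cauchy in norm `r`. The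
  -- same identity makes it Cauchy in every norm, because `κ` is bounded by the norm `r`. Its limit
  -- is a nonzero vector in the kernel of `T`.
  by_contra hcon
  push Not at hcon
  have hex : ∀ i : ℕ, ∃ v, t.nm r v = 1 ∧ w.nm i (T v) ≤ 1 / ((i : ℝ) + 1) := by
    intro i
    obtain ⟨v, hv⟩ := hcon i (i + 1) (by positivity)
    have hpos : 0 < t.nm r v := lt_of_le_of_lt (mul_nonneg (by positivity) (w.nm_nonneg _ _)) hv
    have hc0 : 0 < (t.nm r v)⁻¹ := by positivity
    refine ⟨(((t.nm r v)⁻¹ : ℝ) : 𝕜) • v, ?_, ?_⟩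
    · rw [t.nm_real_smul _ hc0.le, inv_mul_cancel₀ hpos.ne']
    · rw [map_smul, w.nm_real_smul _ hc0.le, inv_mul_eq_div, div_le_div_iff₀ hpos (by positivity)]
      linarith
  choose v hv1 hv2 using hex
  have hTv : ∀ j, Tendsto (fun i => w.nm j (T (v i))) atTop (𝓝 0) := by
    intro j
    refine squeeze_zero' (Eventually.of_forall fun i => w.nm_nonneg _ _) ?_
      tendsto_one_div_add_atTop_nhds_zero_nat
    filter_upwards [eventually_ge_atTop j] with i hi
    exact (w.nm_mono hi _).trans (hv2 i)
  obtain ⟨c, hψ⟩ := hψ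
  have hψv : ∀ j, Tendsto (fun i => t.nm j (ψ (T (v i)))) atTop (𝓝 0) := by
    intro j
    obtain ⟨C, -, hC⟩ := hψ j
    have := (hTv (j + c)).const_mul C
    rw [mul_zero] at this
    exact squeeze_zero (fun i => t.nm_nonneg _ _) (fun i => hC _) this
  have hdec : ∀ i, v i = ψ (T (v i)) - κ (v i) := fun i => by rw [hψT]; abel
  obtain ⟨R, hR⟩ : ∃ R, ∀ i, t.nm (r + 1) (v i) ≤ R := by
    obtain ⟨R, hR⟩ := (hψv (r + 1)).bddAbove_range
    obtain ⟨C, hC0, hC⟩ := hκ (r + 1)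
    refine ⟨R + C, fun i => ?_⟩
    rw [hdec i]
    refine (t.nm_sub _ _ _).trans (add_le_add (hR ⟨i, rfl⟩) ((hC _).trans ?_))
    rw [hv1, mul_one]
  obtain ⟨φ, hφ, hcau⟩ := t.exists_subseq_cauchy r hR
  obtain ⟨z, hz⟩ := t.exists_limit (fun i => v (φ i)) fun j => by
    have h1 : CauchySeq fun i => t.π j (ψ (T (v (φ i)))) := by
      refine Tendsto.cauchySeq (x := 0) ?_
      exact tendsto_zero_iff_norm_tendsto_zero.2 ((hψv j).comp hφ.tendsto_atTop)
    have h2 : CauchySeq fun i => t.π j (κ (v (φ i))) := by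
      obtain ⟨C, hC0, hC⟩ := hκ j
      refine Metric.cauchySeq_iff.2 fun ε hε => ?_
      obtain ⟨N, hN⟩ := Metric.cauchySeq_iff.1 hcau (ε / (C + 1)) (by positivity)
      refine ⟨N, fun m hm n hn => ?_⟩
      have h3 := hN m hm n hn
      rw [dist_eq_norm_sub, ← map_sub, ← nm_apply] at h3 ⊢
      rw [← map_sub]
      refine (hC _).trans_lt ?_
      rw [lt_div_iff₀ (by positivity)] at h3
      nlinarith [t.nm_nonneg r (v (φ m) - v (φ n))]
    have h3 := uniformContinuous_sub.comp_cauchySeq (h1.prodMk h2)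
    have h4 : (fun i => t.π j (v (φ i))) =
        (fun p : t.X j × t.X j => p.1 - p.2) ∘
          fun i => (t.π j (ψ (T (v (φ i)))), t.π j (κ (v (φ i)))) := by
      funext i
      rw [Function.comp_apply, ← map_sub, ← hdec]
    rw [h4]
    exact h3
  have hz1 : t.nm r z = 1 := by
    have h1 := (t.tendsto_nm r z).comp (t.tendsto_nh_iff_nm.2 (hz r))
    simp only [Function.comp_def, hv1] at h1
    exact tendsto_nhds_unique h1 tendsto_const_nhds |>.symm ▸ rfl
  have hTz : T z = 0 := by
    refine w.eq_zero_of_nm (j := 0) (le_antisymm ?_ (w.nm_nonneg _ _))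
    obtain ⟨c', hT⟩ := hT
    obtain ⟨C, hC0, hC⟩ := hT 0
    have h1 : Tendsto (fun i => w.nm 0 (T (v (φ i))) + C * t.nm (0 + c') (v (φ i) - z)) atTop
        (𝓝 (0 + C * 0)) := ((hTv 0).comp hφ.tendsto_atTop).add ((hz (0 + c')).const_mul C)
    rw [mul_zero, add_zero] at h1
    refine ge_of_tendsto' h1 fun i => ?_
    have h2 := w.nm_sub 0 (T (v (φ i))) (T (v (φ i) - z))
    have h3 : T (v (φ i)) - T (v (φ i) - z) = T z := by rw [map_sub, sub_sub_cancel]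
    rw [h3] at h2
    exact h2.trans (add_le_add_right (hC _) _)
  have hz0 : z = 0 := hinj (by rw [hTz, map_zero])
  rw [hz0, nm_zero] at hz1
  exact zero_ne_one hz1

end Family
end ScStructure

/-! ### Families with a parametrix: bijectivity near a point and tame inverses. -/

namespace ScStructure

section InverseFamily

variable {𝕜 : Type*} [RCLike 𝕜]
variable {E : Type u} [AddCommGroup E] [Module 𝕜 E] [TopologicalSpace E]
variable {F : Type u} [AddCommGroup F] [Module 𝕜 F] [TopologicalSpace F]
variable {G : Type u} [AddCommGroup G] [Module 𝕜 G] [TopologicalSpace G]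

variable {s : ScStructure 𝕜 E} {t : ScStructure 𝕜 F} {w : ScStructure 𝕜 G} {x₀ : E}

theorem Fam.tameLin {A : E → F →ₗ[𝕜] G} (hA : Fam 1 s t w x₀ A) : TameLin t w (A x₀) := by
  obtain ⟨r, hr⟩ := hA.bound_at
  exact ⟨r, fun j => by simpa using hr j⟩

/-- A family with a parametrix that is an inverse at `x₀` is bijective near `x₀`, and the inverses
satisfy tame estimates. -/
theorem Fam.exists_inverse_of_eq_zero {T : E → F →ₗ[𝕜] G} {ψ : E → G →ₗ[𝕜] F}
    {κ : E → F →ₗ[𝕜] F} {κ' : E → G →ₗ[𝕜] G} (hψ : Fam 1 s w t x₀ ψ)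
    (hκ : Fam 0 s t t x₀ κ) (hκ' : Fam 0 s w w x₀ κ') {m : ℕ} {V : Set E} (hV : V ∈ s.nh m x₀)
    (h1 : ∀ x ∈ V, ∀ v, ψ x (T x v) = v + κ x v) (h2 : ∀ x ∈ V, ∀ y, T x (ψ x y) = y + κ' x y)
    (hz₁ : κ x₀ = 0) (hz₂ : κ' x₀ = 0) :
    ∃ r, ∃ V ∈ s.nh r x₀, (∀ x ∈ V, Function.Bijective (T x)) ∧
      ∀ j, ∃ C : ℝ, 0 ≤ C ∧ ∀ x ∈ V, ∀ v, t.nm j v ≤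
        C * ((1 + s.nm (j + r) x) * w.nm r (T x v) + w.nm (j + r) (T x v)) := by
  obtain ⟨b, m₁, V₁, hV₁, hs₁, ht₁⟩ := hκ.small hz₁
  obtain ⟨b', m₂, V₂, hV₂, hs₂, ht₂⟩ := hκ'.small hz₂
  obtain ⟨r, V₃, hV₃, -, hb⟩ := hψ
  set q := b + r + m₁ + m₂ + m with hq
  refine ⟨q, (V ∩ V₁ ∩ V₂ ∩ V₃) ∩ {x | s.nm q (x - x₀) < 1}, inter_mem (inter_mem (inter_mem
    (inter_mem (s.nh_anti (by omega) _ hV) (s.nh_anti (by omega) _ hV₁))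
    (s.nh_anti (by omega) _ hV₂)) (s.nh_anti (by omega) _ hV₃)) (s.ball_mem_nh _ _ one_pos),
    ?_, ?_⟩
  · rintro x ⟨⟨⟨⟨hxV, hx1⟩, hx2⟩, hx3⟩, -⟩
    constructor
    · refine (injective_iff_map_eq_zero _).2 fun v hv => t.eq_zero_of_nm (j := b) ?_
      have e := h1 x hxV v
      rw [hv, map_zero] at e
      have e2 := hs₁ x hx1 v
      rw [eq_neg_of_add_eq_zero_right e.symm, map_neg_eq_map] at e2
      have := t.nm_nonneg b v
      linarith
    · intro y
      -- `T x ∘ ψ x = id + κ' x` is onto by the Neumann series, hence so is `T x`. Injectivity above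
      -- came from `v = -κ x v`, which halves the norm `b`.
      obtain ⟨z, hz⟩ := surjective_id_add w (hs₂ x hx2) (fun j => by
        obtain ⟨C, hC, hb⟩ := ht₂ j
        exact ⟨C * (1 + s.nm (j + m₂) x), fun v => by rw [mul_assoc]; exact hb x hx2 v⟩) y
      exact ⟨ψ x z, (h2 x hxV z).trans hz⟩
  · intro j
    obtain ⟨C₁, hC₁, hb1⟩ := hb b
    obtain ⟨C₂, hC₂, hb2⟩ := hb j
    obtain ⟨C₃, hC₃, ht3⟩ := ht₁ j
    obtain ⟨M, hM⟩ : ∃ M, M = s.nm q x₀ + 1 := ⟨_, rfl⟩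
    have hM0 : 0 ≤ M := by linarith [s.nm_nonneg q x₀]
    refine ⟨C₂ + C₃ * (2 * (C₁ * (2 + M))), by positivity, ?_⟩
    rintro x ⟨⟨⟨⟨hxV, hx1⟩, hx2⟩, hx3⟩, hxb⟩ v
    have hxM : s.nm q x ≤ M := by
      have := s.nm_le_add_sub q x x₀
      have h2 : s.nm q (x - x₀) < 1 := hxb
      linarith
    -- The identity is used twice. In the norm `b` the term `κ x v` is at most half of the left side
    -- and is absorbed. In the norm `j` it is bounded by the norm `b` of `v`, which is known by
    -- then.
    have hdec : ψ x (T x v) - κ x v = v := by rw [h1 x hxV]; abel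
    have hbv := hs₁ x hx1 v
    have hjv := ht3 x hx1 v
    have hj := t.nm_sub j (ψ x (T x v)) (κ x v)
    have hb' := t.nm_sub b (ψ x (T x v)) (κ x v)
    rw [hdec] at hj hb'
    have hψb := hb1 x hx3 (T x v)
    have hψj := hb2 x hx3 (T x v)
    generalize T x v = y at *
    have hyq : ∀ i ≤ q, w.nm i y ≤ w.nm q y := fun i hi => w.nm_mono hi y
    have hy0 := w.nm_nonneg q y
    have e1 : t.nm b (ψ x y) ≤ C₁ * ((2 + M) * w.nm q y) := by
      refine hψb.trans (mul_le_mul_of_nonneg_left ?_ hC₁)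
      have i1 := hyq r (by omega)
      have i2 := hyq (1 * b + r) (by omega)
      have i3 : s.nm (b + r) x ≤ M := (s.nm_mono (by omega) x).trans hxM
      have i4 := mul_le_mul (by linarith : 1 + s.nm (b + r) x ≤ 1 + M) i1 (w.nm_nonneg _ _)
        (by linarith)
      linarith
    have e2 : t.nm b v ≤ 2 * (C₁ * ((2 + M) * w.nm q y)) := by linarith
    have hX : 0 ≤ s.nm (j + q) x := s.nm_nonneg _ _
    have f1 : s.nm (j + r) x ≤ s.nm (j + q) x := s.nm_mono (by omega) x
    have f2 : s.nm (j + m₁) x ≤ s.nm (j + q) x := s.nm_mono (by omega) x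
    have f3 : w.nm (1 * j + r) y ≤ w.nm (j + q) y := w.nm_mono (by omega) y
    have hyj := w.nm_nonneg (j + q) y
    have g1 : (1 + s.nm (j + r) x) * w.nm r y ≤ (1 + s.nm (j + q) x) * w.nm q y :=
      mul_le_mul (by linarith) (hyq r (by omega)) (w.nm_nonneg _ _) (by linarith)
    have g2 : (1 + s.nm (j + m₁) x) * t.nm b v ≤
        (1 + s.nm (j + q) x) * (2 * (C₁ * ((2 + M) * w.nm q y))) :=
      mul_le_mul (by linarith) e2 (t.nm_nonneg _ _) (by linarith)
    have g3 := mul_le_mul_of_nonneg_left (add_le_add g1 f3) hC₂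
    have g4 := mul_le_mul_of_nonneg_left g2 hC₃
    have g5 : 0 ≤ C₃ * (2 * (C₁ * (2 + M))) * w.nm (j + q) y := by positivity
    calc t.nm j v ≤ C₂ * ((1 + s.nm (j + q) x) * w.nm q y + w.nm (j + q) y) +
        C₃ * ((1 + s.nm (j + q) x) * (2 * (C₁ * ((2 + M) * w.nm q y)))) := by linarith
      _ ≤ _ := by linarith

/-- A family of operators that is invertible modulo smoothing families near `x₀` and bijective at
`x₀` is bijective near `x₀`, and the inverses satisfy tame estimates. -/
theorem Fam.exists_inverse {T : E → F →ₗ[𝕜] G} {ψ : E → G →ₗ[𝕜] F} {κ : E → F →ₗ[𝕜] F}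
    {κ' : E → G →ₗ[𝕜] G} (hT : Fam 1 s t w x₀ T) (hψ : Fam 1 s w t x₀ ψ)
    (hκ : Fam 0 s t t x₀ κ) (hκ' : Fam 0 s w w x₀ κ') {m : ℕ} {V : Set E} (hV : V ∈ s.nh m x₀)
    (h1 : ∀ x ∈ V, ∀ v, ψ x (T x v) = v + κ x v) (h2 : ∀ x ∈ V, ∀ y, T x (ψ x y) = y + κ' x y)
    (hbij : Function.Bijective (T x₀)) :
    ∃ r, ∃ V ∈ s.nh r x₀, (∀ x ∈ V, Function.Bijective (T x)) ∧
      ∀ j, ∃ C : ℝ, 0 ≤ C ∧ ∀ x ∈ V, ∀ v, t.nm j v ≤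
        C * ((1 + s.nm (j + r) x) * w.nm r (T x v) + w.nm (j + r) (T x v)) := by
  have hx₀ := s.mem_of_mem_nh hV
  obtain ⟨R, hRT, hTR⟩ : ∃ R : G →ₗ[𝕜] F, (∀ v, R (T x₀ v) = v) ∧ ∀ y, T x₀ (R y) = y :=
    ⟨(LinearEquiv.ofBijective (T x₀) hbij).symm.toLinearMap,
      (LinearEquiv.ofBijective (T x₀) hbij).symm_apply_apply,
      (LinearEquiv.ofBijective (T x₀) hbij).apply_symm_apply⟩
  obtain ⟨r₁, hκ0⟩ := hκ.bound_at
  simp only [zero_mul, zero_add] at hκ0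
  obtain ⟨b₁, D, hD, hb₁⟩ := exists_inverse_bound hT.tameLin hψ.tameLin hκ0 (h1 x₀ hx₀) hbij.1
  -- With `R` the inverse of `T x₀`, one has `ψ x₀ = R + κ x₀ ∘ R`, so subtracting `κ x₀ ∘ R` from
  -- `ψ` makes it the exact inverse at `x₀`. The correction is smoothing because `‖R y‖_r` is
  -- bounded by one norm of `y`, by `exists_inverse_bound`.
  have hθ : Fam 0 s w t x₀ fun _ => κ x₀ ∘ₗ R := Fam.const (r := b₁) fun j => by
    obtain ⟨C, hC, hb⟩ := hκ0 j
    refine ⟨C * D, by positivity, fun y => (hb _).trans ?_⟩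
    rw [zero_mul, zero_add, mul_assoc]
    refine mul_le_mul_of_nonneg_left ((hb₁ _).trans ?_) hC
    rw [hTR]
  have hκ₁ : Fam 0 s t t x₀ fun x => κ x - (κ x₀ ∘ₗ R) ∘ₗ T x :=
    hκ.sub (by simpa only [zero_mul] using hθ.comp hT zero_le_one le_rfl)
  have hκ₂ : Fam 0 s w w x₀ fun x => κ' x - T x ∘ₗ (κ x₀ ∘ₗ R) :=
    hκ'.sub (by simpa only [mul_zero] using hT.comp hθ le_rfl zero_le_one)
  refine Fam.exists_inverse_of_eq_zero (T := T) (hψ.sub hθ.of_smoothing) hκ₁ hκ₂ hV ?_ ?_ ?_ ?_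
  · intro x hx v
    simp only [LinearMap.sub_apply, LinearMap.comp_apply, h1 x hx]
    abel
  · intro x hx v
    simp only [LinearMap.sub_apply, LinearMap.comp_apply, map_sub, h2 x hx]
    abel
  · ext v; simp [hRT]
  · ext y
    have e := h1 x₀ hx₀ (R y)
    have e2 := h2 x₀ hx₀ y
    rw [hTR] at e
    rw [e, map_add, hTR] at e2
    simp [add_left_cancel e2]

end InverseFamily

end ScStructure

/-! ### Strongly smoothing families in terms of norms. -/

namespace PreTameSc

open ScStructure

variable {𝕜 : Type*} [RCLike 𝕜]
variable {E : Type u} [AddCommGroup E] [Module 𝕜 E] [TopologicalSpace E]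
variable {F : Type u} [AddCommGroup F] [Module 𝕜 F] [TopologicalSpace F]
variable {G : Type u} [AddCommGroup G] [Module 𝕜 G] [TopologicalSpace G]

/-- For the tame sequence `j ↦ n + j`, level `0` of the lifted envelope takes level `n` of the
parameter and level `0` of the vector to level `n` of the target. Letting `n` vary, every norm of `κ
x v` is controlled by the norm `0` of `v` and one norm of `x`. The estimate on `‖v‖₀ ≤ 1` extends to
all `v` by homogeneity. -/
theorem IsStronglySmoothing.fam {P : PreTameSc 𝕜 E} {P₁ : PreTameSc 𝕜 F} {P₂ : PreTameSc 𝕜 G}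
    {U : Set E} {κ : E → F →ₗ[𝕜] G} (h : IsStronglySmoothing P P₁ P₂ U κ) {x₀ : E}
    (hx₀ : x₀ ∈ U) : Fam 0 P.rep P₁.rep P₂.rep x₀ κ := by
  obtain ⟨V, hV, hVU, s, hs, s₁, hs₁, s₂, hs₂, O, H, -, -, hK⟩ := h x₀ hx₀
  refine Fam.of_nLe (P.nEq_of_mem hs).2 (P₁.nEq_of_mem hs₁).2 (P₂.nEq_of_mem hs₂).1 zero_le_one ?_
  obtain ⟨r, hr⟩ := s.mem_nhds_iff'.1 hV
  have hadd : ∀ n : ℕ, IsTameSeq fun j => n + j := fun n =>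
    ⟨fun _ _ h => Nat.add_lt_add_left h n, n, fun j => by simp only; omega⟩
  refine ⟨r, V, hr, fun v n => ?_, fun n => ?_⟩
  · obtain ⟨K, hKe, -, -⟩ := hK _ (hadd n)
    have hmem : ∀ x ∈ V, ∀ v : F,
        (s.π n x, s₁.π 0 v) ∈ (O (n + 0) ×ˢ univ : Set (s.X (n + 0) × s₁.X 0)) := by
      intro x hx v
      have := hKe.eq_iInter.subset (show (x, v) ∈ V ×ˢ univ from ⟨hx, mem_univ _⟩)
      exact mem_iInter.1 this 0
    have hx := hmem x₀ (mem_of_mem_nhds hV) v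
    have hc := (hKe.continuousOn 0).continuousAt ((hKe.isOpen 0).mem_nhds hx)
    have h1 : Tendsto (fun p : E × F => (s.π n p.1, s₁.π 0 p.2))
        (s.nh (n + r) x₀ ×ˢ s₁.nh (0 * n + r) v) (𝓝 (s.π n x₀, s₁.π 0 v)) := by
      rw [nhds_prod_eq]
      exact Tendsto.prodMap (tendsto_comap.mono_left (s.nh_anti (by omega) x₀))
        (tendsto_comap.mono_left (s₁.nh_anti (Nat.zero_le _) v))
    refine s₂.tendsto_nh_iff.2 ?_
    have h2 := hc.tendsto.comp h1
    have e0 : K 0 (s.π n x₀, s₁.π 0 v) = s₂.π n (κ x₀ v) :=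
      hKe.extends_map 0 (x₀, v) ⟨mem_of_mem_nhds hV, mem_univ _⟩
    have h3 : Tendsto (K 0 ∘ fun p : E × F => (s.π n p.1, s₁.π 0 p.2))
        (s.nh (n + r) x₀ ×ˢ s₁.nh (0 * n + r) v) (𝓝 (s₂.π n (κ x₀ v))) := by
      rw [← e0]; exact h2
    refine h3.congr' ?_
    have : ∀ᶠ p : E × F in s.nh (n + r) x₀ ×ˢ s₁.nh (0 * n + r) v, p.1 ∈ V :=
      tendsto_fst.eventually (s.nh_anti (Nat.le_add_left _ _) x₀ hr)
    filter_upwards [this] with p hp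
    exact hKe.extends_map 0 (p.1, p.2) ⟨hp, mem_univ _⟩
  · obtain ⟨K, hKe, hKb, -⟩ := hK _ (hadd n)
    obtain ⟨C, hC⟩ := hKb 0 1
    have hb : ∀ x ∈ V, ∀ v, s₁.nm 0 v ≤ 1 → s₂.nm n (κ x v) ≤ |C| * (2 * (1 + s.nm n x)) := by
      intro x hx v hv
      have e0 : K 0 (s.π n x, s₁.π 0 v) = s₂.π n (κ x v) :=
        hKe.extends_map 0 (x, v) ⟨hx, mem_univ _⟩
      have hm := hKe.eq_iInter.subset (show (x, v) ∈ V ×ˢ univ from ⟨hx, mem_univ _⟩)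
      have hm := mem_iInter.1 hm 0
      have h1 := hC (s.π n x) hm.1 (s₁.π 0 v) (by rw [s₁.incl_π]; exact hv)
      rw [nm_apply, ← e0]
      refine h1.trans ((mul_le_mul_of_nonneg_right (le_abs_self C) (by positivity)).trans ?_)
      refine mul_le_mul_of_nonneg_left ?_ (abs_nonneg C)
      have e1 : ‖s.π n x‖ = s.nm n x := rfl
      have e2 : ‖s₁.π 0 v‖ = s₁.nm 0 v := rfl
      have := s.nm_nonneg n x
      change 1 + s.nm n x + s₁.nm 0 v ≤ _
      linarith
    refine ⟨|C| * 2, by positivity, fun x hx v => ?_⟩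
    by_cases hv : v = 0
    · subst hv; simp
    have hpos : 0 < s₁.nm 0 v := s₁.nm_pos hv
    have hc0 : 0 < (s₁.nm 0 v)⁻¹ := by positivity
    have h1 := hb x hx ((((s₁.nm 0 v)⁻¹ : ℝ) : 𝕜) • v)
      (by rw [s₁.nm_real_smul _ hc0.le, inv_mul_cancel₀ hpos.ne'])
    rw [map_smul, s₂.nm_real_smul _ hc0.le, inv_mul_le_iff₀ hpos] at h1
    refine h1.trans ?_
    have e1 := s.nm_nonneg n x
    have e2 : s.nm n x ≤ s.nm (n + r) x := s.nm_mono (by omega) x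
    have e3 : s₁.nm 0 v ≤ s₁.nm r v := s₁.nm_mono (by omega) v
    have e4 := s₁.nm_nonneg (0 * n + r) v
    have e5 := mul_le_mul (by linarith : 1 + s.nm n x ≤ 1 + s.nm (n + r) x) e3 hpos.le
      (by linarith)
    have e6 := mul_le_mul_of_nonneg_left e5 (by positivity : 0 ≤ |C| * 2)
    have e7 : 0 ≤ |C| * 2 * s₁.nm (0 * n + r) v := by positivity
    linarith

end PreTameSc

/-! ### The Nash–Moser iteration -/

namespace ScStructure

section Newton

variable {𝕜 : Type*} [RCLike 𝕜]
variable {E : Type u} [AddCommGroup E] [Module 𝕜 E] [TopologicalSpace E]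
variable {F : Type u} [AddCommGroup F] [Module 𝕜 F] [TopologicalSpace F]

/-- The estimates for a map `g` with derivative `A` on the ball `‖u‖_r < δ` that are used in the
Nash–Moser iteration. -/
structure TameNewton (s : ScStructure 𝕜 E) (t : ScStructure 𝕜 F) (g : E → F)
    (A : E → E →ₗ[𝕜] F) (r : ℕ) (δ : ℝ) : Prop where
  pos : 0 < δ
  le_one : δ ≤ 1
  zero : g 0 = 0
  bijective : ∀ u, s.nm r u < δ → Function.Bijective (A u)
  bound : ∀ j, ∃ C : ℝ, 0 ≤ C ∧ ∀ u, s.nm r u < δ → ∀ v,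
    t.nm j (A u v) ≤ C * ((1 + s.nm (j + r) u) * s.nm r v + s.nm (j + r) v)
  taylor : ∀ j, ∃ C : ℝ, 0 ≤ C ∧ ∀ u v, s.nm r u < δ → s.nm r (u + v) < δ →
    t.nm j (g (u + v) - g u - A u v) ≤
      C * (s.nm r v * s.nm (j + r) v + (1 + s.nm (j + r) u) * s.nm r v ^ 2)
  inverse : ∀ j, ∃ C : ℝ, 0 ≤ C ∧ ∀ u, s.nm r u < δ → ∀ v,
    s.nm j v ≤ C * ((1 + s.nm (j + r) u) * t.nm r (A u v) + t.nm (j + r) (A u v))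

variable {s : ScStructure 𝕜 E} {t : ScStructure 𝕜 F} {g : E → F} {A : E → E →ₗ[𝕜] F} {r : ℕ}
  {δ : ℝ}

theorem TameNewton.mono (h : TameNewton s t g A r δ) {δ' : ℝ} (h0 : 0 < δ') (hle : δ' ≤ δ) :
    TameNewton s t g A r δ' where
  pos := h0
  le_one := hle.trans h.le_one
  zero := h.zero
  bijective u hu := h.bijective u (hu.trans_le hle)
  bound j := by
    obtain ⟨C, hC, hb⟩ := h.bound j
    exact ⟨C, hC, fun u hu => hb u (hu.trans_le hle)⟩
  taylor j := by
    obtain ⟨C, hC, hb⟩ := h.taylor j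
    exact ⟨C, hC, fun u v hu huv => hb u v (hu.trans_le hle) (huv.trans_le hle)⟩
  inverse j := by
    obtain ⟨C, hC, hb⟩ := h.inverse j
    exact ⟨C, hC, fun u hu => hb u (hu.trans_le hle)⟩

/-- This is the Taylor estimate at the origin, where `g` vanishes. The quadratic terms are absorbed
since `‖u‖_r < δ ≤ 1`. -/
theorem TameNewton.map_bound (h : TameNewton s t g A r δ) (j : ℕ) :
    ∃ C : ℝ, 0 ≤ C ∧ ∀ u, s.nm r u < δ → t.nm j (g u) ≤ C * s.nm (j + r) u := by
  obtain ⟨C, hC, hb⟩ := h.bound j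
  obtain ⟨C', hC', ht⟩ := h.taylor j
  have h0 : s.nm r (0 : E) < δ := by rw [s.nm_zero]; exact h.pos
  refine ⟨C * 2 + C' * 2, by positivity, fun u hu => ?_⟩
  have h1 := hb 0 h0 u
  have h2 := ht 0 u h0 (by rwa [zero_add])
  rw [zero_add, h.zero, sub_zero, s.nm_zero, add_zero, one_mul] at h2
  rw [s.nm_zero, add_zero, one_mul] at h1
  have h3 := t.nm_le_add_sub j (g u) (A 0 u)
  have h4 := s.nm_mono (by omega : r ≤ j + r) u
  have h5 := s.nm_nonneg r u
  have h6 : s.nm r u ≤ 1 := hu.le.trans h.le_one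
  have h7 : s.nm r u * s.nm (j + r) u + s.nm r u ^ 2 ≤ 2 * s.nm (j + r) u := by nlinarith
  have h8 := mul_le_mul_of_nonneg_left h7 hC'
  have h9 := mul_le_mul_of_nonneg_left (by linarith : s.nm r u + s.nm (j + r) u ≤
    2 * s.nm (j + r) u) hC
  linarith

/-- The left side has the shape of the Taylor remainder, with `n` the low norm of the increment. For
bounded increments it is linear in `n`, with one high-norm factor `Y`. -/
theorem mul_add_mul_sq_le {n a b Y : ℝ} (hn : 0 ≤ n) (hn2 : n ≤ 2) (ha : a ≤ 2 * Y) (hb : b ≤ Y)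
    (hb0 : 0 ≤ b) : n * a + b * n ^ 2 ≤ 4 * (Y * n) := by
  have h1 := mul_le_mul_of_nonneg_left ha hn
  have h2 : b * n ^ 2 ≤ Y * (2 * n) := mul_le_mul hb (by nlinarith) (sq_nonneg _) (hb0.trans hb)
  linarith

/-- Lipschitz estimate for the inverse in a low norm. -/
theorem TameNewton.lipschitz_low (h : TameNewton s t g A r δ) :
    ∃ δ₁ : ℝ, 0 < δ₁ ∧ δ₁ ≤ δ ∧ ∃ C : ℝ, 0 ≤ C ∧ ∀ u v, s.nm (3 * r) u < δ₁ →
      s.nm (3 * r) (u + v) < δ₁ → s.nm r v ≤ C * t.nm (2 * r) (g (u + v) - g u) := by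
  obtain ⟨C₁, hC₁, hi⟩ := h.inverse r
  obtain ⟨C₂, hC₂, ht⟩ := h.taylor (2 * r)
  -- The inverse estimate contributes `3 * C₁` and the Taylor remainder `6 * C₂ * δ₁`. Their product
  -- must be at most `1 / 2` to be absorbed on the left, which leaves the constant `6 * C₁`. Balls
  -- are measured in norm `3 * r` because the Taylor estimate at level `2 * r` involves that norm.
  obtain ⟨δ₁, hpos, hδδ, hδC⟩ : ∃ δ₁ : ℝ, 0 < δ₁ ∧ δ₁ ≤ δ ∧ 18 * (C₁ * C₂) * δ₁ ≤ 1 / 2 := by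
    refine ⟨min δ (1 / (36 * (C₁ * C₂) + 1)), lt_min h.pos (by positivity), min_le_left _ _, ?_⟩
    have h1 : min δ (1 / (36 * (C₁ * C₂) + 1)) ≤ 1 / (36 * (C₁ * C₂) + 1) := min_le_right _ _
    have h2 : 0 < min δ (1 / (36 * (C₁ * C₂) + 1)) := lt_min h.pos (by positivity)
    rw [le_div_iff₀ (by positivity)] at h1
    nlinarith
  refine ⟨δ₁, hpos, hδδ, 6 * C₁, by positivity, fun u v h1 h2 => ?_⟩
  have hu1 : s.nm r u < δ := (s.nm_mono (by omega) u).trans_lt (h1.trans_le hδδ)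
  have hu2 : s.nm r (u + v) < δ := (s.nm_mono (by omega) _).trans_lt (h2.trans_le hδδ)
  have e1 := hi u hu1 v
  have e2 := ht u v hu1 hu2
  have e3 : s.nm (r + r) u ≤ 1 :=
    (s.nm_mono (by omega) u).trans (h1.le.trans (hδδ.trans h.le_one))
  have e3' : s.nm (2 * r + r) u ≤ 1 :=
    (s.nm_mono (by omega) u).trans (h1.le.trans (hδδ.trans h.le_one))
  have e4 : s.nm (2 * r + r) v ≤ 2 * δ₁ := by
    have := s.nm_sub (2 * r + r) (u + v) u
    rw [add_sub_cancel_left] at this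
    have i1 := s.nm_mono (by omega : 2 * r + r ≤ 3 * r) u
    have i2 := s.nm_mono (by omega : 2 * r + r ≤ 3 * r) (u + v)
    linarith
  have e5 : s.nm r v ≤ 2 * δ₁ := (s.nm_mono (by omega) v).trans e4
  have e6 := t.nm_le_add_sub (2 * r) (A u v) (g (u + v) - g u)
  rw [t.nm_sub_rev (2 * r) (A u v)] at e6
  have hv0 := s.nm_nonneg r v
  have e7 : s.nm r v * s.nm (2 * r + r) v + (1 + s.nm (2 * r + r) u) * s.nm r v ^ 2 ≤
      6 * δ₁ * s.nm r v := by
    have i1 := mul_le_mul_of_nonneg_left e4 hv0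
    have i2 : (1 + s.nm (2 * r + r) u) * s.nm r v ^ 2 ≤ 2 * (2 * δ₁ * s.nm r v) := by
      have i3 : s.nm r v ^ 2 ≤ 2 * δ₁ * s.nm r v := by
        rw [pow_two]; exact mul_le_mul_of_nonneg_right e5 hv0
      exact mul_le_mul (by linarith) i3 (sq_nonneg _) (by norm_num)
    linarith
  have e8 := mul_le_mul_of_nonneg_left e7 hC₂
  have hA1 := t.nm_mono (by omega : r ≤ 2 * r) (A u v)
  have hA2 := t.nm_mono (by omega : r + r ≤ 2 * r) (A u v)
  have e9 : (1 + s.nm (r + r) u) * t.nm r (A u v) + t.nm (r + r) (A u v) ≤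
      3 * t.nm (2 * r) (A u v) := by
    have := mul_le_mul (by linarith : 1 + s.nm (r + r) u ≤ 2) hA1 (t.nm_nonneg _ _)
      (by norm_num)
    linarith
  have e10 := e1.trans (mul_le_mul_of_nonneg_left e9 hC₁)
  have e11 : t.nm (2 * r) (A u v) ≤ t.nm (2 * r) (g (u + v) - g u) +
    C₂ * (6 * δ₁ * s.nm r v) := by linarith
  have e12 := mul_le_mul_of_nonneg_left e11 (by positivity : 0 ≤ 3 * C₁)
  have e13 := mul_le_mul_of_nonneg_right hδC hv0
  linarith

/-- Lipschitz estimate for the inverse. -/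
theorem TameNewton.lipschitz (h : TameNewton s t g A r δ) :
    ∃ δ₁ : ℝ, 0 < δ₁ ∧ δ₁ ≤ δ ∧ ∀ j, ∃ C : ℝ, 0 ≤ C ∧ ∀ u v, s.nm (3 * r) u < δ₁ →
      s.nm (3 * r) (u + v) < δ₁ → s.nm j v ≤
        C * ((1 + s.nm (j + 2 * r) u + s.nm (j + 2 * r) (u + v)) *
          t.nm (2 * r) (g (u + v) - g u) + t.nm (j + 2 * r) (g (u + v) - g u)) := by
  obtain ⟨δ₁, hpos, hδδ, C₁, hC₁, hlow⟩ := h.lipschitz_low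
  refine ⟨δ₁, hpos, hδδ, fun j => ?_⟩
  obtain ⟨C₃, hC₃, hi⟩ := h.inverse j
  obtain ⟨C₄, hC₄, ht⟩ := h.taylor (j + r)
  obtain ⟨C₅, hC₅, hb⟩ := h.taylor r
  refine ⟨C₃ * (1 + C₁ * (C₅ * 8 + C₄ * 4)), by positivity, fun u v h1 h2 => ?_⟩
  have hlo := hlow u v h1 h2
  have hu1 : s.nm r u < δ := (s.nm_mono (by omega) u).trans_lt (h1.trans_le hδδ)
  have hu2 : s.nm r (u + v) < δ := (s.nm_mono (by omega) _).trans_lt (h2.trans_le hδδ)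
  have δ1 : δ₁ ≤ 1 := hδδ.trans h.le_one
  have k1 : s.nm (r + r) v ≤ 2 := by
    have := s.nm_sub (r + r) (u + v) u
    rw [add_sub_cancel_left] at this
    have i1 := s.nm_mono (by omega : r + r ≤ 3 * r) u
    have i2 := s.nm_mono (by omega : r + r ≤ 3 * r) (u + v)
    linarith
  have k2 : s.nm r v ≤ 2 := (s.nm_mono (by omega) v).trans k1
  have k3 : s.nm (r + r) u ≤ 1 := (s.nm_mono (by omega) u).trans (h1.le.trans δ1)
  have k4 : s.nm (j + r + r) v ≤ s.nm (j + 2 * r) (u + v) + s.nm (j + 2 * r) u := by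
    have := s.nm_sub (j + r + r) (u + v) u
    rw [add_sub_cancel_left] at this
    have i1 := s.nm_mono (by omega : j + r + r ≤ j + 2 * r) u
    have i2 := s.nm_mono (by omega : j + r + r ≤ j + 2 * r) (u + v)
    linarith
  have k5 := s.nm_mono (by omega : j + r + r ≤ j + 2 * r) u
  have k6 := s.nm_mono (by omega : j + r ≤ j + 2 * r) u
  have g1 := t.nm_mono (by omega : r ≤ 2 * r) (g (u + v) - g u)
  have g2 := t.nm_mono (by omega : j + r ≤ j + 2 * r) (g (u + v) - g u)
  have n1 := s.nm_nonneg r v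
  have n2 := s.nm_nonneg (j + 2 * r) u
  have n3 := s.nm_nonneg (j + 2 * r) (u + v)
  have n4 := t.nm_nonneg (2 * r) (g (u + v) - g u)
  have n5 := t.nm_nonneg (j + 2 * r) (g (u + v) - g u)
  obtain ⟨Y, hY⟩ : ∃ Y, Y = 1 + s.nm (j + 2 * r) u + s.nm (j + 2 * r) (u + v) := ⟨_, rfl⟩
  have hY0 : 0 ≤ Y := by linarith
  -- Both Taylor remainders are linear in `‖v‖_r`, with at most one high norm in front. The low-norm
  -- estimate `hlo` then replaces `‖v‖_r` by the difference of the values of `g`.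
  have q1 := mul_add_mul_sq_le n1 k2 (by linarith : s.nm (r + r) v ≤ 2 * 2)
    (by linarith : 1 + s.nm (r + r) u ≤ 2) (by linarith [s.nm_nonneg (r + r) u])
  have q2 := mul_add_mul_sq_le n1 k2 (by linarith : s.nm (j + r + r) v ≤ 2 * Y)
    (by linarith : 1 + s.nm (j + r + r) u ≤ Y) (by linarith [s.nm_nonneg (j + r + r) u])
  have m1 : t.nm r (A u v) ≤
      t.nm (2 * r) (g (u + v) - g u) + C₅ * (4 * (2 * s.nm r v)) := by
    have f2 := t.nm_le_add_sub r (A u v) (g (u + v) - g u)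
    rw [t.nm_sub_rev _ (A u v)] at f2
    have := (hb u v hu1 hu2).trans (mul_le_mul_of_nonneg_left q1 hC₅)
    linarith
  have m2 : t.nm (j + r) (A u v) ≤
      t.nm (j + 2 * r) (g (u + v) - g u) + C₄ * (4 * (Y * s.nm r v)) := by
    have f1 := t.nm_le_add_sub (j + r) (A u v) (g (u + v) - g u)
    rw [t.nm_sub_rev _ (A u v)] at f1
    have := (ht u v hu1 hu2).trans (mul_le_mul_of_nonneg_left q2 hC₄)
    linarith
  rw [← hY]
  have m3 : (1 + s.nm (j + r) u) * t.nm r (A u v) ≤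
      Y * (t.nm (2 * r) (g (u + v) - g u) + C₅ * (4 * (2 * s.nm r v))) :=
    mul_le_mul (by linarith) m1 (t.nm_nonneg _ _) hY0
  have i1 := mul_le_mul_of_nonneg_left hlo (by positivity : 0 ≤ (C₅ * 8 + C₄ * 4) * Y)
  have i3 : 0 ≤ C₁ * (C₅ * 8 + C₄ * 4) * t.nm (j + 2 * r) (g (u + v) - g u) := by positivity
  rw [mul_assoc]
  exact (hi u hu1 v).trans (mul_le_mul_of_nonneg_left (by linarith) hC₃)

/-- The smoothing operators, as maps of `E`. -/
theorem HasSmoothing.exists_op (h : s.HasSmoothing) :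
    ∃ (σ : ℝ → E → E) (p : ℕ),
      (∀ k d : ℕ, ∃ C : ℝ, 0 ≤ C ∧ ∀ τ, 0 ≤ τ → ∀ x,
        s.nm (k + d) (σ τ x) ≤ C * Real.exp (((p : ℝ) + d) * τ) * s.nm k x) ∧
      ∀ l d : ℕ, ∃ C : ℝ, 0 ≤ C ∧ ∀ τ, 0 ≤ τ → ∀ x,
        s.nm l (x - σ τ x) ≤ C * Real.exp (-(d : ℝ) * τ) * s.nm (l + p + d) x := by
  obtain ⟨S, -, p, C, hC, h1, h2⟩ := h
  refine ⟨fun τ x => S τ.toNNReal (s.π 0 x), p, fun k d => ⟨2 * C k (k + d), by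
    have := hC k (k + d); positivity, fun τ hτ x => ?_⟩, fun l d => ⟨C (l + p + d) l, hC _ _,
    fun τ hτ x => ?_⟩⟩
  · have e := h1 k (k + d) τ.toNNReal (s.π k x)
    rw [s.incl_π, Real.coe_toNNReal τ hτ] at e
    refine e.trans (mul_le_mul_of_nonneg_right ?_ (norm_nonneg _))
    have e1 : ((p : ℝ) + (((k + d : ℕ) : ℝ) - k)) = p + d := by push_cast; ring
    rw [e1]
    -- The summand `1` in the smoothing estimate is absorbed by the exponential, whose exponent is
    -- nonnegative. This is the factor `2`.
    have e2 : 1 ≤ Real.exp (((p : ℝ) + d) * τ) := Real.one_le_exp (by positivity)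
    nlinarith [hC k (k + d)]
  · have e := h2 (l + p + d) l (by omega) (by omega) τ.toNNReal (s.π (l + p + d) x)
    rw [s.incl_π, s.incl_π, ← map_sub, Real.coe_toNNReal τ hτ] at e
    have e1 : ((p : ℝ) - (((l + p + d : ℕ) : ℝ) - l)) = -d := by push_cast; ring
    rw [e1] at e
    exact e

end Newton

end ScStructure

/-! ### Smoothing parameters and the estimates for a single Newton step. -/

namespace ScStructure

section Iteration

theorem exp_coeff_mul (a b t : ℝ) :
    Real.exp (a * t) * Real.exp (b * t) = Real.exp ((a + b) * t) := by
  rw [← Real.exp_add, add_mul]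

theorem exp_coeff_mono {a b t : ℝ} (h : a ≤ b) (ht : 0 ≤ t) :
    Real.exp (a * t) ≤ Real.exp (b * t) :=
  Real.exp_le_exp.2 (mul_le_mul_of_nonneg_right h ht)

/-- A factor bounded by `exp t` raises the exponent by one. -/
theorem mul_exp_coeff_le {a b t B : ℝ} (hB : B ≤ Real.exp t) (h : a + 1 ≤ b) (ht : 0 ≤ t) :
    B * Real.exp (a * t) ≤ Real.exp (b * t) := by
  calc B * Real.exp (a * t) ≤ Real.exp (1 * t) * Real.exp (a * t) := by
        rw [one_mul]; exact mul_le_mul_of_nonneg_right hB (Real.exp_pos _).le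
    _ = Real.exp ((1 + a) * t) := exp_coeff_mul _ _ _
    _ ≤ _ := exp_coeff_mono (by linarith) ht

/-- The smoothing parameters of the iteration. -/
noncomputable def times (t₀ : ℝ) (n : ℕ) : ℝ := t₀ * (3 / 2) ^ n

theorem times_succ (t₀ : ℝ) (n : ℕ) : times t₀ (n + 1) = 3 / 2 * times t₀ n := by
  rw [times, times, pow_succ]; ring

theorem times_ge {t₀ : ℝ} (h : 2 ≤ t₀) (n : ℕ) : t₀ + n ≤ times t₀ n := by
  have h1 := one_add_mul_le_pow (by norm_num : (-2 : ℝ) ≤ 1 / 2) n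
  have h2 : (1 : ℝ) + 1 / 2 = 3 / 2 := by norm_num
  rw [h2] at h1
  rw [times]
  have h3 := mul_le_mul_of_nonneg_left h1 (by linarith : 0 ≤ t₀)
  have h4 : (0 : ℝ) ≤ n := Nat.cast_nonneg n
  nlinarith

theorem exp_neg_times_le {t₀ : ℝ} (h : 2 ≤ t₀) (n : ℕ) :
    Real.exp (-times t₀ n) ≤ Real.exp (-t₀) * (1 / 2) ^ n := by
  have h1 := times_ge h n
  have h2 : Real.exp (-1) ≤ 1 / 2 := by
    rw [Real.exp_neg, inv_eq_one_div, div_le_div_iff₀ (Real.exp_pos _) (by norm_num)]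
    have := Real.add_one_le_exp (1 : ℝ)
    linarith
  calc Real.exp (-times t₀ n) ≤ Real.exp (-t₀ + n * (-1)) := Real.exp_le_exp.2 (by linarith)
    _ = Real.exp (-t₀) * Real.exp (-1) ^ n := by rw [Real.exp_add, Real.exp_nat_mul]
    _ ≤ _ := mul_le_mul_of_nonneg_left (pow_le_pow_left₀ (Real.exp_pos _).le h2 n)
        (Real.exp_pos _).le

/-- The parameters grow by the factor `3 / 2`, so `(2 * q + 2) * times t₀ (n + 1)` equals `(2 * q +
2) * times t₀ n` plus `q * times t₀ n`, which pays for the growth, plus one spare `times t₀ n`. The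
spare terms pay for the constants: the products of the factors `C * exp (-times t₀ i)` are bounded,
since these factors tend to `0`. The bound `D` does not depend on the sequence `H`. -/
theorem growth {t₀ : ℝ} (h : 2 ≤ t₀) {C q : ℝ} (hC : 0 < C) (hq : 0 ≤ q) :
    ∃ D : ℝ, 0 ≤ D ∧ ∀ H : ℕ → ℝ, (∀ n, 0 ≤ H n) →
      (∀ n, H (n + 1) ≤ C * Real.exp (q * times t₀ n) * H n) →
      ∀ n, H n ≤ D * Real.exp ((2 * q + 2) * times t₀ n) * H 0 := by
  set c : ℕ → ℝ := fun n => ∏ i ∈ Finset.range n, C * Real.exp (-times t₀ i) with hc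
  have hcs : ∀ n, c (n + 1) = c n * (C * Real.exp (-times t₀ n)) := fun n =>
    Finset.prod_range_succ _ _
  have hc0 : ∀ n, 0 < c n := fun n => Finset.prod_pos fun i _ => by positivity
  have hlim : Tendsto (fun n => C * Real.exp (-times t₀ n)) atTop (𝓝 0) := by
    have h1 : Tendsto (fun n : ℕ => C * (Real.exp (-t₀) * (1 / 2 : ℝ) ^ n)) atTop
        (𝓝 (C * (Real.exp (-t₀) * 0))) :=
      ((tendsto_pow_atTop_nhds_zero_of_lt_one (by norm_num) (by norm_num)).const_mul _).const_mul _
    rw [mul_zero, mul_zero] at h1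
    exact squeeze_zero (fun n => by positivity)
      (fun n => mul_le_mul_of_nonneg_left (exp_neg_times_le h n) hC.le) h1
  have hsum : Summable c := by
    refine summable_of_ratio_norm_eventually_le (r := 1 / 2) (by norm_num) ?_
    filter_upwards [hlim.eventually (gt_mem_nhds (by norm_num : (0 : ℝ) < 1 / 2))] with n hn
    rw [Real.norm_of_nonneg (hc0 _).le, Real.norm_of_nonneg (hc0 _).le, hcs]
    nlinarith [hc0 n]
  obtain ⟨D, hD⟩ := hsum.tendsto_atTop_zero.bddAbove_range
  refine ⟨D, (hc0 0).le.trans (hD ⟨0, rfl⟩), fun H hH hstep n => ?_⟩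
  have key : H n ≤ c n * Real.exp ((2 * q + 2) * times t₀ n) * H 0 := by
    induction n with
    | zero =>
      have h1 : 1 ≤ Real.exp ((2 * q + 2) * times t₀ 0) := by
        refine Real.one_le_exp (mul_nonneg (by linarith) ?_)
        have := times_ge h 0
        simp only [Nat.cast_zero] at this
        linarith
      have h2 : c 0 = 1 := by simp [hc]
      rw [h2, one_mul]
      nlinarith [hH 0]
    | succ n ih =>
      refine (hstep n).trans ?_
      have h1 : 0 ≤ C * Real.exp (q * times t₀ n) := by positivity
      refine (mul_le_mul_of_nonneg_left ih h1).trans (le_of_eq ?_)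
      have e1 : (2 * q + 2) * times t₀ (n + 1) =
          q * times t₀ n + (2 * q + 2) * times t₀ n + times t₀ n := by rw [times_succ]; ring
      rw [e1, hcs, Real.exp_add, Real.exp_add, Real.exp_neg]
      field_simp
  refine key.trans ?_
  have h1 := hD ⟨n, rfl⟩
  exact mul_le_mul_of_nonneg_right (mul_le_mul_of_nonneg_right h1 (Real.exp_pos _).le) (hH 0)

variable {𝕜 : Type*} [RCLike 𝕜]
variable {E : Type u} [AddCommGroup E] [Module 𝕜 E] [TopologicalSpace E]
variable {F : Type u} [AddCommGroup F] [Module 𝕜 F] [TopologicalSpace F]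
variable {s : ScStructure 𝕜 E} {t : ScStructure 𝕜 F} {g : E → F} {A : E → E →ₗ[𝕜] F} {r : ℕ}
  {δ : ℝ} {σ : ℝ → E → E} {p : ℕ}

/-- The error after one step. -/
theorem TameNewton.error (h : TameNewton s t g A r δ) (j : ℕ) :
    ∃ C : ℝ, 0 ≤ C ∧ ∀ u y v w, s.nm r u < δ → s.nm r (u + w) < δ → A u v = y - g u →
      t.nm j (y - g (u + w)) ≤ C * ((1 + s.nm (j + r) u) * (s.nm r (v - w) + s.nm r w ^ 2) +
        s.nm (j + r) (v - w) + s.nm r w * s.nm (j + r) w) := by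
  obtain ⟨C₁, hC₁, h1⟩ := h.bound j
  obtain ⟨C₂, hC₂, h2⟩ := h.taylor j
  refine ⟨C₁ + C₂, by positivity, fun u y v w hu huw hv => ?_⟩
  -- The full Newton step `v` would leave only the Taylor remainder. Taking the smoothed step `w`
  -- adds the image of the part `v - w` removed by smoothing.
  have e : y - g (u + w) = A u (v - w) - (g (u + w) - g u - A u w) := by
    rw [map_sub, hv]; abel
  rw [e]
  refine (t.nm_sub _ _ _).trans ((add_le_add (h1 u hu _) (h2 u w hu huw)).trans ?_)
  have n1 := s.nm_nonneg r (v - w)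
  have n2 := s.nm_nonneg (j + r) (v - w)
  have n3 := s.nm_nonneg r w
  have n4 := s.nm_nonneg (j + r) w
  have n5 := s.nm_nonneg (j + r) u
  have i1 : 0 ≤ C₂ * ((1 + s.nm (j + r) u) * s.nm r (v - w) + s.nm (j + r) (v - w)) := by
    positivity
  have i2 : 0 ≤ C₁ * (s.nm r w * s.nm (j + r) w + (1 + s.nm (j + r) u) * s.nm r w ^ 2) := by
    positivity
  linarith

/-- The size of one step. -/
theorem TameNewton.step_high (h : TameNewton s t g A r δ)
    (hσ : ∀ k d : ℕ, ∃ C : ℝ, 0 ≤ C ∧ ∀ τ, 0 ≤ τ → ∀ x,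
        s.nm (k + d) (σ τ x) ≤ C * Real.exp (((p : ℝ) + d) * τ) * s.nm k x) (j : ℕ) :
    ∃ C : ℝ, 1 ≤ C ∧ ∀ u y v, s.nm r u < δ → t.nm r (y - g u) ≤ 1 → A u v = y - g u →
      s.nm j v ≤ C * (1 + s.nm (j + 2 * r) u + t.nm (j + r) y) ∧
      ∀ τ, 0 ≤ τ →
        s.nm (j + 2 * r) (σ τ v) ≤ C * Real.exp (((p : ℝ) + (2 * r : ℕ)) * τ) *
          (1 + s.nm (j + 2 * r) u + t.nm (j + r) y) ∧
        1 + s.nm (j + 2 * r) (u + σ τ v) + t.nm (j + r) y ≤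
          C * Real.exp (((p : ℝ) + (2 * r : ℕ)) * τ) *
            (1 + s.nm (j + 2 * r) u + t.nm (j + r) y) := by
  obtain ⟨C₁, hC₁, h1⟩ := h.inverse j
  obtain ⟨C₂, hC₂, h2⟩ := h.map_bound (j + r)
  obtain ⟨C₃, hC₃, h3⟩ := hσ j (2 * r)
  obtain ⟨M, hM⟩ : ∃ M, M = C₁ * (1 + C₂) := ⟨_, rfl⟩
  have hM0 : 0 ≤ M := by rw [hM]; positivity
  refine ⟨1 + M + C₃ * M, by nlinarith [mul_nonneg hC₃ hM0], fun u y v hu hy hv => ?_⟩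
  -- In one step `H` grows at most by a factor `C * exp (q τ)`: solving the linear equation loses `2
  -- * r` levels, and smoothing buys them back. This is the recursion for `growth`.
  obtain ⟨H, hH⟩ : ∃ H, H = 1 + s.nm (j + 2 * r) u + t.nm (j + r) y := ⟨_, rfl⟩
  have n1 := s.nm_nonneg (j + 2 * r) u
  have n2 := t.nm_nonneg (j + r) y
  have hH1 : 1 ≤ H := by linarith
  have e1 : s.nm j v ≤ M * H := by
    refine (h1 u hu v).trans ?_
    rw [hv, hM, mul_assoc]
    refine mul_le_mul_of_nonneg_left ?_ hC₁
    have i1 := t.nm_sub (j + r) y (g u)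
    have i2 := h2 u hu
    have i3 := s.nm_mono (by omega : j + r ≤ j + 2 * r) u
    have i4 := mul_le_mul_of_nonneg_left (s.nm_mono (by omega : j + r + r ≤ j + 2 * r) u) hC₂
    have i5 := mul_le_mul_of_nonneg_left hy (by linarith [s.nm_nonneg (j + r) u] :
      0 ≤ 1 + s.nm (j + r) u)
    have i6 := mul_nonneg hC₂ n2
    rw [hH]
    nlinarith
  rw [← hH]
  refine ⟨e1.trans ?_, fun τ hτ => ?_⟩
  · have := mul_nonneg (mul_nonneg hC₃ hM0) (by linarith : 0 ≤ H)
    linarith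
  have e0 : 1 ≤ Real.exp (((p : ℝ) + (2 * r : ℕ)) * τ) := Real.one_le_exp (by positivity)
  obtain ⟨X, hX⟩ : ∃ X, X = Real.exp (((p : ℝ) + (2 * r : ℕ)) * τ) := ⟨_, rfl⟩
  rw [← hX] at e0 ⊢
  have e2 : s.nm (j + 2 * r) (σ τ v) ≤ C₃ * X * (M * H) := by
    refine (h3 τ hτ v).trans ?_
    rw [← hX]
    exact mul_le_mul_of_nonneg_left e1 (by positivity)
  have k1 : 0 ≤ X * H := by positivity
  have k2 : H ≤ X * H := by nlinarith
  have k3 : 0 ≤ M * (X * H) := by positivity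
  constructor
  · linarith
  · have e3 := s.nm_add (j + 2 * r) u (σ τ v)
    linarith

end Iteration

end ScStructure

/-! ### The iteration in low norms. -/

namespace ScStructure

section Solve

variable {𝕜 : Type*} [RCLike 𝕜]
variable {E : Type u} [AddCommGroup E] [Module 𝕜 E] [TopologicalSpace E]
variable {F : Type u} [AddCommGroup F] [Module 𝕜 F] [TopologicalSpace F]
variable {s : ScStructure 𝕜 E} {t : ScStructure 𝕜 F} {g : E → F} {A : E → E →ₗ[𝕜] F} {r : ℕ}
  {δ : ℝ} {σ : ℝ → E → E} {p : ℕ}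

/-- One step in low norms. -/
theorem TameNewton.step_low (h : TameNewton s t g A r δ)
    (hσ₁ : ∀ k d : ℕ, ∃ C : ℝ, 0 ≤ C ∧ ∀ τ, 0 ≤ τ → ∀ x,
        s.nm (k + d) (σ τ x) ≤ C * Real.exp (((p : ℝ) + d) * τ) * s.nm k x)
    (hσ₂ : ∀ l d : ℕ, ∃ C : ℝ, 0 ≤ C ∧ ∀ τ, 0 ≤ τ → ∀ x,
        s.nm l (x - σ τ x) ≤ C * Real.exp (-(d : ℝ) * τ) * s.nm (l + p + d) x) (d : ℕ) :
    ∃ C : ℝ, 1 ≤ C ∧ ∀ u y v τ, 0 ≤ τ → s.nm (3 * r) u < δ → A u v = y - g u →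
      s.nm (3 * r) (σ τ v) ≤
        C * Real.exp (((p : ℝ) + (2 * r : ℕ)) * τ) * t.nm (2 * r) (y - g u) ∧
      (s.nm r (u + σ τ v) < δ → t.nm (2 * r) (y - g (u + σ τ v)) ≤
        C * (Real.exp (-(d : ℝ) * τ) * s.nm (3 * r + p + d) v +
          (Real.exp (((p : ℝ) + (2 * r : ℕ)) * τ) * t.nm (2 * r) (y - g u)) ^ 2)) := by
  obtain ⟨C₁, hC₁, h1⟩ := h.inverse r
  obtain ⟨C₂, hC₂, h2⟩ := hσ₁ r (2 * r)
  obtain ⟨C₃, hC₃, h3⟩ := h.error (2 * r)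
  obtain ⟨C₄, hC₄, h4⟩ := hσ₂ (3 * r) d
  obtain ⟨M, hM⟩ : ∃ M, M = C₂ * (3 * C₁) := ⟨_, rfl⟩
  have hM0 : 0 ≤ M := by rw [hM]; positivity
  refine ⟨1 + M + 3 * C₃ * (C₄ + M ^ 2), ?_, fun u y v τ hτ hu hv => ?_⟩
  · have : 0 ≤ 3 * C₃ * (C₄ + M ^ 2) := by positivity
    linarith
  obtain ⟨X, hX⟩ : ∃ X, X = Real.exp (((p : ℝ) + (2 * r : ℕ)) * τ) := ⟨_, rfl⟩
  have hX0 : 0 ≤ X := by rw [hX]; positivity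
  obtain ⟨ε, hε⟩ : ∃ ε, ε = t.nm (2 * r) (y - g u) := ⟨_, rfl⟩
  have hε0 : 0 ≤ ε := by rw [hε]; exact t.nm_nonneg _ _
  rw [← hX, ← hε]
  have hu1 : s.nm r u < δ := (s.nm_mono (by omega) u).trans_lt hu
  have hu2 : s.nm (r + r) u ≤ 1 := (s.nm_mono (by omega) u).trans (hu.le.trans h.le_one)
  have e1 : s.nm r v ≤ 3 * C₁ * ε := by
    have i0 := h1 u hu1 v
    rw [hv] at i0
    have i1 := t.nm_mono (by omega : r ≤ 2 * r) (y - g u)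
    have i2 := t.nm_mono (by omega : r + r ≤ 2 * r) (y - g u)
    have i3 := mul_le_mul (by linarith : 1 + s.nm (r + r) u ≤ 2) i1 (t.nm_nonneg _ _)
      (by norm_num)
    have i4 := mul_le_mul_of_nonneg_left (by linarith : (1 + s.nm (r + r) u) *
      t.nm r (y - g u) + t.nm (r + r) (y - g u) ≤ 3 * ε) hC₁
    linarith
  have e2 : s.nm (3 * r) (σ τ v) ≤ M * (X * ε) := by
    refine (s.nm_mono (by omega : 3 * r ≤ r + 2 * r) _).trans ((h2 τ hτ v).trans ?_)
    rw [← hX]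
    have := mul_le_mul_of_nonneg_left e1 (mul_nonneg hC₂ hX0)
    rw [hM]
    linarith
  have hXε : 0 ≤ X * ε := by positivity
  refine ⟨?_, fun huw => ?_⟩
  · have : 0 ≤ (1 + 3 * C₃ * (C₄ + M ^ 2)) * (X * ε) := by positivity
    linarith
  -- `W` measures the smoothed step and is at most `M * (X * ε)`, where `X` is the price of `2 * r`
  -- levels. `z` measures what smoothing removed and is at most `C₄ * Z`, exponentially small in
  -- terms of a higher norm of `v`. The new error is linear in `z` and quadratic in `W`.
  · obtain ⟨W, hW⟩ : ∃ W, W = s.nm (3 * r) (σ τ v) := ⟨_, rfl⟩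
    obtain ⟨z, hz⟩ : ∃ z, z = s.nm (3 * r) (v - σ τ v) := ⟨_, rfl⟩
    obtain ⟨Z, hZ⟩ : ∃ Z, Z = Real.exp (-(d : ℝ) * τ) * s.nm (3 * r + p + d) v := ⟨_, rfl⟩
    have hZ0 : 0 ≤ Z := by rw [hZ]; exact mul_nonneg (Real.exp_pos _).le (s.nm_nonneg _ _)
    have hz1 : z ≤ C₄ * Z := by rw [hz, hZ, ← mul_assoc]; exact h4 τ hτ v
    have hW0 : 0 ≤ W := by rw [hW]; exact s.nm_nonneg _ _
    have hz0 : 0 ≤ z := by rw [hz]; exact s.nm_nonneg _ _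
    rw [← hW] at e2
    rw [← hZ]
    have i1 : s.nm (2 * r + r) u ≤ 1 := (s.nm_mono (by omega) u).trans (hu.le.trans h.le_one)
    have i2 : s.nm r (v - σ τ v) ≤ z := by rw [hz]; exact s.nm_mono (by omega) _
    have i3 : s.nm (2 * r + r) (v - σ τ v) ≤ z := by rw [hz]; exact s.nm_mono (by omega) _
    have i4 : s.nm r (σ τ v) ≤ W := by rw [hW]; exact s.nm_mono (by omega) _
    have i5 : s.nm (2 * r + r) (σ τ v) ≤ W := by rw [hW]; exact s.nm_mono (by omega) _
    have i6 : s.nm r (σ τ v) ^ 2 ≤ W ^ 2 := pow_le_pow_left₀ (s.nm_nonneg _ _) i4 2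
    have i7 : s.nm r (σ τ v) * s.nm (2 * r + r) (σ τ v) ≤ W * W :=
      mul_le_mul i4 i5 (s.nm_nonneg _ _) hW0
    have i8 : (1 + s.nm (2 * r + r) u) * (s.nm r (v - σ τ v) + s.nm r (σ τ v) ^ 2) ≤
        2 * (z + W ^ 2) :=
      mul_le_mul (by linarith) (by linarith)
        (add_nonneg (s.nm_nonneg _ _) (sq_nonneg _)) (by norm_num)
    have i9 : W ^ 2 ≤ (M * (X * ε)) ^ 2 := pow_le_pow_left₀ hW0 e2 2
    have i10 := (h3 u y v (σ τ v) hu1 huw hv).trans (mul_le_mul_of_nonneg_left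
      (by nlinarith : _ ≤ 3 * (C₄ * Z + (M * (X * ε)) ^ 2)) hC₃)
    refine i10.trans ?_
    have j1 : 0 ≤ (1 + M) * (Z + (X * ε) ^ 2) := by positivity
    have j2 : 0 ≤ C₃ * (M ^ 2 * Z) := by positivity
    have j3 : 0 ≤ C₃ * (C₄ * (X * ε) ^ 2) := by positivity
    have j4 : (M * (X * ε)) ^ 2 = M ^ 2 * (X * ε) ^ 2 := by ring
    rw [j4]
    linarith

/-- The iteration in low norms: it stays in the ball, and the error decreases. -/
theorem TameNewton.iteration_low (h : TameNewton s t g A r δ)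
    (hσ₁ : ∀ k d : ℕ, ∃ C : ℝ, 0 ≤ C ∧ ∀ τ, 0 ≤ τ → ∀ x,
        s.nm (k + d) (σ τ x) ≤ C * Real.exp (((p : ℝ) + d) * τ) * s.nm k x)
    (hσ₂ : ∀ l d : ℕ, ∃ C : ℝ, 0 ≤ C ∧ ∀ τ, 0 ≤ τ → ∀ x,
        s.nm l (x - σ τ x) ≤ C * Real.exp (-(d : ℝ) * τ) * s.nm (l + p + d) x) {q : ℝ}
    (hq : q = (p : ℝ) + (2 * r : ℕ)) {d : ℕ} (hd : 14 * q + 11 ≤ d) :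
    ∃ t₀ : ℝ, 2 ≤ t₀ ∧ ∃ η : ℝ, 0 < η ∧ ∀ (y : F) (u v : ℕ → E),
      t.nm (3 * r + p + d + r) y < η → u 0 = 0 →
      (∀ n, s.nm r (u n) < δ → A (u n) (v n) = y - g (u n)) →
      (∀ n, u (n + 1) = u n + σ (times t₀ n) (v n)) → ∀ n,
        s.nm (3 * r) (u n) ≤ δ / 2 ∧
        t.nm (2 * r) (y - g (u n)) ≤ Real.exp (-(6 * q + 4) * times t₀ n) ∧
        1 + s.nm (3 * r + p + d + 2 * r) (u n) + t.nm (3 * r + p + d + r) y ≤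
          2 * Real.exp ((2 * q + 2) * times t₀ n) := by
  have hq0 : 0 ≤ q := by rw [hq]; positivity
  obtain ⟨C₁, hC₁, h1⟩ := h.step_low hσ₁ hσ₂ d
  obtain ⟨C₂, hC₂, h2⟩ := h.step_high hσ₁ (3 * r + p + d)
  obtain ⟨N, hN⟩ : ∃ N, N = 3 * r + p + d := ⟨_, rfl⟩
  rw [← hN] at h1 h2 ⊢
  rw [← hq] at h1 h2
  have hδ := h.pos
  -- `B` dominates every constant that one step produces. Choosing `t₀ = B` makes `B ≤ exp (times t₀
  -- n)`, so each constant costs one unit in the exponent. The summand `2 / δ` keeps the steps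
  -- inside the ball.
  obtain ⟨B, hB⟩ : ∃ B, B = 4 * C₁ * C₂ + 2 * C₁ + C₂ + 2 / δ + 2 := ⟨_, rfl⟩
  have hCC : 0 ≤ C₁ * C₂ := by positivity
  have hδ2 : 0 ≤ 2 / δ := by positivity
  obtain ⟨t₀, ht₀⟩ : ∃ t₀, t₀ = B := ⟨_, rfl⟩
  have ht2 : 2 ≤ t₀ := by linarith
  have hBt : B ≤ Real.exp t₀ := by have := Real.add_one_le_exp t₀; linarith
  have htn : ∀ n, t₀ ≤ times t₀ n := fun n => by
    have := times_ge ht2 n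
    linarith [(Nat.cast_nonneg n : (0 : ℝ) ≤ n)]
  have hBn : ∀ n, B ≤ Real.exp (times t₀ n) := fun n =>
    hBt.trans (Real.exp_le_exp.2 (htn n))
  refine ⟨t₀, ht2, min 1 (Real.exp (-(6 * q + 4) * times t₀ 0)), lt_min one_pos (Real.exp_pos _),
    fun y u v hy hu0 hv hu => ?_⟩
  have hy1 : t.nm (N + r) y ≤ 1 := (hy.trans_le (min_le_left _ _)).le
  -- the stronger statement for the induction
  suffices hP : ∀ n, s.nm (3 * r) (u n) ≤ δ / 2 * (1 - (1 / 2) ^ n) ∧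
        t.nm (2 * r) (y - g (u n)) ≤ Real.exp (-(6 * q + 4) * times t₀ n) ∧
        1 + s.nm (N + 2 * r) (u n) + t.nm (N + r) y ≤
          2 * Real.exp ((2 * q + 2) * times t₀ n) by
    intro n
    refine ⟨(hP n).1.trans ?_, (hP n).2⟩
    have : 0 ≤ (1 / 2 : ℝ) ^ n := by positivity
    nlinarith
  intro n
  induction n with
  | zero =>
    have h0 : 0 ≤ times t₀ 0 := by linarith [htn 0]
    refine ⟨by rw [hu0, s.nm_zero]; simp, ?_, ?_⟩
    · rw [hu0, h.zero, sub_zero]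
      exact (t.nm_mono (by omega) y).trans (hy.le.trans (min_le_right _ _))
    · rw [hu0, s.nm_zero]
      have : 1 ≤ Real.exp ((2 * q + 2) * times t₀ 0) :=
        Real.one_le_exp (mul_nonneg (by linarith) h0)
      linarith
  | succ n ih =>
    obtain ⟨i1, i2, i3⟩ := ih
    have hτ : 0 ≤ times t₀ n := by linarith [htn n]
    have hBn := hBn n
    have hpow := exp_neg_times_le ht2 n
    rw [times_succ, hu n]
    generalize times t₀ n = τ at *
    have hb3 : s.nm (3 * r) (u n) < δ := by
      have : 0 ≤ (1 / 2 : ℝ) ^ n := by positivity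
      nlinarith
    have hb1 : s.nm r (u n) < δ := (s.nm_mono (by omega) _).trans_lt hb3
    have hvn := hv n hb1
    have hε1 : t.nm r (y - g (u n)) ≤ 1 := by
      refine (t.nm_mono (by omega : r ≤ 2 * r) _).trans (i2.trans ?_)
      exact Real.exp_le_one_iff.2 (by nlinarith)
    obtain ⟨j1, j2⟩ := h1 (u n) y (v n) τ hτ hb3 hvn
    obtain ⟨j3, j4⟩ := h2 (u n) y (v n) hb1 hε1 hvn
    obtain ⟨-, j5⟩ := j4 τ hτ
    have hqε : Real.exp (q * τ) * t.nm (2 * r) (y - g (u n)) ≤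
        Real.exp ((-(5 * q + 4)) * τ) := by
      refine (mul_le_mul_of_nonneg_left i2 (Real.exp_pos _).le).trans (le_of_eq ?_)
      rw [exp_coeff_mul]; congr 1; ring
    have hw : s.nm (3 * r) (σ τ (v n)) ≤ δ / 2 * (1 / 2) ^ n * (1 / 2) := by
      have k1 : s.nm (3 * r) (σ τ (v n)) ≤ 1 / 2 * Real.exp (-1 * τ) := by
        rw [mul_assoc] at j1
        have k2 := mul_le_mul_of_nonneg_left hqε (by linarith : 0 ≤ C₁)
        have k3 := mul_exp_coeff_le (a := -(5 * q + 4)) (b := -1) (B := 2 * C₁) (t := τ)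
          (by linarith) (by linarith) hτ
        linarith
      have k4 : Real.exp (-t₀) ≤ δ / 2 := by
        rw [Real.exp_neg, inv_eq_one_div, div_le_div_iff₀ (Real.exp_pos _) (by norm_num)]
        have k5 : 2 / δ ≤ Real.exp t₀ := by linarith
        rw [div_le_iff₀ hδ] at k5
        linarith
      rw [show -1 * τ = -τ by ring] at k1
      have k6 := mul_le_mul_of_nonneg_right k4 (by positivity : 0 ≤ (1 / 2 : ℝ) ^ n)
      linarith
    have hnew : s.nm (3 * r) (u n + σ τ (v n)) ≤ δ / 2 * (1 - (1 / 2) ^ (n + 1)) := by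
      refine (s.nm_add _ _ _).trans ((add_le_add i1 hw).trans (le_of_eq ?_))
      rw [pow_succ]; ring
    have hnewr : s.nm r (u n + σ τ (v n)) < δ := by
      refine (s.nm_mono (by omega : r ≤ 3 * r) _).trans_lt (hnew.trans_lt ?_)
      have : 0 ≤ (1 / 2 : ℝ) ^ (n + 1) := by positivity
      nlinarith
    refine ⟨hnew, (j2 hnewr).trans ?_, j5.trans ?_⟩
    -- The required new error has exponent `-(9 * q + 6)`. The squared step has `2 * (q - (6 * q +
    -- 4)) = -(10 * q + 8)`. The smoothing error has `-d + (2 * q + 2)`, at most `-(12 * q + 9)`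
    -- because `d ≥ 14 * q + 11`. Both leave at least one unit to absorb the constants.
    · rw [show -(6 * q + 4) * (3 / 2 * τ) = -(9 * q + 6) * τ by ring]
      have k1 : (Real.exp (q * τ) * t.nm (2 * r) (y - g (u n))) ^ 2 ≤
          Real.exp (-(10 * q + 8) * τ) := by
        refine (pow_le_pow_left₀ (mul_nonneg (Real.exp_pos _).le (t.nm_nonneg _ _)) hqε 2).trans
          (le_of_eq ?_)
        rw [pow_two, exp_coeff_mul]; congr 1; ring
      have k2 : Real.exp (-(d : ℝ) * τ) * s.nm N (v n) ≤
          2 * C₂ * Real.exp (-(12 * q + 9) * τ) := by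
        have l1 : s.nm N (v n) ≤ C₂ * (2 * Real.exp ((2 * q + 2) * τ)) :=
          j3.trans (mul_le_mul_of_nonneg_left i3 (by linarith))
        have l2 := mul_le_mul_of_nonneg_left l1 (Real.exp_pos (-(d : ℝ) * τ)).le
        have l3 := exp_coeff_mul (-(d : ℝ)) (2 * q + 2) τ
        have l4 : Real.exp ((-(d : ℝ) + (2 * q + 2)) * τ) ≤ Real.exp (-(12 * q + 9) * τ) :=
          exp_coeff_mono (by linarith) hτ
        rw [← l3] at l4
        have l5 := mul_le_mul_of_nonneg_left l4 (by linarith : 0 ≤ 2 * C₂)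
        linarith
      have k3 := mul_exp_coeff_le (a := -(12 * q + 9)) (b := -(9 * q + 6)) (B := 4 * C₁ * C₂)
        (t := τ) (by linarith) (by linarith) hτ
      have k4 := mul_exp_coeff_le (a := -(10 * q + 8)) (b := -(9 * q + 6)) (B := 2 * C₁)
        (t := τ) (by linarith) (by linarith) hτ
      have k5 := mul_le_mul_of_nonneg_left (add_le_add k2 k1) (by linarith : 0 ≤ C₁)
      linarith
    -- For the high norm, one step multiplies by `C₂ * exp (q τ)`, and `q + (2 * q + 2) + 1 = 3 * q
    -- + 3` is exactly what the next parameter allows.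
    · rw [show (2 * q + 2) * (3 / 2 * τ) = (3 * q + 3) * τ by ring]
      have k1 := mul_le_mul_of_nonneg_left i3 (by positivity : 0 ≤ C₂ * Real.exp (q * τ))
      have k2 := mul_exp_coeff_le (a := q + (2 * q + 2)) (b := 3 * q + 3) (B := C₂)
        (t := τ) (by linarith) (by linarith) hτ
      rw [← exp_coeff_mul] at k2
      linarith

end Solve

end ScStructure

/-! ### Convergence in all norms and local surjectivity. -/

namespace ScStructure

section SolveHigh

variable {𝕜 : Type*} [RCLike 𝕜]
variable {E : Type u} [AddCommGroup E] [Module 𝕜 E] [TopologicalSpace E]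
variable {F : Type u} [AddCommGroup F] [Module 𝕜 F] [TopologicalSpace F]

/-- A run `u` of the iteration with steps `v`, with the bounds in low norms. -/
structure NewtonSeq (s : ScStructure 𝕜 E) (t : ScStructure 𝕜 F) (g : E → F) (A : E → E →ₗ[𝕜] F)
    (r N : ℕ) (δ q t₀ : ℝ) (σ : ℝ → E → E) (y : F) (u v : ℕ → E) : Prop where
  zero : u 0 = 0
  solve : ∀ n, A (u n) (v n) = y - g (u n)
  succ : ∀ n, u (n + 1) = u n + σ (times t₀ n) (v n)
  ball : ∀ n, s.nm (3 * r) (u n) < δ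
  error : ∀ n, t.nm (2 * r) (y - g (u n)) ≤ Real.exp (-(6 * q + 4) * times t₀ n)
  target : t.nm (N + r) y ≤ 1

variable {s : ScStructure 𝕜 E} {t : ScStructure 𝕜 F} {g : E → F} {A : E → E →ₗ[𝕜] F} {r N : ℕ}
  {δ q t₀ : ℝ} {σ : ℝ → E → E} {p d : ℕ}

theorem NewtonSeq.ball_r {y : F} {u v : ℕ → E} (h : NewtonSeq s t g A r N δ q t₀ σ y u v)
    (n : ℕ) : s.nm r (u n) < δ :=
  (s.nm_mono (by omega) _).trans_lt (h.ball n)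

theorem NewtonSeq.error_le_one {y : F} {u v : ℕ → E}
    (h : NewtonSeq s t g A r N δ q t₀ σ y u v) (hq : 0 ≤ q) (ht₀ : 2 ≤ t₀) (n : ℕ) :
    t.nm r (y - g (u n)) ≤ 1 := by
  refine (t.nm_mono (by omega : r ≤ 2 * r) _).trans ((h.error n).trans ?_)
  have := times_ge ht₀ n
  have h2 := (Nat.cast_nonneg n : (0 : ℝ) ≤ n)
  exact Real.exp_le_one_iff.2 (by nlinarith)

/-- Growth of the high norms along the iteration. -/
theorem TameNewton.seq_growth (h : TameNewton s t g A r δ)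
    (hσ₁ : ∀ k d : ℕ, ∃ C : ℝ, 0 ≤ C ∧ ∀ τ, 0 ≤ τ → ∀ x,
        s.nm (k + d) (σ τ x) ≤ C * Real.exp (((p : ℝ) + d) * τ) * s.nm k x)
    (hq : q = (p : ℝ) + (2 * r : ℕ)) (ht₀ : 2 ≤ t₀) (j : ℕ) :
    ∃ D : ℝ, 0 ≤ D ∧ ∀ y u v, NewtonSeq s t g A r N δ q t₀ σ y u v → ∀ n,
      1 + s.nm (j + 2 * r) (u n) ≤
        D * Real.exp ((2 * q + 2) * times t₀ n) * (1 + t.nm (j + r) y) ∧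
      s.nm j (v n) ≤ D * Real.exp ((2 * q + 2) * times t₀ n) * (1 + t.nm (j + r) y) ∧
      s.nm (j + 2 * r) (σ (times t₀ n) (v n)) ≤
        D * Real.exp ((3 * q + 2) * times t₀ n) * (1 + t.nm (j + r) y) := by
  have hq0 : 0 ≤ q := by rw [hq]; positivity
  obtain ⟨C, hC, hst⟩ := h.step_high hσ₁ j
  rw [← hq] at hst
  obtain ⟨D, hD, hgr⟩ := growth ht₀ (by linarith : 0 < C) hq0
  refine ⟨D + C * D, by positivity, fun y u v hs n => ?_⟩
  have hT : ∀ n, 0 ≤ times t₀ n := fun n => by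
    have := times_ge ht₀ n
    linarith [(Nat.cast_nonneg n : (0 : ℝ) ≤ n)]
  have hy := t.nm_nonneg (j + r) y
  have hg := hgr (fun n => 1 + s.nm (j + 2 * r) (u n) + t.nm (j + r) y)
    (fun n => by linarith [s.nm_nonneg (j + 2 * r) (u n)]) (fun n => by
      rw [hs.succ n]
      exact ((hst (u n) y (v n) (hs.ball_r n) (hs.error_le_one hq0 ht₀ n)
        (hs.solve n)).2 _ (hT n)).2) n
  simp only [hs.zero, s.nm_zero, add_zero] at hg
  obtain ⟨e1, e2⟩ := hst (u n) y (v n) (hs.ball_r n) (hs.error_le_one hq0 ht₀ n) (hs.solve n)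
  obtain ⟨e2, -⟩ := e2 _ (hT n)
  have n1 : 0 ≤ C * D * Real.exp ((2 * q + 2) * times t₀ n) * (1 + t.nm (j + r) y) := by
    positivity
  have n2 : 0 ≤ D * Real.exp ((2 * q + 2) * times t₀ n) * (1 + t.nm (j + r) y) := by
    positivity
  refine ⟨by linarith, ?_, ?_⟩
  · have := mul_le_mul_of_nonneg_left hg (by linarith : 0 ≤ C)
    linarith
  · have e3 := mul_le_mul_of_nonneg_left hg
      (by positivity : 0 ≤ C * Real.exp (q * times t₀ n))
    have e4 : Real.exp ((3 * q + 2) * times t₀ n) =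
        Real.exp (q * times t₀ n) * Real.exp ((2 * q + 2) * times t₀ n) := by
      rw [exp_coeff_mul]; congr 1; ring
    rw [e4]
    have n3 : 0 ≤ D * (Real.exp (q * times t₀ n) * Real.exp ((2 * q + 2) * times t₀ n)) *
        (1 + t.nm (j + r) y) := by positivity
    linarith

/-- Decay of the high norms of the error. -/
theorem TameNewton.seq_error (h : TameNewton s t g A r δ)
    (hσ₁ : ∀ k d : ℕ, ∃ C : ℝ, 0 ≤ C ∧ ∀ τ, 0 ≤ τ → ∀ x,
        s.nm (k + d) (σ τ x) ≤ C * Real.exp (((p : ℝ) + d) * τ) * s.nm k x)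
    (hσ₂ : ∀ l d : ℕ, ∃ C : ℝ, 0 ≤ C ∧ ∀ τ, 0 ≤ τ → ∀ x,
        s.nm l (x - σ τ x) ≤ C * Real.exp (-(d : ℝ) * τ) * s.nm (l + p + d) x)
    (hq : q = (p : ℝ) + (2 * r : ℕ)) (hd : 14 * q + 11 ≤ d) (ht₀ : 2 ≤ t₀) (j : ℕ) :
    ∃ D : ℝ, 0 ≤ D ∧ ∀ y u v, NewtonSeq s t g A r (3 * r + p + d) δ q t₀ σ y u v → ∀ n,
      t.nm j (y - g (u (n + 1))) ≤
        D * Real.exp (-(2 * q + 2) * times t₀ n) * (1 + t.nm (j + r + p + d + r) y) := by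
  have hq0 : 0 ≤ q := by rw [hq]; positivity
  obtain ⟨C₁, hC₁, h1⟩ := h.error j
  obtain ⟨D₂, hD₂, h2⟩ := h.seq_growth (N := 3 * r + p + d) hσ₁ hq ht₀ j
  obtain ⟨D₃, hD₃, h3⟩ := h.seq_growth (N := 3 * r + p + d) hσ₁ hq ht₀ (3 * r + p + d)
  obtain ⟨D₄, hD₄, h4⟩ := h.seq_growth (N := 3 * r + p + d) hσ₁ hq ht₀ (j + r + p + d)
  obtain ⟨C₅, hC₅, h5⟩ := hσ₂ r d
  obtain ⟨C₆, hC₆, h6⟩ := hσ₂ (j + r) d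
  obtain ⟨C₇, hC₇, h7⟩ := h.step_low hσ₁ hσ₂ d
  rw [← hq] at h7
  refine ⟨C₁ * (D₂ * (2 * C₅ * D₃ + C₇ ^ 2) + C₆ * D₄ + C₇ * D₂), by positivity,
    fun y u v hs n => ?_⟩
  have hτ : 0 ≤ times t₀ n := by
    have := times_ge ht₀ n
    linarith [(Nat.cast_nonneg n : (0 : ℝ) ≤ n)]
  obtain ⟨a1, -, a3⟩ := h2 y u v hs n
  obtain ⟨-, b2, -⟩ := h3 y u v hs n
  obtain ⟨-, c2, -⟩ := h4 y u v hs n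
  obtain ⟨d1, -⟩ := h7 (u n) y (v n) _ hτ (hs.ball n) (hs.solve n)
  have herr := hs.error n
  have hball := hs.ball_r (n + 1)
  have hY := hs.target
  have hsucc := hs.succ n
  rw [hsucc] at hball ⊢
  have e1 := h1 (u n) y (v n) _ (hs.ball_r n) hball (hs.solve n)
  have e5 := h5 _ hτ (v n)
  have e6 := h6 _ hτ (v n)
  generalize times t₀ n = τ at *
  obtain ⟨Y, hYd⟩ : ∃ Y, Y = 1 + t.nm (j + r + p + d + r) y := ⟨_, rfl⟩
  have hYj : 1 + t.nm (j + r) y ≤ Y := by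
    have := t.nm_mono (by omega : j + r ≤ j + r + p + d + r) y
    linarith
  have hyj := t.nm_nonneg (j + r) y
  have hY0 : 0 ≤ Y := by linarith
  rw [← hYd] at c2 ⊢
  have X0 := (Real.exp_pos ((2 * q + 2) * τ)).le
  have f1 : 1 + s.nm (j + r) (u n) ≤ D₂ * Real.exp ((2 * q + 2) * τ) * Y := by
    have k1 := s.nm_mono (by omega : j + r ≤ j + 2 * r) (u n)
    have k2 := mul_le_mul_of_nonneg_left hYj (mul_nonneg hD₂ X0)
    linarith
  have hdec : ∀ a : ℝ, a ≤ 12 * q + 9 → Real.exp (-(d : ℝ) * τ) * Real.exp ((2 * q + 2) * τ) ≤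
      Real.exp (-a * τ) := by
    intro a ha
    rw [exp_coeff_mul]
    exact exp_coeff_mono (by linarith) hτ
  have f2 : s.nm r (v n - σ τ (v n)) ≤ 2 * C₅ * D₃ * Real.exp (-(12 * q + 9) * τ) := by
    have k1 : s.nm (r + p + d) (v n) ≤ D₃ * Real.exp ((2 * q + 2) * τ) * 2 := by
      refine (s.nm_mono (by omega : r + p + d ≤ 3 * r + p + d) _).trans (b2.trans ?_)
      exact mul_le_mul_of_nonneg_left (by linarith) (mul_nonneg hD₃ X0)
    have k2 := mul_le_mul_of_nonneg_left k1 (mul_nonneg hC₅ (Real.exp_pos (-(d : ℝ) * τ)).le)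
    have k3 := mul_le_mul_of_nonneg_left (hdec (12 * q + 9) le_rfl)
      (by positivity : 0 ≤ 2 * C₅ * D₃)
    linarith
  have f3 : s.nm (j + r) (v n - σ τ (v n)) ≤ C₆ * D₄ * Real.exp (-(2 * q + 2) * τ) * Y := by
    have k2 := mul_le_mul_of_nonneg_left c2 (mul_nonneg hC₆ (Real.exp_pos (-(d : ℝ) * τ)).le)
    have k3 := mul_le_mul_of_nonneg_left (hdec (2 * q + 2) (by linarith))
      (by positivity : 0 ≤ C₆ * D₄ * Y)
    linarith
  have f4 : s.nm r (σ τ (v n)) ≤ C₇ * Real.exp (-(5 * q + 4) * τ) := by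
    refine (s.nm_mono (by omega : r ≤ 3 * r) _).trans (d1.trans ?_)
    rw [mul_assoc]
    refine mul_le_mul_of_nonneg_left ((mul_le_mul_of_nonneg_left herr (Real.exp_pos _).le).trans
      (le_of_eq ?_)) (by linarith)
    rw [exp_coeff_mul]; congr 1; ring
  have f5 : s.nm (j + r) (σ τ (v n)) ≤ D₂ * Real.exp ((3 * q + 2) * τ) * Y := by
    have k1 := s.nm_mono (by omega : j + r ≤ j + 2 * r) (σ τ (v n))
    have k2 := mul_le_mul_of_nonneg_left hYj (mul_nonneg hD₂ (Real.exp_pos ((3 * q + 2) * τ)).le)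
    linarith
  have f6 : s.nm r (σ τ (v n)) ^ 2 ≤ C₇ ^ 2 * Real.exp (-(10 * q + 8) * τ) := by
    refine (pow_le_pow_left₀ (s.nm_nonneg _ _) f4 2).trans (le_of_eq ?_)
    rw [mul_pow, pow_two (Real.exp _), exp_coeff_mul]; congr 2; ring
  have f7 : s.nm r (v n - σ τ (v n)) + s.nm r (σ τ (v n)) ^ 2 ≤
      (2 * C₅ * D₃ + C₇ ^ 2) * Real.exp (-(10 * q + 8) * τ) := by
    have k1 : Real.exp (-(12 * q + 9) * τ) ≤ Real.exp (-(10 * q + 8) * τ) :=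
      exp_coeff_mono (by linarith) hτ
    have k2 := mul_le_mul_of_nonneg_left k1 (by positivity : 0 ≤ 2 * C₅ * D₃)
    linarith
  have g1 := mul_le_mul f1 f7 (add_nonneg (s.nm_nonneg _ _) (sq_nonneg _)) (by positivity)
  have g2 := mul_le_mul f4 f5 (s.nm_nonneg _ _) (by positivity)
  -- In each term only one factor is a high norm, and it grows at most like `exp ((3 * q + 2) τ)`.
  -- Its low-norm partner decays fast enough that the product is at most a multiple of `exp (-(2 * q
  -- + 2) τ)`. Having one high factor also keeps the estimate linear in the high norm of `y`.
  have g3 : Real.exp ((2 * q + 2) * τ) * Real.exp (-(10 * q + 8) * τ) ≤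
      Real.exp (-(2 * q + 2) * τ) := by
    rw [exp_coeff_mul]; exact exp_coeff_mono (by linarith) hτ
  have g4 : Real.exp (-(5 * q + 4) * τ) * Real.exp ((3 * q + 2) * τ) =
      Real.exp (-(2 * q + 2) * τ) := by
    rw [exp_coeff_mul]; congr 1; ring
  have g5 := mul_le_mul_of_nonneg_left g3
    (by positivity : 0 ≤ D₂ * Y * (2 * C₅ * D₃ + C₇ ^ 2))
  have g6 : C₇ * Real.exp (-(5 * q + 4) * τ) * (D₂ * Real.exp ((3 * q + 2) * τ) * Y) =
      C₇ * D₂ * Real.exp (-(2 * q + 2) * τ) * Y := by rw [← g4]; ring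
  refine e1.trans ?_
  rw [mul_assoc C₁, mul_assoc C₁]
  refine mul_le_mul_of_nonneg_left ?_ hC₁
  linarith

/-- Decay of the high norms of the steps. -/
theorem TameNewton.seq_step (h : TameNewton s t g A r δ)
    (hσ₁ : ∀ k d : ℕ, ∃ C : ℝ, 0 ≤ C ∧ ∀ τ, 0 ≤ τ → ∀ x,
        s.nm (k + d) (σ τ x) ≤ C * Real.exp (((p : ℝ) + d) * τ) * s.nm k x)
    (hσ₂ : ∀ l d : ℕ, ∃ C : ℝ, 0 ≤ C ∧ ∀ τ, 0 ≤ τ → ∀ x,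
        s.nm l (x - σ τ x) ≤ C * Real.exp (-(d : ℝ) * τ) * s.nm (l + p + d) x)
    (hq : q = (p : ℝ) + (2 * r : ℕ)) (hd : 14 * q + 11 ≤ d) (ht₀ : 2 ≤ t₀) (j : ℕ) :
    ∃ D : ℝ, 0 ≤ D ∧ ∀ y u v, NewtonSeq s t g A r (3 * r + p + d) δ q t₀ σ y u v → ∀ n,
      s.nm j (u (n + 1 + 1) - u (n + 1)) ≤
        D * (1 + t.nm (j + r + r + p + d + r) y) * (1 / 2) ^ n := by
  have hq0 : 0 ≤ q := by rw [hq]; positivity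
  have hpq : (p : ℝ) ≤ q := by rw [hq]; linarith [(Nat.cast_nonneg (2 * r) : (0 : ℝ) ≤ _)]
  obtain ⟨C₁, hC₁, h1⟩ := h.inverse j
  obtain ⟨D₂, hD₂, h2⟩ := h.seq_growth (N := 3 * r + p + d) hσ₁ hq ht₀ j
  obtain ⟨D₃, hD₃, h3⟩ := h.seq_error hσ₁ hσ₂ hq hd ht₀ (j + r)
  obtain ⟨C₄, hC₄, h4⟩ := hσ₁ j 0
  refine ⟨C₄ * (C₁ * (D₂ + D₃)), by positivity, fun y u v hs n => ?_⟩
  have hτ : 0 ≤ times t₀ n := by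
    have := times_ge ht₀ n
    linarith [(Nat.cast_nonneg n : (0 : ℝ) ≤ n)]
  have hpow : Real.exp (-1 * times t₀ n) ≤ (1 / 2) ^ n := by
    rw [neg_one_mul]
    refine (exp_neg_times_le ht₀ n).trans (mul_le_of_le_one_left (by positivity) ?_)
    exact Real.exp_le_one_iff.2 (by linarith)
  have a1 := (h2 y u v hs (n + 1)).1
  have a3 := h3 y u v hs n
  have a4 := hs.error (n + 1)
  have a5 := h1 (u (n + 1)) (hs.ball_r (n + 1)) (v (n + 1))
  rw [hs.solve] at a5
  have a6 := h4 (times t₀ (n + 1)) (by rw [times_succ]; positivity) (v (n + 1))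
  rw [hs.succ (n + 1), add_sub_cancel_left]
  rw [times_succ] at *
  generalize times t₀ n = τ at *
  obtain ⟨Y, hY⟩ : ∃ Y, Y = 1 + t.nm (j + r + r + p + d + r) y := ⟨_, rfl⟩
  have hYj : 1 + t.nm (j + r) y ≤ Y := by
    have := t.nm_mono (by omega : j + r ≤ j + r + r + p + d + r) y
    linarith
  have hY0 : 0 ≤ Y := by linarith [t.nm_nonneg (j + r) y]
  rw [← hY] at a3 ⊢
  have f1 : (1 + s.nm (j + r) (u (n + 1))) * t.nm r (y - g (u (n + 1))) ≤
      D₂ * Y * Real.exp (-(6 * q + 3) * τ) := by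
    have k1 := s.nm_mono (by omega : j + r ≤ j + 2 * r) (u (n + 1))
    have k2 : 1 + s.nm (j + r) (u (n + 1)) ≤ D₂ * Real.exp ((3 * q + 3) * τ) * Y := by
      have k3 := mul_le_mul_of_nonneg_left hYj
        (by positivity : 0 ≤ D₂ * Real.exp ((2 * q + 2) * (3 / 2 * τ)))
      rw [show (3 * q + 3) * τ = (2 * q + 2) * (3 / 2 * τ) by ring]
      linarith
    have k4 : t.nm r (y - g (u (n + 1))) ≤ Real.exp (-(9 * q + 6) * τ) := by
      refine (t.nm_mono (by omega : r ≤ 2 * r) _).trans (a4.trans (le_of_eq ?_))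
      congr 1; ring
    refine (mul_le_mul k2 k4 (t.nm_nonneg _ _) (by positivity)).trans (le_of_eq ?_)
    have k5 : Real.exp (-(6 * q + 3) * τ) =
        Real.exp ((3 * q + 3) * τ) * Real.exp (-(9 * q + 6) * τ) := by
      rw [exp_coeff_mul]; congr 1; ring
    rw [k5]
    ring
  have f2 : s.nm j (v (n + 1)) ≤ C₁ * (D₂ + D₃) * Y * Real.exp (-(2 * q + 2) * τ) := by
    have k1 : Real.exp (-(6 * q + 3) * τ) ≤ Real.exp (-(2 * q + 2) * τ) :=
      exp_coeff_mono (by linarith) hτ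
    have k2 := mul_le_mul_of_nonneg_left k1 (by positivity : 0 ≤ D₂ * Y)
    have k3 := a5.trans (mul_le_mul_of_nonneg_left (add_le_add f1 a3) hC₁)
    have k4 := mul_le_mul_of_nonneg_left k2 hC₁
    linarith
  -- Applying the smoothing operator without gain of levels costs the exponent `p`, at the next
  -- parameter `3 / 2 * τ`. This is less than the decay `2 * q + 2`, and what remains is at most
  -- `exp (-τ)`, hence at most `(1 / 2) ^ n`.
  have f3 : Real.exp (((p : ℝ) + (0 : ℕ)) * (3 / 2 * τ)) ≤ Real.exp ((3 / 2 * q) * τ) := by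
    refine Real.exp_le_exp.2 ?_
    have := mul_le_mul_of_nonneg_right hpq hτ
    push_cast
    linarith
  have f4 : Real.exp ((3 / 2 * q) * τ) * Real.exp (-(2 * q + 2) * τ) ≤ (1 / 2) ^ n := by
    rw [exp_coeff_mul]
    exact (exp_coeff_mono (by linarith) hτ).trans hpow
  have f5 := mul_le_mul (mul_le_mul_of_nonneg_left f3 hC₄) f2 (s.nm_nonneg _ _) (by positivity)
  have f6 := mul_le_mul_of_nonneg_left f4
    (by positivity : 0 ≤ C₄ * (C₁ * (D₂ + D₃)) * Y)
  refine (a6.trans f5).trans (le_trans (le_of_eq ?_) f6)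
  ring

/-- The Nash–Moser theorem: local surjectivity with tame estimates. -/
theorem TameNewton.exists_solution (h : TameNewton s t g A r δ) (hsm : s.HasSmoothing) :
    ∃ m, ∃ η : ℝ, 0 < η ∧ ∃ C : ℕ → ℝ, (∀ j, 0 ≤ C j) ∧ ∀ y, t.nm m y < η →
      ∃ u, s.nm (3 * r) u < δ ∧ g u = y ∧ ∀ j, s.nm j u ≤ C j * (1 + t.nm (j + m) y) := by
  obtain ⟨σ, p, hσ₁, hσ₂⟩ := hsm.exists_op
  obtain ⟨q, hq⟩ : ∃ q : ℝ, q = (p : ℝ) + (2 * r : ℕ) := ⟨_, rfl⟩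
  have hq0 : 0 ≤ q := by rw [hq]; positivity
  obtain ⟨d, hd⟩ := exists_nat_ge (14 * q + 11)
  obtain ⟨t₀, ht₀, η, hη, hlow⟩ := h.iteration_low hσ₁ hσ₂ hq hd
  choose D₁ hD₁ h1 using fun j => h.seq_growth (N := 3 * r + p + d) hσ₁ hq ht₀ j
  choose D₂ hD₂ h2 using fun j => h.seq_step hσ₁ hσ₂ hq hd ht₀ j
  obtain ⟨m, hm⟩ : ∃ m, m = 3 * r + p + d + r := ⟨_, rfl⟩
  refine ⟨m, min η 1, lt_min hη one_pos,
    fun j => D₁ j * Real.exp ((3 * q + 2) * times t₀ 0) + 2 * D₂ j, fun j => ?_, fun y hy => ?_⟩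
  · have := hD₁ j; have := hD₂ j; positivity
  -- A right inverse of `A u` is chosen for every `u`, with a dummy value outside the ball, so that
  -- the recursion can be written before it is known that it stays in the ball.
  have hV : ∀ u : E, ∃ V : F → E, s.nm r u < δ → ∀ y, A u (V y) = y := by
    intro u
    by_cases hu : s.nm r u < δ
    · choose V hV using (h.bijective u hu).2
      exact ⟨V, fun _ => hV⟩
    · exact ⟨fun _ => 0, fun h => absurd h hu⟩
  choose V hV using hV
  obtain ⟨u, hu0, hus⟩ : ∃ u : ℕ → E, u 0 = 0 ∧
      ∀ n, u (n + 1) = u n + σ (times t₀ n) (V (u n) (y - g (u n))) :=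
    ⟨fun n => Nat.rec 0 (fun n u => u + σ (times t₀ n) (V u (y - g u))) n, rfl, fun n => rfl⟩
  have hlo := hlow y u (fun n => V (u n) (y - g (u n)))
    (by rw [← hm]; exact hy.trans_le (min_le_left _ _)) hu0 (fun n hn => hV _ hn _) hus
  have hball : ∀ n, s.nm (3 * r) (u n) < δ := fun n => (hlo n).1.trans_lt (by linarith [h.pos])
  have hs : NewtonSeq s t g A r (3 * r + p + d) δ q t₀ σ y u
      (fun n => V (u n) (y - g (u n))) :=
    ⟨hu0, fun n => hV _ ((s.nm_mono (by omega) _).trans_lt (hball n)) _, hus, hball,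
      fun n => (hlo n).2.1, by rw [← hm]; exact (hy.trans_le (min_le_right _ _)).le⟩
  have hgeo : Summable fun n : ℕ => (1 / 2 : ℝ) ^ n := summable_geometric_two
  obtain ⟨z, hz⟩ := s.exists_limit_of_summable (fun n => u (n + 1)) _
    (fun j => hgeo.mul_left (D₂ j * (1 + t.nm (j + r + r + p + d + r) y)))
    fun j n => h2 j y u _ hs n
  have hle : ∀ j n, s.nm j (u (n + 1)) ≤
      (D₁ j * Real.exp ((3 * q + 2) * times t₀ 0) + 2 * D₂ j) * (1 + t.nm (j + m) y) := by
    intro j n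
    have e1 := (h1 j y u _ hs 0).2.2
    have e2 : s.nm j (u 1) ≤ D₁ j * Real.exp ((3 * q + 2) * times t₀ 0) *
        (1 + t.nm (j + m) y) := by
      rw [hus 0]
      nth_rw 1 [hu0]
      rw [zero_add]
      refine (s.nm_mono (by omega : j ≤ j + 2 * r) _).trans (e1.trans ?_)
      refine mul_le_mul_of_nonneg_left ?_ (mul_nonneg (hD₁ j) (Real.exp_pos _).le)
      linarith [t.nm_mono (by omega : j + r ≤ j + m) y]
    -- The geometric bounds start only at the second step, since the error decay uses a previous
    -- step. The first step is estimated separately by `seq_growth` and gives the other summand of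
    -- the constant.
    have e3 : s.nm j (u (n + 1)) ≤ s.nm j (u 1) + 2 * D₂ j * (1 + t.nm (j + m) y) *
        (1 - (1 / 2) ^ n) := by
      induction n with
      | zero => simp
      | succ n ih =>
        have k1 := h2 j y u _ hs n
        have k2 := s.nm_le_add_sub j (u (n + 1 + 1)) (u (n + 1))
        have k3 : 1 + t.nm (j + r + r + p + d + r) y ≤ 1 + t.nm (j + m) y := by
          linarith [t.nm_mono (by omega : j + r + r + p + d + r ≤ j + m) y]
        have k4 := mul_le_mul_of_nonneg_right (mul_le_mul_of_nonneg_left k3 (hD₂ j))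
          (by positivity : 0 ≤ (1 / 2 : ℝ) ^ n)
        rw [pow_succ]
        linarith
    have k5 : 0 ≤ 2 * D₂ j * (1 + t.nm (j + m) y) * (1 / 2) ^ n := by
      have := hD₂ j
      have := t.nm_nonneg (j + m) y
      positivity
    linarith
  have hz' : ∀ j {c : ℝ}, (∀ n, s.nm j (u (n + 1)) ≤ c) → s.nm j z ≤ c := by
    intro j c hc
    have k := (s.tendsto_nm j z).comp (s.tendsto_nh_iff_nm.2 (hz j))
    exact le_of_tendsto' k hc
  have hz3 : s.nm (3 * r) z < δ :=
    (hz' (3 * r) fun n => (hlo (n + 1)).1).trans_lt (by linarith [h.pos])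
  refine ⟨z, hz3, ?_, fun j => hz' j (hle j)⟩
  -- the limit solves the equation
  have hzr : s.nm r z < δ := (s.nm_mono (by omega) _).trans_lt hz3
  obtain ⟨C, hC, hb⟩ := h.bound 0
  obtain ⟨C', hC', ht⟩ := h.taylor 0
  obtain ⟨X, hX⟩ : ∃ X, X = 1 + s.nm (0 + r) z := ⟨_, rfl⟩
  -- No continuity of `g` is among the hypotheses. The Taylor estimate and the bound on `A`, both at
  -- the limit `z`, show that `g (u n)` tends to `g z`.
  have key : ∀ n, t.nm 0 (y - g z) ≤ Real.exp (-t₀) * (1 / 2) ^ (n + 1) +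
      (C * (X * s.nm r (u (n + 1) - z) + s.nm (0 + r) (u (n + 1) - z)) +
      C' * (s.nm r (u (n + 1) - z) * s.nm (0 + r) (u (n + 1) - z) +
        X * s.nm r (u (n + 1) - z) ^ 2)) := by
    intro n
    have hT := times_ge ht₀ (n + 1)
    have k1 : t.nm 0 (y - g (u (n + 1))) ≤ Real.exp (-t₀) * (1 / 2) ^ (n + 1) := by
      refine (t.nm_mono (Nat.zero_le (2 * r)) _).trans ((hs.error (n + 1)).trans
        (le_trans ?_ (exp_neg_times_le ht₀ (n + 1))))
      refine Real.exp_le_exp.2 ?_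
      have h0 : 0 ≤ times t₀ (n + 1) := by
        linarith [(Nat.cast_nonneg (n + 1) : (0 : ℝ) ≤ _)]
      nlinarith
    have k2 := hb z hzr (u (n + 1) - z)
    have k3 := ht z (u (n + 1) - z) hzr (by rw [add_sub_cancel]; exact hs.ball_r (n + 1))
    rw [add_sub_cancel] at k3
    rw [← hX] at k2 k3
    have e : y - g z = (y - g (u (n + 1))) + (A z (u (n + 1) - z) +
      (g (u (n + 1)) - g z - A z (u (n + 1) - z))) := by abel
    rw [e]
    exact (t.nm_add _ _ _).trans (add_le_add k1 ((t.nm_add _ _ _).trans (add_le_add k2 k3)))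
  have hlim : Tendsto (fun n => Real.exp (-t₀) * (1 / 2 : ℝ) ^ (n + 1) +
      (C * (X * s.nm r (u (n + 1) - z) + s.nm (0 + r) (u (n + 1) - z)) +
      C' * (s.nm r (u (n + 1) - z) * s.nm (0 + r) (u (n + 1) - z) +
        X * s.nm r (u (n + 1) - z) ^ 2))) atTop
      (𝓝 (Real.exp (-t₀) * 0 + (C * (X * 0 + 0) + C' * (0 * 0 + X * 0 ^ 2)))) := by
    have l1 : Tendsto (fun n : ℕ => (1 / 2 : ℝ) ^ (n + 1)) atTop (𝓝 0) :=
      (tendsto_add_atTop_iff_nat 1).2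
        (tendsto_pow_atTop_nhds_zero_of_lt_one (by norm_num) (by norm_num))
    exact (l1.const_mul _).add (((((hz r).const_mul X).add (hz (0 + r))).const_mul C).add
      ((((hz r).mul (hz (0 + r))).add (((hz r).pow 2).const_mul X)).const_mul C'))
  have h0 := ge_of_tendsto' hlim key
  refine (sub_eq_zero.1 (t.eq_zero_of_nm (j := 0) (le_antisymm ?_ (t.nm_nonneg _ _)))).symm
  simpa using h0

end SolveHigh

end ScStructure

/-! ### The Taylor estimate from the second derivative. -/

namespace ScStructure

section Taylor

variable {𝕜 : Type*} [RCLike 𝕜]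
variable {E : Type u} [AddCommGroup E] [Module 𝕜 E] [TopologicalSpace E]
  [IsTopologicalAddGroup E] [ContinuousSMul 𝕜 E]
variable {F : Type u} [AddCommGroup F] [Module 𝕜 F] [TopologicalSpace F]
  [IsTopologicalAddGroup F] [ContinuousSMul 𝕜 F]
variable {s : ScStructure 𝕜 E} {t : ScStructure 𝕜 F} {U : Set E} {G : E → F}
  {A : E → E →L[𝕜] F} {x₀ : E}

/-- The partial derivative of `(x, a) ↦ A x a` in the first variable is homogeneous in `a`. -/
theorem hd_partial_smul (t : ScStructure 𝕜 F) {x a b : E} {c : 𝕜} {L L' : E × E →L[𝕜] F}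
    (h : HD (fun z : E × E => A z.1 z.2) (x, a) L)
    (h' : HD (fun z : E × E => A z.1 z.2) (x, c • a) L') : L' (b, 0) = c • L (b, 0) := by
  have := t.t2Space
  have e : ∀ a : E, HD (fun y : E => (y, a)) x ((ContinuousLinearMap.id 𝕜 E).prod 0) := fun a =>
    (HD.clm (ContinuousLinearMap.id 𝕜 E) x).prodMk (HD.const a x)
  have h1 := (h.comp (f := fun y : E => (y, a)) (e a)).const_smul c
  have h2 := h'.comp (f := fun y : E => (y, c • a)) (e (c • a))
  have h3 : (fun y : E => A y (c • a)) = fun y => c • A y a := funext fun y => map_smul _ _ _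
  simp only [h3] at h2
  simpa using congrArg (fun T : E →L[𝕜] F => T b) (h2.unique h1)

/-- Tame estimate of the second derivative on the diagonal. -/
theorem SCN.second_bound {D : (E × E) × (E × E) → F}
    (hD : LCT True ((s.prod s).prod (s.prod s)) t ((U ×ˢ univ) ×ˢ univ) D)
    (hDA : ∀ x ∈ U, ∀ a, ∃ L : E × E →L[𝕜] F, HD (fun z : E × E => A z.1 z.2) (x, a) L ∧
      ∀ c, D ((x, a), c) = L c) (hx₀ : x₀ ∈ U) :
    ∃ r, ∃ V ∈ s.nh r x₀, V ⊆ U ∧ ∀ j, ∃ C : ℝ, 0 ≤ C ∧ ∀ x ∈ V, ∀ v,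
      t.nm j (D ((x, v), (v, 0))) ≤
        C * (s.nm r v ^ 2 * (1 + s.nm (j + r) x) + s.nm r v * s.nm (j + r) v) := by
  obtain ⟨r, V, hV, hVU, -, hb⟩ := hD ((x₀, 0), (0, 0)) ⟨⟨hx₀, mem_univ _⟩, mem_univ _⟩
  rw [nh_prod, nh_prod, nh_prod] at hV
  obtain ⟨V₁, hV₁, V₂, hV₂, hsub⟩ := mem_prod_iff.1 hV
  obtain ⟨W₁, hW₁, W₂, hW₂, hs1⟩ := mem_prod_iff.1 hV₁
  obtain ⟨W₃, hW₃, W₄, hW₄, hs2⟩ := mem_prod_iff.1 hV₂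
  obtain ⟨ε, hε, hball⟩ := s.mem_nh_iff.1 (inter_mem hW₂ hW₃)
  have hmem : ∀ x ∈ W₁, ∀ v, s.nm r v < ε → ((x, v), (v, 0)) ∈ V := fun x hx v hv => by
    have := hball v (by rwa [sub_zero])
    exact hsub ⟨hs1 ⟨hx, this.1⟩, hs2 ⟨this.2, s.mem_of_mem_nh hW₄⟩⟩
  have hWU : W₁ ⊆ U := fun x hx => (hVU (hmem x hx 0 (by rwa [s.nm_zero]))).1.1
  refine ⟨r, W₁, hW₁, hWU, fun j => ?_⟩
  obtain ⟨C, hC, hb⟩ := hb trivial j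
  refine ⟨C * (4 / ε ^ 2 + 2 / ε), by positivity, fun x hx v => ?_⟩
  by_cases hv : v = 0
  · subst hv
    obtain ⟨L, -, hL⟩ := hDA x (hWU hx) 0
    have : D ((x, 0), (0, 0)) = 0 := by rw [hL]; exact map_zero L
    simp [this]
  have hpos : 0 < s.nm r v := s.nm_pos hv
  -- On the diagonal the second derivative is homogeneous of degree two: once through linearity of
  -- `A x`, by `hd_partial_smul`, and once through linearity of the derivative. Scaling `v` to
  -- length `ε / 2` thus brings the factor `c⁻¹ ^ 2`, which yields the quadratic term in `‖v‖_r`.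
  obtain ⟨c, hc⟩ : ∃ c, c = ε / (2 * s.nm r v) := ⟨_, rfl⟩
  have hc0 : 0 < c := by rw [hc]; positivity
  have hcv : c * s.nm r v = ε / 2 := by rw [hc]; field_simp
  have hhom : D ((x, (c : 𝕜) • v), ((c : 𝕜) • v, 0)) = ((c ^ 2 : ℝ) : 𝕜) • D ((x, v), (v, 0)) := by
    obtain ⟨L, hL, hLD⟩ := hDA x (hWU hx) v
    obtain ⟨L', hL', hLD'⟩ := hDA x (hWU hx) ((c : 𝕜) • v)
    rw [hLD, hLD', hd_partial_smul t hL hL']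
    have : (((c : 𝕜) • v, (0 : E)) : E × E) = (c : 𝕜) • (v, 0) := by simp
    rw [this, map_smul, smul_smul]
    push_cast
    rw [pow_two]
  have h1 := hb _ (hmem x hx ((c : 𝕜) • v) (by rw [s.nm_real_smul _ hc0.le]; linarith))
  rw [hhom, t.nm_real_smul _ (by positivity), nm_prod, nm_prod, nm_prod, s.nm_zero,
    s.nm_real_smul _ hc0.le] at h1
  have hX := s.nm_nonneg (j + r) x
  have hvj := s.nm_nonneg (j + r) v
  have hcvj : 0 ≤ c * s.nm (j + r) v := by positivity
  have h2 : c ^ 2 * t.nm j (D ((x, v), (v, 0))) ≤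
      C * (1 + s.nm (j + r) x + c * s.nm (j + r) v) := by
    refine h1.trans (mul_le_mul_of_nonneg_left ?_ hC)
    have : max (max (s.nm (j + r) x) (c * s.nm (j + r) v)) (max (c * s.nm (j + r) v) 0) ≤
        s.nm (j + r) x + c * s.nm (j + r) v := by
      refine max_le (max_le ?_ ?_) (max_le ?_ ?_) <;> linarith
    linarith
  have hcinv : c⁻¹ = 2 / ε * s.nm r v := by rw [hc]; field_simp
  have h3 : t.nm j (D ((x, v), (v, 0))) ≤
      C * (c⁻¹ ^ 2 * (1 + s.nm (j + r) x) + c⁻¹ * s.nm (j + r) v) := by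
    have h4 := mul_le_mul_of_nonneg_left h2 (by positivity : 0 ≤ c⁻¹ ^ 2)
    have h5 : c⁻¹ ^ 2 * (c ^ 2 * t.nm j (D ((x, v), (v, 0)))) = t.nm j (D ((x, v), (v, 0))) := by
      field_simp
    have h6 : c⁻¹ ^ 2 * (C * (1 + s.nm (j + r) x + c * s.nm (j + r) v)) =
        C * (c⁻¹ ^ 2 * (1 + s.nm (j + r) x) + c⁻¹ * s.nm (j + r) v) := by
      field_simp
    rw [h5, h6] at h4
    exact h4
  refine h3.trans ?_
  rw [mul_assoc C]
  refine mul_le_mul_of_nonneg_left ?_ hC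
  rw [hcinv]
  have i1 : 0 ≤ 2 / ε * (s.nm r v ^ 2 * (1 + s.nm (j + r) x)) := by positivity
  have i2 : 0 ≤ 4 / ε ^ 2 * (s.nm r v * s.nm (j + r) v) := by positivity
  have i3 : (2 / ε * s.nm r v) ^ 2 * (1 + s.nm (j + r) x) + 2 / ε * s.nm r v * s.nm (j + r) v =
    4 / ε ^ 2 * (s.nm r v ^ 2 * (1 + s.nm (j + r) x)) + 2 / ε * (s.nm r v * s.nm (j + r) v) := by
    ring
  rw [i3]
  linarith

theorem nm_segment_lt (s : ScStructure 𝕜 E) {r : ℕ} {x₀ x v : E} {δ τ : ℝ}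
    (h1 : s.nm r (x - x₀) < δ) (h2 : s.nm r (x + v - x₀) < δ) (hτ : τ ∈ Icc (0 : ℝ) 1) :
    s.nm r (x + (τ : 𝕜) • v - x₀) < δ := by
  have e : x + (τ : 𝕜) • v - x₀ = ((1 - τ : ℝ) : 𝕜) • (x - x₀) + (τ : 𝕜) • (x + v - x₀) := by
    push_cast
    module
  rw [e]
  refine (s.nm_add _ _ _).trans_lt ?_
  rw [s.nm_real_smul _ (by linarith [hτ.2]), s.nm_real_smul _ hτ.1]
  rcases hτ.1.eq_or_lt with h0 | h0
  · rw [← h0]; simpa using h1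
  · nlinarith [hτ.2]

/-- The estimates for the Nash–Moser iteration hold for a map of class two whose derivative has
tame inverses. -/
theorem SCN.tameNewton (hG : SCN True 2 s t U G) (hA : ∀ x ∈ U, HD G x (A x)) (hx₀ : x₀ ∈ U)
    (hinv : ∃ r, ∃ V ∈ s.nh r x₀, (∀ x ∈ V, Function.Bijective (A x)) ∧
      ∀ j, ∃ C : ℝ, 0 ≤ C ∧ ∀ x ∈ V, ∀ v, s.nm j v ≤
        C * ((1 + s.nm (j + r) x) * t.nm r (A x v) + t.nm (j + r) (A x v))) :
    ∃ r δ, {x | s.nm r (x - x₀) < δ} ⊆ U ∧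
      TameNewton s t (fun u => G (x₀ + u) - G x₀) (fun u => (A (x₀ + u)).toLinearMap) r δ := by
  have hDA : SCN True 1 (s.prod s) t (U ×ˢ univ) fun z : E × E => A z.1 z.2 :=
    SCN.deriv hG fun x hx => ⟨A x, hA x hx, fun _ => rfl⟩
  have hAlct := hDA.lct
  have hfam := LCT.fam (A := fun x => (A x).toLinearMap) hAlct hx₀
  obtain ⟨-, D, hD, hD2⟩ := hDA
  have hD' : ∀ x ∈ U, ∀ a, ∃ L : E × E →L[𝕜] F, HD (fun z : E × E => A z.1 z.2) (x, a) L ∧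
      ∀ c, D ((x, a), c) = L c := fun x hx a => hD (x, a) ⟨hx, mem_univ _⟩
  obtain ⟨r₁, V₁, hV₁, hV₁U, hb₁⟩ := SCN.second_bound hD2 hD' hx₀
  obtain ⟨r₂, V₂, hV₂, -, hb₂⟩ := hfam
  obtain ⟨r₃, V₃, hV₃, hbij, hb₃⟩ := hinv
  obtain ⟨r, hr⟩ : ∃ r, r = r₁ + r₂ + r₃ := ⟨_, rfl⟩
  obtain ⟨ε, hε, hball⟩ := s.mem_nh_iff.1 (inter_mem (inter_mem
    (s.nh_anti (by omega : r₁ ≤ r) _ hV₁) (s.nh_anti (by omega : r₂ ≤ r) _ hV₂))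
    (s.nh_anti (by omega : r₃ ≤ r) _ hV₃))
  have hmem : ∀ u, s.nm r u < min ε 1 → x₀ + u ∈ (V₁ ∩ V₂) ∩ V₃ := fun u hu =>
    hball _ (by rw [add_sub_cancel_left]; exact hu.trans_le (min_le_left _ _))
  have hone : ∀ j u, 1 + s.nm j (x₀ + u) ≤ (1 + s.nm j x₀) * (1 + s.nm j u) := fun j u => by
    have := s.nm_add j x₀ u
    nlinarith [mul_nonneg (s.nm_nonneg j x₀) (s.nm_nonneg j u)]
  refine ⟨r, min ε 1, fun x hx => hV₁U (hball x (hx.trans_le (min_le_left _ _))).1.1,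
    ⟨lt_min hε one_pos, min_le_right _ _, by simp, fun u hu => hbij _ (hmem u hu).2, fun j => ?_,
      fun j => ?_, fun j => ?_⟩⟩
  · obtain ⟨C, hC, hb⟩ := hb₂ j
    have h0 := s.nm_nonneg (j + r) x₀
    refine ⟨C * (1 + s.nm (j + r) x₀), by positivity, fun u hu v => ?_⟩
    refine (hb _ (hmem u hu).1.2 v).trans ?_
    rw [mul_assoc]
    refine mul_le_mul_of_nonneg_left ?_ hC
    have i1 : 1 + s.nm (j + r₂) (x₀ + u) ≤ (1 + s.nm (j + r) x₀) * (1 + s.nm (j + r) u) :=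
      le_trans (by linarith [s.nm_mono (by omega : j + r₂ ≤ j + r) (x₀ + u)]) (hone _ _)
    have i2 := mul_le_mul i1 (s.nm_mono (by omega : r₂ ≤ r) v) (s.nm_nonneg _ _)
      (mul_nonneg (by linarith) (by linarith [s.nm_nonneg (j + r) u]))
    have i3 := s.nm_mono (by omega : 1 * j + r₂ ≤ j + r) v
    have i4 := mul_nonneg h0 (s.nm_nonneg (j + r) v)
    linarith
  · obtain ⟨C, hC, hb⟩ := hb₁ j
    have h0 := s.nm_nonneg (j + r) x₀
    refine ⟨C * (4 + s.nm (j + r) x₀), by positivity, fun u v hu huv => ?_⟩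
    obtain ⟨x, hx⟩ : ∃ x, x = x₀ + u := ⟨_, rfl⟩
    have hseg : ∀ τ ∈ Icc (0 : ℝ) 1, x + (τ : 𝕜) • v ∈ V₁ := fun τ hτ => by
      have := nm_segment_lt (x₀ := x₀) (x := x) (v := v) s (r := r) (δ := min ε 1)
        (by rw [hx, add_sub_cancel_left]; exact hu)
        (by rw [hx, add_assoc, add_sub_cancel_left]; exact huv) hτ
      exact (hball _ (this.trans_le (min_le_left _ _))).1.1
    obtain ⟨K, hK⟩ : ∃ K, K = C * (4 + s.nm (j + r) x₀) *
      (s.nm r v * s.nm (j + r) v + (1 + s.nm (j + r) u) * s.nm r v ^ 2) := ⟨_, rfl⟩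
    have hsecond : ∀ τ ∈ Icc (0 : ℝ) 1, t.nm j (D ((x + (τ : 𝕜) • v, v), (v, 0))) ≤ K := by
      intro τ hτ
      refine (hb _ (hseg τ hτ) v).trans ?_
      rw [hK, mul_assoc]
      refine mul_le_mul_of_nonneg_left ?_ hC
      have n1 := s.nm_nonneg r v
      have n2 := s.nm_nonneg (j + r) v
      have n3 := s.nm_nonneg (j + r) u
      have i1 : s.nm r₁ v ≤ s.nm r v := s.nm_mono (by omega) v
      have i2 : s.nm (j + r₁) v ≤ s.nm (j + r) v := s.nm_mono (by omega) v
      have i3 : s.nm (j + r₁) (x + (τ : 𝕜) • v) ≤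
          s.nm (j + r) x₀ + s.nm (j + r) u + s.nm (j + r) v := by
        refine (s.nm_mono (by omega : j + r₁ ≤ j + r) _).trans ((s.nm_add _ _ _).trans ?_)
        rw [hx, s.nm_real_smul _ hτ.1]
        have := s.nm_add (j + r) x₀ u
        nlinarith [hτ.2]
      have i4 : s.nm r₁ v ^ 2 ≤ s.nm r v ^ 2 := pow_le_pow_left₀ (s.nm_nonneg _ _) i1 2
      have i5 : s.nm r v ≤ 2 := by
        have k1 := s.nm_sub r (u + v) u
        rw [add_sub_cancel_left] at k1
        have k2 := hu.trans_le (min_le_right _ _)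
        have k3 := huv.trans_le (min_le_right _ _)
        linarith
      have i6 : s.nm r₁ v * s.nm (j + r₁) v ≤ s.nm r v * s.nm (j + r) v :=
        mul_le_mul i1 i2 (s.nm_nonneg _ _) n1
      have i7 : s.nm r₁ v ^ 2 * (1 + s.nm (j + r₁) (x + (τ : 𝕜) • v)) ≤
          s.nm r v ^ 2 * (1 + (s.nm (j + r) x₀ + s.nm (j + r) u + s.nm (j + r) v)) :=
        mul_le_mul i4 (by linarith) (by linarith [s.nm_nonneg (j + r₁) (x + (τ : 𝕜) • v)])
          (sq_nonneg _)
      have i8 : s.nm r v ^ 2 * s.nm (j + r) v ≤ 2 * (s.nm r v * s.nm (j + r) v) := by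
        have := mul_le_mul_of_nonneg_right i5 (mul_nonneg n1 n2)
        linarith
      have i9 : 0 ≤ s.nm (j + r) x₀ * s.nm (j + r) u * s.nm r v ^ 2 := by positivity
      have i10 : 0 ≤ s.nm r v * s.nm (j + r) v := by positivity
      have i11 : 0 ≤ s.nm (j + r) x₀ * (s.nm r v * s.nm (j + r) v) := by positivity
      have i12 : 0 ≤ (1 + s.nm (j + r) u) * s.nm r v ^ 2 := by positivity
      linarith
    -- First use of the mean value inequality, for `y ↦ A y v` on the segment up to parameter `τ`.
    -- Its derivative in the direction `τ v` is `τ` times the second derivative on the diagonal.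
    have hAc : ∀ τ ∈ Icc (0 : ℝ) 1, t.nm j (A (x + (τ : 𝕜) • v) v - A x v) ≤ K := by
      intro τ hτ
      have hsub : ∀ τ' ∈ Icc (0 : ℝ) 1, τ' * τ ∈ Icc (0 : ℝ) 1 := fun τ' hτ' =>
        ⟨mul_nonneg hτ'.1 hτ.1, mul_le_one₀ hτ'.2 hτ.1 hτ.2⟩
      have hpt : ∀ τ' : ℝ, x + (τ' : 𝕜) • ((τ : 𝕜) • v) = x + ((τ' * τ : ℝ) : 𝕜) • v := by
        intro τ'; rw [smul_smul]; push_cast; rfl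
      have hL : ∀ τ' : ℝ, ∃ L : E × E →L[𝕜] F, τ' ∈ Icc (0 : ℝ) 1 →
          HD (fun z : E × E => A z.1 z.2) (x + ((τ' * τ : ℝ) : 𝕜) • v, v) L ∧
            ∀ c, D ((x + ((τ' * τ : ℝ) : 𝕜) • v, v), c) = L c := by
        intro τ'
        by_cases h : τ' ∈ Icc (0 : ℝ) 1
        · obtain ⟨L, hL⟩ := hD' _ (hV₁U (hseg _ (hsub τ' h))) v
          exact ⟨L, fun _ => hL⟩
        · exact ⟨0, fun h' => absurd h' h⟩
      choose L hL using hL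
      refine nm_sub_le_of_hd (g := fun y => A y v) (v := (τ : 𝕜) • v)
        (L := fun τ' => (L τ').comp ((ContinuousLinearMap.id 𝕜 E).prod 0)) t j ?_ ?_ ?_
      · intro τ' hτ'
        rw [hpt]
        have hc := hAlct.continuousAt
          (x := (x + ((τ' * τ : ℝ) : 𝕜) • v, v)) ⟨hV₁U (hseg _ (hsub τ' hτ')), mem_univ _⟩
        exact ContinuousAt.comp (f := fun y : E => (y, v)) hc
          (continuous_id.prodMk continuous_const).continuousAt
      · intro τ' hτ'
        rw [hpt]
        exact (hL τ' hτ').1.comp (f := fun y : E => (y, v))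
          ((HD.clm (ContinuousLinearMap.id 𝕜 E) _).prodMk (HD.const v _))
      · intro τ' hτ'
        have e1 : ((L τ').comp ((ContinuousLinearMap.id 𝕜 E).prod 0)) ((τ : 𝕜) • v) =
            (τ : 𝕜) • D ((x + ((τ' * τ : ℝ) : 𝕜) • v, v), (v, 0)) := by
          rw [(hL τ' hτ').2, ← map_smul, Prod.smul_mk, smul_zero]
          rfl
        rw [e1, t.nm_real_smul _ hτ.1]
        have k1 := hsecond _ (hsub τ' hτ')
        have k2 := t.nm_nonneg j (D ((x + ((τ' * τ : ℝ) : 𝕜) • v, v), (v, 0)))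
        nlinarith [hτ.1, hτ.2]
    -- Second use: `G - A x` has derivative `A (x + τ v) - A x` along the segment, whose value on
    -- `v` was just bounded by `K`. Only the diagonal of the second derivative occurs, so its
    -- symmetry is not needed.
    have hfin := nm_sub_le_of_hd (g := fun y => G y + -(A x y)) (x := x) (v := v) (C := K)
      (L := fun τ => A (x + (τ : 𝕜) • v) + -(A x)) t j ?_ ?_ ?_
    · have e : G (x + v) + -(A x (x + v)) - (G x + -(A x x)) =
          G (x₀ + (u + v)) - G x₀ - (G (x₀ + u) - G x₀) - A (x₀ + u) v := by
        rw [map_add, ← hx, ← add_assoc, ← hx]; abel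
      rw [e] at hfin
      rw [← hK]
      exact hfin
    · intro τ hτ
      exact (hG.lct.continuousAt (hV₁U (hseg τ hτ))).add (A x).continuous.continuousAt.neg
    · intro τ hτ
      exact (hA _ (hV₁U (hseg τ hτ))).add (HD.clm (-(A x)) _)
    · intro τ hτ
      have := hAc τ hτ
      rwa [sub_eq_add_neg] at this
  · obtain ⟨C, hC, hb⟩ := hb₃ j
    have h0 := s.nm_nonneg (j + r) x₀
    refine ⟨C * (1 + s.nm (j + r) x₀), by positivity, fun u hu v => ?_⟩
    refine (hb _ (hmem u hu).2 v).trans ?_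
    rw [mul_assoc]
    refine mul_le_mul_of_nonneg_left ?_ hC
    change _ ≤ (1 + s.nm (j + r) x₀) * ((1 + s.nm (j + r) u) * t.nm r (A (x₀ + u) v) +
      t.nm (j + r) (A (x₀ + u) v))
    have i1 : 1 + s.nm (j + r₃) (x₀ + u) ≤ (1 + s.nm (j + r) x₀) * (1 + s.nm (j + r) u) :=
      le_trans (by linarith [s.nm_mono (by omega : j + r₃ ≤ j + r) (x₀ + u)]) (hone _ _)
    have i2 := mul_le_mul i1 (t.nm_mono (by omega : r₃ ≤ r) (A (x₀ + u) v)) (t.nm_nonneg _ _)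
      (mul_nonneg (by linarith) (by linarith [s.nm_nonneg (j + r) u]))
    have i3 := t.nm_mono (by omega : j + r₃ ≤ j + r) (A (x₀ + u) v)
    have i4 := mul_nonneg h0 (t.nm_nonneg (j + r) (A (x₀ + u) v))
    linarith

end Taylor

end ScStructure

/-! ### Regularity of the family of inverse operators. -/

namespace ScStructure

section InverseRegularity

variable {𝕜 : Type*} [RCLike 𝕜]
variable {E : Type u} [AddCommGroup E] [Module 𝕜 E] [TopologicalSpace E]
  [IsTopologicalAddGroup E] [ContinuousSMul 𝕜 E]
variable {F : Type u} [AddCommGroup F] [Module 𝕜 F] [TopologicalSpace F]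
  [IsTopologicalAddGroup F] [ContinuousSMul 𝕜 F]
variable {s : ScStructure 𝕜 E} {t : ScStructure 𝕜 F} {U B : Set E}
  {A : E → E →L[𝕜] F} {V : E → F →L[𝕜] E}

/-- For a family of linear maps the loss of levels is uniform in the linear variable. -/
theorem LCT.exists_tendsto_linear {τ : Prop}
    (hA : LCT τ (s.prod s) t (U ×ˢ univ) fun z => A z.1 z.2) {x : E} (hx : x ∈ U) :
    ∃ r, ∃ O ∈ s.nh r x, ∀ y ∈ O, ∀ v j, Tendsto (fun z => A z v) (s.nh (j + r) y)
      (t.nh j (A y v)) := by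
  obtain ⟨r, O, hO, -, hc, -⟩ := hA (x, 0) ⟨hx, mem_univ _⟩
  rw [nh_prod] at hO
  obtain ⟨O₁, hO₁, O₂, hO₂, hsub⟩ := mem_prod_iff.1 hO
  obtain ⟨ε, hε, hO₂⟩ := s.mem_nh_iff.1 hO₂
  refine ⟨r, O₁, hO₁, fun y hy v j => ?_⟩
  have hpos : 0 < s.nm r v + 1 := by linarith [s.nm_nonneg r v]
  obtain ⟨c, hcd⟩ : ∃ c, c = ε / (2 * (s.nm r v + 1)) := ⟨_, rfl⟩
  have hc0 : 0 < c := by rw [hcd]; positivity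
  have hcne : (c : 𝕜) ≠ 0 := by exact_mod_cast hc0.ne'
  have hmem : (y, (c : 𝕜) • v) ∈ O := by
    refine hsub ⟨hy, hO₂ _ ?_⟩
    rw [sub_zero, s.nm_real_smul r hc0.le]
    have : c * (s.nm r v + 1) = ε / 2 := by rw [hcd]; field_simp
    nlinarith
  have h1 := hc _ hmem j
  rw [nh_prod] at h1
  have h2 : Tendsto (fun z : E => (z, (c : 𝕜) • v)) (s.nh (j + r) y)
      (s.nh (j + r) y ×ˢ s.nh (j + r) ((c : 𝕜) • v)) :=
    tendsto_id.prodMk (tendsto_const_pure.mono_right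
      (show pure _ ≤ s.nh (j + r) ((c : 𝕜) • v) from fun S hS => s.mem_of_mem_nh hS))
  have h3 := (t.tendsto_nh_iff.1 (h1.comp h2)).const_smul ((c : 𝕜)⁻¹)
  refine t.tendsto_nh_iff.2 ?_
  simpa [inv_smul_smul₀ hcne] using h3

/-- The inverses of a tame family form a tame family. -/
theorem LCT.inverse (hA : LCT True (s.prod s) t (U ×ˢ univ) fun z => A z.1 z.2) (hB : IsOpen B)
    (hBU : B ⊆ U) (hAV : ∀ x ∈ B, ∀ w, A x (V x w) = w) (hVA : ∀ x ∈ B, ∀ v, V x (A x v) = v)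
    {r : ℕ} (hb : ∀ j, ∃ C : ℝ, 0 ≤ C ∧ ∀ x ∈ B, ∀ w,
      s.nm j (V x w) ≤ C * ((1 + s.nm (j + r) x) * t.nm r w + t.nm (j + r) w)) :
    LCT True (s.prod t) s (B ×ˢ univ) fun z => V z.1 z.2 := by
  rintro ⟨x, w⟩ ⟨hx, -⟩
  obtain ⟨r₁, O, hO, hc⟩ := hA.exists_tendsto_linear (hBU hx)
  obtain ⟨m, hm⟩ := s.mem_nhds_iff'.1 (hB.mem_nhds hx)
  obtain ⟨ε, hε, hεB⟩ := s.mem_nh_iff.1 hm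
  refine ⟨r + r₁ + m, (O ∩ {z | s.nm m (z - x) < ε}) ×ˢ {z | t.nm (r + r₁ + m) (z - w) < 1}, ?_,
    fun z hz => ⟨hεB _ hz.1.2, mem_univ _⟩, ?_, fun _ j => ?_⟩
  · rw [nh_prod]
    exact prod_mem_prod (inter_mem (s.nh_anti (by omega) _ hO) (s.nh_anti (by omega) _
      (s.ball_mem_nh m x hε))) (t.ball_mem_nh _ _ one_pos)
  · rintro ⟨y, w'⟩ ⟨⟨hyO, hyε⟩, -⟩ j
    have hyB := hεB y hyε
    obtain ⟨C, hC, hb⟩ := hb j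
    rw [nh_prod]
    obtain ⟨v, hv⟩ : ∃ v, v = V y w' := ⟨_, rfl⟩
    obtain ⟨l, hl⟩ : ∃ l : Filter (E × F), l = s.nh (j + (r + r₁ + m)) y ×ˢ
      t.nh (j + (r + r₁ + m)) w' := ⟨_, rfl⟩
    have h1 : Tendsto (fun p : E × F => t.nm (j + r) (p.2 - w')) l (𝓝 0) :=
      t.tendsto_nh_iff_nm.1 (by rw [hl]; exact tendsto_snd.mono_right (t.nh_anti (by omega) w'))
    have h2 : Tendsto (fun p : E × F => t.nm (j + r) (A p.1 v - A y v)) l (𝓝 0) := by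
      refine t.tendsto_nh_iff_nm.1 ((hc y hyO v (j + r)).comp ?_)
      rw [hl]; exact tendsto_fst.mono_right (s.nh_anti (by omega) y)
    have h3 : Tendsto (fun p : E × F => s.nm (j + r) p.1) l (𝓝 (s.nm (j + r) y)) := by
      refine (s.tendsto_nm (j + r) y).comp ?_
      rw [hl]; exact tendsto_fst.mono_right (s.nh_anti (by omega) y)
    have h4 : Tendsto (fun p : E × F => C * ((2 + s.nm (j + r) p.1) *
        (t.nm (j + r) (p.2 - w') + t.nm (j + r) (A p.1 v - A y v)))) l (𝓝 0) := by
      have := ((h3.const_add 2).mul (h1.add h2)).const_mul C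
      simpa using this
    rw [← hl]
    refine s.tendsto_nh_iff_nm.2 (squeeze_zero' (Eventually.of_forall fun _ => s.nm_nonneg _ _)
      ?_ h4)
    have hBy : ∀ᶠ p : E × F in l, p.1 ∈ B := by
      rw [hl]
      refine tendsto_fst.eventually (s.nh_anti (by omega : m ≤ j + (r + r₁ + m)) y ?_)
      exact mem_of_superset (s.ball_mem_nh_of_mem hyε) hεB
    filter_upwards [hBy] with p hp
    -- The resolvent identity with `v = V y w'` fixed. It reduces continuity of `V` to that of `A`
    -- at the single vector `v`, with `V p.1` controlled by the tame bound.
    have e : V p.1 p.2 - V y w' = V p.1 ((p.2 - w') - (A p.1 v - A y v)) := by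
      rw [hv, hAV y hyB, map_sub, map_sub, map_sub, hVA p.1 hp]; abel
    simp only [e]
    refine (hb p.1 hp _).trans (mul_le_mul_of_nonneg_left ?_ hC)
    have k1 := t.nm_mono (by omega : r ≤ j + r) ((p.2 - w') - (A p.1 v - A y v))
    have k2 := t.nm_sub (j + r) (p.2 - w') (A p.1 v - A y v)
    have k3 := mul_le_mul_of_nonneg_left (k1.trans k2)
      (by linarith [s.nm_nonneg (j + r) p.1] : 0 ≤ 1 + s.nm (j + r) p.1)
    linarith
  · obtain ⟨C, hC, hb⟩ := hb j
    have h0 := t.nm_nonneg (r + r₁ + m) w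
    refine ⟨C * (2 + t.nm (r + r₁ + m) w), by positivity, ?_⟩
    rintro ⟨y, w'⟩ ⟨⟨-, hyε⟩, hw'⟩
    have hyB := hεB y hyε
    refine (hb y hyB w').trans ?_
    rw [mul_assoc]
    refine mul_le_mul_of_nonneg_left ?_ hC
    rw [nm_prod]
    have k1 : t.nm r w' ≤ 1 + t.nm (r + r₁ + m) w := by
      have i1 := t.nm_mono (by omega : r ≤ r + r₁ + m) w'
      have i2 := t.nm_le_add_sub (r + r₁ + m) w' w
      have i3 : t.nm (r + r₁ + m) (w' - w) < 1 := hw'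
      linarith
    obtain ⟨X, hX⟩ : ∃ X, X = max (s.nm (j + (r + r₁ + m)) y) (t.nm (j + (r + r₁ + m)) w') :=
      ⟨_, rfl⟩
    have k2 : s.nm (j + r) y ≤ X :=
      (s.nm_mono (by omega) y).trans ((le_max_left _ _).trans_eq hX.symm)
    have k3 : t.nm (j + r) w' ≤ X :=
      (t.nm_mono (by omega) w').trans ((le_max_right _ _).trans_eq hX.symm)
    have k4 := s.nm_nonneg (j + r) y
    have k5 := mul_le_mul (by linarith : 1 + s.nm (j + r) y ≤ 1 + X) k1 (t.nm_nonneg _ _)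
      (by linarith)
    change _ ≤ (2 + t.nm (r + r₁ + m) w) * (1 + max (s.nm (j + (r + r₁ + m)) y)
      (t.nm (j + (r + r₁ + m)) w'))
    rw [← hX]
    linarith

/-- The derivative of the inverse family. -/
theorem HD.inverse_family (hV : LCT True (s.prod t) s (B ×ˢ univ) fun z => V z.1 z.2)
    (hB : IsOpen B) (hAV : ∀ x ∈ B, ∀ w, A x (V x w) = w) (hVA : ∀ x ∈ B, ∀ v, V x (A x v) = v)
    {x : E} (hx : x ∈ B) {w : F} {L : E × E →L[𝕜] F}
    (hL : HD (fun z : E × E => A z.1 z.2) (x, V x w) L) :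
    HD (fun z : E × F => V z.1 z.2) (x, w) ((V x).comp (ContinuousLinearMap.snd 𝕜 E F -
      L.comp ((ContinuousLinearMap.inl 𝕜 E E).comp (ContinuousLinearMap.fst 𝕜 E F)))) := by
  rintro ⟨a₀, b₀⟩
  obtain ⟨l, hl⟩ : ∃ l : Filter ((E × F) × ℝ), l = 𝓝 (a₀, b₀) ×ˢ 𝓝[>] 0 := ⟨_, rfl⟩
  rw [← hl]
  have ha : Tendsto (fun p : (E × F) × ℝ => p.1.1) l (𝓝 a₀) := by
    rw [hl]; exact (continuous_fst.tendsto (a₀, b₀)).comp tendsto_fst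
  have hb : Tendsto (fun p : (E × F) × ℝ => p.1.2) l (𝓝 b₀) := by
    rw [hl]; exact (continuous_snd.tendsto (a₀, b₀)).comp tendsto_fst
  have hτ : Tendsto (fun p : (E × F) × ℝ => p.2) l (𝓝[>] 0) := by rw [hl]; exact tendsto_snd
  have h1 := (hL (a₀, 0)).comp ((ha.prodMk_nhds tendsto_const_nhds).prodMk hτ)
  have hx' : Tendsto (fun p : (E × F) × ℝ => x + (p.2 : 𝕜) • p.1.1) l (𝓝 x) :=
    (tendsto_add_smul (𝕜 := 𝕜) x a₀).comp (ha.prodMk hτ)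
  have h2 := (hV.continuousAt (x := (x, b₀ - L (a₀, 0))) ⟨hx, mem_univ _⟩).tendsto.comp
    (hx'.prodMk_nhds (hb.sub h1))
  refine Tendsto.congr' ?_ h2
  filter_upwards [hx'.eventually (hB.mem_nhds hx), hτ.eventually eventually_mem_nhdsWithin]
    with p hp hpos
  have hne : (p.2 : 𝕜) ≠ 0 := by exact_mod_cast (ne_of_gt (mem_Ioi.1 hpos))
  simp only [Function.comp_apply, Prod.fst_add, Prod.snd_add,
    Prod.smul_fst, Prod.smul_snd, smul_zero, add_zero, hAV x hx]
  -- The resolvent identity again. After division by `t` the argument of `V` converges to `b₀ - L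
  -- (a₀, 0)`, and joint continuity of `V` gives the limit.
  have e : V (x + (p.2 : 𝕜) • p.1.1) (w + (p.2 : 𝕜) • p.1.2) - V x w =
      V (x + (p.2 : 𝕜) • p.1.1) ((p.2 : 𝕜) • p.1.2 -
        (A (x + (p.2 : 𝕜) • p.1.1) (V x w) - w)) := by
    rw [map_add, map_sub, map_sub, hVA _ hp]; abel
  rw [e, ← map_smul, smul_sub _ ((p.2 : 𝕜) • p.1.2), inv_smul_smul₀ hne]

/-- The inverses of a family of class `n` form a family of class `n`. -/
theorem SCN.inverse_family (hB : IsOpen B) (hBU : B ⊆ U)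
    (hAV : ∀ x ∈ B, ∀ w, A x (V x w) = w) (hVA : ∀ x ∈ B, ∀ v, V x (A x v) = v)
    (hV : LCT True (s.prod t) s (B ×ˢ univ) fun z => V z.1 z.2) (n : ℕ)
    (hA : SCN True n (s.prod s) t (U ×ˢ univ) fun z => A z.1 z.2) :
    SCN True n (s.prod t) s (B ×ˢ univ) fun z => V z.1 z.2 := by
  induction n with
  | zero => exact hV
  | succ n ih =>
    have ih := ih (SCN.of_succ n hA)
    obtain ⟨-, D, hD, hD2⟩ := hA
    -- The derivative is built from `V` itself and the derivative of `A`, both of class `n`, so the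
    -- class of `V` increases by one.
    refine ⟨hV, fun p => V p.1.1 (p.2.2 - D ((p.1.1, V p.1.1 p.1.2), (p.2.1, 0))), ?_, ?_⟩
    · rintro ⟨x, w⟩ ⟨hx, -⟩
      obtain ⟨L, hL, hLD⟩ := hD (x, V x w) ⟨hBU hx, mem_univ _⟩
      refine ⟨_, HD.inverse_family hV hB hAV hVA hx hL, ?_⟩
      rintro ⟨a, b⟩
      simp [hLD]
    · have hO : IsOpen ((B ×ˢ univ) ×ˢ univ : Set ((E × F) × (E × F))) :=
        (hB.prod isOpen_univ).prod isOpen_univ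
      have p1 : SCN True n ((s.prod t).prod (s.prod t)) s ((B ×ˢ univ) ×ˢ univ)
          fun p : (E × F) × (E × F) => p.1.1 :=
        (SCN.clm n (T := (ContinuousLinearMap.fst 𝕜 E F).comp
          (ContinuousLinearMap.fst 𝕜 (E × F) (E × F))) (TameLin.fst.comp TameLin.fst)).mono hO
          (subset_univ _)
      have p2 : SCN True n ((s.prod t).prod (s.prod t)) s ((B ×ˢ univ) ×ˢ univ)
          fun p : (E × F) × (E × F) => p.2.1 :=
        (SCN.clm n (T := (ContinuousLinearMap.fst 𝕜 E F).comp
          (ContinuousLinearMap.snd 𝕜 (E × F) (E × F))) (TameLin.fst.comp TameLin.snd)).mono hO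
          (subset_univ _)
      have p3 : SCN True n ((s.prod t).prod (s.prod t)) t ((B ×ˢ univ) ×ˢ univ)
          fun p : (E × F) × (E × F) => p.2.2 :=
        (SCN.clm n (T := (ContinuousLinearMap.snd 𝕜 E F).comp
          (ContinuousLinearMap.snd 𝕜 (E × F) (E × F))) (TameLin.snd.comp TameLin.snd)).mono hO
          (subset_univ _)
      have p4 : SCN True n ((s.prod t).prod (s.prod t)) (s.prod t) ((B ×ˢ univ) ×ˢ univ)
          fun p : (E × F) × (E × F) => p.1 :=
        (SCN.clm n (T := ContinuousLinearMap.fst 𝕜 (E × F) (E × F)) TameLin.fst).mono hO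
          (subset_univ _)
      have p5 : SCN True n ((s.prod t).prod (s.prod t)) s ((B ×ˢ univ) ×ˢ univ)
          fun p : (E × F) × (E × F) => V p.1.1 p.1.2 :=
        SCN.comp n ih p4 fun p hp => hp.1
      have p6 : SCN True n ((s.prod t).prod (s.prod t)) s ((B ×ˢ univ) ×ˢ univ)
          fun _ : (E × F) × (E × F) => (0 : E) := (SCN.const n 0).mono hO (subset_univ _)
      have p7 : SCN True n ((s.prod t).prod (s.prod t)) t ((B ×ˢ univ) ×ˢ univ)
          fun p : (E × F) × (E × F) => D ((p.1.1, V p.1.1 p.1.2), (p.2.1, 0)) :=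
        SCN.comp n hD2 (SCN.prodMk n (SCN.prodMk n p1 p5) (SCN.prodMk n p2 p6))
          fun p hp => ⟨⟨hBU hp.1.1, mem_univ _⟩, mem_univ _⟩
      exact SCN.comp n ih (SCN.prodMk n p1 (p3.sub p7)) fun p hp => ⟨hp.1.1, mem_univ _⟩

end InverseRegularity

end ScStructure

/-! ### The local inverse and its differentiability class. -/

namespace ScStructure

section LocalInverse

variable {𝕜 : Type*} [RCLike 𝕜]
variable {E : Type u} [AddCommGroup E] [Module 𝕜 E] [TopologicalSpace E]
  [IsTopologicalAddGroup E] [ContinuousSMul 𝕜 E]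
variable {F : Type u} [AddCommGroup F] [Module 𝕜 F] [TopologicalSpace F]
  [IsTopologicalAddGroup F] [ContinuousSMul 𝕜 F]
variable {s : ScStructure 𝕜 E} {t : ScStructure 𝕜 F}

theorem tendsto_nm_nhds (s : ScStructure 𝕜 E) (j : ℕ) (x : E) :
    Tendsto (s.nm j) (𝓝 x) (𝓝 (s.nm j x)) :=
  (s.tendsto_nm j x).mono_left (s.nhds_le_nh j x)

theorem isOpen_nm_lt (s : ScStructure 𝕜 E) (m : ℕ) (η : ℝ) : IsOpen {x | s.nm m x < η} := by
  simpa using s.isOpen_ball m 0 η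

/-- The Nash–Moser theorem: existence of a local inverse with tame Lipschitz estimates. -/
theorem TameNewton.exists_inverse {g : E → F} {A : E → E →ₗ[𝕜] F} {r : ℕ} {δ : ℝ}
    (h : TameNewton s t g A r δ) (hsm : s.HasSmoothing) :
    ∃ (m M : ℕ) (δ₁ η : ℝ) (ψ : F → E), 0 < δ₁ ∧ δ₁ ≤ δ ∧ 0 < η ∧
      (∀ y, t.nm m y < η → s.nm (3 * r) (ψ y) < δ₁ ∧ g (ψ y) = y) ∧
      (∀ u, s.nm (3 * r) u < δ₁ → t.nm m (g u) < η → ψ (g u) = u) ∧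
      (∀ j, ∃ C : ℝ, 0 ≤ C ∧ ∀ y, t.nm m y < η → s.nm j (ψ y) ≤ C * (1 + t.nm (j + M) y)) ∧
      ∀ j, ∃ C : ℝ, 0 ≤ C ∧ ∀ y y', t.nm m y < η → t.nm m y' < η →
        s.nm j (ψ y' - ψ y) ≤
          C * ((1 + t.nm (j + M) y + t.nm (j + M) y') * t.nm (j + M) (y' - y)) := by
  obtain ⟨δ₁, hδ₁, hle, hL⟩ := h.lipschitz
  -- Solutions are sought in the smaller ball of radius `δ₁`, on which the Lipschitz estimate holds.
  -- There the solution is unique and depends on `y` with tame Lipschitz bounds.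
  obtain ⟨m, η, hη, C, hC, hsol⟩ := (h.mono hδ₁ hle).exists_solution hsm
  choose! ψ hψ₁ hψ₂ hψ₃ using hsol
  refine ⟨m, m + 2 * r, δ₁, η, ψ, hδ₁, hle, hη, fun y hy => ⟨hψ₁ y hy, hψ₂ y hy⟩,
    fun u hu hgu => ?_, fun j => ⟨C j, hC j, fun y hy => (hψ₃ y hy j).trans ?_⟩, fun j => ?_⟩
  · refine sub_eq_zero.1 (s.eq_zero_of_nm (j := 0) ?_)
    obtain ⟨K, hK, hL⟩ := hL 0
    have := hL u (ψ (g u) - u) hu (by rw [add_sub_cancel]; exact hψ₁ _ hgu)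
    rw [add_sub_cancel, hψ₂ _ hgu, sub_self, t.nm_zero, t.nm_zero, mul_zero, add_zero,
      mul_zero] at this
    exact le_antisymm this (s.nm_nonneg _ _)
  · exact mul_le_mul_of_nonneg_left (by linarith [t.nm_mono (by omega : j + m ≤ j + (m + 2 * r)) y])
      (hC j)
  · obtain ⟨K, hK, hL⟩ := hL j
    have hCj := hC (j + 2 * r)
    refine ⟨K * (2 + 2 * C (j + 2 * r)), by positivity, fun y y' hy hy' => ?_⟩
    have h1 := hL (ψ y) (ψ y' - ψ y) (hψ₁ y hy) (by rw [add_sub_cancel]; exact hψ₁ _ hy')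
    rw [add_sub_cancel, hψ₂ y hy, hψ₂ y' hy'] at h1
    refine h1.trans ?_
    rw [mul_assoc]
    refine mul_le_mul_of_nonneg_left ?_ hK
    have e : j + 2 * r + m = j + (m + 2 * r) := by ring
    have k1 := hψ₃ y hy (j + 2 * r)
    have k2 := hψ₃ y' hy' (j + 2 * r)
    rw [e] at k1 k2
    have k3 := t.nm_mono (by omega : 2 * r ≤ j + (m + 2 * r)) (y' - y)
    have k4 := t.nm_mono (by omega : j + 2 * r ≤ j + (m + 2 * r)) (y' - y)
    obtain ⟨a, ha⟩ : ∃ a, a = t.nm (j + (m + 2 * r)) y := ⟨_, rfl⟩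
    obtain ⟨b, hb⟩ : ∃ a, a = t.nm (j + (m + 2 * r)) y' := ⟨_, rfl⟩
    obtain ⟨d, hd⟩ : ∃ a, a = t.nm (j + (m + 2 * r)) (y' - y) := ⟨_, rfl⟩
    have ha0 : 0 ≤ a := ha ▸ t.nm_nonneg _ _
    have hb0 : 0 ≤ b := hb ▸ t.nm_nonneg _ _
    have hd0 : 0 ≤ d := hd ▸ t.nm_nonneg _ _
    rw [← ha] at k1 ⊢
    rw [← hb] at k2 ⊢
    rw [← hd] at k3 k4 ⊢
    have n1 := s.nm_nonneg (j + 2 * r) (ψ y)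
    have n2 := s.nm_nonneg (j + 2 * r) (ψ y')
    have k5 : 1 + s.nm (j + 2 * r) (ψ y) + s.nm (j + 2 * r) (ψ y') ≤
        1 + 2 * C (j + 2 * r) * (1 + a + b) := by
      have i1 : 0 ≤ C (j + 2 * r) * a := mul_nonneg hCj ha0
      have i2 : 0 ≤ C (j + 2 * r) * b := mul_nonneg hCj hb0
      linarith
    have k6 := mul_le_mul k5 k3 (t.nm_nonneg _ _) (by linarith)
    have k7 : 0 ≤ (a + b) * d := by positivity
    linarith

/-- A map with tame Lipschitz estimates is levelwise continuous. -/
theorem lct_of_lipschitz {ψ : F → E} {m M : ℕ} {η : ℝ}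
    (hb : ∀ j, ∃ C : ℝ, 0 ≤ C ∧ ∀ y, t.nm m y < η → s.nm j (ψ y) ≤ C * (1 + t.nm (j + M) y))
    (hL : ∀ j, ∃ C : ℝ, 0 ≤ C ∧ ∀ y y', t.nm m y < η → t.nm m y' < η →
      s.nm j (ψ y' - ψ y) ≤
        C * ((1 + t.nm (j + M) y + t.nm (j + M) y') * t.nm (j + M) (y' - y))) :
    LCT True t s {y | t.nm m y < η} ψ := by
  have hmem : ∀ y, t.nm m y < η → {z | t.nm m z < η} ∈ t.nh m y := fun y hy => by
    simpa using t.ball_mem_nh_of_mem (x := 0) (ε := η) (y := y) (by simpa using hy)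
  intro y hy
  refine ⟨M + m, _, t.nh_anti (by omega) y (hmem y hy), subset_rfl, fun z hz j => ?_,
    fun _ j => ?_⟩
  · obtain ⟨C, hC, hL⟩ := hL j
    have h1 : Tendsto (fun p => t.nm (j + M) p) (t.nh (j + (M + m)) z) (𝓝 (t.nm (j + M) z)) :=
      (t.tendsto_nm (j + M) z).mono_left (t.nh_anti (by omega) z)
    have h2 : Tendsto (fun p => t.nm (j + M) (p - z)) (t.nh (j + (M + m)) z) (𝓝 0) :=
      (t.tendsto_nh_iff_nm.1 tendsto_id).mono_left (t.nh_anti (by omega) z)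
    have h3 := ((h1.const_add (1 + t.nm (j + M) z)).mul h2).const_mul C
    rw [mul_zero, mul_zero] at h3
    refine s.tendsto_nh_iff_nm.2 (squeeze_zero' (Eventually.of_forall fun _ => s.nm_nonneg _ _)
      ?_ h3)
    filter_upwards [t.nh_anti (by omega : m ≤ j + (M + m)) z (hmem z hz)] with p hp
    exact hL z p hz hp
  · obtain ⟨C, hC, hb⟩ := hb j
    refine ⟨C, hC, fun z hz => (hb z hz).trans (mul_le_mul_of_nonneg_left ?_ hC)⟩
    linarith [t.nm_mono (by omega : j + M ≤ j + (M + m)) z]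

/-- The derivative of the local inverse. -/
theorem TameNewton.hd_inverse {g : E → F} {A : E → E →ₗ[𝕜] F} {r : ℕ} {δ : ℝ}
    (h : TameNewton s t g A r δ) {ψ : F → E} {m M : ℕ} {η : ℝ}
    (hψ : ∀ y, t.nm m y < η → s.nm r (ψ y) < δ ∧ g (ψ y) = y)
    (hL : ∀ j, ∃ C : ℝ, 0 ≤ C ∧ ∀ y y', t.nm m y < η → t.nm m y' < η →
      s.nm j (ψ y' - ψ y) ≤
        C * ((1 + t.nm (j + M) y + t.nm (j + M) y') * t.nm (j + M) (y' - y)))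
    {y : F} (hy : t.nm m y < η) {L : F →L[𝕜] E} (hAL : ∀ w, A (ψ y) (L w) = w) : HD ψ y L := by
  intro h₀
  refine s.tendsto_nhds_iff.2 fun j => s.tendsto_nh_iff_nm.2 ?_
  obtain ⟨C₁, hC₁, hi⟩ := h.inverse j
  obtain ⟨C₂, hC₂, ht⟩ := h.taylor (j + r)
  obtain ⟨C₃, hC₃, hL⟩ := hL (j + r + r)
  obtain ⟨N, hN⟩ : ∃ N, N = j + r + r + M := ⟨_, rfl⟩
  rw [← hN] at hL
  obtain ⟨l, hl⟩ : ∃ l : Filter (F × ℝ), l = 𝓝 h₀ ×ˢ 𝓝[>] 0 := ⟨_, rfl⟩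
  rw [← hl]
  have hy' : Tendsto (fun p : F × ℝ => y + (p.2 : 𝕜) • p.1) l (𝓝 y) := by
    rw [hl]; exact tendsto_add_smul y h₀
  have hfst : Tendsto (fun p : F × ℝ => p.1) l (𝓝 h₀) := by rw [hl]; exact tendsto_fst
  have hsnd : Tendsto (fun p : F × ℝ => p.2) l (𝓝 0) := by
    rw [hl]; exact tendsto_snd.mono_right nhdsWithin_le_nhds
  obtain ⟨b, hb⟩ : ∃ b : F × ℝ → ℝ, b = fun p => C₃ * ((1 + t.nm N y +
    t.nm N (y + (p.2 : 𝕜) • p.1)) * t.nm N p.1) := ⟨_, rfl⟩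
  have hbl : Tendsto b l (𝓝 (C₃ * ((1 + t.nm N y + t.nm N y) * t.nm N h₀))) := by
    rw [hb]
    exact ((((t.tendsto_nm_nhds N y).comp hy').const_add _).mul
      ((t.tendsto_nm_nhds N h₀).comp hfst)).const_mul _
  obtain ⟨K, hK⟩ : ∃ K, K = C₁ * ((2 + s.nm (j + r) (ψ y)) *
    (C₂ * (2 + s.nm (j + r + r) (ψ y)))) := ⟨_, rfl⟩
  have h1 : Tendsto (fun p => K * (p.2 * b p ^ 2)) l (𝓝 0) := by
    have := (hsnd.mul (hbl.pow 2)).const_mul K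
    simpa using this
  have h2 : Tendsto (fun p : F × ℝ => s.nm j (L p.1 - L h₀)) l (𝓝 0) :=
    s.tendsto_nh_iff_nm.1 ((s.tendsto_nhds_iff.1 ((L.continuous.tendsto h₀).comp hfst)) j)
  have h3 := h1.add h2
  rw [add_zero] at h3
  refine squeeze_zero' (Eventually.of_forall fun _ => s.nm_nonneg _ _) ?_ h3
  have hpos : ∀ᶠ p : F × ℝ in l, 0 < p.2 := by rw [hl]; exact eventually_snd_pos h₀
  filter_upwards [hpos, hy'.eventually ((t.isOpen_nm_lt m η).mem_nhds hy)] with p hp hpη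
  replace hpη : t.nm m (y + (p.2 : 𝕜) • p.1) < η := hpη
  have hne : (p.2 : 𝕜) ≠ 0 := by exact_mod_cast hp.ne'
  -- By the Lipschitz estimate `D` is of order `t`, so the Taylor remainder of `g` is of order `t²`.
  -- Up to the factor `1 / t`, this remainder is the image under `A (ψ y)` of `D / t - L h`, so the
  -- tame inverse estimate bounds `D / t - L h` by a multiple of `t`.
  obtain ⟨D, hD⟩ : ∃ D, D = ψ (y + (p.2 : 𝕜) • p.1) - ψ y := ⟨_, rfl⟩
  have hDb : s.nm (j + r + r) D ≤ p.2 * b p := by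
    have := hL y _ hy hpη
    rw [← hD, add_sub_cancel_left, t.nm_real_smul _ hp.le] at this
    rw [hb]
    linarith
  have hψD : ψ y + D = ψ (y + (p.2 : 𝕜) • p.1) := by rw [hD]; abel
  have ht := ht (ψ y) D (hψ y hy).1 (by rw [hψD]; exact (hψ _ hpη).1)
  rw [hψD, (hψ _ hpη).2, (hψ _ hy).2, add_sub_cancel_left] at ht
  have hi := hi (ψ y) (hψ y hy).1 ((p.2 : 𝕜)⁻¹ • D - L p.1)
  have e : A (ψ y) ((p.2 : 𝕜)⁻¹ • D - L p.1) =
      -(((p.2⁻¹ : ℝ) : 𝕜) • ((p.2 : 𝕜) • p.1 - A (ψ y) D)) := by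
    rw [map_sub, hAL, map_smul, smul_sub, RCLike.ofReal_inv, inv_smul_smul₀ hne]; abel
  have hn1 : ∀ i, t.nm i (A (ψ y) ((p.2 : 𝕜)⁻¹ • D - L p.1)) =
      p.2⁻¹ * t.nm i ((p.2 : 𝕜) • p.1 - A (ψ y) D) := fun i => by
    rw [e, map_neg_eq_map, t.nm_real_smul _ (inv_nonneg.2 hp.le)]
  rw [hn1, hn1] at hi
  obtain ⟨Q, hQ⟩ : ∃ Q, Q = t.nm (j + r) ((p.2 : 𝕜) • p.1 - A (ψ y) D) := ⟨_, rfl⟩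
  have hQr : t.nm r ((p.2 : 𝕜) • p.1 - A (ψ y) D) ≤ Q := hQ ▸ t.nm_mono (by omega) _
  rw [← hQ] at hi ht
  have hinv0 : 0 ≤ p.2⁻¹ := inv_nonneg.2 hp.le
  have n0 := s.nm_nonneg (j + r) (ψ y)
  have n1 := s.nm_nonneg (j + r + r) (ψ y)
  have nD := s.nm_nonneg (j + r + r) D
  have nr := s.nm_mono (by omega : r ≤ j + r + r) D
  have nr0 := s.nm_nonneg r D
  have hQb : Q ≤ C₂ * (2 + s.nm (j + r + r) (ψ y)) * (p.2 * b p) ^ 2 := by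
    refine ht.trans ?_
    rw [mul_assoc]
    refine mul_le_mul_of_nonneg_left ?_ hC₂
    have i1 : s.nm r D * s.nm (j + r + r) D ≤ (p.2 * b p) ^ 2 := by nlinarith
    have i2 : s.nm r D ^ 2 ≤ (p.2 * b p) ^ 2 := by nlinarith
    nlinarith
  have hfin : s.nm j ((p.2 : 𝕜)⁻¹ • D - L p.1) ≤ K * (p.2 * b p ^ 2) := by
    have i1 : s.nm j ((p.2 : 𝕜)⁻¹ • D - L p.1) ≤
        C₁ * ((2 + s.nm (j + r) (ψ y)) * (p.2⁻¹ * Q)) := by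
      refine hi.trans (mul_le_mul_of_nonneg_left ?_ hC₁)
      have := mul_le_mul_of_nonneg_left (mul_le_mul_of_nonneg_left hQr hinv0)
        (by linarith : 0 ≤ 1 + s.nm (j + r) (ψ y))
      linarith
    refine i1.trans ?_
    have i2 : p.2⁻¹ * Q ≤ C₂ * (2 + s.nm (j + r + r) (ψ y)) * (p.2 * b p ^ 2) := by
      refine (mul_le_mul_of_nonneg_left hQb hinv0).trans_eq ?_
      field_simp
    rw [hK, mul_assoc, mul_assoc]
    exact mul_le_mul_of_nonneg_left (mul_le_mul_of_nonneg_left i2 (by linarith)) hC₁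
  have := s.nm_add j ((p.2 : 𝕜)⁻¹ • D - L p.1) (L p.1 - L h₀)
  rw [sub_add_sub_cancel] at this
  rw [← hD]
  linarith

/-- Local inversion: a map of class `k ≥ 2` whose derivatives have tame inverses near `x₀` has a
local inverse of class `k`. -/
theorem SCN.exists_local_inverse {k : ℕ∞} (hk : 2 ≤ k) {G : E → F} {U : Set E} {A : E → E →L[𝕜] F}
    {x₀ : E} (hsm : s.HasSmoothing) (hG : ∀ n : ℕ, (n : ℕ∞) ≤ k → SCN True n s t U G)
    (hA : ∀ x ∈ U, HD G x (A x)) (hx₀ : x₀ ∈ U)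
    (hinv : ∃ r, ∃ V ∈ s.nh r x₀, (∀ x ∈ V, Function.Bijective (A x)) ∧
      ∀ j, ∃ C : ℝ, 0 ≤ C ∧ ∀ x ∈ V, ∀ v, s.nm j v ≤
        C * ((1 + s.nm (j + r) x) * t.nm r (A x v) + t.nm (j + r) (A x v))) :
    ∃ (m : ℕ) (η : ℝ) (B : Set E) (ψ : F → E) (V : E → F →L[𝕜] E), 0 < η ∧ IsOpen B ∧ x₀ ∈ B ∧
      B ⊆ U ∧ (∀ x ∈ B, ∀ w, A x (V x w) = w) ∧
      (∀ y, t.nm m (y - G x₀) < η → ψ y ∈ B ∧ G (ψ y) = y ∧ HD ψ y (V (ψ y))) ∧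
      (∀ x ∈ B, t.nm m (G x - G x₀) < η → ψ (G x) = x) ∧
      ∀ n : ℕ, (n : ℕ∞) ≤ k → SCN True n t s {y | t.nm m (y - G x₀) < η} ψ := by
  obtain ⟨r, δ, hδU, hN⟩ := SCN.tameNewton (hG 2 hk) hA hx₀ hinv
  obtain ⟨m, M, δ₁, η, ψ, hδ₁, hle, hη, hψ, hψG, hb, hL⟩ := hN.exists_inverse hsm
  have hlow : ∀ x, s.nm (3 * r) (x - x₀) < δ₁ → s.nm r (x - x₀) < δ := fun x hx =>
    (s.nm_mono (by omega) _).trans_lt (hx.trans_le hle)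
  obtain ⟨B, hB⟩ : ∃ B, B = {x | s.nm (3 * r) (x - x₀) < δ₁} := ⟨_, rfl⟩
  have hmemB : ∀ x, x ∈ B ↔ s.nm (3 * r) (x - x₀) < δ₁ := fun x => by rw [hB]; rfl
  have hBo : IsOpen B := by rw [hB]; exact s.isOpen_ball _ _ _
  have hBU : B ⊆ U := fun x hx => hδU (hlow x ((hmemB x).1 hx))
  have hVex : ∀ x, ∃ V : F →L[𝕜] E, x ∈ B → (∀ w, A x (V w) = w) ∧ ∀ v, V (A x v) = v := by
    intro x
    by_cases hx : x ∈ B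
    swap
    · exact ⟨0, fun h => absurd h hx⟩
    have hx' := hlow x ((hmemB x).1 hx)
    have hbij : Function.Bijective (A x).toLinearMap := by
      simpa using hN.bijective (x - x₀) hx'
    let e := LinearEquiv.ofBijective (A x).toLinearMap hbij
    have hAe : ∀ w, A x (e.symm w) = w := fun w => e.apply_symm_apply w
    have heA : ∀ v, e.symm (A x v) = v := fun v => e.symm_apply_apply v
    refine ⟨⟨e.symm.toLinearMap, t.continuous_of_bounds s _ fun j => ?_⟩, fun _ => ⟨hAe, heA⟩⟩
    obtain ⟨C, hC, hi⟩ := hN.inverse j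
    refine ⟨j + r, C * (2 + s.nm (j + r) (x - x₀)), fun w => (hi (x - x₀) hx' _).trans ?_⟩
    have hw : (A (x₀ + (x - x₀))).toLinearMap (e.symm.toLinearMap w) = w := by
      rw [add_sub_cancel]; exact hAe w
    rw [hw, mul_assoc]
    refine mul_le_mul_of_nonneg_left ?_ hC
    have := mul_le_mul_of_nonneg_left (t.nm_mono (by omega : r ≤ j + r) w)
      (by linarith [s.nm_nonneg (j + r) (x - x₀)] : 0 ≤ 1 + s.nm (j + r) (x - x₀))
    linarith
  choose V hV using hVex
  have hAV : ∀ x ∈ B, ∀ w, A x (V x w) = w := fun x hx => (hV x hx).1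
  have hVA : ∀ x ∈ B, ∀ v, V x (A x v) = v := fun x hx => (hV x hx).2
  have hVb : ∀ j, ∃ C : ℝ, 0 ≤ C ∧ ∀ x ∈ B, ∀ w,
      s.nm j (V x w) ≤ C * ((1 + s.nm (j + r) x) * t.nm r w + t.nm (j + r) w) := by
    intro j
    obtain ⟨C, hC, hi⟩ := hN.inverse j
    have h0 := s.nm_nonneg (j + r) x₀
    refine ⟨C * (1 + s.nm (j + r) x₀), by positivity, fun x hx w => ?_⟩
    refine (hi (x - x₀) (hlow x ((hmemB x).1 hx)) _).trans ?_
    have hw : (A (x₀ + (x - x₀))).toLinearMap (V x w) = w := by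
      rw [add_sub_cancel]; exact hAV x hx w
    rw [hw, mul_assoc]
    refine mul_le_mul_of_nonneg_left ?_ hC
    have h1 := s.nm_sub (j + r) x x₀
    have h2 := s.nm_nonneg (j + r) x
    have h3 := mul_le_mul_of_nonneg_right (by nlinarith : 1 + s.nm (j + r) (x - x₀) ≤
      (1 + s.nm (j + r) x₀) * (1 + s.nm (j + r) x)) (t.nm_nonneg r w)
    have h4 := mul_nonneg h0 (t.nm_nonneg (j + r) w)
    linarith
  have hlct : LCT True t s {y | t.nm m (y - G x₀) < η} fun y => x₀ + ψ (y - G x₀) := by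
    have h1 : SCN True 0 t t univ fun y => y - G x₀ :=
      SCN.sub (SCN.clm 0 (T := ContinuousLinearMap.id 𝕜 F) TameLin.id) (SCN.const 0 (G x₀))
    have h2 : LCT True t s {y | t.nm m (y - G x₀) < η} fun y => ψ (y - G x₀) :=
      (lct_of_lipschitz hb hL).comp (h1.lct.mono (t.isOpen_ball _ _ _) (subset_univ _))
        fun y hy => hy
    exact ((SCN.const 0 x₀).mono (t.isOpen_ball _ _ _) (subset_univ _)).add (n := 0) h2
  have hmem : ∀ y, t.nm m (y - G x₀) < η → x₀ + ψ (y - G x₀) ∈ B := fun y hy => by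
    rw [hmemB, add_sub_cancel_left]; exact (hψ _ hy).1
  have hhd : ∀ y, t.nm m (y - G x₀) < η → HD (fun y => x₀ + ψ (y - G x₀)) y
      (V (x₀ + ψ (y - G x₀))) := by
    intro y hy
    have h1 : HD ψ (y + -G x₀) (V (x₀ + ψ (y - G x₀))) := by
      rw [← sub_eq_add_neg]
      refine hN.hd_inverse (fun z hz => ⟨(s.nm_mono (by omega) _).trans_lt
        ((hψ z hz).1.trans_le hle), (hψ z hz).2⟩) hL hy fun w => ?_
      exact hAV _ (hmem y hy) w
    have h2 : HD (fun z : F => z + -G x₀) y (ContinuousLinearMap.id 𝕜 F) :=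
      HD.of_clm (ContinuousLinearMap.id 𝕜 F) (-G x₀) y
    have h3 := (HD.const x₀ y).add (h1.comp (f := fun z : F => z + -G x₀) h2)
    rw [zero_add, ContinuousLinearMap.comp_id] at h3
    simpa only [sub_eq_add_neg] using h3
  refine ⟨m, η, B, fun y => x₀ + ψ (y - G x₀), V, hη, hBo, ?_, hBU, hAV, fun y hy =>
    ⟨hmem y hy, ?_, hhd y hy⟩, fun x hx hGx => ?_, fun n => ?_⟩
  · rw [hmemB, sub_self, s.nm_zero]; exact hδ₁
  · exact sub_left_injective (hψ _ hy).2
  · have := hψG (x - x₀) ((hmemB x).1 hx)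
    simp only [add_sub_cancel] at this
    simp only [this hGx, add_sub_cancel]
  · induction n with
    | zero => exact fun _ => hlct
    | succ n ih =>
      intro hn
      have hn' : (n : ℕ∞) ≤ k := le_trans (by exact_mod_cast Nat.le_succ n) hn
      -- Bootstrapping: the derivative of the local inverse is `V` composed with the local inverse.
      -- The latter is of class `n` by induction, and `V` is of class `n` because the derivative of
      -- `G` is, so the local inverse is of class `n + 1`.
      refine ⟨hlct, fun z => V (x₀ + ψ (z.1 - G x₀)) z.2,
        fun y hy => ⟨_, hhd y hy, fun _ => rfl⟩, ?_⟩
      have hAn : SCN True n (s.prod s) t (U ×ˢ univ) fun z : E × E => A z.1 z.2 :=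
        SCN.deriv (hG (n + 1) hn) fun x hx => ⟨A x, hA x hx, fun _ => rfl⟩
      have hVlct := LCT.inverse hAn.lct hBo hBU hAV hVA hVb
      have hVn := SCN.inverse_family hBo hBU hAV hVA hVlct n hAn
      have hO : IsOpen ({y | t.nm m (y - G x₀) < η} ×ˢ univ : Set (F × F)) :=
        (t.isOpen_ball _ _ _).prod isOpen_univ
      have p1 : SCN True n (t.prod t) t ({y | t.nm m (y - G x₀) < η} ×ˢ univ)
          fun z : F × F => z.1 :=
        (SCN.clm n (T := ContinuousLinearMap.fst 𝕜 F F) TameLin.fst).mono hO (subset_univ _)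
      have p2 : SCN True n (t.prod t) t ({y | t.nm m (y - G x₀) < η} ×ˢ univ)
          fun z : F × F => z.2 :=
        (SCN.clm n (T := ContinuousLinearMap.snd 𝕜 F F) TameLin.snd).mono hO (subset_univ _)
      exact SCN.comp n hVn (SCN.prodMk n (SCN.comp n (ih hn') p1 fun z hz => hz.1) p2)
        fun z hz => ⟨hmem _ hz.1, mem_univ _⟩

end LocalInverse

end ScStructure

/-! ### Riesz theory of compact perturbations of the identity on a Banach space. -/

section CompactPerturbation

variable {𝕜 : Type*} [RCLike 𝕜]
variable {X : Type*} [NormedAddCommGroup X] [NormedSpace 𝕜 X] {K : X →L[𝕜] X}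

/-- On the kernel `-K` is the identity, so the identity of the kernel is compact. -/
theorem IsCompactOperator.finiteDimensional_ker_id_add (hK : IsCompactOperator K) :
    FiniteDimensional 𝕜 (ContinuousLinearMap.id 𝕜 X + K).ker := by
  obtain ⟨N, hN⟩ : ∃ N, N = (ContinuousLinearMap.id 𝕜 X + K).ker := ⟨_, rfl⟩
  have hmem : ∀ x ∈ N, -K x = x := fun x hx => by
    rw [hN, LinearMap.mem_ker] at hx
    exact (eq_neg_of_add_eq_zero_left hx).symm
  have hcl : IsClosed (N : Set X) := by rw [hN]; exact ContinuousLinearMap.isClosed_ker _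
  have hV : ∀ x ∈ N, (-K : X →L[𝕜] X).toLinearMap x ∈ N := fun x hx => by
    have : (-K : X →L[𝕜] X).toLinearMap x = x := hmem x hx
    rwa [this]
  have h := IsCompactOperator.restrict (f := (-K : X →L[𝕜] X).toLinearMap) hK.neg hV hcl
  rw [← hN]
  refine FiniteDimensional.of_isCompactOperator_id ?_
  have e : ((-K : X →L[𝕜] X).toLinearMap.restrict hV : N → N) = id :=
    funext fun x => Subtype.ext (hmem x x.2)
  rwa [e] at h

variable [CompleteSpace X]

/-- This is the Fredholm alternative at `-1`: injectivity excludes an eigenvalue, so `-1` lies in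
the resolvent set. -/
theorem IsCompactOperator.surjective_id_add (hK : IsCompactOperator K)
    (hinj : ∀ x, x + K x = 0 → x = 0) (y : X) : ∃ x, x + K x = y := by
  rcases hK.hasEigenvalue_or_mem_resolventSet (μ := -1) (by simp) with h | h
  · obtain ⟨v, hv⟩ := h.exists_hasEigenvector
    refine absurd (hinj v ?_) hv.2
    have : K v = (-1 : 𝕜) • v := hv.apply_eq_smul
    rw [this]; simp
  · rw [spectrum.mem_resolventSet_iff, ContinuousLinearMap.isUnit_iff_bijective] at h
    obtain ⟨x, hx⟩ := h.2 (-y)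
    refine ⟨x, ?_⟩
    have : -x - K x = -y := by simpa [Algebra.algebraMap_eq_smul_one] using hx
    rw [← neg_inj, ← this]; abel

/-- If an algebraic complement `C` of the range were infinite-dimensional, the kernel would embed
into it by some `J`. Adding the finite-rank operator `J ∘ q`, with `q` a projection onto the kernel,
makes the operator injective, hence onto. Then `C` lies in the range of `J` and is
finite-dimensional. -/
theorem IsCompactOperator.cofg_range_id_add (hK : IsCompactOperator K) :
    FiniteDimensional 𝕜 (X ⧸ (ContinuousLinearMap.id 𝕜 X + K).range) := by
  have hfd := hK.finiteDimensional_ker_id_add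
  obtain ⟨N, hN⟩ : ∃ N, N = (ContinuousLinearMap.id 𝕜 X + K).ker := ⟨_, rfl⟩
  rw [← hN] at hfd
  obtain ⟨q, hq⟩ := Submodule.ClosedComplemented.of_finiteDimensional N
  obtain ⟨C, hC⟩ := (ContinuousLinearMap.id 𝕜 X + K).range.exists_isCompl
  suffices FiniteDimensional 𝕜 C from
    (Submodule.quotientEquivOfIsCompl _ C hC).symm.finiteDimensional
  by_contra hcon
  have hrank : (Module.finrank 𝕜 N : Cardinal) ≤ Module.rank 𝕜 C := by
    refine (Cardinal.natCast_lt_aleph0.le).trans (not_lt.1 fun h => hcon ?_)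
    exact Module.rank_lt_aleph0_iff.1 h
  obtain ⟨j, hj⟩ := Module.le_rank_iff_exists_linearMap.1 hrank
  let J : N →ₗ[𝕜] X := C.subtype ∘ₗ j ∘ₗ (Module.finBasis 𝕜 N).equivFun.toLinearMap
  have hJC : ∀ n, J n ∈ C := fun n => (j _).2
  have hJ : Function.Injective J :=
    Subtype.val_injective.comp (hj.comp (Module.finBasis 𝕜 N).equivFun.injective)
  let T : X →L[𝕜] X := K + J.toContinuousLinearMap.comp q
  have hT : IsCompactOperator T := by
    refine hK.add ?_
    have : IsCompactOperator (id : N → N) := isCompactOperator_id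
    exact (this.clm_comp J.toContinuousLinearMap).comp_clm q
  have hTx : ∀ x, x + T x = (x + K x) + J (q x) := fun x => (add_assoc _ _ _).symm
  have hR : ∀ x, x + K x ∈ (ContinuousLinearMap.id 𝕜 X + K).range := fun x => ⟨x, rfl⟩
  have hdisj : ∀ x c, c ∈ C → x + K x = c → c = 0 := fun x c hc h =>
    Submodule.disjoint_def.1 hC.disjoint c (h ▸ hR x) hc
  have hsurj := hT.surjective_id_add fun x hx => by
    rw [hTx] at hx
    have h1 := hdisj x _ (C.neg_mem (hJC (q x))) (eq_neg_of_add_eq_zero_left hx)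
    have h2 : q x = 0 := hJ (by rw [map_zero]; exact neg_eq_zero.1 h1)
    have h3 : x ∈ N := by
      rw [h2, map_zero, add_zero] at hx
      rw [hN]; exact hx
    have h4 := hq ⟨x, h3⟩
    rw [h2] at h4
    exact (congrArg Subtype.val h4).symm
  refine hcon ?_
  have hle : C ≤ LinearMap.range J := by
    intro c hc
    obtain ⟨x, hx⟩ := hsurj c
    rw [hTx] at hx
    have h1 := hdisj x _ (C.sub_mem hc (hJC (q x))) (eq_sub_of_add_eq hx)
    exact ⟨q x, (sub_eq_zero.1 h1).symm⟩
  exact Submodule.finiteDimensional_of_le hle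

/-- Restricting to the kernel of a projection onto the kernel leaves the range unchanged and makes
the operator injective. An injective bounded operator whose range has a finite-dimensional, hence
closed, algebraic complement has closed range. -/
theorem IsCompactOperator.isClosed_range_id_add (hK : IsCompactOperator K) :
    IsClosed ((ContinuousLinearMap.id 𝕜 X + K).range : Set X) := by
  have hfd := hK.finiteDimensional_ker_id_add
  have hcofg := hK.cofg_range_id_add
  obtain ⟨S, hS⟩ : ∃ S, S = ContinuousLinearMap.id 𝕜 X + K := ⟨_, rfl⟩
  rw [← hS] at hfd hcofg ⊢
  obtain ⟨q, hq⟩ := Submodule.ClosedComplemented.of_finiteDimensional S.ker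
  obtain ⟨C, hC⟩ := S.range.exists_isCompl
  have hCfd : FiniteDimensional 𝕜 C := (Submodule.quotientEquivOfIsCompl _ C hC).finiteDimensional
  have hr : (S.comp q.ker.subtypeL).range = S.range := by
    refine le_antisymm ?_ ?_
    · rintro _ ⟨x, rfl⟩; exact ⟨x, rfl⟩
    · rintro _ ⟨x, rfl⟩
      refine ⟨⟨x - q x, ?_⟩, ?_⟩
      · rw [LinearMap.mem_ker]
        change q (x - q x) = 0
        rw [map_sub, hq, sub_self]
      · change S (x - q x) = S x
        rw [map_sub, sub_eq_self]
        exact (q x).2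
  have : CompleteSpace q.ker := q.isClosed_ker.completeSpace_coe
  rw [← hr] at hC ⊢
  refine (S.comp q.ker.subtypeL).closed_complemented_range_of_isCompl_of_ker_eq_bot C hC
    C.closed_of_finiteDimensional ?_
  refine (Submodule.eq_bot_iff _).2 fun x hx => Subtype.ext ?_
  have h1 : q (x : X) = ⟨x, hx⟩ := hq ⟨x, hx⟩
  have h2 : q (x : X) = 0 := x.2
  have h3 : ((⟨x, hx⟩ : S.ker) : X) = 0 := congrArg Subtype.val (h1.symm.trans h2)
  exact h3

end CompactPerturbation

/-! ### Fredholm operators on the Fréchet space. -/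

namespace ScStructure

section Fredholm

variable {𝕜 : Type*} [RCLike 𝕜]
variable {E : Type u} [AddCommGroup E] [Module 𝕜 E] [TopologicalSpace E]
variable {F : Type u} [AddCommGroup F] [Module 𝕜 F] [TopologicalSpace F]

/-- A linear map that is bounded for a pair of levels extends to these levels. -/
theorem exists_extension (s : ScStructure 𝕜 E) (t : ScStructure 𝕜 F) {T : E →ₗ[𝕜] F} {i j : ℕ}
    (h : ∃ C : ℝ, ∀ x, t.nm j (T x) ≤ C * s.nm i x) :
    ∃ A : s.X i →L[𝕜] t.X j, ∀ x, A (s.π i x) = t.π j (T x) :=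
  ⟨((t.π j).toLinearMap ∘ₗ T).extendOfNorm (s.π i).toLinearMap, fun x =>
    LinearMap.extendOfNorm_eq (f := (t.π j).toLinearMap ∘ₗ T) (e := (s.π i).toLinearMap)
      (s.denseRange_π i) h x⟩

theorem clm_ext (s : ScStructure 𝕜 E) {i : ℕ} {Y : Type*} [NormedAddCommGroup Y]
    [NormedSpace 𝕜 Y] {A B : s.X i →L[𝕜] Y} (h : ∀ x, A (s.π i x) = B (s.π i x)) : A = B :=
  ContinuousLinearMap.ext fun y => congrFun
    ((s.denseRange_π i).equalizer A.continuous B.continuous (funext h)) y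

variable {s : ScStructure 𝕜 E} {κ : E →ₗ[𝕜] E} {r : ℕ}

/-- A smoothing operator extends to a compact operator whose values come from `E`. -/
theorem exists_compact_extension (hκ : ∀ j, ∃ C : ℝ, ∀ v, s.nm j (κ v) ≤ C * s.nm r v) :
    ∃ K : s.X r →L[𝕜] s.X r, IsCompactOperator K ∧ (∀ x, K (s.π r x) = s.π r (κ x)) ∧
      ∀ y, ∃ x, K y = s.π r x := by
  choose A hA using fun j => s.exists_extension s (hκ j)
  have hcomp : ∀ j, (s.ι j).comp (A (j + 1)) = A j := fun j => s.clm_ext fun x => by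
    rw [ContinuousLinearMap.comp_apply, hA, hA, s.ι_π]
  refine ⟨A r, ?_, hA r, fun y => ?_⟩
  · rw [← hcomp r]; exact (s.ι_compact r).comp_clm (A (r + 1))
  -- The extensions of `κ` from level `r` to all levels are compatible, so the values at one `y` of
  -- level `r` form a point of the projective limit.
  · obtain ⟨x, hx, -⟩ := s.existsUnique_lift (fun j => A j y) fun j =>
      congrArg (fun B : s.X r →L[𝕜] s.X j => B y) (hcomp j)
    exact ⟨x, (hx r).symm⟩

theorem finiteDimensional_ker_id_add (hκ : ∀ j, ∃ C : ℝ, ∀ v, s.nm j (κ v) ≤ C * s.nm r v) :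
    FiniteDimensional 𝕜 (LinearMap.ker (LinearMap.id + κ)) := by
  obtain ⟨K, hK, hKκ, -⟩ := exists_compact_extension hκ
  have := hK.finiteDimensional_ker_id_add
  have hmem : ∀ x ∈ LinearMap.ker (LinearMap.id + κ),
      (s.π r).toLinearMap x ∈ (ContinuousLinearMap.id 𝕜 (s.X r) + K).ker := by
    intro x hx
    rw [LinearMap.mem_ker] at hx ⊢
    change s.π r x + K (s.π r x) = 0
    have hx' : x + κ x = 0 := hx
    rw [hKκ, ← map_add, hx', map_zero]
  refine FiniteDimensional.of_injective ((s.π r).toLinearMap.restrict hmem) ?_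
  exact fun x y h => Subtype.ext (s.π_injective r (congrArg Subtype.val h))

/-- The range is the preimage under `π r` of the range of the extension `id + K`. Indeed, if `x + K
x` comes from `E`, then so does `x`, since `K x` always does. Closedness and finite codimension are
inherited from the Banach level. -/
theorem closed_cofg_range_id_add (hκ : ∀ j, ∃ C : ℝ, ∀ v, s.nm j (κ v) ≤ C * s.nm r v) :
    IsClosed (LinearMap.range (LinearMap.id + κ) : Set E) ∧
      FiniteDimensional 𝕜 (E ⧸ LinearMap.range (LinearMap.id + κ)) := by
  obtain ⟨K, hK, hKκ, hKE⟩ := exists_compact_extension hκ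
  have hfd := hK.cofg_range_id_add
  have hcl := hK.isClosed_range_id_add
  have hr : LinearMap.range (LinearMap.id + κ) =
      (ContinuousLinearMap.id 𝕜 (s.X r) + K).range.comap (s.π r).toLinearMap := by
    refine le_antisymm ?_ ?_
    · rintro _ ⟨x, rfl⟩
      refine ⟨s.π r x, ?_⟩
      change s.π r x + K (s.π r x) = s.π r (x + κ x)
      rw [hKκ, map_add]
    · rintro y ⟨x, hx⟩
      replace hx : x + K x = s.π r y := hx
      obtain ⟨e, he⟩ := hKE x
      have h1 : x = s.π r (y - e) := by rw [map_sub, ← hx, ← he]; abel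
      refine ⟨y - e, s.π_injective r ?_⟩
      change s.π r ((y - e) + κ (y - e)) = s.π r y
      rw [map_add, ← hKκ, ← h1, hx]
  rw [hr]
  refine ⟨hcl.preimage (s.π r).continuous, ?_⟩
  refine FiniteDimensional.of_injective (Submodule.mapQ _ _ (s.π r).toLinearMap le_rfl) ?_
  rw [← LinearMap.ker_eq_bot, Submodule.ker_mapQ]
  exact Submodule.mkQ_map_self _

/-- An operator with a parametrix modulo smoothing operators has finite-dimensional kernel and
closed range of finite codimension. -/
theorem fredholm_of_parametrix [IsTopologicalAddGroup F] [ContinuousSMul 𝕜 F]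
    {t : ScStructure 𝕜 F} {L : E →ₗ[𝕜] F} {ψ : F →ₗ[𝕜] E}
    {κ' : F →ₗ[𝕜] F} {r' : ℕ} (hκ : ∀ j, ∃ C : ℝ, ∀ v, s.nm j (κ v) ≤ C * s.nm r v)
    (hκ' : ∀ j, ∃ C : ℝ, ∀ v, t.nm j (κ' v) ≤ C * t.nm r' v)
    (h : ψ ∘ₗ L = LinearMap.id + κ) (h' : L ∘ₗ ψ = LinearMap.id + κ') :
    FiniteDimensional 𝕜 (LinearMap.ker L) ∧ IsClosed (LinearMap.range L : Set F) ∧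
      FiniteDimensional 𝕜 (F ⧸ LinearMap.range L) := by
  have h1 := finiteDimensional_ker_id_add hκ
  obtain ⟨h2, h3⟩ := closed_cofg_range_id_add hκ'
  rw [← h] at h1
  rw [← h'] at h2 h3
  refine ⟨Submodule.finiteDimensional_of_le (LinearMap.ker_le_ker_comp L ψ), ?_, ?_⟩
  · exact Submodule.isClosed_mono_of_finiteDimensional_quotient h2 (LinearMap.range_comp_le_range ψ L)
  · exact Submodule.CoFG.of_le (LinearMap.range_comp_le_range ψ L) h3

end Fredholm

end ScStructure

/-! ### Structures on closed subspaces and on finite-dimensional spaces. -/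

namespace ScStructure

section Subspace

variable {𝕜 : Type*} [RCLike 𝕜]
variable {E : Type u} [AddCommGroup E] [Module 𝕜 E] [TopologicalSpace E]
variable {F : Type u} [AddCommGroup F] [Module 𝕜 F] [TopologicalSpace F]

/-- The closure of the image of a subspace in a level. -/
noncomputable abbrev level (s : ScStructure 𝕜 E) (S : Submodule 𝕜 E) (j : ℕ) :
    Submodule 𝕜 (s.X j) := (S.map (s.π j).toLinearMap).topologicalClosure

theorem π_mem_level (s : ScStructure 𝕜 E) (S : Submodule 𝕜 E) (j : ℕ) {x : E} (hx : x ∈ S) :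
    s.π j x ∈ s.level S j :=
  (S.map (s.π j).toLinearMap).le_topologicalClosure ⟨x, hx, rfl⟩

theorem ι_mem_level (s : ScStructure 𝕜 E) (S : Submodule 𝕜 E) (j : ℕ) {y : s.X (j + 1)}
    (hy : y ∈ s.level S (j + 1)) : s.ι j y ∈ s.level S j := by
  refine map_mem_closure (s.ι j).continuous hy ?_
  rintro _ ⟨x, hx, rfl⟩
  exact ⟨x, hx, (s.ι_π j x).symm⟩

/-- The map of the chain of closed subspaces. -/
noncomputable abbrev levelMap (s : ScStructure 𝕜 E) (S : Submodule 𝕜 E) (j : ℕ) :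
    s.level S (j + 1) →L[𝕜] s.level S j :=
  ((s.ι j).comp (s.level S (j + 1)).subtypeL).codRestrict (s.level S j)
    fun y => s.ι_mem_level S j y.2

theorem denseRange_π_level (s : ScStructure 𝕜 E) (S : Submodule 𝕜 E) (j : ℕ) :
    DenseRange fun x : S => (⟨s.π j x, s.π_mem_level S j x.2⟩ : s.level S j) := by
  intro y
  rw [closure_subtype]
  refine closure_mono ?_ y.2
  rintro _ ⟨x, hx, rfl⟩
  exact ⟨_, ⟨⟨x, hx⟩, rfl⟩, rfl⟩

/-- The chain of closures of the images of a subspace. -/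
noncomputable abbrev subChain (s : ScStructure 𝕜 E) (S : Submodule 𝕜 E) : ScChain.{u} 𝕜 where
  X j := s.level S j
  complete j := (S.map (s.π j).toLinearMap).isClosed_topologicalClosure.completeSpace_coe
  ι j := s.levelMap S j
  ι_injective j x y h := Subtype.ext (s.ι_injective j (congrArg Subtype.val h))
  ι_dense j := by
    refine (s.denseRange_π_level S j).mono ?_
    rintro _ ⟨x, rfl⟩
    exact ⟨⟨s.π (j + 1) x, s.π_mem_level S (j + 1) x.2⟩, Subtype.ext (s.ι_π j x)⟩
  ι_norm j := by
    refine ContinuousLinearMap.opNorm_le_bound _ zero_le_one fun x => ?_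
    exact (s.ι j).le_of_opNorm_le (s.ι_norm j) x
  ι_compact j := ((s.ι_compact j).comp_clm (s.level S (j + 1)).subtypeL).codRestrict
    (V := s.level S j) (fun y => s.ι_mem_level S j y.2)
    (S.map (s.π j).toLinearMap).isClosed_topologicalClosure

/-- A neighbourhood is given by a single norm, so approximation in each level separately is
approximation in `E`. For closed `S` the projective limit of the closures is therefore `S` itself.
-/
theorem mem_of_forall_mem_level (s : ScStructure 𝕜 E) {S : Submodule 𝕜 E}
    (hS : IsClosed (S : Set E)) {x : E} (h : ∀ j, s.π j x ∈ s.level S j) : x ∈ S := by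
  have : x ∈ closure (S : Set E) := by
    refine mem_closure_iff_nhds.2 fun V hV => ?_
    obtain ⟨j, hj⟩ := s.mem_nhds_iff'.1 hV
    obtain ⟨ε, hε, hV⟩ := s.mem_nh_iff.1 hj
    obtain ⟨_, ⟨v, hv, rfl⟩, hd⟩ := Metric.mem_closure_iff.1 (h j) ε hε
    refine ⟨v, hV v ?_, hv⟩
    rw [dist_comm, dist_eq_norm_sub] at hd
    rw [nm_apply, map_sub]
    exact hd
  rwa [hS.closure_eq] at this

/-- The structure induced on a closed subspace. -/
noncomputable abbrev sub (s : ScStructure 𝕜 E) (S : Submodule 𝕜 E) (hS : IsClosed (S : Set E)) :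
    ScStructure 𝕜 S where
  toScChain := s.subChain S
  π j := ((s.π j).comp S.subtypeL).codRestrict (s.level S j) fun x => s.π_mem_level S j x.2
  ι_π j x := Subtype.ext (s.ι_π j x)
  existsUnique_lift := by
    intro y hy
    obtain ⟨x, hx, -⟩ := s.existsUnique_lift (fun j => (y j : s.X j)) fun j =>
      congrArg Subtype.val (hy j)
    have hxS : x ∈ S := s.mem_of_forall_mem_level hS fun j => by rw [hx j]; exact (y j).2
    refine ⟨⟨x, hxS⟩, fun j => Subtype.ext (hx j), fun z hz => Subtype.ext (s.π_injective 0 ?_)⟩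
    exact (congrArg Subtype.val (hz 0)).trans (hx 0).symm
  topology_eq := by
    have h : (inferInstance : TopologicalSpace S) = TopologicalSpace.induced Subtype.val
        (⨅ k, TopologicalSpace.induced (s.π k) inferInstance) := by
      rw [← s.topology_eq]; rfl
    rw [h, induced_iInf]
    refine iInf_congr fun k => ?_
    rw [induced_compose]
    change _ = TopologicalSpace.induced _ (TopologicalSpace.induced Subtype.val _)
    rw [induced_compose]
    rfl

theorem nm_sub_coe (s : ScStructure 𝕜 E) (S : Submodule 𝕜 E) (hS : IsClosed (S : Set E)) (j : ℕ)
    (x : S) : (s.sub S hS).nm j x = s.nm j (x : E) := rfl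

theorem coe_incl_sub (s : ScStructure 𝕜 E) (S : Submodule 𝕜 E) {m n : ℕ} (h : m ≤ n)
    (y : s.level S n) : (((s.subChain S).incl h y : s.level S m) : s.X m) = s.incl h (y : s.X n) := by
  induction n, h using Nat.le_induction with
  | base => rw [ScChain.incl_self, ScChain.incl_self]; rfl
  | succ n h ih =>
    rw [ScChain.incl_succ _ h, ScChain.incl_succ _ h]
    exact ih _

/-- Transport of a structure along an isomorphism. -/
noncomputable abbrev transport (s : ScStructure 𝕜 E) (e : F ≃L[𝕜] E) : ScStructure 𝕜 F where
  toScChain := s.toScChain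
  π j := (s.π j).comp (e : F →L[𝕜] E)
  ι_π j x := s.ι_π j (e x)
  existsUnique_lift := by
    intro y hy
    obtain ⟨x, hx, hux⟩ := s.existsUnique_lift y hy
    refine ⟨e.symm x, fun j => ?_, fun z hz => ?_⟩
    · rw [← hx j]; exact congrArg (s.π j) (e.apply_symm_apply x)
    · rw [← hux (e z) hz, e.symm_apply_apply]
  topology_eq := by
    have h : (inferInstance : TopologicalSpace F) = TopologicalSpace.induced e
        (⨅ k, TopologicalSpace.induced (s.π k) inferInstance) := by
      rw [← s.topology_eq]; exact e.toHomeomorph.isInducing.eq_induced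
    rw [h, induced_iInf]
    refine iInf_congr fun k => ?_
    rw [induced_compose]
    rfl

/-- On a finite-dimensional space all norms are equivalent. -/
theorem nm_le_of_finiteDimensional (s : ScStructure 𝕜 E) [FiniteDimensional 𝕜 E] (i j : ℕ) :
    ∃ C : ℝ, 0 ≤ C ∧ ∀ x, s.nm j x ≤ C * s.nm i x := by
  let e := LinearEquiv.ofInjective (s.π i).toLinearMap (s.π_injective i)
  have : FiniteDimensional 𝕜 (LinearMap.range (s.π i).toLinearMap) := e.finiteDimensional
  let A := ((s.π j).toLinearMap ∘ₗ e.symm.toLinearMap).toContinuousLinearMap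
  refine ⟨‖A‖, norm_nonneg _, fun x => ?_⟩
  have h : A (e x) = s.π j x := congrArg (s.π j) (e.symm_apply_apply x)
  rw [nm_apply, ← h]
  exact A.le_opNorm (e x)

/-- A continuous linear map into a finite-dimensional space is smoothing. -/
theorem exists_bound_of_finiteDimensional (s : ScStructure 𝕜 E) (t : ScStructure 𝕜 F)
    [FiniteDimensional 𝕜 F] (T : E →L[𝕜] F) :
    ∃ r, ∀ j, ∃ C : ℝ, 0 ≤ C ∧ ∀ x, t.nm j (T x) ≤ C * s.nm r x := by
  obtain ⟨r, C, hC, h⟩ := s.exists_bound t T 0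
  refine ⟨r, fun j => ?_⟩
  obtain ⟨C', hC', h'⟩ := t.nm_le_of_finiteDimensional 0 j
  refine ⟨C' * C, by positivity, fun x => (h' _).trans ?_⟩
  rw [mul_assoc]
  exact mul_le_mul_of_nonneg_left (h x) hC'

/-- For linear maps norm estimates do give extensions to the levels, by density of `E`.
Compatibility with the inclusions is also checked on `E`. -/
theorem TameLin.isTameWeakMorphism {s : ScStructure 𝕜 E} {t : ScStructure 𝕜 F} {T : E →L[𝕜] F}
    (h : TameLin s t T) : IsTameWeakMorphism s t T := by
  obtain ⟨c, h⟩ := h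
  have hex : ∀ j, ∃ A : s.X (j + c) →L[𝕜] t.X j, ∀ x, A (s.π (j + c) x) = t.π j (T x) := fun j => by
    obtain ⟨C, -, hC⟩ := h j
    exact s.exists_extension t (T := T.toLinearMap) ⟨C, hC⟩
  choose A hA using hex
  refine ⟨_, isTameSeq_add c, A, hA, fun j => ?_⟩
  have : (A j).comp (s.incl (strictMono_add_right c (Nat.lt_succ_self j)).le) =
      (t.ι j).comp (A (j + 1)) := by
    refine s.clm_ext fun x => ?_
    rw [ContinuousLinearMap.comp_apply, ContinuousLinearMap.comp_apply, s.incl_π, hA, hA, t.ι_π]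
  exact fun y => congrArg (fun B : s.X (j + 1 + c) →L[𝕜] t.X j => B y) this

end Subspace

end ScStructure

namespace PreTameSc

open ScStructure

variable {𝕜 : Type*} [RCLike 𝕜]
variable {E : Type u} [AddCommGroup E] [Module 𝕜 E] [TopologicalSpace E]
variable {F : Type u} [AddCommGroup F] [Module 𝕜 F] [TopologicalSpace F]

theorem isSubspace_ofRep_sub (P : PreTameSc 𝕜 E) (S : Submodule 𝕜 E) (hS : IsClosed (S : Set E)) :
    P.IsSubspace S (ofRep (P.rep.sub S hS)) :=
  ⟨hS, _, P.shift_rep_mem 0, _, mem_ofRep _, fun j => (P.rep.level S (j + 0)).subtypeₗᵢ,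
    fun _ y => P.rep.coe_incl_sub S _ y, fun _ _ => rfl⟩

theorem isTameMorphism_of_tameLin {P : PreTameSc 𝕜 E} {Q : PreTameSc 𝕜 F} {T : E →L[𝕜] F}
    (h : TameLin P.rep Q.rep T) : IsTameMorphism P Q T := by
  refine ⟨_, P.shift_rep_mem 0, _, Q.shift_rep_mem 0, TameLin.isTameWeakMorphism ?_⟩
  exact h

end PreTameSc

/-! ### The augmented map and the normal form. -/

namespace ScStructure

section NormalForm

variable {𝕜 : Type*} [RCLike 𝕜]
variable {E : Type u} [AddCommGroup E] [Module 𝕜 E] [TopologicalSpace E]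
  [IsTopologicalAddGroup E] [ContinuousSMul 𝕜 E]
variable {F : Type u} [AddCommGroup F] [Module 𝕜 F] [TopologicalSpace F]
  [IsTopologicalAddGroup F] [ContinuousSMul 𝕜 F]
variable {R : Type u} [AddCommGroup R] [Module 𝕜 R] [TopologicalSpace R]
  [IsTopologicalAddGroup R] [ContinuousSMul 𝕜 R]
variable {K : Type u} [AddCommGroup K] [Module 𝕜 K] [TopologicalSpace K]
  [IsTopologicalAddGroup K] [ContinuousSMul 𝕜 K]
variable {Q : Type u} [AddCommGroup Q] [Module 𝕜 Q] [TopologicalSpace Q]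
  [IsTopologicalAddGroup Q] [ContinuousSMul 𝕜 Q]
variable {s : ScStructure 𝕜 E} {t : ScStructure 𝕜 F} {tR : ScStructure 𝕜 R}
  {sK : ScStructure 𝕜 K} {tQ : ScStructure 𝕜 Q}

/-- A diffeomorphism of class `k` with tame derivatives, for fixed structures. -/
structure IsLevelDiffeo (k : ℕ∞) (s : ScStructure 𝕜 E) (t : ScStructure 𝕜 F) (W : Set E)
    (W' : Set F) (φ : E → F) (ψ : F → E) : Prop where
  mapsTo : MapsTo φ W W'
  mapsTo_inv : MapsTo ψ W' W
  invOn : InvOn ψ φ W W'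
  scn : ∀ n : ℕ, (n : ℕ∞) ≤ k → SCN True n s t W φ
  scn_inv : ∀ n : ℕ, (n : ℕ∞) ≤ k → SCN True n t s W' ψ

/-- A tame splitting of `F` into the direct sum of `R` and `Q`. -/
structure TameSplitting (t : ScStructure 𝕜 F) (tR : ScStructure 𝕜 R) (tQ : ScStructure 𝕜 Q)
    (i : R →L[𝕜] F) (p : F →L[𝕜] R) (q : F →L[𝕜] Q) (σ : Q →L[𝕜] F) : Prop where
  tame_i : TameLin tR t i
  tame_p : TameLin t tR p
  tame_q : TameLin t tQ q
  tame_σ : TameLin tQ t σ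
  p_i : ∀ u, p (i u) = u
  q_i : ∀ u, q (i u) = 0
  p_σ : ∀ c, p (σ c) = 0
  q_σ : ∀ c, q (σ c) = c
  add : ∀ y, i (p y) + σ (q y) = y

variable {i : R →L[𝕜] F} {p : F →L[𝕜] R} {q : F →L[𝕜] Q} {σ : Q →L[𝕜] F}

theorem TameLin.inl : TameLin tR (tR.prod sK) (LinearMap.inl 𝕜 R K) := TameLin.id.prodMk TameLin.zero

theorem TameLin.inr : TameLin sK (tR.prod sK) (LinearMap.inr 𝕜 R K) := TameLin.zero.prodMk TameLin.id

theorem Fam.smoothing_comp {A : E → F →ₗ[𝕜] R} {B : E → K →ₗ[𝕜] F} {x₀ : E}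
    (hA : Fam 0 s t tR x₀ A) (hB : Fam 1 s sK t x₀ B) : Fam 0 s sK tR x₀ fun x => A x ∘ₗ B x := by
  simpa only [zero_mul] using hA.comp hB zero_le_one le_rfl

theorem Fam.comp_smoothing {A : E → F →ₗ[𝕜] R} {B : E → K →ₗ[𝕜] F} {x₀ : E}
    (hA : Fam 1 s t tR x₀ A) (hB : Fam 0 s sK t x₀ B) : Fam 0 s sK tR x₀ fun x => A x ∘ₗ B x := by
  simpa only [mul_zero] using hA.comp hB le_rfl zero_le_one

theorem Fam.tame_comp {A : E → F →ₗ[𝕜] R} {B : E → K →ₗ[𝕜] F} {x₀ : E}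
    (hA : Fam 1 s t tR x₀ A) (hB : Fam 1 s sK t x₀ B) : Fam 1 s sK tR x₀ fun x => A x ∘ₗ B x := by
  simpa only [mul_one] using hA.comp hB le_rfl le_rfl

theorem Fam.const_of_finiteDimensional [FiniteDimensional 𝕜 R] {x₀ : E} (T : F →L[𝕜] R) :
    Fam 0 s t tR x₀ fun _ => T.toLinearMap := by
  obtain ⟨r, hr⟩ := t.exists_bound_of_finiteDimensional tR T
  exact Fam.const (r := r) fun j => by simpa using hr j

/-- The family `(p ∘ A, ϖ)` of augmented operators is invertible near a point at which it is
bijective, if `A` has a parametrix. -/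
theorem TameSplitting.exists_inverse_augmented [FiniteDimensional 𝕜 K] [FiniteDimensional 𝕜 Q]
    (h : TameSplitting t tR tQ i p q σ) (ϖ : E →L[𝕜] K) {x₀ : E} {A : E → E →ₗ[𝕜] F}
    {ψ : E → F →ₗ[𝕜] E} {κ : E → E →ₗ[𝕜] E} {κ' : E → F →ₗ[𝕜] F} (hA : Fam 1 s s t x₀ A)
    (hψ : Fam 1 s t s x₀ ψ) (hκ : Fam 0 s s s x₀ κ) (hκ' : Fam 0 s t t x₀ κ') {m : ℕ} {V : Set E}
    (hV : V ∈ s.nh m x₀) (h1 : ∀ x ∈ V, ∀ v, ψ x (A x v) = v + κ x v)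
    (h2 : ∀ x ∈ V, ∀ y, A x (ψ x y) = y + κ' x y)
    (hbij : Function.Bijective fun v => (p (A x₀ v), ϖ v)) :
    ∃ r, ∃ V ∈ s.nh r x₀, (∀ x ∈ V, Function.Bijective fun v => (p (A x v), ϖ v)) ∧
      ∀ j, ∃ C : ℝ, 0 ≤ C ∧ ∀ x ∈ V, ∀ v, s.nm j v ≤
        C * ((1 + s.nm (j + r) x) * (tR.prod sK).nm r (p (A x v), ϖ v) +
          (tR.prod sK).nm (j + r) (p (A x v), ϖ v)) := by
  have hi := h.tame_i
  have hp := h.tame_p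
  have fi : Fam 1 s tR t x₀ fun _ => i.toLinearMap := Fam.const_of_tameLin hi
  have fp : Fam 1 s t tR x₀ fun _ => p.toLinearMap := Fam.const_of_tameLin hp
  have fσ : Fam 1 s tQ t x₀ fun _ => σ.toLinearMap := Fam.const_of_tameLin h.tame_σ
  have fq : Fam 0 s t tQ x₀ fun _ => q.toLinearMap := Fam.const_of_finiteDimensional q
  have fϖ : Fam 0 s s sK x₀ fun _ => ϖ.toLinearMap := Fam.const_of_finiteDimensional ϖ
  have finl : Fam 1 s tR (tR.prod sK) x₀ fun _ => LinearMap.inl 𝕜 R K :=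
    Fam.const_of_tameLin TameLin.inl
  have finr : Fam 1 s sK (tR.prod sK) x₀ fun _ => LinearMap.inr 𝕜 R K :=
    Fam.const_of_tameLin TameLin.inr
  have ffst : Fam 1 s (tR.prod sK) tR x₀ fun _ => LinearMap.fst 𝕜 R K :=
    Fam.const_of_tameLin TameLin.fst
  have fsnd : Fam 0 s (tR.prod sK) sK x₀ fun _ => LinearMap.snd 𝕜 R K :=
    Fam.const_of_finiteDimensional (ContinuousLinearMap.snd 𝕜 R K)
  have hT : Fam 1 s s (tR.prod sK) x₀ fun x => LinearMap.inl 𝕜 R K ∘ₗ (p.toLinearMap ∘ₗ A x) +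
      LinearMap.inr 𝕜 R K ∘ₗ ϖ.toLinearMap :=
    (finl.tame_comp (fp.tame_comp hA)).add (finr.comp_smoothing fϖ).of_smoothing
  -- The parametrix of `A` is restricted to `R` and ignores the component in `K`. On the left this
  -- leaves `ψ i p A = ψ A - ψ σ q A`, and the last term is smoothing because it factors through the
  -- finite-dimensional `Q`.
  have hψ' : Fam 1 s (tR.prod sK) s x₀ fun x => ψ x ∘ₗ (i.toLinearMap ∘ₗ LinearMap.fst 𝕜 R K) :=
    hψ.tame_comp (fi.tame_comp ffst)
  have hκ₁ : Fam 0 s s s x₀ fun x =>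
      κ x - ψ x ∘ₗ (σ.toLinearMap ∘ₗ (q.toLinearMap ∘ₗ A x)) :=
    hκ.sub (hψ.comp_smoothing (fσ.comp_smoothing (fq.smoothing_comp hA)))
  -- On the right, the first component of the remainder is `p κ' i u`. The second is `ϖ ψ i u - z`,
  -- smoothing because its values lie in the finite-dimensional `K`.
  have hκ₂ : Fam 0 s (tR.prod sK) (tR.prod sK) x₀ fun x =>
      LinearMap.inl 𝕜 R K ∘ₗ (p.toLinearMap ∘ₗ (κ' x ∘ₗ (i.toLinearMap ∘ₗ LinearMap.fst 𝕜 R K))) +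
      (LinearMap.inr 𝕜 R K ∘ₗ (ϖ.toLinearMap ∘ₗ (ψ x ∘ₗ
        (i.toLinearMap ∘ₗ LinearMap.fst 𝕜 R K))) - LinearMap.inr 𝕜 R K ∘ₗ LinearMap.snd 𝕜 R K) :=
    (finl.comp_smoothing (fp.comp_smoothing (hκ'.smoothing_comp (fi.tame_comp ffst)))).add
      ((finr.comp_smoothing (fϖ.smoothing_comp hψ')).sub (finr.comp_smoothing fsnd))
  have hTv : ∀ x v, (LinearMap.inl 𝕜 R K ∘ₗ (p.toLinearMap ∘ₗ A x) +
      LinearMap.inr 𝕜 R K ∘ₗ ϖ.toLinearMap) v = (p (A x v), ϖ v) := fun x v => by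
    simp
  have hTf : ∀ x, ⇑(LinearMap.inl 𝕜 R K ∘ₗ (p.toLinearMap ∘ₗ A x) +
      LinearMap.inr 𝕜 R K ∘ₗ ϖ.toLinearMap : E →ₗ[𝕜] R × K) = fun v => (p (A x v), ϖ v) :=
    fun x => funext (hTv x)
  have key := Fam.exists_inverse hT hψ' hκ₁ hκ₂ hV (fun x hx v => ?_) (fun x hx y => ?_) ?_
  · simp only [hTv] at key
    obtain ⟨r, V, hV, hb, he⟩ := key
    exact ⟨r, V, hV, fun x hx => hTf x ▸ hb x hx, he⟩
  · rw [hTv]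
    have e : i (p (A x v)) = A x v - σ (q (A x v)) := eq_sub_of_add_eq (h.add _)
    change ψ x (i (p (A x v))) = v + (κ x v - ψ x (σ (q (A x v))))
    rw [e, map_sub, h1 x hx]; abel
  · rw [hTv]
    obtain ⟨u, z⟩ := y
    change (p (A x (ψ x (i u))), ϖ (ψ x (i u))) = _
    rw [h2 x hx, map_add, h.p_i]
    refine Prod.ext ?_ ?_
    · simp
    · simp
  · rw [hTf]; exact hbij

/-- The straightened map does not depend on the kernel variable. -/
theorem eq_of_partial_eq_zero {g : R × K → Q} {m : ℕ} {η : ℝ} {y₀ : R × K}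
    {D : R × K → R × K →L[𝕜] Q}
    (hc : ∀ y, (tR.prod sK).nm m (y - y₀) < η → ContinuousAt g y)
    (hd : ∀ y, (tR.prod sK).nm m (y - y₀) < η → HD g y (D y))
    (hD : ∀ y, (tR.prod sK).nm m (y - y₀) < η → ∀ b, D y (0, b) = 0) (tQ : ScStructure 𝕜 Q)
    {y : R × K} (hy : (tR.prod sK).nm m (y - y₀) < η) : g y = g (y.1, y₀.2) := by
  have h0 : (tR.prod sK).nm m ((y.1, y₀.2) - y₀) < η := by
    refine lt_of_le_of_lt ?_ hy
    rw [nm_prod, nm_prod]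
    refine max_le (le_max_left _ _) ?_
    rw [Prod.snd_sub, sub_self, nm_zero]
    exact le_max_of_le_left (tR.nm_nonneg _ _)
  have e : (y.1, y₀.2) + ((0 : R), y.2 - y₀.2) = y := by ext <;> simp
  have hseg : ∀ τ ∈ Icc (0 : ℝ) 1,
      (tR.prod sK).nm m ((y.1, y₀.2) + (τ : 𝕜) • ((0 : R), y.2 - y₀.2) - y₀) < η :=
    fun τ hτ => nm_segment_lt _ h0 (by rwa [e]) hτ
  -- Mean value inequality with constant `0` along the segment from `(y.1, y₀.2)` to `y`, which
  -- stays in the ball by convexity.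
  have key := nm_sub_le_of_hd tQ 0 (g := g) (C := 0) (fun τ hτ => hc _ (hseg τ hτ))
    (fun τ hτ => hd _ (hseg τ hτ)) fun τ hτ => by rw [hD _ (hseg τ hτ), nm_zero]
  rw [e] at key
  exact sub_eq_zero.1 (tQ.eq_zero_of_nm (le_antisymm key (tQ.nm_nonneg _ _)))

/-- The normal form of a map whose augmented derivative is invertible and whose derivatives have
the same rank. -/
theorem TameSplitting.exists_normal_form (h : TameSplitting t tR tQ i p q σ) {ϖ : E →L[𝕜] K}
    (hϖ : TameLin s sK ϖ) {k : ℕ∞} (hk : 2 ≤ k) {f : E → F} {U : Set E} {A : E → E →L[𝕜] F}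
    {x₀ : E} (hsm : s.HasSmoothing) (hf : ∀ n : ℕ, (n : ℕ∞) ≤ k → SCN True n s t U f)
    (hA : ∀ x ∈ U, HD f x (A x)) (hx₀ : x₀ ∈ U)
    (hrank : ∀ x ∈ U, ∀ v, p (A x v) = 0 → A x v = 0)
    (hinv : ∃ r, ∃ V ∈ s.nh r x₀, (∀ x ∈ V, Function.Bijective fun v => (p (A x v), ϖ v)) ∧
      ∀ j, ∃ C : ℝ, 0 ≤ C ∧ ∀ x ∈ V, ∀ v, s.nm j v ≤
        C * ((1 + s.nm (j + r) x) * (tR.prod sK).nm r (p (A x v), ϖ v) +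
          (tR.prod sK).nm (j + r) (p (A x v), ϖ v))) :
    ∃ (W : Set E) (W' : Set F) (Wt : Set (R × K)) (Wt' : Set (R × Q)) (Φ : E → R × K)
      (Φinv : R × K → E) (Ψ : F → R × Q) (Ψinv : R × Q → F), x₀ ∈ W ∧ W ⊆ U ∧ f x₀ ∈ W' ∧
      MapsTo f W W' ∧ IsLevelDiffeo k s (tR.prod sK) W Wt Φ Φinv ∧
      IsLevelDiffeo k t (tR.prod tQ) W' Wt' Ψ Ψinv ∧ ∀ z ∈ Wt, Ψ (f (Φinv z)) = (z.1, 0) := by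
  have hUo : IsOpen U := (hf 2 hk).lct.isOpen
  obtain ⟨G, hGdef⟩ : ∃ G : E → R × K, G = fun x => (p (f x), ϖ x) := ⟨_, rfl⟩
  have hG : ∀ n : ℕ, (n : ℕ∞) ≤ k → SCN True n s (tR.prod sK) U G := fun n hn => by
    rw [hGdef]
    exact SCN.prodMk n (SCN.clm_comp h.tame_p (hf n hn)) ((SCN.clm n hϖ).mono hUo (subset_univ _))
  obtain ⟨m, η, B, φ, V, hη, hBo, hxB, hBU, hAV, hφ, hφG, hφn⟩ := SCN.exists_local_inverse hk hsm hG
    (A := fun x => (p.comp (A x)).prod ϖ)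
    (fun x hx => by
      rw [hGdef]
      exact (((HD.clm p (f x)).comp (f := f) (hA x hx)).prodMk (HD.clm ϖ x))) hx₀ hinv
  obtain ⟨N, hN⟩ : ∃ N, N = {y | (tR.prod sK).nm m (y - G x₀) < η} := ⟨_, rfl⟩
  rw [← hN] at hφn
  have hNo : IsOpen N := by rw [hN]; exact (tR.prod sK).isOpen_ball _ _ _
  have hmemN : ∀ y, y ∈ N ↔ (tR.prod sK).nm m (y - G x₀) < η := fun y => by rw [hN]; rfl
  -- Product norms are maxima, so `N` is the product of `D` with a ball of `K`. Hence `N` projects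
  -- into `D` and contains the slice `D × {(G x₀).2}` on which `b` is defined.
  obtain ⟨D, hD⟩ : ∃ D, D = {u | tR.nm m (u - (G x₀).1) < η} := ⟨_, rfl⟩
  have hDo : IsOpen D := by rw [hD]; exact tR.isOpen_ball _ _ _
  have hND : ∀ y ∈ N, y.1 ∈ D := fun y hy => by
    rw [hD]; exact (le_max_left _ _).trans_lt ((hmemN y).1 hy)
  have hDN : ∀ u ∈ D, (u, (G x₀).2) ∈ N := fun u hu => by
    rw [hD] at hu
    rw [hmemN, nm_prod]
    refine max_lt hu ?_
    rwa [Prod.snd_sub, sub_self, nm_zero]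
  have hG0 : G x₀ ∈ N := by rw [hmemN, sub_self, nm_zero]; exact hη
  have hGφ : ∀ y ∈ N, G (φ y) = y := fun y hy => (hφ y ((hmemN y).1 hy)).2.1
  have hφB : ∀ y ∈ N, φ y ∈ B := fun y hy => (hφ y ((hmemN y).1 hy)).1
  have hfφ : ∀ n : ℕ, (n : ℕ∞) ≤ k → SCN True n (tR.prod sK) tQ N fun y => q (f (φ y)) :=
    fun n hn => SCN.clm_comp h.tame_q (SCN.comp n (hf n hn) (hφn n hn) fun y hy => hBU (hφB y hy))
  obtain ⟨b, hb⟩ : ∃ b : R → Q, b = fun u => q (f (φ (u, (G x₀).2))) := ⟨_, rfl⟩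
  have hbn : ∀ n : ℕ, (n : ℕ∞) ≤ k → SCN True n tR tQ D b := fun n hn => by
    rw [hb]
    refine SCN.comp n (f := fun u : R => (u, (G x₀).2)) (g := fun y => q (f (φ y))) (hfφ n hn)
      (SCN.prodMk n ?_ ?_) hDN
    · exact (SCN.clm n (T := ContinuousLinearMap.id 𝕜 R) TameLin.id).mono hDo (subset_univ _)
    · exact (SCN.const n (G x₀).2).mono hDo (subset_univ _)
  have hconst : ∀ y ∈ N, q (f (φ y)) = b y.1 := fun y hy => by
    rw [hb]
    refine eq_of_partial_eq_zero (tR := tR) (sK := sK) (m := m) (η := η) (y₀ := G x₀)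
      (g := fun y => q (f (φ y)))
      (D := fun y => (q.comp ((A (φ y)).comp (V (φ y))))) ?_ ?_ ?_ tQ ((hmemN y).1 hy)
    · exact fun y hy => (hfφ 2 hk).lct.continuousAt ((hmemN y).2 hy)
    · intro y hy
      exact (HD.clm q (f (φ y))).comp (f := fun y => f (φ y))
        ((hA _ (hBU (hφ y hy).1)).comp (hφ y hy).2.2)
    · intro y hy c
      -- A kernel direction `(0, c)` is lifted by `V` to a vector whose image under the derivative
      -- of `f` has no component in `R`. The rank hypothesis then makes the whole image vanish.
      have h1 : (p (A (φ y) (V (φ y) (0, c))), ϖ (V (φ y) (0, c))) = ((0 : R), c) :=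
        hAV (φ y) (hφ y hy).1 (0, c)
      have h2 := hrank _ (hBU (hφ y hy).1) _ (congrArg Prod.fst h1)
      change q (A (φ y) (V (φ y) (0, c))) = 0
      rw [h2, map_zero]
  have hfD : ∀ x, G x ∈ N → p (f x) ∈ D := fun x hx => by
    have := hND _ hx
    rwa [hGdef] at this
  have hW'o : IsOpen (p ⁻¹' D) := hDo.preimage p.continuous
  have hWt'o : IsOpen (D ×ˢ (univ : Set Q)) := hDo.prod isOpen_univ
  have hWo : IsOpen (B ∩ G ⁻¹' N) :=
    ((hG 2 hk).lct.continuousOn.mono hBU).isOpen_inter_preimage hBo hNo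
  -- The source chart is the augmented map. The target chart is the splitting followed by a shear
  -- along the graph of `b`, whose inverse is explicit, so `W'` is a full cylinder over `D`.
  refine ⟨B ∩ G ⁻¹' N, p ⁻¹' D, N, D ×ˢ univ, G, φ, fun y => (p y, q y - b (p y)),
    fun z => i z.1 + σ (z.2 + b z.1), ⟨hxB, hG0⟩, fun x hx => hBU hx.1, hfD x₀ hG0,
    fun x hx => hfD x hx.2, ?_, ?_, fun z hz => ?_⟩
  · exact
    { mapsTo := fun x hx => hx.2
      mapsTo_inv := fun y hy => ⟨hφB y hy, by rw [mem_preimage, hGφ y hy]; exact hy⟩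
      invOn := ⟨fun x hx => hφG x hx.1 ((hmemN _).1 hx.2), fun y hy => hGφ y hy⟩
      scn := fun n hn => (hG n hn).mono hWo fun x hx => hBU hx.1
      scn_inv := hφn }
  · refine
    { mapsTo := fun y hy => ⟨hy, mem_univ _⟩
      mapsTo_inv := fun z hz => ?_
      invOn := ⟨fun y hy => ?_, fun z hz => ?_⟩
      scn := fun n hn => ?_
      scn_inv := fun n hn => ?_ }
    · rw [mem_preimage, map_add, h.p_i, h.p_σ, add_zero]; exact hz.1
    · simp only [sub_add_cancel]; exact h.add y
    · simp only [map_add, h.p_i, h.p_σ, h.q_i, h.q_σ, add_zero, zero_add, add_sub_cancel_right]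
    · have hp := (SCN.clm (τ := True) n h.tame_p).mono hW'o (subset_univ _)
      exact SCN.prodMk n hp (((SCN.clm n h.tame_q).mono hW'o (subset_univ _)).sub
        (SCN.comp n (hbn n hn) hp fun y hy => hy))
    · have h1 : SCN True n (tR.prod tQ) tR (D ×ˢ univ) fun z : R × Q => z.1 :=
        (SCN.clm n (T := ContinuousLinearMap.fst 𝕜 R Q) TameLin.fst).mono hWt'o (subset_univ _)
      have h2 : SCN True n (tR.prod tQ) tQ (D ×ˢ univ) fun z : R × Q => z.2 :=
        (SCN.clm n (T := ContinuousLinearMap.snd 𝕜 R Q) TameLin.snd).mono hWt'o (subset_univ _)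
      exact (SCN.clm_comp h.tame_i h1).add (SCN.clm_comp h.tame_σ
        (h2.add (SCN.comp n (hbn n hn) h1 fun z hz => hz.1)))
  · have h1 : p (f (φ z)) = z.1 := by
      have := congrArg Prod.fst (hGφ z hz)
      rwa [hGdef] at this
    simp only [h1, hconst z hz, sub_self]

end NormalForm

end ScStructure

/-! ### Tame splittings and the algebra of constant corank. -/

namespace ScStructure

section Splitting

variable {𝕜 : Type*} [RCLike 𝕜]
variable {E : Type u} [AddCommGroup E] [Module 𝕜 E] [TopologicalSpace E]
  [IsTopologicalAddGroup E] [ContinuousSMul 𝕜 E]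
variable {F : Type u} [AddCommGroup F] [Module 𝕜 F] [TopologicalSpace F]
  [IsTopologicalAddGroup F] [ContinuousSMul 𝕜 F]

theorem TameLin.of_finiteDimensional [FiniteDimensional 𝕜 F] (s : ScStructure 𝕜 E)
    (t : ScStructure 𝕜 F) (T : E →L[𝕜] F) : TameLin s t T := by
  obtain ⟨r, hr⟩ := s.exists_bound_of_finiteDimensional t T
  refine ⟨r, fun j => ?_⟩
  obtain ⟨C, hC, h⟩ := hr j
  exact ⟨C, hC, fun x => (h x).trans
    (mul_le_mul_of_nonneg_left (s.nm_mono (Nat.le_add_left r j) x) hC)⟩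

/-- A finite-dimensional subspace is the image of a continuous projection. -/
theorem exists_projection (s : ScStructure 𝕜 E) (S : Submodule 𝕜 E) [FiniteDimensional 𝕜 S] :
    ∃ ϖ : E →L[𝕜] S, ∀ x : S, ϖ x = x := by
  have hinj : Function.Injective (s.π 0).toLinearMap := s.π_injective 0
  let e := S.equivMapOfInjective (s.π 0).toLinearMap hinj
  have : FiniteDimensional 𝕜 (S.map (s.π 0).toLinearMap) := e.finiteDimensional
  obtain ⟨q, hq⟩ := Submodule.ClosedComplemented.of_finiteDimensional (S.map (s.π 0).toLinearMap)
  refine ⟨(e.symm.toLinearMap.toContinuousLinearMap.comp q).comp (s.π 0), fun x => ?_⟩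
  have h : q (s.π 0 x) = e x := hq (e x)
  change e.symm (q (s.π 0 x)) = x
  rw [h, e.symm_apply_apply]

/-- A closed subspace of finite codimension is a tame direct summand. -/
theorem exists_tameSplitting (t : ScStructure 𝕜 F) (S : Submodule 𝕜 F) (hS : IsClosed (S : Set F))
    [FiniteDimensional 𝕜 (F ⧸ S)] :
    ∃ (tQ : ScStructure 𝕜 (F ⧸ S)) (p : F →L[𝕜] S) (σ : F ⧸ S →L[𝕜] F),
      TameSplitting t (t.sub S hS) tQ S.subtypeL p S.mkQL σ := by
  have := t.t2Space
  obtain ⟨C, hC⟩ := S.exists_isCompl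
  have hfd : FiniteDimensional 𝕜 C := (S.quotientEquivOfIsCompl C hC).finiteDimensional
  have htop := Submodule.IsCompl.isTopCompl_of_isClosed_of_finiteDimensional hC hS
  let e := S.quotientEquivOfIsTopCompl C htop
  have hCcl : IsClosed (C : Set F) := C.closed_of_finiteDimensional
  -- The quotient takes its structure from a finite-dimensional complement. The section `σ` is then
  -- isometric for each norm, and the projection onto `S` is `id - σ ∘ q`.
  let tQ : ScStructure 𝕜 (F ⧸ S) := (t.sub C hCcl).transport e
  let σ : F ⧸ S →L[𝕜] F := C.subtypeL.comp (e : F ⧸ S →L[𝕜] C)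
  have hqσ : ∀ c, S.mkQL (σ c) = c := fun c => by
    change S.mkQ (e c : F) = c
    exact e.symm_apply_apply c
  have hmem : ∀ y, (ContinuousLinearMap.id 𝕜 F - σ.comp S.mkQL) y ∈ S := fun y => by
    refine (Submodule.Quotient.mk_eq_zero S).1 ?_
    change S.mkQL (y - σ (S.mkQL y)) = 0
    rw [map_sub, hqσ, sub_self]
  have hσ : TameLin tQ t σ := ⟨0, fun j => ⟨1, zero_le_one, fun c => (one_mul _).ge⟩⟩
  have hq : TameLin t tQ S.mkQL := TameLin.of_finiteDimensional t tQ S.mkQL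
  have hqi : ∀ u : S, S.mkQL (u : F) = 0 := fun u => (Submodule.Quotient.mk_eq_zero S).2 u.2
  refine ⟨tQ, (ContinuousLinearMap.id 𝕜 F - σ.comp S.mkQL).codRestrict S hmem, σ,
    ⟨⟨0, fun j => ⟨1, zero_le_one, fun c => (one_mul _).ge⟩⟩, ?_, hq, hσ, fun u => Subtype.ext ?_,
      hqi, fun c => Subtype.ext ?_, hqσ, fun y => ?_⟩⟩
  · obtain ⟨c, h⟩ := TameLin.id.add (hσ.comp hq).neg
    refine ⟨c, fun j => ?_⟩
    obtain ⟨C, hC, h⟩ := h j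
    refine ⟨C, hC, fun y => ?_⟩
    rw [nm_sub_coe]
    exact le_trans (le_of_eq (congrArg (t.nm j) (sub_eq_add_neg y _))) (h y)
  · change (u : F) - σ (S.mkQL (u : F)) = u
    rw [hqi, map_zero, sub_zero]
  · change σ c - σ (S.mkQL (σ c)) = 0
    rw [hqσ, sub_self]
  · exact sub_add_cancel y _

theorem nEq_rescale (s : ScStructure 𝕜 E) {k : ℕ → ℕ} (hk : IsTameSeq k) :
    NEq s (s.rescale k hk.1) := by
  obtain ⟨c, hc⟩ := hk.2
  exact ⟨⟨0, fun j => ⟨1, zero_le_one, fun x => (s.nm_mono hk.1.le_apply x).trans_eq (one_mul _).symm⟩⟩,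
    ⟨c, fun j => ⟨1, zero_le_one, fun x => (s.nm_mono (hc j) x).trans_eq (one_mul _).symm⟩⟩⟩

end Splitting

end ScStructure

/-- If all operators near `L` have the same finite corank as `L`, and `p ∘ A` is onto, then
the range of `A` meets the complement of the range of `L` trivially. -/
theorem eq_zero_of_corank_eq {𝕜 : Type*} [Field 𝕜] {E F R Q : Type*} [AddCommGroup E] [Module 𝕜 E]
    [AddCommGroup F] [Module 𝕜 F] [AddCommGroup R] [Module 𝕜 R] [AddCommGroup Q] [Module 𝕜 Q]
    [FiniteDimensional 𝕜 Q] {A : E →ₗ[𝕜] F} {i : R →ₗ[𝕜] F} {p : F →ₗ[𝕜] R} {q : F →ₗ[𝕜] Q}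
    {σ : Q →ₗ[𝕜] F} (hadd : ∀ y, i (p y) + σ (q y) = y)
    (hsurj : Function.Surjective fun v => p (A v))
    (hrank : Module.finrank 𝕜 (F ⧸ LinearMap.range A) = Module.finrank 𝕜 Q) {v : E}
    (hv : p (A v) = 0) : A v = 0 := by
  -- Since `p ∘ A` is onto, every class modulo the range of `A` is represented in `σ Q`, so `B` is
  -- onto. Equal dimensions make it injective, and a value of `A` lying in `σ Q` is in its kernel.
  let B : Q →ₗ[𝕜] F ⧸ LinearMap.range A := (LinearMap.range A).mkQ ∘ₗ σ
  have hB : Function.Surjective B := by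
    intro c
    obtain ⟨y, rfl⟩ := (LinearMap.range A).mkQ_surjective c
    obtain ⟨w, hw⟩ := hsurj (p y)
    have h1 : i (p (y - A w)) = 0 := by
      rw [map_sub, sub_eq_zero.2 hw.symm, map_zero]
    have h2 := hadd (y - A w)
    rw [h1, zero_add] at h2
    refine ⟨q (y - A w), ?_⟩
    change (LinearMap.range A).mkQ (σ (q (y - A w))) = _
    rw [h2, map_sub, sub_eq_self]
    exact (Submodule.Quotient.mk_eq_zero _).2 ⟨w, rfl⟩
  have : FiniteDimensional 𝕜 (F ⧸ LinearMap.range A) := Module.Finite.of_surjective B hB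
  have hBi := (LinearMap.injective_iff_surjective_of_finrank_eq_finrank hrank.symm).2 hB
  have h1 := hadd (A v)
  rw [hv, map_zero, zero_add] at h1
  have h2 : B (q (A v)) = 0 := by
    change (LinearMap.range A).mkQ (σ (q (A v))) = 0
    rw [h1]
    exact (Submodule.Quotient.mk_eq_zero _).2 ⟨v, rfl⟩
  have h3 : q (A v) = 0 := hBi (h2.trans (map_zero B).symm)
  rw [← h1, h3, map_zero]

/-! ### Assembly of the constant rank theorem. -/

namespace PreTameSc

open ScStructure

variable {𝕜 : Type*} [RCLike 𝕜]
variable {E : Type u} [AddCommGroup E] [Module 𝕜 E] [TopologicalSpace E]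
  [IsTopologicalAddGroup E] [ContinuousSMul 𝕜 E]
variable {F : Type u} [AddCommGroup F] [Module 𝕜 F] [TopologicalSpace F]
  [IsTopologicalAddGroup F] [ContinuousSMul 𝕜 F]

theorem isTameDiffeo_of_isLevelDiffeo {k : ℕ∞} {P : PreTameSc 𝕜 E} {Q : PreTameSc 𝕜 F}
    {s : ScStructure 𝕜 E} {t : ScStructure 𝕜 F} (hs : NEq P.rep s) (ht : NEq Q.rep t) {W : Set E}
    {W' : Set F} {φ : E → F} {ψ : F → E} (h : IsLevelDiffeo k s t W W' φ ψ) :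
    IsTameDiffeo k P Q W W' φ ψ := by
  have h1 : ∀ n : ℕ, (n : ℕ∞) ≤ k → SCN True n P.rep Q.rep W φ := fun n hn =>
    (h.scn n hn).of_nLe hs.2 ht.1
  have h2 : ∀ n : ℕ, (n : ℕ∞) ≤ k → SCN True n Q.rep P.rep W' ψ := fun n hn =>
    (h.scn_inv n hn).of_nLe ht.2 hs.1
  exact
  { isOpen_source := (h1 0 (by simp)).lct.isOpen
    isOpen_target := (h2 0 (by simp)).lct.isOpen
    mapsTo := h.mapsTo
    mapsTo_inv := h.mapsTo_inv
    invOn := h.invOn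
    sc := scUnder_of_scn h1
    sc_inv := scUnder_of_scn h2
    tame := tameUnderUpTo_of_scn h1
    tame_inv := tameUnderUpTo_of_scn h2 }

end PreTameSc

open ScStructure in
theorem theorem4p2 {𝕜 : Type*} [RCLike 𝕜]
    {E : Type u} [AddCommGroup E] [Module 𝕜 E] [TopologicalSpace E] [IsTopologicalAddGroup E]
    [ContinuousSMul 𝕜 E]
    {E' : Type u} [AddCommGroup E'] [Module 𝕜 E'] [TopologicalSpace E'] [IsTopologicalAddGroup E']
    [ContinuousSMul 𝕜 E']
    (P : PreTameSc 𝕜 E) (P' : PreTameSc 𝕜 E') (hP : P.IsWeaklyTame) (hP' : P'.IsWeaklyTame)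
    (U : Set E) (hU : IsOpen U) (f : E → E') (k : ℕ∞) (hk : 2 ≤ k)
    (hf : PreTameSc.ScBar k P P' U f) (hft : PreTameSc.TameBarUpTo k P P' U f)
    (x₀ : E) (hx₀ : x₀ ∈ U)
    (hrank : ∃ V : Set E, IsOpen V ∧ x₀ ∈ V ∧ V ⊆ U ∧ PreTameSc.IsTameFredholm P P' V f ∧
      HasConstantRank 𝕜 f V) :
    ∃ (Qim : PreTameSc 𝕜 (wDeriv 𝕜 f U x₀).range) (Qker : PreTameSc 𝕜 (wDeriv 𝕜 f U x₀).ker)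
      (Qcoker : PreTameSc 𝕜 (E' ⧸ (wDeriv 𝕜 f U x₀).range)),
      P'.IsSubspace (wDeriv 𝕜 f U x₀).range Qim ∧
      P.IsSubspace (wDeriv 𝕜 f U x₀).ker Qker ∧
      PreTameSc.IsTameMorphism P' Qcoker (wDeriv 𝕜 f U x₀).range.mkQL ∧
      FiniteDimensional 𝕜 (E' ⧸ (wDeriv 𝕜 f U x₀).range) ∧
      ∃ (W : Set E) (W' : Set E') (_ : x₀ ∈ W) (_ : W ⊆ U) (_ : f x₀ ∈ W') (_ : MapsTo f W W')
        (Wt : Set ((wDeriv 𝕜 f U x₀).range × (wDeriv 𝕜 f U x₀).ker))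
        (Wt' : Set ((wDeriv 𝕜 f U x₀).range × (E' ⧸ (wDeriv 𝕜 f U x₀).range)))
        (Φ : E → (wDeriv 𝕜 f U x₀).range × (wDeriv 𝕜 f U x₀).ker)
        (Φinv : (wDeriv 𝕜 f U x₀).range × (wDeriv 𝕜 f U x₀).ker → E)
        (Ψ : E' → (wDeriv 𝕜 f U x₀).range × (E' ⧸ (wDeriv 𝕜 f U x₀).range))
        (Ψinv : (wDeriv 𝕜 f U x₀).range × (E' ⧸ (wDeriv 𝕜 f U x₀).range) → E'),
        PreTameSc.IsTameDiffeo k P (Qim.prod Qker) W Wt Φ Φinv ∧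
        PreTameSc.IsTameDiffeo k P' (Qim.prod Qcoker) W' Wt' Ψ Ψinv ∧
        ∀ z ∈ Wt, Ψ (f (Φinv z)) = (z.1, 0) := by
  have ht2 := P'.rep.t2Space
  have ht2E := P.rep.t2Space
  obtain ⟨V, hVo, hx₀V, hVU, ⟨hf1, -, -, hfred⟩, c, hc⟩ := hrank
  have h1k : (1 : ℕ∞) ≤ k := le_trans (by norm_num) hk
  have hdU : WDiffOn 𝕜 f U := (hf 1 h1k).1
  have hdV : WDiffOn 𝕜 f V := (hf1 1 le_rfl).1
  -- `wDeriv` refers to the ambient set. The Fredholm and rank hypotheses concern `V` and the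
  -- conclusion `U`, and uniqueness of Hadamard derivatives identifies the two.
  have hAeq : ∀ x ∈ V, wDeriv 𝕜 f V x = wDeriv 𝕜 f U x := fun x hx =>
    hdU.mono_hd hdV (hVU hx) hx
  obtain ⟨V₁, hV₁o, hx₁, hV₁V, ψ, κ, κ', hψ, hκ, hκ', hψκ⟩ := hfred x₀ hx₀V
  obtain ⟨s₀, hs₀, l, hl, hsm⟩ := hP
  -- Smoothing operators are tied to a particular chain, so the source is treated with this
  -- structure throughout. Its norms agree with those of `P.rep` up to a bounded shift.
  obtain ⟨s, hs⟩ : ∃ s, s = s₀.rescale l hl.1 := ⟨_, rfl⟩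
  rw [← hs] at hsm
  have hsP : NEq P.rep s := by
    rw [hs]; exact (P.nEq_of_mem hs₀).trans (s₀.nEq_rescale hl)
  obtain ⟨A, hAdef⟩ : ∃ A, A = wDeriv 𝕜 f U := ⟨_, rfl⟩
  rw [← hAdef] at hAeq ⊢
  have hA : ∀ x ∈ U, HD f x (A x) := fun x hx => by rw [hAdef]; exact hdU.hd hx
  have hfn : ∀ n : ℕ, (n : ℕ∞) ≤ k → SCN True n s P'.rep U f := fun n hn =>
    (PreTameSc.scn_of_bar hf hft hn).of_nLe hsP.1 (NLe.refl _)
  -- the parametrix as families for the structure `s`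
  have fA : Fam 1 s s P'.rep x₀ fun x => (A x).toLinearMap := by
    have h1 : SCN True 1 (s.prod s) P'.rep (U ×ˢ univ) fun z : E × E => A z.1 z.2 :=
      SCN.deriv (hfn 2 hk) fun x hx => ⟨A x, hA x hx, fun _ => rfl⟩
    exact LCT.fam (A := fun x => (A x).toLinearMap) h1.lct hx₀
  have fψ : Fam 1 s P'.rep s x₀ ψ := by
    have h1 := (PreTameSc.TameBar.lct hψ).of_nLe (PreTameSc.nEq_rep_prod P P').1 (NLe.refl _)
    exact (LCT.fam h1 hx₁).of_nLe hsP.1 (NLe.refl _) hsP.2 le_rfl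
  have fκ : Fam 0 s s s x₀ κ := (hκ.fam hx₁).of_nLe hsP.1 hsP.1 hsP.2 zero_le_one
  have fκ' : Fam 0 s P'.rep P'.rep x₀ κ' :=
    (hκ'.fam hx₁).of_nLe hsP.1 (NLe.refl _) (NLe.refl _) zero_le_one
  have hψA : ∀ x ∈ V₁, ψ x ∘ₗ (A x).toLinearMap = LinearMap.id + κ x ∧
      (A x).toLinearMap ∘ₗ ψ x = LinearMap.id + κ' x := fun x hx => by
    rw [← hAeq x (hV₁V hx)]; exact hψκ x hx
  -- kernel and cokernel at `x₀`
  obtain ⟨r, hr⟩ := fκ.bound_at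
  obtain ⟨r', hr'⟩ := fκ'.bound_at
  obtain ⟨hker, hcl, hcok⟩ := fredholm_of_parametrix (s := s) (t := P'.rep) (r := r) (r' := r')
    (fun j => by obtain ⟨C, -, h⟩ := hr j; exact ⟨C, by simpa using h⟩)
    (fun j => by obtain ⟨C, -, h⟩ := hr' j; exact ⟨C, by simpa using h⟩)
    (hψA x₀ hx₁).1 (hψA x₀ hx₁).2
  obtain ⟨tQ, p, σ, hsplit⟩ := P'.rep.exists_tameSplitting (A x₀).range hcl
  obtain ⟨ϖ, hϖ⟩ := P.rep.exists_projection (A x₀).ker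
  have hkcl : IsClosed ((A x₀).ker : Set E) := (A x₀).isClosed_ker
  have hϖt : TameLin s (P.rep.sub (A x₀).ker hkcl) ϖ := TameLin.of_finiteDimensional _ _ _
  have hbij : Function.Bijective fun v => (p ((A x₀).toLinearMap v), ϖ v) := by
    have hpA : ∀ v, (p (A x₀ v) : E') = A x₀ v := fun v =>
      congrArg Subtype.val (hsplit.p_i ⟨A x₀ v, v, rfl⟩)
    refine ⟨fun v w hvw => ?_, ?_⟩
    · obtain ⟨h1, h2⟩ := Prod.ext_iff.1 hvw
      replace h1 : A x₀ v = A x₀ w := by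
        rw [← hpA v, ← hpA w]; exact congrArg Subtype.val h1
      replace h2 : ϖ v = ϖ w := h2
      have h3 : v - w ∈ (A x₀).ker := by
        rw [LinearMap.mem_ker]
        change A x₀ (v - w) = 0
        rw [map_sub, h1, sub_self]
      have h4 := hϖ ⟨v - w, h3⟩
      rw [map_sub, h2, sub_self] at h4
      exact sub_eq_zero.1 (congrArg Subtype.val h4).symm
    · rintro ⟨⟨_, v, rfl⟩, z⟩
      -- Replacing the kernel component of `v` by `z` does not change the image under `A x₀`.
      refine ⟨v - ϖ v + z, ?_⟩
      have h1 : A x₀ (v - ϖ v + z) = A x₀ v := by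
        have e1 : A x₀ (ϖ v) = 0 := (ϖ v).2
        have e2 : A x₀ z = 0 := z.2
        rw [map_add, map_sub, e1, e2, sub_zero, add_zero]
      refine Prod.ext (Subtype.ext ?_) ?_
      · exact (hpA _).trans h1
      · change ϖ (v - ϖ v + z) = z
        rw [map_add, map_sub, hϖ, hϖ, sub_self, zero_add]
  obtain ⟨m, hm⟩ := s.mem_nhds_iff'.1 (hV₁o.mem_nhds hx₁)
  obtain ⟨r₂, V₂, hV₂, hbij₂, hbd₂⟩ := hsplit.exists_inverse_augmented
    (sK := P.rep.sub (A x₀).ker hkcl) ϖ fA fψ fκ fκ' hm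
    (fun x hx v => congrArg (fun T : E →ₗ[𝕜] E => T v) (hψA x hx).1)
    (fun x hx y => congrArg (fun T : E' →ₗ[𝕜] E' => T y) (hψA x hx).2) hbij
  have hUo : IsOpen (V₁ ∩ interior V₂) := hV₁o.inter isOpen_interior
  have hUU : V₁ ∩ interior V₂ ⊆ U := fun x hx => hVU (hV₁V hx.1)
  have hxU : x₀ ∈ V₁ ∩ interior V₂ := ⟨hx₁, mem_interior_iff_mem_nhds.2 (s.nhds_le_nh _ _ hV₂)⟩
  -- On this neighbourhood the augmented derivative is bijective, so `p ∘ A x` is onto the range of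
  -- `A x₀`. Constant corank then gives the claim algebraically.
  have hrank' : ∀ x ∈ V₁ ∩ interior V₂, ∀ v, p (A x v) = 0 → A x v = 0 := by
    intro x hx v hv
    have hcx : Module.finrank 𝕜 (E' ⧸ (A x).range) = c := by
      rw [← hAeq x (hV₁V hx.1)]; exact hc x (hV₁V hx.1)
    have hc0 : Module.finrank 𝕜 (E' ⧸ (A x₀).range) = c := by
      rw [← hAeq x₀ hx₀V]; exact hc x₀ hx₀V
    refine eq_zero_of_corank_eq (A := (A x).toLinearMap) (i := (A x₀).range.subtype)
      (p := p.toLinearMap) (q := (A x₀).range.mkQ) (σ := σ.toLinearMap) hsplit.add (fun u => ?_)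
      (hcx.trans hc0.symm) hv
    obtain ⟨w, hw⟩ := (hbij₂ x (interior_subset hx.2)).2 (u, 0)
    exact ⟨w, congrArg Prod.fst hw⟩
  obtain ⟨W, W', Wt, Wt', Φ, Φinv, Ψ, Ψinv, hxW, hWU, hfW', hmaps, hΦ, hΨ, hfin⟩ :=
    hsplit.exists_normal_form hϖt hk hsm (fun n hn => (hfn n hn).mono hUo hUU)
      (fun x hx => hA x (hUU hx)) hxU hrank' ⟨r₂, V₂, hV₂, hbij₂, hbd₂⟩
  have nR := PreTameSc.nEq_rep_ofRep (P'.rep.sub (A x₀).range hcl)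
  have nK := PreTameSc.nEq_rep_ofRep (P.rep.sub (A x₀).ker hkcl)
  have nQ := PreTameSc.nEq_rep_ofRep tQ
  refine ⟨PreTameSc.ofRep (P'.rep.sub (A x₀).range hcl), PreTameSc.ofRep (P.rep.sub (A x₀).ker hkcl),
    PreTameSc.ofRep tQ, P'.isSubspace_ofRep_sub _ _, P.isSubspace_ofRep_sub _ _,
    PreTameSc.isTameMorphism_of_tameLin ((TameLin.of_nLe nQ.1).comp hsplit.tame_q), hcok,
    W, W', hxW, hWU.trans hUU, hfW', hmaps, Wt, Wt', Φ, Φinv, Ψ, Ψinv, ?_, ?_, hfin⟩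
  · exact PreTameSc.isTameDiffeo_of_isLevelDiffeo hsP
      ((PreTameSc.nEq_rep_prod _ _).trans (nR.prod nK)) hΦ
  · exact PreTameSc.isTameDiffeo_of_isLevelDiffeo (NEq.refl _)
      ((PreTameSc.nEq_rep_prod _ _).trans (nR.prod nQ)) hΨ
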